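/- **Setting.** Let $d\ge2$, $\Omega=[0,1]^d$, and let $\boldsymbol a\in\mathbb R^d$ be constant. Let $u$ be the weak solution of $u_t+\nabla\cdot(\boldsymbol a u)=0$ on $\Omega$ with periodic boundary conditions and $u(0)=u_0$; that is, $u(t)\in L^2(\Omega)$ and $\frac{d}{dt}\int_\Omega u\,\psi\,dx=\int_\Omega u\,\boldsymbol a\cdot\nabla\psi\,dx$ for all smooth periodic $\psi$ and all $t\ge0$. *Spaces.* Let $V_n^k$ be the functions on $(0,1]$ that are polynomials of degree at most $k$ on each $(2^{-n}j,2^{-n}(j+1)]$, $0\le j<2^n$. Let $W_0^k=V_0^k$, and for $n\ge1$ let $W_n^k$ be the $L^2(0,1)$-orthogonal complement of $V_{n-1}^k$ in $V_n^k$. Put $\mathbf V_N^k=V_N^k\otimes\cdots\otimes V_N^k$ and $\hat{\mathbf V}_N^k=\bigoplus_{l\in\mathbb N_0^d,\ l_1+\cdots+l_d\le N}W_{l_1}^k\otimes\cdots\otimes W_{l_d}^k$. Let $\mathbf P$ be the $L^2(\Omega)$ projection onto $\hat{\mathbf V}_N^k$, and let $P_n^k$, $\mathbf P_N^k$ be the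 $L^2$ projections onto $V_n^k$, $\mathbf V_N^k$. *Scheme.* Let $T_h$ be the set of cells of the uniform grid $\Omega_N$ of mesh size $h_N=2^{-N}$, and let $\Gamma$ be the set of interfaces between cells, opposite sides of $\Omega$ being identified. On an interface shared by $T_\pm$ with outward unit normals $\mathbf n^\pm$, let $[v]=v^-\mathbf n^-+v^+\mathbf n^+$ and $\{v\}=\frac12(v^-+v^+)$. The semi-discrete solution satisfies $u_h(t)\in\hat{\mathbf V}_N^k$, $u_h(0)=\mathbf Pu_0$, and, for all $v_h\in\hat{\mathbf V}_N^k$ and $t\ge0$, $$\frac{d}{dt}\int_\Omega u_hv_h\,dx=\sum_{T\in T_h}\int_T u_h\,\boldsymbol a\cdot\nabla v_h\,dx-\sum_{e\in\Gamma}\int_e\Big(\boldsymbol a\{u_h\}+\tfrac{|\boldsymbol a\cdot\mathbf n|}{2}[u_h]\Big)\cdot[v_h]\,ds .$$ *Norms.* $|v|_{H^s(\Omega')}^2=\sum_{|\alpha|_1=s}\|\partial^\alpha v\|_{L^2(\Omega')}^2$, $|v|_{H^s(\Omega_N)}^2=\sum_{T\in T_h}|v|_{H^s(T)}^2$, and $|v|_{\mathcal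 H^{m}(\Omega)}=\max_{\emptyset\ne L\subset\{1,\dots,d\}}\big\|\big(\prod_{i\in L}\partial_{x_i}^{m}\big)v\big\|_{L^2(\Omega)}$. The periodic space $\mathcal H^{m}$ consists of the $1$-periodic functions on $\mathbb R^d$ whose weak derivatives $\partial^\alpha v$ on $\mathbb R^d$ with $\max_i\alpha_i\le m$ are square integrable on $\Omega$. *Constants.* Given numbers $c_{k,s,q}$ and $\bar{\bar c}_{k,s,q}$, put $\tilde c_{k,s,q}=c_{k,s,q}(1+2^{-(q+1-s)})$, $\hat c_{k,0}=1$, $\hat c_{k,1}=\sqrt{12}\,k^2$, $C_{k,q}=\max(\tilde c_{k,0,q},\hat c_{k,0})$, $\bar c_{k,q}=\max(\tilde c_{k,1,q}^2\hat c_{k,0}^2,\ \tilde c_{k,0,q}^2\hat c_{k,1}^2)$, $\kappa_0(k,q,N)=(N+1)C_{k,q}$, $\kappa_1(k,q,N)=2C_{k,q}$, $B_0(k,q,d)=2^{-(q+1)}$, $B_1(k,q,d)=\frac12d^{3/2}\sqrt{\bar c_{k,q}}\,C_{k,q}^{-2}$, and $C_\star(k,q,d,N)=\max_{s=0,1}\big(\bar{\bar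 c}_{k,s,q}+B_s(k,q,d)\,\kappa_s(k,q,N)^d\big)$. **Theorem ($L^2$ error estimate).** There are positive constants $c_{k,s,q}$ and $\bar{\bar c}_{k,s,q}$, depending only on $k,s,q$, and $C_d$, depending only on $d$, with the following properties. 1. For $k\ge1$, $1\le q\le\min\{p,k\}$ and $s\in\{0,1\}$: for all $n\ge0$, all $v\in H^{p+1}(0,1)$ and every cell $I$ of the $n$-th level grid, $|P_n^kv-v|_{H^s(I)}\le c_{k,s,q}2^{-n(q+1-s)}|v|_{H^{q+1}(I)}$; and for all $d\ge2$, $N\ge0$ and $v\in H^{p+1}(\Omega)$, $|\mathbf P_N^kv-v|_{H^s(\Omega_N)}\le\bar{\bar c}_{k,s,q}2^{-N(q+1-s)}|v|_{H^{q+1}(\Omega)}$. 2. For all $d\ge2$, $k\ge1$, $1\le q\le\min\{p,k\}$, $N\ge1$, $\boldsymbol a\in\mathbb R^d$, all $u_0$ in the periodic space $\mathcal H^{p+1}$ and all $t\ge0$, $$\|u_h(t)-u(t)\|_{L^2(\Omega)}\le\Big(2\sqrt{C_d\|\boldsymbol a\|_2t}\;C_\star(k,q,d,N)+\big(\bar{\bar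 c}_{k,0,q}+B_0(k,q,d)\,\kappa_0(k,q,N)^d\big)2^{-N/2}\Big)2^{-N(q+1/2)}\,|u_0|_{\mathcal H^{q+1}(\Omega)} .$$ Moreover, for all $d\ge2$ and $k\ge1$ there is $M>0$, depending only on $d$ and $k$, such that for all $\boldsymbol a$, all $u_0$ in the periodic space $\mathcal H^{k+1}$, all $N\ge1$ and all $t\ge0$, the error $\|u_h(t)-u(t)\|_{L^2(\Omega)}$ is at most $$M\big(1+\sqrt{\|\boldsymbol a\|_2t}\big)|u_0|_{\mathcal H^{k+1}(\Omega)}\,N^d2^{-N(k+1/2)}\quad\text{and at most}\quad M\big(1+\sqrt{\|\boldsymbol a\|_2t}\big)|u_0|_{\mathcal H^{k+1}(\Omega)}\,|\log h_N|^d\,h_N^{k+1/2}.$$ -/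

import Mathlib

open MeasureTheory Set
open scoped ContDiff

noncomputable section

namespace SparseDG

/-! ## Domain, derivatives, Sobolev semi-norms

Points of `ℝ^d` are functions `Fin d → ℝ`, with Lebesgue measure. -/

/-- The (open) unit cube `Ω = (0,1)^d`. -/
def cube (d : ℕ) : Set (Fin d → ℝ) := Set.univ.pi fun _ => Ioo (0 : ℝ) 1

/-- The elementary cell of the uniform grid `Ω_N` of mesh size `2^{-N}` with multi-index `j`. -/
def cell {d : ℕ} (N : ℕ) (j : Fin d → Fin (2 ^ N)) : Set (Fin d → ℝ) :=
  Set.univ.pi fun i => Ioo (((j i : ℕ) : ℝ) / 2 ^ N) ((((j i : ℕ) : ℝ) + 1) / 2 ^ N)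

/-- `f` is `1`-periodic in each coordinate. -/
def UnitPeriodic {d : ℕ} (f : (Fin d → ℝ) → ℝ) : Prop :=
  ∀ i : Fin d, Function.Periodic f (Pi.single i (1 : ℝ))

/-- The classical partial derivative `∂f/∂x_i`. -/
def partialDeriv {d : ℕ} (i : Fin d) (f : (Fin d → ℝ) → ℝ) : (Fin d → ℝ) → ℝ :=
  fun x => fderiv ℝ f x (Pi.single i 1)

/-- The classical derivative `∂^α f` (used on smooth functions only). -/
def multiDeriv {d : ℕ} (α : Fin d → ℕ) (f : (Fin d → ℝ) → ℝ) : (Fin d → ℝ) → ℝ :=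
  (List.finRange d).foldr (fun i g => (partialDeriv i)^[α i] g) f

/-- `g` is the weak derivative `∂^α v` on the open set `U`. -/
def HasWeakDeriv {d : ℕ} (α : Fin d → ℕ) (U : Set (Fin d → ℝ)) (v g : (Fin d → ℝ) → ℝ) : Prop :=
  LocallyIntegrableOn v U ∧ LocallyIntegrableOn g U ∧
    ∀ φ : (Fin d → ℝ) → ℝ, ContDiff ℝ ∞ φ → HasCompactSupport φ → tsupport φ ⊆ U →
      ∫ x in U, v x * multiDeriv α φ x = (-1) ^ (∑ i, α i) * ∫ x in U, g x * φ x

open Classical in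
/-- The weak derivative `∂^α v` on `U` (unique up to null sets when it exists, `0` otherwise). -/
def weakDeriv {d : ℕ} (α : Fin d → ℕ) (U : Set (Fin d → ℝ)) (v : (Fin d → ℝ) → ℝ) :
    (Fin d → ℝ) → ℝ :=
  if h : ∃ g, HasWeakDeriv α U v g then h.choose else 0

/-- The norm of `L^2(U)`, for square-integrable functions. -/
def l2Norm {d : ℕ} (U : Set (Fin d → ℝ)) (f : (Fin d → ℝ) → ℝ) : ℝ :=
  √(∫ x in U, f x ^ 2)

/-- The Sobolev space `H^m(U)`. -/
def MemSobolev {d : ℕ} (m : ℕ) (U : Set (Fin d → ℝ)) (v : (Fin d → ℝ) → ℝ) : Prop :=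
  ∀ α : Fin d → ℕ, ∑ i, α i ≤ m →
    ∃ g, MemLp g 2 (volume.restrict U) ∧ HasWeakDeriv α U v g

/-- The Sobolev semi-norm `|v|_{H^s(U)}`; for `s = 0` it is the `L^2` norm. -/
def sobolevSeminorm {d : ℕ} (s : ℕ) (U : Set (Fin d → ℝ)) (v : (Fin d → ℝ) → ℝ) : ℝ :=
  √(∑ α ∈ Finset.Nat.antidiagonalTuple d s, l2Norm U (weakDeriv α U v) ^ 2)

/-- The broken Sobolev semi-norm `|v|_{H^s(Ω_N)}`. -/
def brokenSeminorm {d : ℕ} (s N : ℕ) (v : (Fin d → ℝ) → ℝ) : ℝ :=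
  √(∑ j : Fin d → Fin (2 ^ N), sobolevSeminorm s (cell N j) v ^ 2)

/-- The periodic space `𝓗^m` of mixed smoothness: periodic functions all of whose weak derivatives
`∂^α v` of order at most `m` in each direction are square integrable over a period. The weak
derivatives are taken on all of `ℝ^d`, so `v` has no jumps across the boundary of the cube. -/
def MemMixedPeriodic {d : ℕ} (m : ℕ) (v : (Fin d → ℝ) → ℝ) : Prop :=
  UnitPeriodic v ∧ ∀ α : Fin d → ℕ, (∀ i, α i ≤ m) →
    ∃ g, MemLp g 2 (volume.restrict (cube d)) ∧ HasWeakDeriv α Set.univ v g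

/-- `|v|_{𝓗^m(U)} = max_L ‖(∏_{i ∈ L} ∂_i^m) v‖_{L^2(U)}` over the non-empty sets `L` of
directions. -/
def mixedSeminorm {d : ℕ} (m : ℕ) (U : Set (Fin d → ℝ)) (v : (Fin d → ℝ) → ℝ) : ℝ :=
  ⨆ L : {L : Finset (Fin d) // L.Nonempty},
    l2Norm U (weakDeriv (fun i => if i ∈ L.1 then m else 0) U v)

/-! ## Finite element spaces

Piecewise polynomials are extended periodically, so that the traces on the two opposite sides of the
cube are identified as prescribed by periodic boundary conditions. -/

/-- `V_n^k`: polynomials of degree at most `k` on each `(2^{-n} j, 2^{-n} (j+1)]`, `0 ≤ j < 2^n`,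
extended `1`-periodically. -/
def V (n k : ℕ) : Set (ℝ → ℝ) :=
  {v | Function.Periodic v 1 ∧ ∀ j : ℕ, j < 2 ^ n →
    ∃ P : Polynomial ℝ, P.natDegree ≤ k ∧
      ∀ x ∈ Ioc ((j : ℝ) / 2 ^ n) (((j : ℝ) + 1) / 2 ^ n), v x = P.eval x}

/-- The multiwavelet space `W_n^k`: `W_0^k = V_0^k`, and `W_n^k` is the `L^2(0,1)`-orthogonal
complement of `V_{n-1}^k` in `V_n^k` for `n ≥ 1`. -/
def W : ℕ → ℕ → Set (ℝ → ℝ)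
  | 0, k => V 0 k
  | n + 1, k => {v | v ∈ V (n + 1) k ∧ ∀ w ∈ V n k, ∫ x in (0 : ℝ)..1, v x * w x = 0}

/-- The tensor product `S_1 ⊗ ⋯ ⊗ S_d` of spaces of functions of one variable. -/
def tensorSpan {d : ℕ} (S : Fin d → Set (ℝ → ℝ)) : Submodule ℝ ((Fin d → ℝ) → ℝ) :=
  Submodule.span ℝ {f | ∃ g : Fin d → ℝ → ℝ, (∀ i, g i ∈ S i) ∧ f = fun x => ∏ i, g i (x i)}

/-- The full tensor-product space `𝐕_N^k`. -/
def fullSpace (d N k : ℕ) : Submodule ℝ ((Fin d → ℝ) → ℝ) :=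
  tensorSpan fun _ => V N k

/-- The sparse grid space `𝐕̂_N^k`, the sum of the `𝐖_𝐥^k` with `|𝐥|_1 ≤ N`. -/
def sparseSpace (d N k : ℕ) : Submodule ℝ ((Fin d → ℝ) → ℝ) :=
  ⨆ l : {l : Fin d → ℕ // ∑ i, l i ≤ N}, tensorSpan fun i => W (l.1 i) k

/-- `w` is the `L^2(Ω)` projection of `v` onto `S`. -/
def IsL2Proj {d : ℕ} (S : Submodule ℝ ((Fin d → ℝ) → ℝ)) (v w : (Fin d → ℝ) → ℝ) : Prop :=
  w ∈ S ∧ ∀ z ∈ S, ∫ x in cube d, (w x - v x) * z x = 0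

/-! ## The DG scheme -/

/-- The trace of `v` at `x` from the cell on the lower side of `x` in direction `m`, for which
`e_m` is the outward normal. -/
def traceMinus {d : ℕ} (m : Fin d) (v : (Fin d → ℝ) → ℝ) (x : Fin d → ℝ) : ℝ :=
  Function.leftLim (fun s => v (Function.update x m s)) (x m)

/-- The trace of `v` at `x` from the cell on the upper side of `x` in direction `m`, for which
`-e_m` is the outward normal. -/
def tracePlus {d : ℕ} (m : Fin d) (v : (Fin d → ℝ) → ℝ) (x : Fin d → ℝ) : ℝ :=
  Function.rightLim (fun s => v (Function.update x m s)) (x m)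

/-- The unit vector `e_m`. -/
def normal {d : ℕ} (m : Fin d) : Fin d → ℝ := Pi.single m 1

/-- The jump `[v] = v^- n^- + v^+ n^+` across an interface orthogonal to `e_m`. -/
def jump {d : ℕ} (m : Fin d) (v : (Fin d → ℝ) → ℝ) (x : Fin d → ℝ) : Fin d → ℝ :=
  traceMinus m v x • normal m + tracePlus m v x • (-normal m)

/-- The average `{v}` on an interface orthogonal to `e_m`. -/
def average {d : ℕ} (m : Fin d) (v : (Fin d → ℝ) → ℝ) (x : Fin d → ℝ) : ℝ :=
  (traceMinus m v x + tracePlus m v x) / 2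

/-- The upwind flux `a {u} + (|a · n| / 2) [u]`. -/
def upwindFlux {d : ℕ} (a : EuclideanSpace ℝ (Fin d)) (m : Fin d) (u : (Fin d → ℝ) → ℝ)
    (x : Fin d → ℝ) : Fin d → ℝ :=
  average m u x • (fun i => a i) + (|∑ i, a i * normal m i| / 2) • jump m u x

/-- The integral of `f` over the lower face orthogonal to `e_m` of the cell with index `j`, with
respect to the `(d-1)`-dimensional surface measure. With opposite sides of the cube identified,
every interface of the grid is the face of exactly one pair `(m, j)`. -/
def faceIntegral {d : ℕ} (N : ℕ) (m : Fin d) (j : Fin d → Fin (2 ^ N))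
    (f : (Fin d → ℝ) → ℝ) : ℝ :=
  ∫ y in Set.univ.pi (fun i : {i : Fin d // i ≠ m} =>
      Ioo (((j i : ℕ) : ℝ) / 2 ^ N) ((((j i : ℕ) : ℝ) + 1) / 2 ^ N)),
    f (fun i => if h : i = m then ((j m : ℕ) : ℝ) / 2 ^ N else y ⟨i, h⟩)

/-- The DG form
`A(u, v) = ∫_Ω u a · ∇v dx - ∑_{e ∈ Γ} ∫_e (upwind flux of u) · [v] ds`
with `∇v` taken cell by cell. -/
def dgForm {d : ℕ} (a : EuclideanSpace ℝ (Fin d)) (N : ℕ) (u v : (Fin d → ℝ) → ℝ) : ℝ :=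
  (∑ j : Fin d → Fin (2 ^ N), ∫ x in cell N j, u x * ∑ i, a i * partialDeriv i v x)
    - ∑ m : Fin d, ∑ j : Fin d → Fin (2 ^ N),
        faceIntegral N m j fun x => ∑ i, upwindFlux a m u x i * jump m v x i

/-- `uh` solves the semi-discrete scheme: `uh(t)` lies in the sparse space and
`d/dt ∫_Ω uh v = A(uh, v)` for all test functions `v` of the sparse space and all `t ≥ 0`. -/
structure IsDGSolution {d : ℕ} (a : EuclideanSpace ℝ (Fin d)) (N k : ℕ)
    (uh : ℝ → (Fin d → ℝ) → ℝ) : Prop where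
  mem : ∀ t, 0 ≤ t → uh t ∈ sparseSpace d N k
  eqn : ∀ t, 0 ≤ t → ∀ v ∈ sparseSpace d N k,
    HasDerivWithinAt (fun s => ∫ x in cube d, uh s x * v x) (dgForm a N (uh t) v) (Ici 0) t

/-- `u` is the (weak) solution of `u_t + ∇ · (a u) = 0` on the unit cube with periodic boundary
conditions and `u(0) = u₀`: `u(t) ∈ L^2(Ω)` and
`d/dt ∫_Ω u ψ dx = ∫_Ω u a · ∇ψ dx` for all smooth periodic `ψ` and all `t ≥ 0`. -/
structure IsTransportSolution {d : ℕ} (a : EuclideanSpace ℝ (Fin d)) (u₀ : (Fin d → ℝ) → ℝ)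
    (u : ℝ → (Fin d → ℝ) → ℝ) : Prop where
  memLp : ∀ t, 0 ≤ t → MemLp (u t) 2 (volume.restrict (cube d))
  init : u 0 =ᵐ[volume.restrict (cube d)] u₀
  eqn : ∀ t, 0 ≤ t → ∀ ψ : (Fin d → ℝ) → ℝ, ContDiff ℝ ∞ ψ → UnitPeriodic ψ →
    HasDerivWithinAt (fun s => ∫ x in cube d, u s x * ψ x)
      (∫ x in cube d, u t x * ∑ i, a i * partialDeriv i ψ x) (Ici 0) t

/-! ## Constants

`c k s q` is a constant `c_{k,s,q}` of the one-dimensional projection estimate, and `cc k s q` a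
constant of the estimate for the full tensor-product projection. -/

/-- `|P_n^k v - v|_{H^s(I)} ≤ c_{k,s,q} 2^{-n(q+1-s)} |v|_{H^{q+1}(I)}` on all cells `I` of the `n`-th
level grid, for all `v ∈ H^{p+1}(0,1)`, `1 ≤ q ≤ min(p,k)`, `s ∈ {0,1}`. -/
def IsProjConst1D (c : ℕ → ℕ → ℕ → ℝ) : Prop :=
  ∀ k p q s n : ℕ, 1 ≤ k → 1 ≤ q → q ≤ min p k → s ≤ 1 →
    ∀ v w : (Fin 1 → ℝ) → ℝ, MemSobolev (p + 1) (cube 1) v → IsL2Proj (fullSpace 1 n k) v w →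
      ∀ j : Fin 1 → Fin (2 ^ n),
        sobolevSeminorm s (cell n j) (fun x => w x - v x)
          ≤ c k s q * (2 : ℝ) ^ (-((n : ℝ) * ((q : ℝ) + 1 - s)))
              * sobolevSeminorm (q + 1) (cell n j) v

/-- `|𝐏_N^k v - v|_{H^s(Ω_N)} ≤ cc_{k,s,q} 2^{-N(q+1-s)} |v|_{H^{q+1}(Ω)}` for the `L^2` projection
onto the full tensor-product space, for all `v ∈ H^{p+1}(Ω)`, `1 ≤ q ≤ min(p,k)`, `s ∈ {0,1}`, in
every dimension `d ≥ 2`. -/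
def IsProjConstTensor (cc : ℕ → ℕ → ℕ → ℝ) : Prop :=
  ∀ d k p q s N : ℕ, 2 ≤ d → 1 ≤ k → 1 ≤ q → q ≤ min p k → s ≤ 1 →
    ∀ v w : (Fin d → ℝ) → ℝ, MemSobolev (p + 1) (cube d) v → IsL2Proj (fullSpace d N k) v w →
      brokenSeminorm s N (fun x => w x - v x)
        ≤ cc k s q * (2 : ℝ) ^ (-((N : ℝ) * ((q : ℝ) + 1 - s)))
            * sobolevSeminorm (q + 1) (cube d) v

/-- `c̃_{k,s,q} = c_{k,s,q} (1 + 2^{-(q+1-s)})`. -/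
def cTilde (c : ℕ → ℕ → ℕ → ℝ) (k s q : ℕ) : ℝ :=
  c k s q * (1 + (2 : ℝ) ^ (-((q : ℝ) + 1 - s)))

/-- `ĉ_{k,0} = 1` and `ĉ_{k,1} = √12 k²`. -/
def cHat (k s : ℕ) : ℝ := if s = 0 then 1 else √12 * (k : ℝ) ^ 2

/-- `C_{k,q} = max(c̃_{k,0,q}, ĉ_{k,0})`. -/
def bigC (c : ℕ → ℕ → ℕ → ℝ) (k q : ℕ) : ℝ := max (cTilde c k 0 q) (cHat k 0)

/-- `c̄_{k,q} = max(c̃_{k,1,q}² ĉ_{k,0}², c̃_{k,0,q}² ĉ_{k,1}²)`. -/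
def cBar (c : ℕ → ℕ → ℕ → ℝ) (k q : ℕ) : ℝ :=
  max (cTilde c k 1 q ^ 2 * cHat k 0 ^ 2) (cTilde c k 0 q ^ 2 * cHat k 1 ^ 2)

/-- `κ_0 = (N+1) C_{k,q}` and `κ_1 = 2 C_{k,q}`. -/
def kappa (c : ℕ → ℕ → ℕ → ℝ) (s k q N : ℕ) : ℝ :=
  if s = 0 then ((N : ℝ) + 1) * bigC c k q else 2 * bigC c k q

/-- `B_0 = 2^{-(q+1)}` and `B_1 = d^{3/2} √c̄_{k,q} C_{k,q}^{-2} / 2`. -/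
def bigB (c : ℕ → ℕ → ℕ → ℝ) (s k q d : ℕ) : ℝ :=
  if s = 0 then (2 : ℝ) ^ (-((q : ℝ) + 1))
  else (d : ℝ) ^ (3 / 2 : ℝ) * √(cBar c k q) * (bigC c k q ^ 2)⁻¹ / 2

/-- `cc_{k,s,q} + B_s(k,q,d) κ_s(k,q,N)^d`. -/
def approxConst (c cc : ℕ → ℕ → ℕ → ℝ) (s k q d N : ℕ) : ℝ :=
  cc k s q + bigB c s k q d * kappa c s k q N ^ d

/-- `C_⋆(k,q,d,N)`. -/
def cStar (c cc : ℕ → ℕ → ℕ → ℝ) (k q d N : ℕ) : ℝ :=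
  max (approxConst c cc 0 k q d N) (approxConst c cc 1 k q d N)

/-- The mesh size `h_N = 2^{-N}`. -/
def meshSize (N : ℕ) : ℝ := (1 / 2 : ℝ) ^ N

end SparseDG

end

/-!
The proof rests on three facts: constant-coefficient transport is translation, the sparse space is
closed under differentiation on the cells, and the upwind flux dissipates the jumps of the test
function.

**Reduction to smooth data.** A weak solution of the transport equation has the trigonometric
moments of the translated initial value (`IsTransportSolution.moment`), hence is that translate
(`IsTransportSolution.ae_eq_translate`). Translation preserves all the norms involved, and a
function of the periodic mixed Sobolev space is an `L²` limit of smooth periodic functions whose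
mixed derivatives obey the same bound (`MemMixedPeriodic.exists_isMixedFamily`). It therefore
suffices to compare the scheme with translates of smooth functions.

**Stability.** Let `w` be the projection of the smooth solution `v` onto the sparse space, and
`e = u_h - w`. The derivative of `‖e‖²` contains the volume term `∫ (w - v) a · ∇e`, which vanishes
because the cellwise gradient of `e` again has its components in the sparse space
(`derivOp_mem_sparseSpace`) and `w - v` is orthogonal to that space. In the interface terms the
upwind flux absorbs the jumps of `e` (`flux_young`, `dgForm_energy_le`), leaving the squared traces
of `w - v`. These are bounded by `h⁻¹` times the square of the approximation error
(`integral_traceError_le`), so that `‖e‖` grows at most like `√(‖a‖ t / h)` times that error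
(`l2Norm_dg_sub_translate_le`).

**Approximation.** In one variable the projection is the integral operator whose kernel is the
reproducing kernel of the polynomials on each cell. With Taylor's formula its error is a cell-local
operator, bounded uniformly in the level, applied to a derivative of order `q + 1`
(`sub_projOp_eq`). In `d` variables the sparse combination of the one-dimensional details maps into
the sparse space (`sparseOp_mem_sparseSpace`); peeling off one direction at a time gives the error
bound `(C (N + 1))^d h^(q+1)` (`l2Norm_sub_sparseOp_le`), and the projection onto the sparse space
is at least as good. For the full tensor-product projection the errors in the single directions are
orthogonal (`l2Norm_sub_fullOp_sq_le`), so the constants do not depend on the dimension; Sobolev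
functions are treated by density (`MemSobolev.exists_smooth_seq_proj`).

**Constants.** The admissible constants of the projection estimates may be enlarged, and `projConst`
is chosen so large that `κ_0 ^ d` dominates the constants above
(`sparseConst_pow_le_approxConst`).
-/

noncomputable section

namespace SparseDG

/-! ### Lebesgue measure on the unit cube and its one-dimensional slices -/

/-- Lebesgue measure on the unit interval. -/
abbrev unitMeasure : Measure ℝ := volume.restrict (Ioo (0 : ℝ) 1)

/-- Lebesgue measure on the unit cube. -/
abbrev cubeMeasure (d : ℕ) : Measure (Fin d → ℝ) := volume.restrict (cube d)

instance : IsProbabilityMeasure unitMeasure := ⟨by simp⟩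

lemma cubeMeasure_eq_pi (d : ℕ) : cubeMeasure d = Measure.pi fun _ : Fin d => unitMeasure := by
  rw [cubeMeasure, cube, volume_pi, Measure.restrict_pi_pi]

instance (d : ℕ) : IsProbabilityMeasure (cubeMeasure d) := by
  rw [cubeMeasure_eq_pi]; infer_instance

lemma measurableSet_cube (d : ℕ) : MeasurableSet (cube d) :=
  MeasurableSet.univ_pi fun _ => measurableSet_Ioo

lemma isOpen_cube (d : ℕ) : IsOpen (cube d) :=
  isOpen_set_pi Set.finite_univ fun _ _ => isOpen_Ioo

lemma ae_mem_cube (d : ℕ) : ∀ᵐ x ∂cubeMeasure d, x ∈ cube d :=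
  ae_restrict_mem (measurableSet_cube d)

lemma mem_cube {d : ℕ} {x : Fin d → ℝ} : x ∈ cube d ↔ ∀ i, x i ∈ Ioo (0 : ℝ) 1 := by
  simp [cube]

lemma update_mem_cube {d : ℕ} {x : Fin d → ℝ} (hx : x ∈ cube d) (m : Fin d) {s : ℝ}
    (hs : s ∈ Ioo (0 : ℝ) 1) : Function.update x m s ∈ cube d := by
  rw [mem_cube] at *
  intro i
  by_cases h : i = m
  · subst h; simpa using hs
  · simpa [h] using hx i

lemma measurable_update_prod {d : ℕ} (m : Fin d) :
    Measurable fun p : (Fin d → ℝ) × ℝ => Function.update p.1 m p.2 := by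
  rw [measurable_pi_iff]
  intro i
  by_cases h : i = m
  · subst h; simpa using measurable_snd
  · simp only [Function.update_of_ne h]
    exact (measurable_pi_apply i).comp measurable_fst

/-- Resampling one coordinate independently preserves the measure of the cube; this is Fubini's
theorem in a form that keeps all functions on the same space. -/
lemma measurePreserving_update {d : ℕ} (m : Fin d) :
    MeasurePreserving (fun p : (Fin d → ℝ) × ℝ => Function.update p.1 m p.2)
      ((cubeMeasure d).prod unitMeasure) (cubeMeasure d) := by
  refine ⟨measurable_update_prod m, ?_⟩
  rw [cubeMeasure_eq_pi]
  symm
  refine Measure.pi_eq fun s hs => ?_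
  rw [Measure.map_apply (measurable_update_prod m) (MeasurableSet.univ_pi hs)]
  have : (fun p : (Fin d → ℝ) × ℝ => Function.update p.1 m p.2) ⁻¹' (univ.pi s)
      = (univ.pi (Function.update s m univ)) ×ˢ (s m) := by
    ext ⟨x, t⟩
    simp only [mem_preimage, mem_pi, mem_univ, forall_const, mem_prod]
    constructor
    · intro h
      refine ⟨fun i => ?_, by simpa using h m⟩
      by_cases hi : i = m
      · subst hi; simp
      · simpa [hi] using h i
    · rintro ⟨h1, h2⟩ i
      by_cases hi : i = m
      · subst hi; simpa using h2
      · simpa [hi] using h1 i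
  rw [this, Measure.prod_prod, Measure.pi_pi]
  rw [← Finset.prod_erase_mul _ _ (Finset.mem_univ m),
    ← Finset.prod_erase_mul Finset.univ (fun i => unitMeasure (s i)) (Finset.mem_univ m)]
  have h1 : unitMeasure (Function.update s m univ m) = 1 := by
    simp
  rw [h1, mul_one]
  congr 1
  refine Finset.prod_congr rfl fun i hi => ?_
  rw [Function.update_of_ne (Finset.ne_of_mem_erase hi)]

lemma integrable_update {d : ℕ} (m : Fin d) {F : (Fin d → ℝ) → ℝ}
    (hF : Integrable F (cubeMeasure d)) :
    Integrable (fun p : (Fin d → ℝ) × ℝ => F (Function.update p.1 m p.2))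
      ((cubeMeasure d).prod unitMeasure) :=
  (measurePreserving_update m).integrable_comp_of_integrable hF

lemma integral_update {d : ℕ} (m : Fin d) {F : (Fin d → ℝ) → ℝ}
    (hF : Integrable F (cubeMeasure d)) :
    ∫ x in cube d, F x = ∫ x in cube d, ∫ s in Ioo (0 : ℝ) 1, F (Function.update x m s) := by
  have h := measurePreserving_update m
  rw [← integral_prod (fun p : (Fin d → ℝ) × ℝ => F (Function.update p.1 m p.2))
    (integrable_update m hF)]
  conv_lhs => rw [show volume.restrict (cube d) = cubeMeasure d from rfl, ← h.map_eq]
  rw [integral_map h.measurable.aemeasurable]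
  rw [h.map_eq]; exact hF.1

/-- Forgetting one coordinate maps the measure of the cube to that of a face. -/
lemma measurePreserving_forget {d : ℕ} (m : Fin d) :
    MeasurePreserving (fun (x : Fin d → ℝ) (i : {i : Fin d // i ≠ m}) => x i)
      (cubeMeasure d)
      (volume.restrict (univ.pi fun _ : {i : Fin d // i ≠ m} => Ioo (0 : ℝ) 1)) := by
  have hm : Measurable (fun (x : Fin d → ℝ) (i : {i : Fin d // i ≠ m}) => x i) :=
    measurable_pi_iff.2 fun i => measurable_pi_apply _
  refine ⟨hm, ?_⟩
  rw [cubeMeasure_eq_pi, volume_pi, Measure.restrict_pi_pi]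
  symm
  refine Measure.pi_eq fun s hs => ?_
  rw [Measure.map_apply hm (MeasurableSet.univ_pi hs)]
  have : (fun (x : Fin d → ℝ) (i : {i : Fin d // i ≠ m}) => x i) ⁻¹' (univ.pi s)
      = univ.pi (fun i : Fin d => if h : i = m then univ else s ⟨i, h⟩) := by
    ext x
    simp only [mem_preimage, mem_pi, mem_univ, forall_const]
    constructor
    · intro h i
      by_cases hi : i = m
      · simp [hi]
      · simpa [hi] using h ⟨i, hi⟩
    · rintro h ⟨i, hi⟩
      have := h i
      rw [dif_neg hi] at this
      exact this
  rw [this, Measure.pi_pi]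
  rw [← Fintype.prod_subtype_mul_prod_subtype (fun i => i ≠ m)]
  have : ∏ i : {i : Fin d // ¬ i ≠ m}, unitMeasure
      (if h : (i : Fin d) = m then univ else s ⟨i, h⟩) = 1 := by
    refine Finset.prod_eq_one fun i _ => ?_
    have := i.2
    simp only [ne_eq, not_not] at this
    rw [dif_pos this]; simp
  rw [this, mul_one]
  refine Finset.prod_congr rfl fun i _ => ?_
  rw [dif_neg i.2]

/-! ### Square-integrable functions on the cube -/

lemma l2Norm_nonneg {d : ℕ} (U : Set (Fin d → ℝ)) (f : (Fin d → ℝ) → ℝ) : 0 ≤ l2Norm U f :=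
  Real.sqrt_nonneg _

lemma l2Norm_sq {d : ℕ} (U : Set (Fin d → ℝ)) (f : (Fin d → ℝ) → ℝ) :
    l2Norm U f ^ 2 = ∫ x in U, f x ^ 2 :=
  Real.sq_sqrt (integral_nonneg fun _ => sq_nonneg _)

lemma l2Norm_congr {d : ℕ} {U : Set (Fin d → ℝ)} {f g : (Fin d → ℝ) → ℝ}
    (h : f =ᵐ[volume.restrict U] g) : l2Norm U f = l2Norm U g := by
  unfold l2Norm
  congr 1
  refine integral_congr_ae ?_
  filter_upwards [h] with x hx
  rw [hx]

lemma l2Norm_eq_norm_toLp {d : ℕ} {U : Set (Fin d → ℝ)} {f : (Fin d → ℝ) → ℝ}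
    (hf : MemLp f 2 (volume.restrict U)) : l2Norm U f = ‖hf.toLp f‖ := by
  have h := hf.toLp f |> fun F => real_inner_self_eq_norm_sq F
  rw [L2.inner_def] at h
  rw [l2Norm, Real.sqrt_eq_iff_mul_self_eq (integral_nonneg fun _ => sq_nonneg _) (norm_nonneg _),
    ← sq, ← h]
  refine integral_congr_ae ?_
  filter_upwards [hf.coeFn_toLp] with x hx
  rw [hx]; simp [sq]

lemma l2Norm_add_le {d : ℕ} {U : Set (Fin d → ℝ)} {f g : (Fin d → ℝ) → ℝ}
    (hf : MemLp f 2 (volume.restrict U)) (hg : MemLp g 2 (volume.restrict U)) :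
    l2Norm U (fun x => f x + g x) ≤ l2Norm U f + l2Norm U g := by
  have h : l2Norm U (fun x => f x + g x) = ‖hf.toLp f + hg.toLp g‖ := by
    rw [← MemLp.toLp_add, ← l2Norm_eq_norm_toLp]; rfl
  rw [h, l2Norm_eq_norm_toLp hf, l2Norm_eq_norm_toLp hg]
  exact norm_add_le _ _

lemma l2Norm_neg {d : ℕ} (U : Set (Fin d → ℝ)) (f : (Fin d → ℝ) → ℝ) :
    l2Norm U (fun x => - f x) = l2Norm U f := by simp [l2Norm]

lemma l2Norm_zero {d : ℕ} (U : Set (Fin d → ℝ)) : l2Norm U (fun _ => 0) = 0 := by simp [l2Norm]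

lemma l2Norm_const_mul {d : ℕ} (U : Set (Fin d → ℝ)) (c : ℝ) (f : (Fin d → ℝ) → ℝ) :
    l2Norm U (fun x => c * f x) = |c| * l2Norm U f := by
  simp only [l2Norm, mul_pow]
  rw [integral_const_mul, Real.sqrt_mul (sq_nonneg c), Real.sqrt_sq_eq_abs]

lemma l2Norm_sub_comm {d : ℕ} (U : Set (Fin d → ℝ)) (f g : (Fin d → ℝ) → ℝ) :
    l2Norm U (fun x => f x - g x) = l2Norm U (fun x => g x - f x) := by
  rw [← l2Norm_neg]; simp

lemma l2Norm_sub_le {d : ℕ} {U : Set (Fin d → ℝ)} {f g : (Fin d → ℝ) → ℝ}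
    (hf : MemLp f 2 (volume.restrict U)) (hg : MemLp g 2 (volume.restrict U)) :
    l2Norm U (fun x => f x - g x) ≤ l2Norm U f + l2Norm U g := by
  have := l2Norm_add_le hf hg.neg
  simp only [Pi.neg_apply, ← sub_eq_add_neg] at this
  refine this.trans (le_of_eq ?_)
  rw [← l2Norm_neg U g]; rfl

lemma l2Norm_sub_le_sub {d : ℕ} {U : Set (Fin d → ℝ)} {f g h : (Fin d → ℝ) → ℝ}
    (hf : MemLp f 2 (volume.restrict U)) (hg : MemLp g 2 (volume.restrict U))
    (hh : MemLp h 2 (volume.restrict U)) :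
    l2Norm U (fun x => f x - h x) ≤ l2Norm U (fun x => f x - g x)
      + l2Norm U (fun x => g x - h x) := by
  have := l2Norm_add_le (hf.sub hg) (hg.sub hh)
  simp only [Pi.sub_apply, sub_add_sub_cancel] at this
  exact this

lemma l2Norm_sum_le {d : ℕ} {U : Set (Fin d → ℝ)} {ι : Type*} (s : Finset ι)
    {f : ι → (Fin d → ℝ) → ℝ} (hf : ∀ i ∈ s, MemLp (f i) 2 (volume.restrict U)) :
    l2Norm U (fun x => ∑ i ∈ s, f i x) ≤ ∑ i ∈ s, l2Norm U (f i) := by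
  classical
  induction s using Finset.induction_on with
  | empty => simp [l2Norm_zero]
  | insert a s ha ih =>
    simp only [Finset.sum_insert ha]
    have h1 : MemLp (fun x => ∑ i ∈ s, f i x) 2 (volume.restrict U) :=
      memLp_finsetSum s fun i hi => hf i (Finset.mem_insert_of_mem hi)
    refine (l2Norm_add_le (hf a (Finset.mem_insert_self _ _)) h1).trans ?_
    gcongr
    exact ih fun i hi => hf i (Finset.mem_insert_of_mem hi)

/-- Bounded measurable functions, the class on which all operators act. -/
structure BddMeas {d : ℕ} (f : (Fin d → ℝ) → ℝ) : Prop where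
  measurable : Measurable f
  bdd : ∃ C, ∀ x, |f x| ≤ C

namespace BddMeas
variable {d : ℕ} {f g : (Fin d → ℝ) → ℝ}

lemma memLp (hf : BddMeas f) {ν : Measure (Fin d → ℝ)} [IsFiniteMeasure ν] (p : ENNReal) :
    MemLp f p ν := by
  obtain ⟨C, hC⟩ := hf.bdd
  exact MemLp.of_bound hf.measurable.aestronglyMeasurable C (Filter.Eventually.of_forall hC)

lemma integrable (hf : BddMeas f) {ν : Measure (Fin d → ℝ)} [IsFiniteMeasure ν] :
    Integrable f ν := memLp_one_iff_integrable.1 (hf.memLp 1)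

lemma const (c : ℝ) : BddMeas (fun _ : Fin d → ℝ => c) := ⟨measurable_const, |c|, fun _ => le_rfl⟩

lemma add (hf : BddMeas f) (hg : BddMeas g) : BddMeas (fun x => f x + g x) := by
  obtain ⟨C, hC⟩ := hf.bdd
  obtain ⟨D, hD⟩ := hg.bdd
  exact ⟨hf.1.add hg.1, C + D, fun x => (abs_add_le _ _).trans (add_le_add (hC x) (hD x))⟩

lemma mul (hf : BddMeas f) (hg : BddMeas g) : BddMeas (fun x => f x * g x) := by
  obtain ⟨C, hC⟩ := hf.bdd
  obtain ⟨D, hD⟩ := hg.bdd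
  refine ⟨hf.1.mul hg.1, C * D, fun x => ?_⟩
  rw [abs_mul]
  exact mul_le_mul (hC x) (hD x) (abs_nonneg _) ((abs_nonneg _).trans (hC x))

lemma neg (hf : BddMeas f) : BddMeas (fun x => - f x) := by
  obtain ⟨C, hC⟩ := hf.bdd
  exact ⟨hf.1.neg, C, fun x => by rw [abs_neg]; exact hC x⟩

lemma sub (hf : BddMeas f) (hg : BddMeas g) : BddMeas (fun x => f x - g x) := by
  simpa only [sub_eq_add_neg] using hf.add hg.neg

lemma const_mul (c : ℝ) (hf : BddMeas f) : BddMeas (fun x => c * f x) := (const c).mul hf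

lemma sum {ι : Type*} (s : Finset ι) {F : ι → (Fin d → ℝ) → ℝ} (hF : ∀ i ∈ s, BddMeas (F i)) :
    BddMeas (fun x => ∑ i ∈ s, F i x) := by
  classical
  induction s using Finset.induction_on with
  | empty => simpa using const 0
  | insert a s ha ih =>
    simp only [Finset.sum_insert ha]
    exact (hF a (Finset.mem_insert_self _ _)).add
      (ih fun i hi => hF i (Finset.mem_insert_of_mem hi))

lemma prod {ι : Type*} (s : Finset ι) {F : ι → (Fin d → ℝ) → ℝ} (hF : ∀ i ∈ s, BddMeas (F i)) :
    BddMeas (fun x => ∏ i ∈ s, F i x) := by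
  classical
  induction s using Finset.induction_on with
  | empty => simpa using const 1
  | insert a s ha ih =>
    simp only [Finset.prod_insert ha]
    exact (hF a (Finset.mem_insert_self _ _)).mul
      (ih fun i hi => hF i (Finset.mem_insert_of_mem hi))

lemma update (hf : BddMeas f) (m : Fin d) (s : ℝ) :
    BddMeas (fun x => f (Function.update x m s)) := by
  obtain ⟨C, hC⟩ := hf.bdd
  refine ⟨hf.1.comp ?_, C, fun x => hC _⟩
  exact (measurable_update_prod m).comp (measurable_id.prodMk measurable_const)

lemma slice_measurable (hf : BddMeas f) (m : Fin d) (x : Fin d → ℝ) :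
    Measurable (fun s => f (Function.update x m s)) :=
  hf.1.comp ((measurable_update_prod m).comp (measurable_const.prodMk measurable_id))

lemma slice_integrable (hf : BddMeas f) (m : Fin d) (x : Fin d → ℝ) {ν : Measure ℝ}
    [IsFiniteMeasure ν] : Integrable (fun s => f (Function.update x m s)) ν := by
  obtain ⟨C, hC⟩ := hf.bdd
  exact Integrable.of_bound (hf.slice_measurable m x).aestronglyMeasurable C
    (Filter.Eventually.of_forall fun s => hC _)

end BddMeas

lemma abs_integral_mul_le_l2Norm {d : ℕ} {U : Set (Fin d → ℝ)} {f g : (Fin d → ℝ) → ℝ}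
    (hf : MemLp f 2 (volume.restrict U)) (hg : MemLp g 2 (volume.restrict U)) :
    |∫ x in U, f x * g x| ≤ l2Norm U f * l2Norm U g := by
  rw [l2Norm_eq_norm_toLp hf, l2Norm_eq_norm_toLp hg]
  have : ∫ x in U, f x * g x = inner ℝ (hf.toLp f) (hg.toLp g) := by
    rw [L2.inner_def]
    refine integral_congr_ae ?_
    filter_upwards [hf.coeFn_toLp, hg.coeFn_toLp] with x h1 h2
    rw [h1, h2]; simp [mul_comm]
  rw [this]
  exact abs_real_inner_le_norm _ _

/-- The Cauchy--Schwarz inequality against an indicator function. -/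
lemma sq_setIntegral_abs_le {A : Set ℝ} (hA : MeasurableSet A) {f : ℝ → ℝ}
    (hf : MemLp f 2 unitMeasure) :
    (∫ s in Ioo (0 : ℝ) 1, A.indicator (fun s => |f s|) s) ^ 2
      ≤ unitMeasure.real A * ∫ s in Ioo (0 : ℝ) 1, A.indicator (fun s => f s ^ 2) s := by
  have h1 : MemLp (A.indicator (fun s => |f s|)) 2 unitMeasure := hf.abs.indicator hA
  have h2 : MemLp (A.indicator (fun _ => (1 : ℝ))) 2 unitMeasure :=
    (memLp_const (1 : ℝ)).indicator hA
  have e : ∫ s in Ioo (0 : ℝ) 1, A.indicator (fun s => |f s|) s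
      = inner ℝ (h1.toLp _) (h2.toLp _) := by
    rw [L2.inner_def]
    refine integral_congr_ae ?_
    filter_upwards [h1.coeFn_toLp, h2.coeFn_toLp] with x h1 h2
    rw [h1, h2]
    by_cases hx : x ∈ A <;> simp [hx]
  have e1 : ∫ s in Ioo (0 : ℝ) 1, A.indicator (fun s => f s ^ 2) s = ‖h1.toLp _‖ ^ 2 := by
    rw [← real_inner_self_eq_norm_sq, L2.inner_def]
    refine integral_congr_ae ?_
    filter_upwards [h1.coeFn_toLp] with x h1
    rw [h1]
    by_cases hx : x ∈ A <;> simp [hx]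
  have e2 : unitMeasure.real A = ‖h2.toLp _‖ ^ 2 := by
    rw [← real_inner_self_eq_norm_sq, L2.inner_def, ← integral_indicator_one hA]
    refine integral_congr_ae ?_
    filter_upwards [h2.coeFn_toLp] with x h2
    rw [h2]
    by_cases hx : x ∈ A <;> simp [hx]
  rw [e, e1, e2, mul_comm, ← mul_pow]
  exact sq_le_sq' (by linarith [neg_le_of_abs_le (abs_real_inner_le_norm (h1.toLp _) (h2.toLp _))])
    (real_inner_le_norm _ _)

/-! ### Dyadic cells in one variable -/

/-- The index `j` (modulo `2 ^ n`) of the dyadic cell `(2^{-n} j, 2^{-n} (j+1)]` containing `x`. -/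
def cellIdx (n : ℕ) (x : ℝ) : ℤ := (⌈(2 : ℝ) ^ n * x⌉ - 1) % 2 ^ n

/-- The affine coordinate of `x` in its dyadic cell of level `n`; it lies in `(0, 1]`. -/
def cellLoc (n : ℕ) (x : ℝ) : ℝ := (2 : ℝ) ^ n * x - ⌈(2 : ℝ) ^ n * x⌉ + 1

lemma cellLoc_mem (n : ℕ) (x : ℝ) : cellLoc n x ∈ Ioc (0 : ℝ) 1 := by
  unfold cellLoc
  constructor
  · linarith [Int.ceil_lt_add_one ((2 : ℝ) ^ n * x)]
  · linarith [Int.le_ceil ((2 : ℝ) ^ n * x)]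

lemma measurable_cellIdx (n : ℕ) : Measurable (cellIdx n) := by
  unfold cellIdx
  exact (Measurable.of_discrete (f := fun z : ℤ => (z - 1) % 2 ^ n)).comp
    (Int.measurable_ceil.comp (measurable_const.mul measurable_id))

lemma measurable_cellLoc (n : ℕ) : Measurable (cellLoc n) := by
  unfold cellLoc
  have : Measurable fun x : ℝ => ((⌈(2 : ℝ) ^ n * x⌉ : ℤ) : ℝ) :=
    (Measurable.of_discrete (f := fun z : ℤ => (z : ℝ))).comp
      (Int.measurable_ceil.comp (measurable_const.mul measurable_id))
  exact ((measurable_const.mul measurable_id).sub this).add_const 1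

lemma ceil_of_mem_cell {n j : ℕ} {x : ℝ}
    (hx : x ∈ Ioc ((j : ℝ) / 2 ^ n) (((j : ℝ) + 1) / 2 ^ n)) : ⌈(2 : ℝ) ^ n * x⌉ = j + 1 := by
  have h2 : (0 : ℝ) < 2 ^ n := by positivity
  rw [mem_Ioc, div_lt_iff₀ h2, le_div_iff₀ h2] at hx
  rw [Int.ceil_eq_iff]
  push_cast
  constructor <;> linarith [hx.1, hx.2]

lemma cellIdx_of_mem {n j : ℕ} (hj : j < 2 ^ n) {x : ℝ}
    (hx : x ∈ Ioc ((j : ℝ) / 2 ^ n) (((j : ℝ) + 1) / 2 ^ n)) : cellIdx n x = j := by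
  rw [cellIdx, ceil_of_mem_cell hx, add_sub_cancel_right]
  exact Int.emod_eq_of_lt (by positivity) (by exact_mod_cast hj)

lemma cellLoc_of_mem {n j : ℕ} {x : ℝ}
    (hx : x ∈ Ioc ((j : ℝ) / 2 ^ n) (((j : ℝ) + 1) / 2 ^ n)) :
    cellLoc n x = 2 ^ n * x - j := by
  rw [cellLoc, ceil_of_mem_cell hx]; push_cast; ring

lemma ceil_two_pow_add_one (n : ℕ) (x : ℝ) :
    ⌈(2 : ℝ) ^ n * (x + 1)⌉ = ⌈(2 : ℝ) ^ n * x⌉ + 2 ^ n := by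
  have : (2 : ℝ) ^ n * (x + 1) = 2 ^ n * x + ((2 ^ n : ℤ) : ℝ) := by push_cast; ring
  rw [this, Int.ceil_add_intCast]

lemma cellIdx_add_one (n : ℕ) (x : ℝ) : cellIdx n (x + 1) = cellIdx n x := by
  rw [cellIdx, cellIdx, ceil_two_pow_add_one,
    show ⌈(2 : ℝ) ^ n * x⌉ + 2 ^ n - 1 = ⌈(2 : ℝ) ^ n * x⌉ - 1 + 2 ^ n by ring, Int.add_emod_right]

lemma cellLoc_add_one (n : ℕ) (x : ℝ) : cellLoc n (x + 1) = cellLoc n x := by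
  rw [cellLoc, cellLoc, ceil_two_pow_add_one]; push_cast; ring

lemma exists_cellIdx_eq (n : ℕ) (x : ℝ) : ∃ j : ℕ, j < 2 ^ n ∧ cellIdx n x = j := by
  have h0 : 0 ≤ cellIdx n x := Int.emod_nonneg _ (by positivity)
  have h1 : cellIdx n x < 2 ^ n := Int.emod_lt_of_pos _ (by positivity)
  refine ⟨(cellIdx n x).toNat, ?_, (Int.toNat_of_nonneg h0).symm⟩
  zify; rw [Int.toNat_of_nonneg h0]; exact h1

lemma exists_mem_cell (n : ℕ) {x : ℝ} (hx : x ∈ Ioc (0 : ℝ) 1) :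
    ∃ j : ℕ, j < 2 ^ n ∧ x ∈ Ioc ((j : ℝ) / 2 ^ n) (((j : ℝ) + 1) / 2 ^ n) := by
  have h2 : (0 : ℝ) < 2 ^ n := by positivity
  have h1 : 0 < ⌈(2 : ℝ) ^ n * x⌉ := Int.ceil_pos.2 (mul_pos h2 hx.1)
  have h3 : ⌈(2 : ℝ) ^ n * x⌉ ≤ 2 ^ n := by
    refine Int.ceil_le.2 ?_
    push_cast
    nlinarith [hx.2]
  obtain ⟨j, hj⟩ := Int.eq_ofNat_of_zero_le (show 0 ≤ ⌈(2 : ℝ) ^ n * x⌉ - 1 by omega)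
  have hj' : ⌈(2 : ℝ) ^ n * x⌉ = j + 1 := by omega
  refine ⟨j, ?_, ?_⟩
  · rw [hj'] at h3; zify; omega
  · rw [Int.ceil_eq_iff] at hj'
    push_cast at hj'
    rw [mem_Ioc, div_lt_iff₀ h2, le_div_iff₀ h2]
    constructor <;> linarith [hj'.1, hj'.2]

lemma cell_subset_Ioc {n j : ℕ} (hj : j < 2 ^ n) :
    Ioc ((j : ℝ) / 2 ^ n) (((j : ℝ) + 1) / 2 ^ n) ⊆ Ioc 0 1 := by
  have h2 : (0 : ℝ) < 2 ^ n := by positivity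
  refine Ioc_subset_Ioc (by positivity) ?_
  rw [div_le_one h2]
  exact_mod_cast hj

lemma cellIdx_eq_iff {n j : ℕ} (hj : j < 2 ^ n) {x : ℝ} (hx : x ∈ Ioc (0 : ℝ) 1) :
    cellIdx n x = j ↔ x ∈ Ioc ((j : ℝ) / 2 ^ n) (((j : ℝ) + 1) / 2 ^ n) := by
  refine ⟨fun h => ?_, cellIdx_of_mem hj⟩
  obtain ⟨i, hi, hxi⟩ := exists_mem_cell n hx
  rw [cellIdx_of_mem hi hxi] at h
  have : i = j := by exact_mod_cast h
  rwa [← this]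

/-- On the unit interval a point is recovered from its cell index and local coordinate. -/
lemma cellIdx_add_cellLoc {n : ℕ} {x : ℝ} (hx : x ∈ Ioc (0 : ℝ) 1) :
    ((cellIdx n x : ℝ) + cellLoc n x) / 2 ^ n = x := by
  obtain ⟨j, hj, hxj⟩ := exists_mem_cell n hx
  rw [cellIdx_of_mem hj hxj, cellLoc_of_mem hxj]
  field_simp
  push_cast; ring

lemma setOf_cellIdx_eq {n j : ℕ} (hj : j < 2 ^ n) :
    {s | cellIdx n s = j} ∩ Ioc 0 1 = Ioc ((j : ℝ) / 2 ^ n) (((j : ℝ) + 1) / 2 ^ n) := by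
  ext s
  simp only [mem_inter_iff, mem_ofPred_eq]
  exact ⟨fun h => (cellIdx_eq_iff hj h.2).1 h.1,
    fun h => ⟨cellIdx_of_mem hj h, cell_subset_Ioc hj h⟩⟩

lemma unitMeasure_eq_Ioc : unitMeasure = volume.restrict (Ioc (0 : ℝ) 1) :=
  Measure.restrict_congr_set Ioo_ae_eq_Ioc

lemma measurableSet_cellIdx (n : ℕ) (z : ℤ) : MeasurableSet {s | cellIdx n s = z} :=
  measurable_cellIdx n (measurableSet_singleton z)

lemma unitMeasure_real_cellIdx {n : ℕ} (x : ℝ) :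
    unitMeasure.real {s | cellIdx n s = cellIdx n x} = (2 ^ n)⁻¹ := by
  obtain ⟨j, hj, hxj⟩ := exists_cellIdx_eq n x
  rw [hxj, unitMeasure_eq_Ioc, measureReal_restrict_apply (measurableSet_cellIdx n _),
    setOf_cellIdx_eq hj, Real.volume_real_Ioc_of_le]
  · ring
  · gcongr; linarith

/-! ### Cell-local kernels -/

/-- The kernel on the unit interval that acts on every dyadic cell of level `n` as the kernel `k₀`
acts on `(0, 1]`. -/
def cellKernel (n : ℕ) (k₀ : ℝ → ℝ → ℝ) (x y : ℝ) : ℝ :=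
  if cellIdx n x = cellIdx n y then 2 ^ n * k₀ (cellLoc n x) (cellLoc n y) else 0

/-- The integral operator with kernel `κ` in the `m`-th variable. -/
def kernelOp {d : ℕ} (κ : ℝ → ℝ → ℝ) (m : Fin d) (f : (Fin d → ℝ) → ℝ) (x : Fin d → ℝ) : ℝ :=
  ∫ s in Ioo (0 : ℝ) 1, κ (x m) s * f (Function.update x m s)

/-- Bounded measurable kernels. -/
structure BddKernel (κ : ℝ → ℝ → ℝ) : Prop where
  measurable : Measurable (Function.uncurry κ)
  bdd : ∃ C, ∀ x y, |κ x y| ≤ C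

/-- Measurable kernels on `(0, 1]` bounded by `M`. -/
structure LocalKernel (k₀ : ℝ → ℝ → ℝ) (M : ℝ) : Prop where
  measurable : Measurable (Function.uncurry k₀)
  bdd : ∀ x ∈ Ioc (0 : ℝ) 1, ∀ y ∈ Ioc (0 : ℝ) 1, |k₀ x y| ≤ M

lemma LocalKernel.nonneg {k₀ : ℝ → ℝ → ℝ} {M : ℝ} (h : LocalKernel k₀ M) : 0 ≤ M :=
  (abs_nonneg _).trans (h.bdd 1 (by simp) 1 (by simp))

lemma LocalKernel.bddKernel {k₀ : ℝ → ℝ → ℝ} {M : ℝ} (h : LocalKernel k₀ M) (n : ℕ) :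
    BddKernel (cellKernel n k₀) := by
  constructor
  · unfold cellKernel Function.uncurry
    refine Measurable.ite ?_ ?_ measurable_const
    · exact measurableSet_eq_fun ((measurable_cellIdx n).comp measurable_fst)
        ((measurable_cellIdx n).comp measurable_snd)
    · exact measurable_const.mul (h.measurable.comp
        (((measurable_cellLoc n).comp measurable_fst).prodMk
          ((measurable_cellLoc n).comp measurable_snd)))
  · refine ⟨2 ^ n * M, fun x y => ?_⟩
    unfold cellKernel
    split_ifs
    · rw [abs_mul, abs_of_pos (by positivity : (0 : ℝ) < 2 ^ n)]
      gcongr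
      exact h.bdd _ (cellLoc_mem n x) _ (cellLoc_mem n y)
    · rw [abs_zero]; have := h.nonneg; positivity

section kernelOp
variable {d : ℕ} {κ κ' : ℝ → ℝ → ℝ} {m m' : Fin d} {f g : (Fin d → ℝ) → ℝ}

lemma BddKernel.integrable (hκ : BddKernel κ) (y : ℝ) {φ : ℝ → ℝ}
    (hφ : Integrable φ unitMeasure) :
    Integrable (fun s => κ y s * φ s) unitMeasure := by
  obtain ⟨C, hC⟩ := hκ.bdd
  refine hφ.bdd_mul (c := C) ?_ (Filter.Eventually.of_forall fun s => hC y s)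
  exact (hκ.measurable.comp (measurable_const.prodMk measurable_id)).aestronglyMeasurable

lemma BddMeas.kernelOp (hf : BddMeas f) (hκ : BddKernel κ) (m : Fin d) :
    BddMeas (kernelOp κ m f) := by
  obtain ⟨C, hC⟩ := hκ.bdd
  obtain ⟨D, hD⟩ := hf.bdd
  constructor
  · unfold SparseDG.kernelOp
    refine StronglyMeasurable.measurable ?_
    refine StronglyMeasurable.integral_prod_right'
      (f := fun p : (Fin d → ℝ) × ℝ => κ (p.1 m) p.2 * f (Function.update p.1 m p.2)) ?_
    refine Measurable.stronglyMeasurable ?_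
    refine (hκ.measurable.comp (((measurable_pi_apply m).comp measurable_fst).prodMk
      measurable_snd)).mul (hf.measurable.comp (measurable_update_prod m))
  · refine ⟨C * D, fun x => ?_⟩
    have := norm_integral_le_of_norm_le_const (μ := unitMeasure) (C := C * D)
      (f := fun s => κ (x m) s * f (Function.update x m s))
      (Filter.Eventually.of_forall fun s => by
        rw [Real.norm_eq_abs, abs_mul]
        exact mul_le_mul (hC _ _) (hD _) (abs_nonneg _) ((abs_nonneg _).trans (hC 0 0)))
    simpa [SparseDG.kernelOp] using this

lemma kernelOp_add (hκ : BddKernel κ) (hf : BddMeas f) (hg : BddMeas g) :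
    kernelOp κ m (fun x => f x + g x) = fun x => kernelOp κ m f x + kernelOp κ m g x := by
  ext x
  simp only [kernelOp, mul_add]
  exact integral_add (hκ.integrable _ (hf.slice_integrable m x))
    (hκ.integrable _ (hg.slice_integrable m x))

lemma kernelOp_sub (hκ : BddKernel κ) (hf : BddMeas f) (hg : BddMeas g) :
    kernelOp κ m (fun x => f x - g x) = fun x => kernelOp κ m f x - kernelOp κ m g x := by
  ext x
  simp only [kernelOp, mul_sub]
  exact integral_sub (hκ.integrable _ (hf.slice_integrable m x))
    (hκ.integrable _ (hg.slice_integrable m x))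

lemma kernelOp_const_mul (c : ℝ) :
    kernelOp κ m (fun x => c * f x) = fun x => c * kernelOp κ m f x := by
  ext x
  simp only [kernelOp]
  rw [← integral_const_mul]
  congr 1; ext s; ring

lemma kernelOp_zero : kernelOp κ m (fun _ => 0) = fun _ : Fin d → ℝ => 0 := by
  ext x; simp [kernelOp]

lemma kernelOp_sum (hκ : BddKernel κ) {ι : Type*} (s : Finset ι) {F : ι → (Fin d → ℝ) → ℝ}
    (hF : ∀ i ∈ s, BddMeas (F i)) :
    kernelOp κ m (fun x => ∑ i ∈ s, F i x) = fun x => ∑ i ∈ s, kernelOp κ m (F i) x := by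
  ext x
  simp only [kernelOp, Finset.mul_sum]
  exact integral_finsetSum s fun i hi => hκ.integrable _ ((hF i hi).slice_integrable m x)

lemma kernelOp_congr_cube (h : EqOn f g (cube d)) :
    EqOn (kernelOp κ m f) (kernelOp κ m g) (cube d) := by
  intro x hx
  refine setIntegral_congr_fun measurableSet_Ioo fun s hs => ?_
  rw [h (update_mem_cube hx m hs)]

/-- Integral operators in different variables commute. -/
lemma kernelOp_comm (hκ : BddKernel κ) (hκ' : BddKernel κ') (hm : m ≠ m') (hf : BddMeas f) :
    kernelOp κ m (kernelOp κ' m' f) = kernelOp κ' m' (kernelOp κ m f) := by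
  ext x
  simp only [kernelOp]
  have h1 : ∀ s, Function.update x m s m' = x m' := fun s => Function.update_of_ne hm.symm _ _
  have h2 : ∀ s, Function.update x m' s m = x m := fun s => Function.update_of_ne hm _ _
  simp only [h1, h2, ← integral_const_mul]
  rw [integral_integral_swap]
  · refine integral_congr_ae (Filter.Eventually.of_forall fun s => ?_)
    refine integral_congr_ae (Filter.Eventually.of_forall fun t => ?_)
    simp only
    rw [Function.update_comm hm]; ring
  · obtain ⟨C, hC⟩ := hκ.bdd
    obtain ⟨C', hC'⟩ := hκ'.bdd
    obtain ⟨D, hD⟩ := hf.bdd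
    refine Integrable.of_bound (C := C * (C' * D)) ?_ (Filter.Eventually.of_forall fun p => ?_)
    · refine Measurable.aestronglyMeasurable ?_
      refine (hκ.measurable.comp (measurable_const.prodMk measurable_fst)).mul
        ((hκ'.measurable.comp (measurable_const.prodMk measurable_snd)).mul (hf.measurable.comp ?_))
      exact (measurable_update_prod m').comp (((measurable_update_prod m).comp
        (measurable_const.prodMk measurable_fst)).prodMk measurable_snd)
    · simp only [Function.uncurry]
      rw [Real.norm_eq_abs, abs_mul, abs_mul]
      have := (abs_nonneg _).trans (hC 0 0)
      have := (abs_nonneg _).trans (hC' 0 0)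
      gcongr
      · exact hC _ _
      · exact hC' _ _
      · exact hD _

end kernelOp

/-- The average over the dyadic cell of level `n` in the `m`-th variable. -/
def cellAvg {d : ℕ} (n : ℕ) (m : Fin d) : ((Fin d → ℝ) → ℝ) → (Fin d → ℝ) → ℝ :=
  kernelOp (cellKernel n fun _ _ => 1) m

lemma localKernel_one : LocalKernel (fun _ _ => 1) 1 :=
  ⟨measurable_const, fun _ _ _ _ => by simp⟩

lemma BddMeas.sq {d : ℕ} {f : (Fin d → ℝ) → ℝ} (hf : BddMeas f) :
    BddMeas (fun x => f x ^ 2) := by simpa only [pow_two] using hf.mul hf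

lemma BddMeas.cellAvg {d : ℕ} {f : (Fin d → ℝ) → ℝ} (hf : BddMeas f) (n : ℕ) (m : Fin d) :
    BddMeas (cellAvg n m f) := hf.kernelOp (localKernel_one.bddKernel n) m

/-- The pointwise Cauchy--Schwarz bound on a cell. -/
lemma sq_kernelOp_le_cellAvg {d : ℕ} {k₀ : ℝ → ℝ → ℝ} {M : ℝ} (hk : LocalKernel k₀ M) (n : ℕ)
    (m : Fin d) {f : (Fin d → ℝ) → ℝ} (hf : BddMeas f) (x : Fin d → ℝ) :
    kernelOp (cellKernel n k₀) m f x ^ 2 ≤ M ^ 2 * cellAvg n m (fun x => f x ^ 2) x := by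
  have hM := hk.nonneg
  have hκ := hk.bddKernel n
  obtain ⟨D, hD⟩ := hf.bdd
  set A := {s | cellIdx n s = cellIdx n (x m)} with hA
  have hAm : MeasurableSet A := measurableSet_cellIdx n _
  have hrew : cellAvg n m (fun x => f x ^ 2) x
      = 2 ^ n * ∫ s in Ioo (0 : ℝ) 1, A.indicator (fun s => f (Function.update x m s) ^ 2) s := by
    rw [← integral_const_mul, cellAvg, kernelOp]
    refine integral_congr_ae (Filter.Eventually.of_forall fun s => ?_)
    simp only [cellKernel, mul_one]
    by_cases h : cellIdx n s = cellIdx n (x m)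
    · rw [if_pos h.symm, indicator_of_mem (by exact h)]
    · rw [if_neg (Ne.symm h), indicator_of_notMem (by exact h)]; simp
  have hs : MemLp (fun s => f (Function.update x m s)) 2 unitMeasure :=
    MemLp.of_bound (hf.slice_measurable m x).aestronglyMeasurable D
      (Filter.Eventually.of_forall fun s => hD _)
  have h1 : |kernelOp (cellKernel n k₀) m f x| ≤ 2 ^ n * M *
      ∫ s in Ioo (0 : ℝ) 1, A.indicator (fun s => |f (Function.update x m s)|) s := by
    rw [← integral_const_mul]
    refine (norm_integral_le_integral_norm (G := ℝ) _).trans ?_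
    refine integral_mono ?_ ?_ fun s => ?_
    · exact (hκ.integrable _ (hf.slice_integrable m x)).norm
    · exact ((hs.integrable (by norm_num)).abs.indicator hAm).const_mul _
    · simp only [Real.norm_eq_abs, abs_mul, cellKernel]
      by_cases h : cellIdx n s = cellIdx n (x m)
      · rw [if_pos h.symm, indicator_of_mem (by exact h), abs_mul,
          abs_of_pos (by positivity : (0 : ℝ) < 2 ^ n)]
        gcongr
        exact hk.bdd _ (cellLoc_mem _ _) _ (cellLoc_mem _ _)
      · rw [if_neg (Ne.symm h), indicator_of_notMem (by exact h)]; simp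
  -- The cell has measure `2⁻ⁿ`, which cancels one of the two factors `2ⁿ` of the kernel.
  have h2 := sq_setIntegral_abs_le hAm hs
  rw [hA, unitMeasure_real_cellIdx, ← hA] at h2
  rw [← sq_abs, hrew]
  calc |kernelOp (cellKernel n k₀) m f x| ^ 2
      ≤ (2 ^ n * M * ∫ s in Ioo (0 : ℝ) 1,
          A.indicator (fun s => |f (Function.update x m s)|) s) ^ 2 := by gcongr
    _ = (2 ^ n * M) ^ 2 * (∫ s in Ioo (0 : ℝ) 1,
          A.indicator (fun s => |f (Function.update x m s)|) s) ^ 2 := by ring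
    _ ≤ (2 ^ n * M) ^ 2 * ((2 ^ n)⁻¹ * ∫ s in Ioo (0 : ℝ) 1,
          A.indicator (fun s => f (Function.update x m s) ^ 2) s) := by gcongr
    _ = _ := by field_simp

/-- Averaging over the cells preserves the integral over the cube. -/
lemma integral_cellAvg {d : ℕ} (n : ℕ) (m : Fin d) {f : (Fin d → ℝ) → ℝ} (hf : BddMeas f) :
    ∫ x in cube d, cellAvg n m f x = ∫ x in cube d, f x := by
  have hLb := localKernel_one.bddKernel n
  rw [integral_update m (hf.cellAvg n m).integrable, integral_update m hf.integrable]
  refine integral_congr_ae (Filter.Eventually.of_forall fun x => ?_)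
  simp only [cellAvg, kernelOp, Function.update_self, Function.update_idem]
  obtain ⟨C, hC⟩ := hLb.bdd
  obtain ⟨E, hE⟩ := hf.bdd
  rw [integral_integral_swap]
  · refine integral_congr_ae (Filter.Eventually.of_forall fun t => ?_)
    simp only
    rw [integral_mul_const]
    have : ∫ s in Ioo (0 : ℝ) 1, cellKernel n (fun _ _ => 1) s t = 1 := by
      have h1 : (fun s => cellKernel n (fun _ _ => 1) s t)
          = {s | cellIdx n s = cellIdx n t}.indicator (fun _ => (2 : ℝ) ^ n) := by
        ext s
        by_cases h : cellIdx n s = cellIdx n t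
        · rw [indicator_of_mem (by exact h), cellKernel, if_pos h, mul_one]
        · rw [indicator_of_notMem (by exact h), cellKernel, if_neg h]
      rw [h1, integral_indicator_const _ (measurableSet_cellIdx n _),
        unitMeasure_real_cellIdx]
      simp
    rw [this, one_mul]
  · refine Integrable.of_bound (C := C * E) ?_ (Filter.Eventually.of_forall fun p => ?_)
    · exact (hLb.measurable.mul ((hf.slice_measurable m x).comp
        measurable_snd)).aestronglyMeasurable
    · simp only [Function.uncurry]
      rw [Real.norm_eq_abs, abs_mul]
      exact mul_le_mul (hC _ _) (hE _) (abs_nonneg _) ((abs_nonneg _).trans (hC 0 0))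

/-- Cell-local operators are bounded on `L²`, uniformly in the level. -/
lemma l2Norm_cellKernel_le {d : ℕ} {k₀ : ℝ → ℝ → ℝ} {M : ℝ} (hk : LocalKernel k₀ M) (n : ℕ)
    (m : Fin d) {f : (Fin d → ℝ) → ℝ} (hf : BddMeas f) :
    l2Norm (cube d) (kernelOp (cellKernel n k₀) m f) ≤ M * l2Norm (cube d) f := by
  rw [← abs_of_nonneg (l2Norm_nonneg _ _),
    ← abs_of_nonneg (mul_nonneg hk.nonneg (l2Norm_nonneg (cube d) f)), ← sq_le_sq, mul_pow,
    l2Norm_sq, l2Norm_sq, ← integral_cellAvg n m hf.sq, ← integral_const_mul]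
  exact integral_mono (hf.kernelOp (hk.bddKernel n) m).sq.integrable
    ((hf.sq.cellAvg n m).integrable.const_mul _) fun x => sq_kernelOp_le_cellAvg hk n m hf x

/-- A cell-local operator in the local coordinate of the cell. -/
lemma integral_cellKernel (n : ℕ) (k₀ : ℝ → ℝ → ℝ) (x : ℝ) (φ : ℝ → ℝ) :
    ∫ s in Ioo (0 : ℝ) 1, cellKernel n k₀ x s * φ s
      = ∫ σ in (0 : ℝ)..1, k₀ (cellLoc n x) σ * φ (((cellIdx n x : ℝ) + σ) / 2 ^ n) := by
  obtain ⟨j, hj, hxj⟩ := exists_cellIdx_eq n x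
  have h2 : (0 : ℝ) < 2 ^ n := by positivity
  have hind : ∀ s, cellKernel n k₀ x s * φ s = {s | cellIdx n s = j}.indicator
      (fun s => 2 ^ n * k₀ (cellLoc n x) (cellLoc n s) * φ s) s := by
    intro s
    by_cases h : cellIdx n s = j
    · rw [indicator_of_mem (by exact h), cellKernel, if_pos (hxj.trans h.symm)]
    · rw [indicator_of_notMem (by exact h), cellKernel, if_neg (by rw [hxj]; exact Ne.symm h),
        zero_mul]
  simp_rw [hind]
  rw [show volume.restrict (Ioo (0 : ℝ) 1) = volume.restrict (Ioc 0 1) from unitMeasure_eq_Ioc,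
    integral_indicator (measurableSet_cellIdx n _),
    Measure.restrict_restrict (measurableSet_cellIdx n _), setOf_cellIdx_eq hj]
  have hle : (j : ℝ) / 2 ^ n ≤ ((j : ℝ) + 1) / 2 ^ n := by gcongr; linarith
  have e1 : ∫ s in Ioc ((j : ℝ) / 2 ^ n) (((j : ℝ) + 1) / 2 ^ n),
      2 ^ n * k₀ (cellLoc n x) (cellLoc n s) * φ s
      = ∫ s in Ioc ((j : ℝ) / 2 ^ n) (((j : ℝ) + 1) / 2 ^ n),
        2 ^ n * (fun σ => k₀ (cellLoc n x) σ * φ (((j : ℝ) + σ) / 2 ^ n)) (2 ^ n * s - j) := by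
    refine setIntegral_congr_fun measurableSet_Ioc fun s hs => ?_
    simp only
    rw [cellLoc_of_mem hs, show ((j : ℝ) + (2 ^ n * s - j)) / 2 ^ n = s by field_simp; ring]
    ring
  rw [e1, ← intervalIntegral.integral_of_le hle, intervalIntegral.integral_const_mul,
    intervalIntegral.integral_comp_mul_sub
      (fun σ => k₀ (cellLoc n x) σ * φ (((j : ℝ) + σ) / 2 ^ n)) h2.ne', smul_eq_mul, ← mul_assoc,
    mul_inv_cancel₀ h2.ne', one_mul, hxj]
  congr 1 <;> field_simp <;> ring

/-! ### The reproducing kernel of polynomials on the unit interval -/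

/-- The Gram matrix of the monomials of degree at most `k` in `L²(0,1)`. -/
def hilbertMatrix (k : ℕ) : Matrix (Fin (k + 1)) (Fin (k + 1)) ℝ :=
  Matrix.of fun i j => 1 / ((i : ℝ) + j + 1)

/-- The inverse of the Gram matrix of the monomials. -/
def gramInv (k : ℕ) : Matrix (Fin (k + 1)) (Fin (k + 1)) ℝ := (hilbertMatrix k)⁻¹

lemma integral_pow_mul_pow (i j : ℕ) :
    ∫ τ in (0 : ℝ)..1, τ ^ i * τ ^ j = 1 / ((i : ℝ) + j + 1) := by
  simp_rw [← pow_add]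
  rw [integral_pow]; simp

/-- A combination of monomials that is orthogonal to all of them vanishes. -/
lemma isUnit_hilbertMatrix (k : ℕ) : IsUnit (hilbertMatrix k) := by
  rw [← Matrix.mulVec_injective_iff_isUnit]
  rw [← Matrix.coe_mulVecLin, ← LinearMap.ker_eq_bot, LinearMap.ker_eq_bot']
  intro c hc
  have hc' : (hilbertMatrix k).mulVec c = 0 := hc
  set p : Polynomial ℝ := ∑ i : Fin (k + 1), Polynomial.C (c i) * Polynomial.X ^ (i : ℕ) with hp
  have hev : ∀ x : ℝ, p.eval x = ∑ i : Fin (k + 1), c i * x ^ (i : ℕ) := by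
    intro x; simp [hp, Polynomial.eval_finsetSum]
  -- `∫ p²` is the quadratic form of the Gram matrix at the coefficient vector of `p`.
  have hint : ∫ x in (0 : ℝ)..1, p.eval x ^ 2 = 0 := by
    have : ∀ x : ℝ, p.eval x ^ 2
        = ∑ i : Fin (k + 1), ∑ j : Fin (k + 1), c i * c j * (x ^ (i : ℕ) * x ^ (j : ℕ)) := by
      intro x
      rw [hev, sq, Finset.sum_mul_sum]
      refine Finset.sum_congr rfl fun i _ => Finset.sum_congr rfl fun j _ => by ring
    simp_rw [this]
    rw [intervalIntegral.integral_finsetSum fun i _ =>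
      Continuous.intervalIntegrable (by fun_prop) _ _]
    refine Finset.sum_eq_zero fun i _ => ?_
    rw [intervalIntegral.integral_finsetSum fun i _ =>
      Continuous.intervalIntegrable (by fun_prop) _ _]
    have := congrFun hc' i
    simp only [Matrix.mulVec, dotProduct, hilbertMatrix, Matrix.of_apply, Pi.zero_apply] at this
    simp_rw [intervalIntegral.integral_const_mul, integral_pow_mul_pow, mul_assoc,
      ← Finset.mul_sum, mul_comm (c _), this, zero_mul]
  have hz : ∀ x ∈ Ioc (0 : ℝ) 1, p.eval x = 0 := by
    have h1 := (intervalIntegral.integral_eq_zero_iff_of_nonneg_ae (a := 0) (b := 1) (μ := volume)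
      (f := fun x => p.eval x ^ 2) (Filter.Eventually.of_forall fun x => sq_nonneg _)
      (Continuous.intervalIntegrable (by fun_prop) _ _)).1 hint
    by_contra! hcon
    obtain ⟨x, hx, hne⟩ := hcon
    have : Ioc (0 : ℝ) 1 ∪ Ioc 1 0 = Ioc 0 1 := by simp
    rw [this] at h1
    have h2 := Measure.eqOn_Ioc_of_ae_eq volume h1
      (Continuous.continuousOn (by fun_prop)) continuousOn_const
    exact hne (by simpa using h2 hx)
  have hp0 : p = 0 := by
    refine Polynomial.eq_zero_of_infinite_isRoot p ?_
    exact (Set.Ioc_infinite (zero_lt_one (α := ℝ))).mono fun x hx => hz x hx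
  funext i
  have : p.coeff i = c i := by
    rw [hp]
    simp only [Polynomial.finsetSum_coeff, Polynomial.coeff_C_mul, Polynomial.coeff_X_pow]
    rw [Finset.sum_eq_single i]
    · simp
    · intro b _ hb
      rw [if_neg (fun h => hb (Fin.ext h.symm))]; simp
    · simp
  rw [← this, hp0]; simp

lemma gramInv_symm (k : ℕ) (i j : Fin (k + 1)) : gramInv k i j = gramInv k j i := by
  have h : (hilbertMatrix k).transpose = hilbertMatrix k := by
    ext i j; simp [hilbertMatrix, add_comm]
  have : (gramInv k).transpose = gramInv k := by
    rw [gramInv, Matrix.transpose_nonsing_inv, h]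
  conv_lhs => rw [← this]
  rfl

lemma gramInv_mul (k : ℕ) : gramInv k * hilbertMatrix k = 1 :=
  Matrix.nonsing_inv_mul _ ((Matrix.isUnit_iff_isUnit_det _).1 (isUnit_hilbertMatrix k))

/-- Integration of a polynomial against the dual basis of the monomials reads off its
coefficients. -/
lemma integral_gramInv_mul (k : ℕ) (w : ℕ → ℝ) {P : Polynomial ℝ} (hP : P.natDegree ≤ k) :
    ∫ τ in (0 : ℝ)..1, (∑ i : Fin (k + 1), ∑ j : Fin (k + 1), gramInv k i j * w i * τ ^ (j : ℕ))
      * P.eval τ = ∑ i ∈ Finset.range (k + 1), w i * P.coeff i := by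
  have hev : ∀ τ : ℝ, P.eval τ = ∑ l : Fin (k + 1), P.coeff l * τ ^ (l : ℕ) := by
    intro τ
    rw [Polynomial.eval_eq_sum_range' (Nat.lt_succ_of_le hP), Finset.sum_range]
  simp_rw [hev, Finset.sum_mul]
  rw [intervalIntegral.integral_finsetSum fun i _ =>
    Continuous.intervalIntegrable (by fun_prop) _ _,
    Finset.sum_range]
  refine Finset.sum_congr rfl fun i _ => ?_
  rw [intervalIntegral.integral_finsetSum fun i _ =>
    Continuous.intervalIntegrable (by fun_prop) _ _]
  have : ∀ j : Fin (k + 1), ∫ τ in (0 : ℝ)..1, gramInv k i j * w i * τ ^ (j : ℕ)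
      * ∑ l : Fin (k + 1), P.coeff l * τ ^ (l : ℕ)
      = ∑ l : Fin (k + 1), w i * P.coeff l * (gramInv k i j * hilbertMatrix k j l) := by
    intro j
    simp_rw [Finset.mul_sum]
    rw [intervalIntegral.integral_finsetSum
      fun i _ => Continuous.intervalIntegrable (by fun_prop) _ _]
    refine Finset.sum_congr rfl fun l _ => ?_
    rw [show (fun τ : ℝ => gramInv k i j * w i * τ ^ (j : ℕ) * (P.coeff l * τ ^ (l : ℕ)))
      = fun τ => gramInv k i j * w i * P.coeff l * (τ ^ (j : ℕ) * τ ^ (l : ℕ)) by ext; ring,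
      intervalIntegral.integral_const_mul, integral_pow_mul_pow]
    simp only [hilbertMatrix, Matrix.of_apply]
    ring
  simp_rw [this]
  rw [Finset.sum_comm]
  simp_rw [← Finset.mul_sum]
  have h1 : ∀ l : Fin (k + 1), ∑ j, gramInv k i j * hilbertMatrix k j l
      = if i = l then 1 else 0 := by
    intro l
    rw [← Matrix.mul_apply, gramInv_mul, Matrix.one_apply]
  simp [h1]

/-- The reproducing kernel of the polynomials of degree at most `k` in `L²(0,1)`. -/
def reproKernel (k : ℕ) (σ τ : ℝ) : ℝ :=
  ∑ i : Fin (k + 1), ∑ j : Fin (k + 1), gramInv k i j * σ ^ (i : ℕ) * τ ^ (j : ℕ)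

/-- The derivative of the reproducing kernel in its first variable. -/
def reproDeriv (k : ℕ) (σ τ : ℝ) : ℝ :=
  ∑ i : Fin (k + 1), ∑ j : Fin (k + 1),
    gramInv k i j * ((i : ℕ) * σ ^ ((i : ℕ) - 1)) * τ ^ (j : ℕ)

/-- A bound for the reproducing kernel and its derivative on the unit square. -/
def reproBound (k : ℕ) : ℝ :=
  1 + ∑ i : Fin (k + 1), ∑ j : Fin (k + 1), |gramInv k i j| * (1 + (i : ℕ))

lemma one_le_reproBound (k : ℕ) : 1 ≤ reproBound k := by
  unfold reproBound
  have : 0 ≤ ∑ i : Fin (k + 1), ∑ j : Fin (k + 1), |gramInv k i j| * (1 + ((i : ℕ) : ℝ)) :=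
    Finset.sum_nonneg fun i _ => Finset.sum_nonneg fun j _ => by positivity
  linarith

/-- The reproducing property. -/
lemma integral_reproKernel (k : ℕ) (σ : ℝ) {P : Polynomial ℝ} (hP : P.natDegree ≤ k) :
    ∫ τ in (0 : ℝ)..1, reproKernel k σ τ * P.eval τ = P.eval σ := by
  unfold reproKernel
  rw [integral_gramInv_mul k (fun i => σ ^ i) hP,
    Polynomial.eval_eq_sum_range' (Nat.lt_succ_of_le hP)]
  exact Finset.sum_congr rfl fun i _ => mul_comm _ _

/-- The derivative of the kernel in its first variable reads off derivatives of polynomials. -/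
lemma integral_reproDeriv (k : ℕ) (σ : ℝ) {P : Polynomial ℝ} (hP : P.natDegree ≤ k) :
    ∫ τ in (0 : ℝ)..1, reproDeriv k σ τ * P.eval τ = P.derivative.eval σ := by
  unfold reproDeriv
  rw [integral_gramInv_mul k (fun i => i * σ ^ (i - 1)) hP, Polynomial.derivative_eval,
    Polynomial.sum_over_range' _ (by simp) (k + 1) (Nat.lt_succ_of_le hP)]
  exact Finset.sum_congr rfl fun i _ => by ring

lemma localKernel_repro_aux (k : ℕ) (w : ℕ → ℝ → ℝ) (hw : ∀ i, Continuous (w i))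
    (hb : ∀ i, ∀ σ ∈ Ioc (0 : ℝ) 1, |w i σ| ≤ 1 + (i : ℝ)) :
    LocalKernel (fun σ τ => ∑ i : Fin (k + 1), ∑ j : Fin (k + 1),
      gramInv k i j * w i σ * τ ^ (j : ℕ)) (reproBound k) := by
  constructor
  · refine Continuous.measurable ?_
    unfold Function.uncurry
    refine continuous_finsetSum _ fun i _ => continuous_finsetSum _ fun j _ => ?_
    exact (continuous_const.mul ((hw i).comp continuous_fst)).mul (continuous_snd.pow _)
  · intro σ hσ τ hτ
    refine (Finset.abs_sum_le_sum_abs _ _).trans ?_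
    refine le_trans ?_ (le_add_of_nonneg_left zero_le_one)
    refine Finset.sum_le_sum fun i _ => (Finset.abs_sum_le_sum_abs _ _).trans ?_
    refine Finset.sum_le_sum fun j _ => ?_
    rw [abs_mul, abs_mul]
    have h1 : |τ ^ (j : ℕ)| ≤ 1 := by
      rw [abs_pow, abs_of_pos hτ.1]; exact pow_le_one₀ hτ.1.le hτ.2
    calc |gramInv k i j| * |w i σ| * |τ ^ (j : ℕ)| ≤ |gramInv k i j| * |w i σ| * 1 := by gcongr
      _ ≤ |gramInv k i j| * (1 + (i : ℕ)) := by
        rw [mul_one]; gcongr; exact hb i σ hσ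

lemma localKernel_repro (k : ℕ) : LocalKernel (reproKernel k) (reproBound k) :=
  localKernel_repro_aux k (fun i σ => σ ^ i) (fun i => by fun_prop) fun i σ hσ => by
    rw [abs_pow, abs_of_pos hσ.1]
    have := pow_le_one₀ (n := i) hσ.1.le hσ.2
    have : (0 : ℝ) ≤ i := by positivity
    linarith

lemma localKernel_reproDeriv (k : ℕ) : LocalKernel (reproDeriv k) (reproBound k) :=
  localKernel_repro_aux k (fun i σ => i * σ ^ (i - 1)) (fun i => by fun_prop) fun i σ hσ => by
    rw [abs_mul, abs_pow, abs_of_pos hσ.1, abs_of_nonneg (by positivity)]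
    have := pow_le_one₀ (n := i - 1) hσ.1.le hσ.2
    have : (0 : ℝ) ≤ i := by positivity
    nlinarith

/-! ### Taylor expansion on dyadic cells -/

/-- The Peano kernel of the Taylor remainder of order `q`. -/
def taylorKernel (q : ℕ) (σ τ : ℝ) : ℝ := if τ ≤ σ then (σ - τ) ^ q / (q.factorial : ℝ) else 0

lemma localKernel_taylor (q : ℕ) : LocalKernel (taylorKernel q) 1 := by
  constructor
  · unfold taylorKernel Function.uncurry
    exact Measurable.ite (measurableSet_le measurable_snd measurable_fst)
      (((measurable_fst.sub measurable_snd).pow_const q).div_const _) measurable_const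
  · intro σ hσ τ hτ
    unfold taylorKernel
    split_ifs with h
    · rw [abs_of_nonneg (by have := sub_nonneg.2 h; positivity)]
      rw [div_le_one (by positivity)]
      have h1 : (σ - τ) ^ q ≤ 1 := pow_le_one₀ (sub_nonneg.2 h) (by linarith [hσ.2, hτ.1])
      have : (1 : ℝ) ≤ q.factorial := by exact_mod_cast Nat.factorial_pos q
      linarith
    · simp

/-- The Taylor polynomial of degree `q` at the origin. -/
def taylorPoly (φ : ℝ → ℝ) (q : ℕ) : Polynomial ℝ :=
  ∑ i ∈ Finset.range (q + 1),
    Polynomial.C (iteratedDeriv i φ 0 / (i.factorial : ℝ)) * Polynomial.X ^ i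

lemma natDegree_taylorPoly_le (φ : ℝ → ℝ) (q : ℕ) : (taylorPoly φ q).natDegree ≤ q := by
  refine Polynomial.natDegree_sum_le_of_forall_le _ _ fun i hi => ?_
  exact (Polynomial.natDegree_C_mul_X_pow_le _ _).trans (Nat.lt_succ_iff.1 (Finset.mem_range.1 hi))

lemma eval_taylorPoly (φ : ℝ → ℝ) (q : ℕ) (ξ : ℝ) : (taylorPoly φ q).eval ξ
    = ∑ i ∈ Finset.range (q + 1), iteratedDeriv i φ 0 / (i.factorial : ℝ) * ξ ^ i := by
  simp [taylorPoly, Polynomial.eval_finsetSum]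

lemma derivative_taylorPoly (φ : ℝ → ℝ) (q : ℕ) :
    (taylorPoly φ (q + 1)).derivative = taylorPoly (deriv φ) q := by
  unfold taylorPoly
  rw [Polynomial.derivative_sum, Finset.sum_range_succ']
  simp only [Polynomial.derivative_C_mul, Polynomial.derivative_X_pow, pow_zero,
    Polynomial.derivative_one, mul_zero, add_zero]
  refine Finset.sum_congr rfl fun i _ => ?_
  rw [iteratedDeriv_succ', ← mul_assoc, ← Polynomial.C_mul, add_tsub_cancel_right]
  congr 2
  rw [Nat.factorial_succ]
  push_cast
  field_simp

/-- Taylor's formula on the unit interval with Peano kernel. -/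
lemma taylor_unit {φ : ℝ → ℝ} (hφ : ContDiff ℝ ∞ φ) (q : ℕ) {ξ : ℝ} (hξ : ξ ∈ Ioc (0 : ℝ) 1) :
    φ ξ = (taylorPoly φ q).eval ξ
      + ∫ σ in (0 : ℝ)..1, taylorKernel q ξ σ * iteratedDeriv (q + 1) φ σ := by
  have hu : uIcc 0 ξ = Icc 0 ξ := uIcc_of_le hξ.1.le
  have hud : UniqueDiffOn ℝ (Icc 0 ξ) := uniqueDiffOn_Icc hξ.1
  have h := taylor_integral_remainder (f := φ) (x := ξ) (x₀ := 0) (n := q)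
    ((hφ.of_le (by exact_mod_cast le_top)).contDiffOn)
  rw [hu] at h
  have e1 : taylorWithinEval φ q (Icc 0 ξ) 0 ξ = (taylorPoly φ q).eval ξ := by
    rw [taylor_within_apply, eval_taylorPoly]
    refine Finset.sum_congr rfl fun i _ => ?_
    rw [iteratedDerivWithin_eq_iteratedDeriv hud
      ((hφ.of_le (by exact_mod_cast le_top)).contDiffAt) (left_mem_Icc.2 hξ.1.le), smul_eq_mul,
      sub_zero]
    ring
  have e2 : ∫ t in (0 : ℝ)..ξ, ((ξ - t) ^ q / (q.factorial : ℝ)) •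
        iteratedDerivWithin (q + 1) φ (Icc 0 ξ) t
      = ∫ t in (0 : ℝ)..ξ, taylorKernel q ξ t * iteratedDeriv (q + 1) φ t := by
    refine intervalIntegral.integral_congr fun t ht => ?_
    rw [hu] at ht
    simp only [smul_eq_mul]
    rw [iteratedDerivWithin_eq_iteratedDeriv hud
      ((hφ.of_le (by exact_mod_cast le_top)).contDiffAt) ht, taylorKernel, if_pos ht.2]
  -- The Peano kernel vanishes above `ξ`, so the remainder extends to the whole interval.
  have e3 : ∫ t in ξ..1, taylorKernel q ξ t * iteratedDeriv (q + 1) φ t = 0 := by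
    rw [intervalIntegral.integral_of_le hξ.2]
    rw [setIntegral_congr_fun (g := fun _ => (0 : ℝ)) measurableSet_Ioc]
    · simp
    · intro t ht
      simp only [taylorKernel]
      rw [if_neg (not_le.2 ht.1), zero_mul]
  have hc : Continuous (iteratedDeriv (q + 1) φ) :=
    hφ.continuous_iteratedDeriv _ (by exact_mod_cast le_top)
  have hbi : IntervalIntegrable (fun t => taylorKernel q ξ t * iteratedDeriv (q + 1) φ t)
      volume 0 1 := by
    rw [intervalIntegrable_iff_integrableOn_Ioc_of_le zero_le_one]
    refine Integrable.bdd_mul (c := 1)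
      ((hc.intervalIntegrable 0 1).1) ?_ ?_
    · exact ((localKernel_taylor q).measurable.comp
        (measurable_const.prodMk measurable_id)).aestronglyMeasurable
    · filter_upwards [ae_restrict_mem measurableSet_Ioc] with t ht
      exact (localKernel_taylor q).bdd ξ hξ t ht
  have hsub1 : IntervalIntegrable (fun t => taylorKernel q ξ t * iteratedDeriv (q + 1) φ t)
      volume 0 ξ := hbi.mono_set (by
        rw [hu, uIcc_of_le zero_le_one]; exact Icc_subset_Icc_right hξ.2)
  have hsub2 : IntervalIntegrable (fun t => taylorKernel q ξ t * iteratedDeriv (q + 1) φ t)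
      volume ξ 1 := hbi.mono_set (by
        rw [uIcc_of_le hξ.2, uIcc_of_le zero_le_one]; exact Icc_subset_Icc_left hξ.1.le)
  rw [e1, e2] at h
  rw [← intervalIntegral.integral_add_adjacent_intervals hsub1 hsub2, e3, add_zero, ← h]
  ring

/-! ### Partial derivatives of smooth functions -/

lemma contDiff_partialDeriv {d : ℕ} {f : (Fin d → ℝ) → ℝ} (hf : ContDiff ℝ ∞ f) (i : Fin d) :
    ContDiff ℝ ∞ (partialDeriv i f) :=
  (hf.fderiv_right (m := ∞) le_rfl).clm_apply contDiff_const

lemma contDiff_iterate_partialDeriv {d : ℕ} {f : (Fin d → ℝ) → ℝ} (hf : ContDiff ℝ ∞ f)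
    (i : Fin d) (n : ℕ) : ContDiff ℝ ∞ ((partialDeriv i)^[n] f) := by
  induction n with
  | zero => exact hf
  | succ n ih => rw [Function.iterate_succ_apply']; exact contDiff_partialDeriv ih i

lemma hasDerivAt_comp_update {d : ℕ} {f : (Fin d → ℝ) → ℝ} {x : Fin d → ℝ} {m : Fin d} {s : ℝ}
    (hf : DifferentiableAt ℝ f (Function.update x m s)) :
    HasDerivAt (fun s => f (Function.update x m s)) (partialDeriv m f (Function.update x m s)) s :=
  hf.hasFDerivAt.comp_hasDerivAt s (hasDerivAt_update x m s)

lemma partialDeriv_comm {d : ℕ} {f : (Fin d → ℝ) → ℝ} (hf : ContDiff ℝ ∞ f) (i j : Fin d) :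
    partialDeriv i (partialDeriv j f) = partialDeriv j (partialDeriv i f) := by
  have key : ∀ (a b : Fin d) (x : Fin d → ℝ), partialDeriv a (partialDeriv b f) x
      = fderiv ℝ (fderiv ℝ f) x (Pi.single a 1) (Pi.single b 1) := by
    intro a b x
    unfold partialDeriv
    rw [fderiv_clm_apply ((hf.fderiv_right (m := ∞) le_rfl).differentiable (by simp) x)
      (differentiableAt_const _)]
    simp
  ext x
  rw [key, key]
  exact (hf.contDiffAt.isSymmSndFDerivAt (by
    simp only [minSmoothness_of_isRCLikeNormedField]; exact WithTop.coe_le_coe.2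
      (le_top : (2 : ℕ∞) ≤ ⊤))).eq _ _

/-! ### Polynomial approximation on cells -/

/-- The `L²` projection in the `m`-th variable onto piecewise polynomials of level `n`. -/
abbrev projOp {d : ℕ} (k n : ℕ) (m : Fin d) : ((Fin d → ℝ) → ℝ) → (Fin d → ℝ) → ℝ :=
  kernelOp (cellKernel n (reproKernel k)) m

/-- The derivative, in local coordinates, of the projection in the `m`-th variable. -/
abbrev dprojOp {d : ℕ} (k n : ℕ) (m : Fin d) : ((Fin d → ℝ) → ℝ) → (Fin d → ℝ) → ℝ :=
  kernelOp (cellKernel n (reproDeriv k)) m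

/-- The Taylor remainder, in local coordinates, as an operator in the `m`-th variable. -/
abbrev remOp {d : ℕ} (q n : ℕ) (m : Fin d) : ((Fin d → ℝ) → ℝ) → (Fin d → ℝ) → ℝ :=
  kernelOp (cellKernel n (taylorKernel q)) m

lemma mk_mem_cell {n : ℕ} (z : ℝ) {σ : ℝ} (hσ : σ ∈ Ioc (0 : ℝ) 1) :
    ∃ j : ℕ, j < 2 ^ n ∧ cellIdx n z = j ∧
      ((cellIdx n z : ℝ) + σ) / 2 ^ n ∈ Ioc ((j : ℝ) / 2 ^ n) (((j : ℝ) + 1) / 2 ^ n) := by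
  obtain ⟨j, hj, hz⟩ := exists_cellIdx_eq n z
  refine ⟨j, hj, hz, ?_⟩
  rw [hz]
  push_cast
  constructor
  · gcongr; linarith [hσ.1]
  · gcongr; exact hσ.2

lemma cellIdx_mk {n : ℕ} (z : ℝ) {σ : ℝ} (hσ : σ ∈ Ioc (0 : ℝ) 1) :
    cellIdx n (((cellIdx n z : ℝ) + σ) / 2 ^ n) = cellIdx n z := by
  obtain ⟨j, hj, hz, h⟩ := mk_mem_cell (n := n) z hσ
  rw [cellIdx_of_mem hj h, hz]

lemma cellLoc_mk {n : ℕ} (z : ℝ) {σ : ℝ} (hσ : σ ∈ Ioc (0 : ℝ) 1) :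
    cellLoc n (((cellIdx n z : ℝ) + σ) / 2 ^ n) = σ := by
  obtain ⟨j, hj, hz, h⟩ := mk_mem_cell (n := n) z hσ
  rw [cellLoc_of_mem h, hz]
  field_simp
  push_cast; ring

lemma kernelOp_cellKernel {d : ℕ} (n : ℕ) (k₀ : ℝ → ℝ → ℝ) (m : Fin d) (f : (Fin d → ℝ) → ℝ)
    (x : Fin d → ℝ) : kernelOp (cellKernel n k₀) m f x
      = ∫ σ in (0 : ℝ)..1, k₀ (cellLoc n (x m)) σ
          * f (Function.update x m (((cellIdx n (x m) : ℝ) + σ) / 2 ^ n)) :=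
  integral_cellKernel n k₀ (x m) fun s => f (Function.update x m s)

lemma intervalIntegral_congr_unit {φ ψ : ℝ → ℝ} (h : ∀ σ ∈ Ioc (0 : ℝ) 1, φ σ = ψ σ) :
    ∫ σ in (0 : ℝ)..1, φ σ = ∫ σ in (0 : ℝ)..1, ψ σ := by
  rw [intervalIntegral.integral_of_le zero_le_one, intervalIntegral.integral_of_le zero_le_one]
  exact setIntegral_congr_fun measurableSet_Ioc h

lemma LocalKernel.intervalIntegrable {k₀ : ℝ → ℝ → ℝ} {M : ℝ} (hk : LocalKernel k₀ M) {ξ : ℝ}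
    (hξ : ξ ∈ Ioc (0 : ℝ) 1) {φ : ℝ → ℝ} (hφ : IntervalIntegrable φ volume 0 1) :
    IntervalIntegrable (fun σ => k₀ ξ σ * φ σ) volume 0 1 := by
  rw [intervalIntegrable_iff_integrableOn_Ioc_of_le zero_le_one] at hφ ⊢
  refine Integrable.bdd_mul (c := M) hφ ?_ ?_
  · exact (hk.measurable.comp (measurable_const.prodMk measurable_id)).aestronglyMeasurable
  · filter_upwards [ae_restrict_mem measurableSet_Ioc] with t ht
    exact hk.bdd ξ hξ t ht

lemma BddMeas.intervalIntegrable_comp {d : ℕ} {f : (Fin d → ℝ) → ℝ} (hf : BddMeas f) (m : Fin d)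
    (x : Fin d → ℝ) {φ : ℝ → ℝ} (hφ : Measurable φ) (a b : ℝ) :
    IntervalIntegrable (fun σ => f (Function.update x m (φ σ))) volume a b := by
  obtain ⟨C, hC⟩ := hf.bdd
  rw [intervalIntegrable_iff]
  have : IsFiniteMeasure (volume.restrict (uIoc a b)) := ⟨by simp [uIoc]⟩
  exact Integrable.of_bound (C := C) ((hf.slice_measurable m x).comp hφ).aestronglyMeasurable
    (Filter.Eventually.of_forall fun s => hC _)

/-- The function on the unit interval that describes `f` on the cell of `x` in the `m`-th
variable. -/
def localSlice {d : ℕ} (n : ℕ) (m : Fin d) (f : (Fin d → ℝ) → ℝ) (x : Fin d → ℝ) (σ : ℝ) : ℝ :=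
  f (Function.update x m (((cellIdx n (x m) : ℝ) + σ) / 2 ^ n))

lemma contDiff_localSlice {d : ℕ} (n : ℕ) (m : Fin d) {f : (Fin d → ℝ) → ℝ}
    (hf : ContDiff ℝ ∞ f) (x : Fin d → ℝ) : ContDiff ℝ ∞ (localSlice n m f x) := by
  refine hf.comp ((contDiff_update ∞ x m).comp ?_)
  fun_prop

lemma deriv_localSlice {d : ℕ} (n : ℕ) (m : Fin d) {f : (Fin d → ℝ) → ℝ} (hf : ContDiff ℝ ∞ f)
    (x : Fin d → ℝ) :
    deriv (localSlice n m f x) = fun σ => (1 / 2 ^ n) * localSlice n m (partialDeriv m f) x σ := by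
  ext σ
  have h1 := hasDerivAt_comp_update (f := f) (x := x) (m := m)
    (s := ((cellIdx n (x m) : ℝ) + σ) / 2 ^ n) (hf.differentiable (by simp) _)
  have h2 : HasDerivAt (fun σ : ℝ => ((cellIdx n (x m) : ℝ) + σ) / 2 ^ n) (1 / 2 ^ n) σ :=
    ((hasDerivAt_id σ).const_add _).div_const _
  have := h1.comp σ h2
  rw [show localSlice n m f x = (fun s => f (Function.update x m s)) ∘
    (fun σ : ℝ => ((cellIdx n (x m) : ℝ) + σ) / 2 ^ n) from rfl, this.deriv]
  rw [localSlice, mul_comm]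

lemma iteratedDeriv_localSlice {d : ℕ} (n : ℕ) (m : Fin d) {f : (Fin d → ℝ) → ℝ}
    (hf : ContDiff ℝ ∞ f) (x : Fin d → ℝ) (r : ℕ) :
    iteratedDeriv r (localSlice n m f x)
      = fun σ => (1 / 2 ^ n) ^ r * localSlice n m ((partialDeriv m)^[r] f) x σ := by
  induction r with
  | zero => simp
  | succ r ih =>
    rw [iteratedDeriv_succ, ih, Function.iterate_succ_apply']
    ext σ
    rw [deriv_const_mul_field, deriv_localSlice n m (contDiff_iterate_partialDeriv hf m r)]
    ring

lemma kernelOp_update_mk {d : ℕ} (n : ℕ) (k₀ : ℝ → ℝ → ℝ) (m : Fin d) (g : (Fin d → ℝ) → ℝ)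
    (x : Fin d → ℝ) {σ : ℝ} (hσ : σ ∈ Ioc (0 : ℝ) 1) :
    kernelOp (cellKernel n k₀) m g (Function.update x m (((cellIdx n (x m) : ℝ) + σ) / 2 ^ n))
      = ∫ τ in (0 : ℝ)..1, k₀ σ τ * localSlice n m g x τ := by
  rw [kernelOp_cellKernel]
  simp only [Function.update_self, Function.update_idem]
  rw [cellIdx_mk _ hσ, cellLoc_mk _ hσ]
  rfl

/-- Taylor's formula on a cell. -/
lemma localSlice_eq_taylor {d : ℕ} (n q : ℕ) (m : Fin d) {f : (Fin d → ℝ) → ℝ}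
    (hf : ContDiff ℝ ∞ f) (x : Fin d → ℝ) {σ : ℝ} (hσ : σ ∈ Ioc (0 : ℝ) 1) :
    localSlice n m f x σ = (taylorPoly (localSlice n m f x) q).eval σ
      + (1 / 2 ^ n) ^ (q + 1)
        * localSlice n m (remOp q n m ((partialDeriv m)^[q + 1] f)) x σ := by
  rw [taylor_unit (contDiff_localSlice n m hf x) q hσ]
  congr 1
  conv_rhs => rw [localSlice, remOp, kernelOp_update_mk n _ m _ x hσ]
  rw [← intervalIntegral.integral_const_mul, iteratedDeriv_localSlice n m hf]
  congr 1
  ext τ; ring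

/-- The effect of a cell-local operator on the two parts of Taylor's formula. -/
lemma kernelOp_eq_taylor {d : ℕ} {k₀ : ℝ → ℝ → ℝ} {M : ℝ} (hk : LocalKernel k₀ M) (n q : ℕ)
    (m : Fin d) {f : (Fin d → ℝ) → ℝ} (hf : ContDiff ℝ ∞ f)
    (hg : BddMeas ((partialDeriv m)^[q + 1] f)) (x : Fin d → ℝ) :
    kernelOp (cellKernel n k₀) m f x
      = (∫ σ in (0 : ℝ)..1, k₀ (cellLoc n (x m)) σ
          * (taylorPoly (localSlice n m f x) q).eval σ)
        + (1 / 2 ^ n) ^ (q + 1) * kernelOp (cellKernel n k₀) m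
            (remOp q n m ((partialDeriv m)^[q + 1] f)) x := by
  rw [kernelOp_cellKernel, kernelOp_cellKernel, ← intervalIntegral.integral_const_mul,
    ← intervalIntegral.integral_add]
  · refine intervalIntegral_congr_unit fun σ hσ => ?_
    have := localSlice_eq_taylor n q m hf x hσ
    rw [localSlice] at this
    rw [this, localSlice]; ring
  · exact hk.intervalIntegrable (cellLoc_mem _ _) (Continuous.intervalIntegrable (by fun_prop) _ _)
  · refine IntervalIntegrable.const_mul (hk.intervalIntegrable (cellLoc_mem _ _) ?_) _
    exact (hg.kernelOp ((localKernel_taylor q).bddKernel n) m).intervalIntegrable_comp m x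
      (by fun_prop) 0 1

lemma localSlice_cellLoc {d : ℕ} (n : ℕ) (m : Fin d) (f : (Fin d → ℝ) → ℝ) {x : Fin d → ℝ}
    (hx : x m ∈ Ioc (0 : ℝ) 1) : localSlice n m f x (cellLoc n (x m)) = f x := by
  rw [localSlice, cellIdx_add_cellLoc hx, Function.update_eq_self]

/-- The error of the projection is a bounded cell-local operator applied to a derivative. -/
lemma sub_projOp_eq {d k q : ℕ} (hq : q ≤ k) (n : ℕ) (m : Fin d) {f : (Fin d → ℝ) → ℝ}
    (hf : ContDiff ℝ ∞ f) (hg : BddMeas ((partialDeriv m)^[q + 1] f)) {x : Fin d → ℝ}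
    (hx : x m ∈ Ioc (0 : ℝ) 1) :
    f x - projOp k n m f x = (1 / 2 ^ n) ^ (q + 1)
      * (remOp q n m ((partialDeriv m)^[q + 1] f) x
        - projOp k n m (remOp q n m ((partialDeriv m)^[q + 1] f)) x) := by
  have h1 := localSlice_eq_taylor n q m hf x (cellLoc_mem n (x m))
  rw [localSlice_cellLoc n m _ hx, localSlice_cellLoc n m _ hx] at h1
  -- The projection reproduces the Taylor polynomial, whose contributions cancel.
  have h2 := kernelOp_eq_taylor (localKernel_repro k) n q m hf hg x
  rw [integral_reproKernel k _ ((natDegree_taylorPoly_le _ q).trans hq)] at h2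
  rw [projOp, h2]
  conv_lhs => rw [h1]
  ring

/-- The derivative of the projection error as a cell-local operator applied to a derivative. -/
lemma partialDeriv_sub_dprojOp_eq {d k r : ℕ} (hr : r + 1 ≤ k) (n : ℕ) (m : Fin d)
    {f : (Fin d → ℝ) → ℝ} (hf : ContDiff ℝ ∞ f) (hg : BddMeas ((partialDeriv m)^[r + 2] f))
    {x : Fin d → ℝ} (hx : x m ∈ Ioc (0 : ℝ) 1) :
    partialDeriv m f x - 2 ^ n * dprojOp k n m f x = (1 / 2 ^ n) ^ (r + 1)
      * (remOp r n m ((partialDeriv m)^[r + 2] f) x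
        - dprojOp k n m (remOp (r + 1) n m ((partialDeriv m)^[r + 2] f)) x) := by
  have h1 := localSlice_eq_taylor n r m (contDiff_partialDeriv hf m) x (cellLoc_mem n (x m))
  rw [localSlice_cellLoc n m _ hx, localSlice_cellLoc n m _ hx,
    ← Function.iterate_succ_apply] at h1
  -- Here the polynomial has degree `r + 1`, and its derivative is the Taylor polynomial of the
  -- derivative.
  have h2 := kernelOp_eq_taylor (localKernel_reproDeriv k) n (r + 1) m hf hg x
  rw [integral_reproDeriv k _ ((natDegree_taylorPoly_le _ (r + 1)).trans hr),
    derivative_taylorPoly, deriv_localSlice n m hf] at h2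
  have h3 : (taylorPoly (fun σ => (1 / 2 ^ n) * localSlice n m (partialDeriv m f) x σ) r).eval
      (cellLoc n (x m)) = (1 / 2 ^ n) * (taylorPoly (localSlice n m (partialDeriv m f) x) r).eval
      (cellLoc n (x m)) := by
    rw [eval_taylorPoly, eval_taylorPoly, Finset.mul_sum]
    refine Finset.sum_congr rfl fun i _ => ?_
    rw [iteratedDeriv_const_mul_field]; ring
  rw [h3] at h2
  rw [dprojOp, h2]
  conv_lhs => rw [h1]
  have h4 : (2 : ℝ) ^ n * (1 / 2 ^ n) = 1 := by field_simp
  linear_combination (-(taylorPoly (localSlice n m (partialDeriv m f) x) r).eval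
      (cellLoc n (x m)) - (1 / 2 ^ n) ^ (r + 1) * kernelOp (cellKernel n (reproDeriv k)) m
        (remOp (r + 1) n m ((partialDeriv m)^[r + 1 + 1] f)) x) * h4

/-- The derivative of the projection only depends on the derivative of the function. -/
lemma dprojOp_eq {d k : ℕ} (n : ℕ) (m : Fin d) {f : (Fin d → ℝ) → ℝ}
    (hf : ContDiff ℝ ∞ f) (hg : BddMeas (partialDeriv m f)) (x : Fin d → ℝ) :
    dprojOp k n m f x = (1 / 2 ^ n) * dprojOp k n m (remOp 0 n m (partialDeriv m f)) x := by
  have h2 := kernelOp_eq_taylor (localKernel_reproDeriv k) n 0 m hf hg x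
  -- The Taylor polynomial of degree `0` is constant and has no derivative.
  have hdeg := natDegree_taylorPoly_le (localSlice n m f x) 0
  rw [integral_reproDeriv k _ (hdeg.trans (Nat.zero_le _)),
    Polynomial.derivative_of_natDegree_zero (Nat.le_zero.1 hdeg)] at h2
  simpa using h2

lemma cellAvg_cellAvg {d : ℕ} (n : ℕ) (m : Fin d) (f : (Fin d → ℝ) → ℝ) :
    cellAvg n m (cellAvg n m f) = cellAvg n m f := by
  ext x
  have h : ∀ σ ∈ Ioc (0 : ℝ) 1, (1 : ℝ) * cellAvg n m f
      (Function.update x m (((cellIdx n (x m) : ℝ) + σ) / 2 ^ n)) = cellAvg n m f x := by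
    intro σ hσ
    rw [cellAvg, kernelOp_update_mk n _ m f x hσ, kernelOp_cellKernel, one_mul]
    rfl
  refine (kernelOp_cellKernel n (fun _ _ => 1) m (cellAvg n m f) x).trans ?_
  rw [intervalIntegral_congr_unit h]
  simp

lemma cellAvg_mono {d : ℕ} (n : ℕ) (m : Fin d) {f g : (Fin d → ℝ) → ℝ} (hf : BddMeas f)
    (hg : BddMeas g) (h : ∀ x, f x ≤ g x) (x : Fin d → ℝ) : cellAvg n m f x ≤ cellAvg n m g x := by
  have hb := localKernel_one.bddKernel n
  refine integral_mono (hb.integrable _ (hf.slice_integrable m x))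
    (hb.integrable _ (hg.slice_integrable m x)) fun s => ?_
  refine mul_le_mul_of_nonneg_left (h _) ?_
  unfold cellKernel
  split_ifs <;> positivity

/-- A pointwise bound for the projection error, valid up to the end points of the cell. -/
lemma sq_sub_projOp_le {d k q : ℕ} (hq : q ≤ k) (n : ℕ) (m : Fin d) {f : (Fin d → ℝ) → ℝ}
    (hf : ContDiff ℝ ∞ f) (hg : BddMeas ((partialDeriv m)^[q + 1] f)) {x : Fin d → ℝ}
    (hx : x m ∈ Ioc (0 : ℝ) 1) :
    (f x - projOp k n m f x) ^ 2 ≤ ((1 / 2 ^ n) ^ (q + 1)) ^ 2 * (4 * reproBound k ^ 2)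
      * cellAvg n m (fun y => (partialDeriv m)^[q + 1] f y ^ 2) x := by
  rw [sub_projOp_eq hq n m hf hg hx, mul_pow, mul_assoc]
  refine mul_le_mul_of_nonneg_left ?_ (by positivity)
  set g := (partialDeriv m)^[q + 1] f
  have h1 := sq_kernelOp_le_cellAvg (localKernel_taylor q) n m hg
  have hR : BddMeas (remOp q n m g) := hg.kernelOp ((localKernel_taylor q).bddKernel n) m
  have h2 := sq_kernelOp_le_cellAvg (localKernel_repro k) n m hR x
  have h3 := cellAvg_mono n m hR.sq (hg.sq.cellAvg n m)
    (fun y => (h1 y).trans (le_of_eq (by ring))) x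
  -- Averaging over the same cell twice changes nothing, so only one average of `g²` remains.
  rw [cellAvg_cellAvg] at h3
  have hM := one_le_reproBound k
  have h4 : 0 ≤ cellAvg n m (fun y => g y ^ 2) x := by
    have := h1 x
    nlinarith [sq_nonneg (kernelOp (cellKernel n (taylorKernel q)) m g x)]
  have h5 : projOp k n m (remOp q n m g) x ^ 2
      ≤ reproBound k ^ 2 * cellAvg n m (fun y => g y ^ 2) x :=
    h2.trans (mul_le_mul_of_nonneg_left h3 (by positivity))
  have h6 : remOp q n m g x ^ 2 ≤ reproBound k ^ 2 * cellAvg n m (fun y => g y ^ 2) x := by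
    refine (h1 x).trans ?_
    gcongr
  nlinarith [sq_nonneg (remOp q n m g x + projOp k n m (remOp q n m g) x)]

/-! ### Piecewise polynomials in one variable -/

lemma periodic_cellIdx (n : ℕ) : Function.Periodic (cellIdx n) 1 := cellIdx_add_one n
lemma periodic_cellLoc (n : ℕ) : Function.Periodic (cellLoc n) 1 := cellLoc_add_one n

lemma exists_mem_Ioc_add_int (x : ℝ) : ∃ y ∈ Ioc (0 : ℝ) 1, ∃ z : ℤ, x = y + z := by
  refine ⟨x - ⌈x⌉ + 1, ⟨?_, ?_⟩, ⌈x⌉ - 1, by push_cast; ring⟩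
  · linarith [Int.ceil_lt_add_one x]
  · linarith [Int.le_ceil x]

lemma periodic_add_int {β : Type*} {f : ℝ → β} (hf : Function.Periodic f 1) (x : ℝ) (z : ℤ) :
    f (x + z) = f x := by
  simpa using hf.int_mul z x

/-- `V_n^k` as a linear subspace. -/
def VSubmodule (n k : ℕ) : Submodule ℝ (ℝ → ℝ) where
  carrier := V n k
  zero_mem' := ⟨fun _ => rfl, fun _ _ => ⟨0, by simp, fun x _ => by simp⟩⟩
  add_mem' := by
    rintro u v ⟨hu, hu'⟩ ⟨hv, hv'⟩
    refine ⟨hu.add hv, fun j hj => ?_⟩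
    obtain ⟨P, hP, hPe⟩ := hu' j hj
    obtain ⟨Q, hQ, hQe⟩ := hv' j hj
    refine ⟨P + Q, (Polynomial.natDegree_add_le _ _).trans (max_le hP hQ), fun x hx => ?_⟩
    rw [Pi.add_apply, hPe x hx, hQe x hx, Polynomial.eval_add]
  smul_mem' := by
    rintro c u ⟨hu, hu'⟩
    refine ⟨fun x => by simp [hu x], fun j hj => ?_⟩
    obtain ⟨P, hP, hPe⟩ := hu' j hj
    refine ⟨c • P, (Polynomial.natDegree_smul_le _ _).trans hP, fun x hx => ?_⟩
    rw [Pi.smul_apply, hPe x hx, Polynomial.eval_smul]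

lemma mem_VSubmodule {n k : ℕ} {v : ℝ → ℝ} : v ∈ VSubmodule n k ↔ v ∈ V n k := Iff.rfl

/-- The monomial of degree `i` in the local coordinate of the cell `j`, extended by zero. -/
def cellBasis (n j i : ℕ) (x : ℝ) : ℝ := if cellIdx n x = j then cellLoc n x ^ i else 0

/-- The dual basis of `cellBasis` in `L²(0,1)`. -/
def cellDual (k n j : ℕ) (i : Fin (k + 1)) (y : ℝ) : ℝ :=
  2 ^ n * ∑ l : Fin (k + 1), gramInv k i l * cellBasis n j l y

lemma natDegree_C_mul_X_le_one (a : ℝ) : (Polynomial.C a * Polynomial.X).natDegree ≤ 1 := by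
  simpa using Polynomial.natDegree_C_mul_X_pow_le a 1

lemma cellBasis_mem_V {n j i k : ℕ} (hi : i ≤ k) : cellBasis n j i ∈ V n k := by
  refine ⟨fun x => by simp only [cellBasis, cellIdx_add_one, cellLoc_add_one], fun l hl => ?_⟩
  by_cases h : l = j
  · refine ⟨(Polynomial.C ((2 : ℝ) ^ n) * Polynomial.X - Polynomial.C (l : ℝ)) ^ i, ?_, ?_⟩
    · refine Polynomial.natDegree_pow_le.trans ?_
      rw [Polynomial.natDegree_sub_C]
      have := natDegree_C_mul_X_le_one ((2 : ℝ) ^ n)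
      nlinarith
    · intro x hx
      rw [cellBasis, cellIdx_of_mem hl hx, cellLoc_of_mem hx, if_pos (by rw [h])]
      simp
  · refine ⟨0, by simp, fun x hx => ?_⟩
    rw [cellBasis, cellIdx_of_mem hl hx, if_neg (by exact_mod_cast h)]
    simp

lemma measurable_cellBasis (n j i : ℕ) : Measurable (cellBasis n j i) :=
  Measurable.ite (measurable_cellIdx n (measurableSet_singleton _))
    ((measurable_cellLoc n).pow_const i) measurable_const

lemma abs_cellBasis_le (n j i : ℕ) (x : ℝ) : |cellBasis n j i x| ≤ 1 := by
  unfold cellBasis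
  split_ifs
  · rw [abs_pow, abs_of_pos (cellLoc_mem n x).1]
    exact pow_le_one₀ (cellLoc_mem n x).1.le (cellLoc_mem n x).2
  · simp

/-- The projection kernel has finite rank. -/
lemma cellKernel_reproKernel_eq (k n : ℕ) (x y : ℝ) : cellKernel n (reproKernel k) x y
    = ∑ j ∈ Finset.range (2 ^ n), ∑ i : Fin (k + 1), cellBasis n j i x * cellDual k n j i y := by
  obtain ⟨j, hj, hxj⟩ := exists_cellIdx_eq n x
  rw [Finset.sum_eq_single j]
  · by_cases h : cellIdx n y = j
    · rw [cellKernel, if_pos (hxj.trans h.symm), reproKernel, Finset.mul_sum]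
      refine Finset.sum_congr rfl fun i _ => ?_
      simp only [cellDual, cellBasis, if_pos hxj, if_pos h]
      rw [← mul_assoc, mul_comm _ ((2 : ℝ) ^ n), mul_assoc]
      congr 1
      rw [Finset.mul_sum]
      exact Finset.sum_congr rfl fun l _ => by ring
    · rw [cellKernel, if_neg (by rw [hxj]; exact Ne.symm h)]
      symm
      refine Finset.sum_eq_zero fun i _ => ?_
      simp [cellDual, cellBasis, h]
  · intro l _ hl
    refine Finset.sum_eq_zero fun i _ => ?_
    rw [cellBasis, if_neg, zero_mul]
    rw [hxj]; exact_mod_cast Ne.symm hl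
  · intro h; exact absurd (Finset.mem_range.2 hj) h

/-- Piecewise polynomials are reproduced by the projection kernel. -/
lemma integral_cellKernel_of_poly {k n : ℕ} {v : ℝ → ℝ} {x : ℝ} (hx : x ∈ Ioc (0 : ℝ) 1)
    {P : Polynomial ℝ} (hP : P.natDegree ≤ k)
    (hv : ∀ s ∈ Ioc (0 : ℝ) 1, cellIdx n s = cellIdx n x → v s = P.eval s) :
    ∫ s in Ioo (0 : ℝ) 1, cellKernel n (reproKernel k) x s * v s = P.eval x ∧
    2 ^ n * ∫ s in Ioo (0 : ℝ) 1, cellKernel n (reproDeriv k) x s * v s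
      = P.derivative.eval x := by
  set Q : Polynomial ℝ := P.comp (Polynomial.C (1 / (2 : ℝ) ^ n) * Polynomial.X
    + Polynomial.C ((cellIdx n x : ℝ) / 2 ^ n)) with hQ
  have hQdeg : Q.natDegree ≤ k := by
    refine Polynomial.natDegree_comp_le.trans ?_
    have : (Polynomial.C (1 / (2 : ℝ) ^ n) * Polynomial.X
        + Polynomial.C ((cellIdx n x : ℝ) / 2 ^ n)).natDegree ≤ 1 := by
      rw [Polynomial.natDegree_add_C]; exact natDegree_C_mul_X_le_one _
    nlinarith
  have hQe : ∀ σ, Q.eval σ = P.eval (((cellIdx n x : ℝ) + σ) / 2 ^ n) := by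
    intro σ
    rw [hQ, Polynomial.eval_comp]
    congr 1
    simp; ring
  have hvQ : ∀ σ ∈ Ioc (0 : ℝ) 1, v (((cellIdx n x : ℝ) + σ) / 2 ^ n) = Q.eval σ := by
    intro σ hσ
    obtain ⟨j, hj, hz, h⟩ := mk_mem_cell (n := n) x hσ
    rw [hQe]
    exact hv _ (cell_subset_Ioc hj h) (cellIdx_mk x hσ)
  rw [integral_cellKernel, integral_cellKernel]
  constructor
  · rw [intervalIntegral_congr_unit (fun σ hσ => by rw [hvQ σ hσ]),
      integral_reproKernel k _ hQdeg, hQe, cellIdx_add_cellLoc hx]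
  · rw [intervalIntegral_congr_unit (fun σ hσ => by rw [hvQ σ hσ]),
      integral_reproDeriv k _ hQdeg, hQ, Polynomial.derivative_comp]
    simp only [Polynomial.derivative_add, Polynomial.derivative_C_mul, Polynomial.derivative_X,
      Polynomial.derivative_C, Polynomial.eval_mul, Polynomial.eval_comp, Polynomial.eval_add,
      Polynomial.eval_C, Polynomial.eval_X, mul_one, add_zero]
    rw [show 1 / 2 ^ n * cellLoc n x + (cellIdx n x : ℝ) / 2 ^ n
      = ((cellIdx n x : ℝ) + cellLoc n x) / 2 ^ n by ring, cellIdx_add_cellLoc hx]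
    field_simp

lemma exists_poly_of_mem_V {k n : ℕ} {v : ℝ → ℝ} (hv : v ∈ V n k) {x : ℝ}
    (hx : x ∈ Ioc (0 : ℝ) 1) : ∃ P : Polynomial ℝ, P.natDegree ≤ k ∧
      ∀ s ∈ Ioc (0 : ℝ) 1, cellIdx n s = cellIdx n x → v s = P.eval s := by
  obtain ⟨j, hj, hxj⟩ := exists_mem_cell n hx
  obtain ⟨P, hP, hPe⟩ := hv.2 j hj
  refine ⟨P, hP, fun s hs hsx => hPe s ?_⟩
  rw [cellIdx_of_mem hj hxj] at hsx
  exact (cellIdx_eq_iff hj hs).1 hsx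

lemma cellKernel_add_int (n : ℕ) (k₀ : ℝ → ℝ → ℝ) (x y : ℝ) (z : ℤ) :
    cellKernel n k₀ (x + z) y = cellKernel n k₀ x y := by
  simp only [cellKernel, periodic_add_int (periodic_cellIdx n),
    periodic_add_int (periodic_cellLoc n)]

lemma integral_cellKernel_of_mem_V {k n : ℕ} {v : ℝ → ℝ} (hv : v ∈ V n k) (x : ℝ) :
    ∫ s in Ioo (0 : ℝ) 1, cellKernel n (reproKernel k) x s * v s = v x := by
  obtain ⟨y, hy, z, rfl⟩ := exists_mem_Ioc_add_int x
  obtain ⟨P, hP, hPe⟩ := exists_poly_of_mem_V hv hy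
  simp_rw [cellKernel_add_int, periodic_add_int hv.1]
  rw [(integral_cellKernel_of_poly hy hP hPe).1, hPe y hy rfl]

lemma integrable_of_bdd {φ : ℝ → ℝ} (hφ : Measurable φ) {C : ℝ} (hC : ∀ x, |φ x| ≤ C) :
    Integrable φ unitMeasure :=
  Integrable.of_bound hφ.aestronglyMeasurable C (Filter.Eventually.of_forall hC)

lemma measurable_cellDual (k n j : ℕ) (i : Fin (k + 1)) : Measurable (cellDual k n j i) := by
  unfold cellDual
  exact (Finset.measurable_sum Finset.univ fun (l : Fin (k + 1)) _ =>
    (measurable_cellBasis n j (l : ℕ)).const_mul (gramInv k i l)).const_mul ((2 : ℝ) ^ n)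

lemma exists_abs_cellDual_le (k n j : ℕ) (i : Fin (k + 1)) :
    ∃ C, ∀ x, |cellDual k n j i x| ≤ C := by
  refine ⟨2 ^ n * ∑ l : Fin (k + 1), |gramInv k i l|, fun x => ?_⟩
  rw [cellDual, abs_mul, abs_of_pos (by positivity : (0 : ℝ) < 2 ^ n)]
  gcongr
  refine (Finset.abs_sum_le_sum_abs _ _).trans (Finset.sum_le_sum fun l _ => ?_)
  rw [abs_mul]
  exact mul_le_of_le_one_right (abs_nonneg _) (abs_cellBasis_le _ _ _ _)

/-- Piecewise polynomials are measurable and bounded, since every polynomial is continuous on the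
closure of its cell. -/
lemma measurable_bdd_of_mem_V {k n : ℕ} {v : ℝ → ℝ} (hv : v ∈ V n k) :
    Measurable v ∧ ∃ C, ∀ x, |v x| ≤ C := by
  -- extend the pieces to all of `ℝ` in the local coordinate
  choose P hP hPe using fun j : Fin (2 ^ n) => hv.2 j j.2
  have hrep : v = fun x => ∑ j : Fin (2 ^ n), ∑ i : Fin (k + 1),
      ((P j).comp (Polynomial.C (1 / (2 : ℝ) ^ n) * Polynomial.X
        + Polynomial.C ((j : ℝ) / 2 ^ n))).coeff i * cellBasis n j i x := by
    funext x
    obtain ⟨y, hy, z, rfl⟩ := exists_mem_Ioc_add_int x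
    obtain ⟨j, hj, hyj⟩ := exists_mem_cell n hy
    have hper : ∀ j i : ℕ, cellBasis n j i (y + z) = cellBasis n j i y := fun j i => by
      simp only [cellBasis, periodic_add_int (periodic_cellIdx n),
        periodic_add_int (periodic_cellLoc n)]
    simp_rw [hper, periodic_add_int hv.1]
    rw [Finset.sum_eq_single (⟨j, hj⟩ : Fin (2 ^ n))]
    · rw [hPe ⟨j, hj⟩ y hyj]
      set Q := (P ⟨j, hj⟩).comp (Polynomial.C (1 / (2 : ℝ) ^ n) * Polynomial.X
        + Polynomial.C ((j : ℝ) / 2 ^ n)) with hQ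
      have hQdeg : Q.natDegree ≤ k := by
        refine Polynomial.natDegree_comp_le.trans ?_
        have h1 : (Polynomial.C (1 / (2 : ℝ) ^ n) * Polynomial.X
            + Polynomial.C ((j : ℝ) / 2 ^ n)).natDegree ≤ 1 := by
          rw [Polynomial.natDegree_add_C]; exact natDegree_C_mul_X_le_one _
        have := hP ⟨j, hj⟩
        nlinarith
      have : (P ⟨j, hj⟩).eval y = Q.eval (cellLoc n y) := by
        rw [hQ, Polynomial.eval_comp, cellLoc_of_mem hyj]
        congr 1
        simp; field_simp; ring
      rw [this, Polynomial.eval_eq_sum_range' (Nat.lt_succ_of_le hQdeg), Finset.sum_range]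
      refine Finset.sum_congr rfl fun i _ => ?_
      rw [cellBasis, if_pos (cellIdx_of_mem hj hyj)]
    · intro l _ hl
      refine Finset.sum_eq_zero fun i _ => ?_
      rw [cellBasis, if_neg, mul_zero]
      rw [cellIdx_of_mem hj hyj]
      intro h
      exact hl (Fin.ext (by exact_mod_cast h.symm))
    · simp
  constructor
  · rw [hrep]
    exact Finset.measurable_sum _ fun j _ => Finset.measurable_sum _ fun i _ =>
      (measurable_cellBasis n j i).const_mul _
  · rw [hrep]
    refine ⟨∑ j : Fin (2 ^ n), ∑ i : Fin (k + 1),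
      |((P j).comp (Polynomial.C (1 / (2 : ℝ) ^ n) * Polynomial.X
        + Polynomial.C ((j : ℝ) / 2 ^ n))).coeff i|, fun x => ?_⟩
    refine (Finset.abs_sum_le_sum_abs _ _).trans (Finset.sum_le_sum fun j _ => ?_)
    refine (Finset.abs_sum_le_sum_abs _ _).trans (Finset.sum_le_sum fun i _ => ?_)
    rw [abs_mul]
    exact mul_le_of_le_one_right (abs_nonneg _) (abs_cellBasis_le _ _ _ _)

lemma integrable_of_mem_V {k n : ℕ} {v : ℝ → ℝ} (hv : v ∈ V n k) : Integrable v unitMeasure := by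
  obtain ⟨h1, C, h2⟩ := measurable_bdd_of_mem_V hv
  exact integrable_of_bdd h1 h2

/-- Refining the grid enlarges the space: a fine cell lies in a coarse one. -/
lemma V_mono {n n' k : ℕ} (h : n ≤ n') : V n k ⊆ V n' k := by
  rintro v ⟨hv, hv'⟩
  refine ⟨hv, fun j hj => ?_⟩
  obtain ⟨r, rfl⟩ := Nat.exists_eq_add_of_le h
  have hj' : j / 2 ^ r < 2 ^ n := Nat.div_lt_of_lt_mul (by rwa [mul_comm, ← pow_add])
  obtain ⟨P, hP, hPe⟩ := hv' (j / 2 ^ r) hj'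
  refine ⟨P, hP, fun x hx => hPe x ?_⟩
  have hr : (0 : ℝ) < 2 ^ r := by positivity
  have hn : (0 : ℝ) < 2 ^ n := by positivity
  have h1 : ((j / 2 ^ r : ℕ) : ℝ) * 2 ^ r ≤ j := by
    exact_mod_cast Nat.div_mul_le_self j (2 ^ r)
  have h2 : (j : ℝ) + 1 ≤ (((j / 2 ^ r : ℕ) : ℝ) + 1) * 2 ^ r := by
    have := Nat.lt_mul_div_succ j (show 0 < 2 ^ r by positivity)
    have h3 : j + 1 ≤ (j / 2 ^ r + 1) * 2 ^ r := by rw [mul_comm]; exact this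
    exact_mod_cast h3
  rw [pow_add] at hx
  constructor
  · refine lt_of_le_of_lt ?_ hx.1
    rw [div_le_div_iff₀ hn (by positivity)]
    nlinarith
  · refine hx.2.trans ?_
    rw [div_le_div_iff₀ (by positivity) hn]
    nlinarith

lemma W_subset_V (l k : ℕ) : W l k ⊆ V l k := by
  cases l with
  | zero => exact fun v hv => hv
  | succ l => exact fun v hv => hv.1

/-- The projection of a function of one variable. -/
def proj1 (k n : ℕ) (v : ℝ → ℝ) (x : ℝ) : ℝ :=
  ∫ s in Ioo (0 : ℝ) 1, cellKernel n (reproKernel k) x s * v s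

lemma proj1_mem_V (k n : ℕ) {v : ℝ → ℝ} (hv : Integrable v unitMeasure) :
    proj1 k n v ∈ V n k := by
  have hint : ∀ j (i : Fin (k + 1)), Integrable (fun s => cellDual k n j i s * v s) unitMeasure :=
      by
    intro j i
    obtain ⟨C, hC⟩ := exists_abs_cellDual_le k n j i
    exact hv.bdd_mul (c := C) (measurable_cellDual k n j i).aestronglyMeasurable
      (Filter.Eventually.of_forall hC)
  have : proj1 k n v = ∑ j ∈ Finset.range (2 ^ n), ∑ i : Fin (k + 1),
      (∫ s in Ioo (0 : ℝ) 1, cellDual k n j i s * v s) • cellBasis n j i := by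
    funext x
    simp only [proj1, cellKernel_reproKernel_eq, Finset.sum_mul, Finset.sum_apply, Pi.smul_apply,
      smul_eq_mul]
    rw [integral_finsetSum _ fun j _ => integrable_finsetSum _ fun i _ => by
      simpa only [mul_assoc] using (hint j i).const_mul (cellBasis n j i x)]
    refine Finset.sum_congr rfl fun j _ => ?_
    rw [integral_finsetSum _ fun i _ => by
      simpa only [mul_assoc] using (hint j i).const_mul (cellBasis n j i x)]
    refine Finset.sum_congr rfl fun i _ => ?_
    simp_rw [mul_assoc]
    rw [integral_const_mul, mul_comm]
  rw [this]
  exact (VSubmodule n k).sum_mem fun j _ => (VSubmodule n k).sum_mem fun i _ =>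
    (VSubmodule n k).smul_mem _ (cellBasis_mem_V (Nat.lt_succ_iff.1 i.2))

lemma reproKernel_symm (k : ℕ) (σ τ : ℝ) : reproKernel k σ τ = reproKernel k τ σ := by
  unfold reproKernel
  rw [Finset.sum_comm]
  refine Finset.sum_congr rfl fun i _ => Finset.sum_congr rfl fun j _ => ?_
  rw [gramInv_symm]; ring

lemma cellKernel_repro_symm (k n : ℕ) (x y : ℝ) :
    cellKernel n (reproKernel k) x y = cellKernel n (reproKernel k) y x := by
  unfold cellKernel
  by_cases h : cellIdx n x = cellIdx n y
  · rw [if_pos h, if_pos h.symm, reproKernel_symm]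
  · rw [if_neg h, if_neg (Ne.symm h)]

/-- The kernel operator is the orthogonal projection onto `V n k`. -/
lemma integral_sub_proj1_mul {k n n' : ℕ} {v w : ℝ → ℝ} (hv : v ∈ V n' k) (hw : w ∈ V n k) :
    ∫ x in Ioo (0 : ℝ) 1, (v x - proj1 k n v x) * w x = 0 := by
  obtain ⟨hvm, C, hC⟩ := measurable_bdd_of_mem_V hv
  obtain ⟨hwm, D, hD⟩ := measurable_bdd_of_mem_V hw
  obtain ⟨hpm, E, hE⟩ := measurable_bdd_of_mem_V (proj1_mem_V k n (integrable_of_mem_V hv))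
  have hκ := (localKernel_repro k).bddKernel n
  obtain ⟨F, hF⟩ := hκ.bdd
  have i1 : Integrable (fun x => v x * w x) unitMeasure :=
    integrable_of_bdd (hvm.mul hwm) (C := C * D) fun x => by
      rw [abs_mul]; exact mul_le_mul (hC x) (hD x) (abs_nonneg _) ((abs_nonneg _).trans (hC 0))
  have i2 : Integrable (fun x => proj1 k n v x * w x) unitMeasure :=
    integrable_of_bdd (hpm.mul hwm) (C := E * D) fun x => by
      rw [abs_mul]; exact mul_le_mul (hE x) (hD x) (abs_nonneg _) ((abs_nonneg _).trans (hE 0))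
  simp_rw [sub_mul]
  rw [integral_sub i1 i2, sub_eq_zero]
  simp only [proj1, ← integral_mul_const]
  -- The kernel is symmetric, so the operator can be moved onto `w`, which it reproduces.
  rw [integral_integral_swap]
  · refine integral_congr_ae (Filter.Eventually.of_forall fun s => ?_)
    simp only
    rw [show (fun x => cellKernel n (reproKernel k) x s * v s * w x)
      = fun x => v s * (cellKernel n (reproKernel k) s x * w x) by
        ext x; rw [cellKernel_repro_symm]; ring, integral_const_mul,
      integral_cellKernel_of_mem_V hw]
  · refine Integrable.of_bound (C := F * C * D) ?_ (Filter.Eventually.of_forall fun p => ?_)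
    · exact ((hκ.measurable.mul (hvm.comp measurable_snd)).mul
        (hwm.comp measurable_fst)).aestronglyMeasurable
    · simp only [Function.uncurry]
      rw [Real.norm_eq_abs, abs_mul, abs_mul]
      have := (abs_nonneg _).trans (hF 0 0)
      have := (abs_nonneg _).trans (hC 0)
      gcongr
      · exact hF _ _
      · exact hC _
      · exact hD _

/-- The multilevel decomposition `V_l = W_0 ⊕ ⋯ ⊕ W_l`. -/
lemma exists_multilevel_decomposition {k l : ℕ} {v : ℝ → ℝ} (hv : v ∈ V l k) :
    ∃ w : ℕ → ℝ → ℝ, (∀ i, w i ∈ W i k) ∧ ∀ x, v x = ∑ i ∈ Finset.range (l + 1), w i x := by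
  have hzero : ∀ i, (fun _ => 0 : ℝ → ℝ) ∈ W i k := by
    intro i
    cases i with
    | zero => exact (VSubmodule 0 k).zero_mem
    | succ i => exact ⟨(VSubmodule (i + 1) k).zero_mem, fun w _ => by simp⟩
  induction l generalizing v with
  | zero =>
    refine ⟨fun i => if i = 0 then v else fun _ => 0, fun i => ?_, fun x => by simp⟩
    by_cases h : i = 0
    · subst h; exact hv
    · simpa [h] using hzero i
  | succ l ih =>
    have hp := proj1_mem_V k l (integrable_of_mem_V hv)
    obtain ⟨w, hw, hwe⟩ := ih hp
    -- The component of the top level is the error of the projection onto the next coarser level.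
    refine ⟨Function.update w (l + 1) (fun x => v x - proj1 k l v x), fun i => ?_, fun x => ?_⟩
    · by_cases h : i = l + 1
      · subst h
        rw [Function.update_self]
        refine ⟨(VSubmodule (l + 1) k).sub_mem hv (V_mono (Nat.le_succ l) hp), fun z hz => ?_⟩
        rw [intervalIntegral.integral_of_le zero_le_one, integral_Ioc_eq_integral_Ioo]
        exact integral_sub_proj1_mul hv hz
      · rw [Function.update_of_ne h]; exact hw i
    · rw [Finset.sum_range_succ, Function.update_self]
      have : ∑ i ∈ Finset.range (l + 1), Function.update w (l + 1)
          (fun x => v x - proj1 k l v x) i x = proj1 k l v x := by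
        rw [hwe x]
        refine Finset.sum_congr rfl fun i hi => ?_
        rw [Function.update_of_ne (Finset.mem_range.1 hi).ne]
      rw [this]; ring

/-- The cellwise derivative, as an integral operator, maps `V_l` to itself, for every grid finer
than that of `V_l`. -/
lemma deriv_mem_V {k l n : ℕ} (hl : l ≤ n) {v : ℝ → ℝ} (hv : v ∈ V l k) :
    (fun x => 2 ^ n * ∫ s in Ioo (0 : ℝ) 1, cellKernel n (reproDeriv k) x s * v s) ∈ V l k := by
  refine ⟨fun x => ?_, fun j hj => ?_⟩
  · have := fun s => cellKernel_add_int n (reproDeriv k) x s 1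
    simp only [Int.cast_one] at this
    simp only [this]
  · obtain ⟨P, hP, hPe⟩ := hv.2 j hj
    refine ⟨P.derivative, (Polynomial.natDegree_derivative_le P).trans (by omega),
      fun x hx => ?_⟩
    have hx1 := cell_subset_Ioc hj hx
    refine (integral_cellKernel_of_poly hx1 hP fun s hs hsx => hPe s ?_).2
    -- the cell of `x` on the fine grid lies in the cell of `x` on the coarse grid
    obtain ⟨i, hi, hxi⟩ := exists_mem_cell n hx1
    have hsi := (cellIdx_eq_iff hi hs).1 (hsx.trans (cellIdx_of_mem hi hxi))
    have hB := V_mono (k := 0) hl (cellBasis_mem_V (n := l) (j := j) (i := 0) le_rfl)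
    obtain ⟨Q, hQ, hQe⟩ := hB.2 i hi
    rw [Polynomial.eq_C_of_natDegree_le_zero hQ] at hQe
    have h1 := hQe x hxi
    have h2 := hQe s hsi
    rw [cellBasis, if_pos (cellIdx_of_mem hj hx)] at h1
    simp only [pow_zero, Polynomial.eval_C] at h1 h2
    rw [← h1, cellBasis] at h2
    by_contra hcon
    rw [if_neg (fun h => hcon ((cellIdx_eq_iff hj hs).1 h))] at h2
    exact zero_ne_one h2

/-! ### Tensor-product piecewise polynomials -/

section Spaces
variable {d : ℕ}

lemma mem_tensorSpan {S : Fin d → Set (ℝ → ℝ)} {g : Fin d → ℝ → ℝ} (hg : ∀ i, g i ∈ S i) :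
    (fun x : Fin d → ℝ => ∏ i, g i (x i)) ∈ tensorSpan S :=
  Submodule.subset_span ⟨g, hg, rfl⟩

lemma tensorSpan_mono {S S' : Fin d → Set (ℝ → ℝ)} (h : ∀ i, S i ⊆ S' i) :
    tensorSpan S ≤ tensorSpan S' :=
  Submodule.span_mono fun _ ⟨g, hg, hf⟩ => ⟨g, fun i => h i (hg i), hf⟩

lemma tensorSpan_le {S : Fin d → Set (ℝ → ℝ)} {T : Submodule ℝ ((Fin d → ℝ) → ℝ)}
    (h : ∀ g : Fin d → ℝ → ℝ, (∀ i, g i ∈ S i) → (fun x : Fin d → ℝ => ∏ i, g i (x i)) ∈ T) :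
    tensorSpan S ≤ T := by
  refine Submodule.span_le.2 ?_
  rintro f ⟨g, hg, rfl⟩
  exact h g hg

lemma le_of_sum_le {l : Fin d → ℕ} {N : ℕ} (hl : ∑ i, l i ≤ N) (i : Fin d) : l i ≤ N :=
  (Finset.single_le_sum (f := l) (fun _ _ => Nat.zero_le _) (Finset.mem_univ i)).trans hl

lemma sparseSpace_le_fullSpace (d N k : ℕ) : sparseSpace d N k ≤ fullSpace d N k :=
  iSup_le fun l => tensorSpan_mono fun i =>
    (W_subset_V (l.1 i) k).trans (V_mono (le_of_sum_le l.2 i))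

/-- The sparse space contains all products of piecewise polynomials whose levels add up to at most
`N`. -/
lemma tensorSpan_V_le_sparseSpace {N k : ℕ} {l : Fin d → ℕ} (hl : ∑ i, l i ≤ N) :
    tensorSpan (fun i => V (l i) k) ≤ sparseSpace d N k := by
  refine tensorSpan_le fun g hg => ?_
  choose w hw hwe using fun i => exists_multilevel_decomposition (hg i)
  have : (fun x : Fin d → ℝ => ∏ i, g i (x i))
      = ∑ p ∈ Fintype.piFinset fun i => Finset.range (l i + 1),
          fun x : Fin d → ℝ => ∏ i, w i (p i) (x i) := by
    funext x
    rw [Finset.sum_apply]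
    simp_rw [hwe]
    exact Finset.prod_univ_sum _ _
  rw [this]
  refine Submodule.sum_mem _ fun p hp => ?_
  rw [Fintype.mem_piFinset] at hp
  have hpl : ∑ i, p i ≤ N := (Finset.sum_le_sum fun i _ =>
    Nat.lt_succ_iff.1 (Finset.mem_range.1 (hp i))).trans hl
  exact (le_iSup (fun l : {l : Fin d → ℕ // ∑ i, l i ≤ N} => tensorSpan fun i => W (l.1 i) k)
    ⟨p, hpl⟩) (mem_tensorSpan fun i => hw i (p i))

lemma bddMeas_comp_apply {v : ℝ → ℝ} (hv : Measurable v) (hb : ∃ C, ∀ x, |v x| ≤ C) (i : Fin d) :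
    BddMeas (fun x : Fin d → ℝ => v (x i)) := by
  obtain ⟨C, hC⟩ := hb
  exact ⟨hv.comp (measurable_pi_apply i), C, fun x => hC _⟩

lemma bddMeas_of_mem_fullSpace {N k : ℕ} {f : (Fin d → ℝ) → ℝ} (hf : f ∈ fullSpace d N k) :
    BddMeas f := by
  induction hf using Submodule.span_induction with
  | mem f h =>
    obtain ⟨g, hg, rfl⟩ := h
    refine BddMeas.prod _ fun i _ => ?_
    have := measurable_bdd_of_mem_V (hg i)
    exact bddMeas_comp_apply this.1 this.2 i
  | zero => exact BddMeas.const 0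
  | add f g _ _ hf hg => exact hf.add hg
  | smul c f _ hf => exact hf.const_mul c

lemma prod_update_apply (g : Fin d → ℝ → ℝ) (x : Fin d → ℝ) (m : Fin d) (s : ℝ) :
    ∏ i, g i (Function.update x m s i) = (∏ i ∈ Finset.univ.erase m, g i (x i)) * g m s := by
  rw [← Finset.prod_erase_mul _ _ (Finset.mem_univ m), Function.update_self]
  congr 1
  refine Finset.prod_congr rfl fun i hi => ?_
  rw [Function.update_of_ne (Finset.ne_of_mem_erase hi)]

lemma slice_mem_V {N k : ℕ} {f : (Fin d → ℝ) → ℝ} (hf : f ∈ fullSpace d N k) (m : Fin d)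
    (x : Fin d → ℝ) : (fun s => f (Function.update x m s)) ∈ V N k := by
  rw [← mem_VSubmodule]
  induction hf using Submodule.span_induction with
  | mem f h =>
    obtain ⟨g, hg, rfl⟩ := h
    have : (fun s => ∏ i, g i (Function.update x m s i))
        = (∏ i ∈ Finset.univ.erase m, g i (x i)) • g m := by
      funext s; rw [prod_update_apply]; rfl
    rw [this]
    exact (VSubmodule N k).smul_mem _ (hg m)
  | zero => exact (VSubmodule N k).zero_mem
  | add f g _ _ hf hg => exact (VSubmodule N k).add_mem hf hg
  | smul c f _ hf => exact (VSubmodule N k).smul_mem c hf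

lemma projOp_of_mem_fullSpace {N k : ℕ} {f : (Fin d → ℝ) → ℝ} (hf : f ∈ fullSpace d N k)
    (m : Fin d) : projOp k N m f = f := by
  ext x
  have := integral_cellKernel_of_mem_V (slice_mem_V hf m x) (x m)
  rw [Function.update_eq_self] at this
  exact this

/-- A kernel operator in the `m`-th variable acts on the `m`-th factor of a product. -/
lemma kernelOp_prod (κ : ℝ → ℝ → ℝ) (m : Fin d) (g : Fin d → ℝ → ℝ) :
    kernelOp κ m (fun x => ∏ i, g i (x i))
      = fun x => ∏ i, Function.update g m
          (fun y => ∫ s in Ioo (0 : ℝ) 1, κ y s * g m s) i (x i) := by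
  ext x
  simp only [kernelOp, prod_update_apply]
  rw [← Finset.prod_erase_mul _ _ (Finset.mem_univ m), Function.update_self,
    ← integral_const_mul]
  have : ∏ i ∈ Finset.univ.erase m, Function.update g m
      (fun y => ∫ s in Ioo (0 : ℝ) 1, κ y s * g m s) i (x i)
      = ∏ i ∈ Finset.univ.erase m, g i (x i) :=
    Finset.prod_congr rfl fun i hi => by rw [Function.update_of_ne (Finset.ne_of_mem_erase hi)]
  rw [this]
  congr 1; ext s; ring

/-- The sparse space is closed under cellwise differentiation. -/
lemma derivOp_mem_sparseSpace {N k : ℕ} {f : (Fin d → ℝ) → ℝ} (hf : f ∈ sparseSpace d N k)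
    (m : Fin d) : (fun x => 2 ^ N * dprojOp k N m f x) ∈ sparseSpace d N k := by
  have hb := (localKernel_reproDeriv k).bddKernel N
  refine Submodule.iSup_induction' _ (motive := fun f _ =>
    BddMeas f ∧ (fun x => 2 ^ N * dprojOp k N m f x) ∈ sparseSpace d N k) ?_ ?_ ?_ hf |>.2
  · intro l f hf
    induction hf using Submodule.span_induction with
    | mem f h =>
      obtain ⟨g, hg, rfl⟩ := h
      have hgV : ∀ i, g i ∈ V (l.1 i) k := fun i => W_subset_V _ k (hg i)
      refine ⟨bddMeas_of_mem_fullSpace (N := N) (k := k) (mem_tensorSpan fun i =>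
        V_mono (le_of_sum_le l.2 i) (hgV i)), ?_⟩
      rw [dprojOp, kernelOp_prod]
      have : (fun x : Fin d → ℝ => 2 ^ N * ∏ i, Function.update g m
          (fun y => ∫ s in Ioo (0 : ℝ) 1, cellKernel N (reproDeriv k) y s * g m s) i (x i))
          = fun x => ∏ i, Function.update g m (fun y => 2 ^ N *
              ∫ s in Ioo (0 : ℝ) 1, cellKernel N (reproDeriv k) y s * g m s) i (x i) := by
        ext x
        rw [← Finset.prod_erase_mul _ _ (Finset.mem_univ m),
          ← Finset.prod_erase_mul Finset.univ _ (Finset.mem_univ m), Function.update_self,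
          Function.update_self]
        rw [mul_left_comm]
        congr 1
        exact Finset.prod_congr rfl fun i hi => by
          rw [Function.update_of_ne (Finset.ne_of_mem_erase hi),
            Function.update_of_ne (Finset.ne_of_mem_erase hi)]
      rw [this]
      -- The derivative of a factor of level `l_m` has level at most `l_m`, although it need not be
      -- orthogonal to the coarser levels.
      refine tensorSpan_V_le_sparseSpace l.2 (mem_tensorSpan fun i => ?_)
      by_cases h : i = m
      · subst h
        rw [Function.update_self]
        exact deriv_mem_V (le_of_sum_le l.2 i) (hgV i)
      · rw [Function.update_of_ne h]; exact hgV i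
    | zero =>
      refine ⟨BddMeas.const 0, ?_⟩
      have : (fun x : Fin d → ℝ => 2 ^ N * dprojOp k N m 0 x) = 0 := by
        ext x; simp [kernelOp]
      rw [this]; exact Submodule.zero_mem _
    | add f g _ _ hf hg =>
      refine ⟨hf.1.add hg.1, ?_⟩
      have := (sparseSpace d N k).add_mem hf.2 hg.2
      convert this using 1
      ext x
      rw [dprojOp, show f + g = fun x => f x + g x from rfl, kernelOp_add hb hf.1 hg.1]
      simp [mul_add]
    | smul c f _ hf =>
      refine ⟨hf.1.const_mul c, ?_⟩
      have := (sparseSpace d N k).smul_mem c hf.2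
      convert this using 1
      ext x
      rw [dprojOp, show c • f = fun x => c * f x from rfl, kernelOp_const_mul]
      simp; ring
  · refine ⟨BddMeas.const 0, ?_⟩
    have : (fun x : Fin d → ℝ => 2 ^ N * dprojOp k N m 0 x) = 0 := by
      ext x; simp [kernelOp]
    rw [this]; exact Submodule.zero_mem _
  · intro f g _ _ hf hg
    refine ⟨hf.1.add hg.1, ?_⟩
    have := (sparseSpace d N k).add_mem hf.2 hg.2
    convert this using 1
    ext x
    rw [dprojOp, show f + g = fun x => f x + g x from rfl, kernelOp_add hb hf.1 hg.1]
    simp [mul_add]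

/-- The tensor-product reproducing kernel, as a finite sum of products. -/
lemma mem_fullSpace_repr {N k : ℕ} {f : (Fin d → ℝ) → ℝ} (hf : f ∈ fullSpace d N k)
    (x : Fin d → ℝ) :
    f x = ∑ p ∈ Fintype.piFinset fun _ : Fin d =>
        Finset.range (2 ^ N) ×ˢ (Finset.univ : Finset (Fin (k + 1))),
      (∫ y in cube d, (∏ i, cellDual k N (p i).1 (p i).2 (y i)) * f y)
        * ∏ i, cellBasis N (p i).1 (p i).2 (x i) := by
  have hdual : ∀ p : Fin d → ℕ × Fin (k + 1),
      BddMeas (fun y : Fin d → ℝ => ∏ i, cellDual k N (p i).1 (p i).2 (y i)) := fun p =>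
    BddMeas.prod _ fun i _ => bddMeas_comp_apply (measurable_cellDual _ _ _ _)
      (exists_abs_cellDual_le _ _ _ _) i
  induction hf using Submodule.span_induction with
  | mem f h =>
    obtain ⟨g, hg, rfl⟩ := h
    have h1 : ∀ i, g i (x i) = ∑ q ∈ Finset.range (2 ^ N) ×ˢ (Finset.univ : Finset (Fin (k + 1))),
        (∫ s in Ioo (0 : ℝ) 1, cellDual k N q.1 q.2 s * g i s) * cellBasis N q.1 q.2 (x i) := by
      intro i
      have hint : ∀ j (l : Fin (k + 1)), Integrable (fun s => cellBasis N j l (x i) *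
          (cellDual k N j l s * g i s)) unitMeasure := by
        intro j l
        obtain ⟨C, hC⟩ := exists_abs_cellDual_le k N j l
        exact ((integrable_of_mem_V (hg i)).bdd_mul (c := C)
          (measurable_cellDual k N j l).aestronglyMeasurable
          (Filter.Eventually.of_forall hC)).const_mul _
      rw [← integral_cellKernel_of_mem_V (hg i) (x i)]
      simp only [cellKernel_reproKernel_eq, Finset.sum_mul, mul_assoc]
      rw [integral_finsetSum _ fun j _ => integrable_finsetSum _ fun l _ => hint j l,
        Finset.sum_product]
      refine Finset.sum_congr rfl fun j _ => ?_
      rw [integral_finsetSum _ fun l _ => hint j l]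
      refine Finset.sum_congr rfl fun l _ => ?_
      rw [integral_const_mul, mul_comm]
    simp_rw [h1]
    rw [Finset.prod_univ_sum]
    refine Finset.sum_congr rfl fun p _ => ?_
    rw [Finset.prod_mul_distrib]
    congr 1
    simp_rw [← Finset.prod_mul_distrib]
    rw [show volume.restrict (cube d) = cubeMeasure d from rfl, cubeMeasure_eq_pi,
      integral_fintype_prod_eq_prod (fun i s => cellDual k N (p i).1 (p i).2 s * g i s)]
  | zero => simp
  | add f g hf' hg' hf hg =>
    have hfb := bddMeas_of_mem_fullSpace hf'
    have hgb := bddMeas_of_mem_fullSpace hg'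
    rw [Pi.add_apply, hf, hg, ← Finset.sum_add_distrib]
    refine Finset.sum_congr rfl fun p _ => ?_
    simp only [Pi.add_apply, mul_add]
    rw [integral_add ((hdual p).mul hfb).integrable ((hdual p).mul hgb).integrable, add_mul]
  | smul c f hf' hf =>
    rw [Pi.smul_apply, hf, smul_eq_mul, Finset.mul_sum]
    refine Finset.sum_congr rfl fun p _ => ?_
    simp only [Pi.smul_apply, smul_eq_mul, mul_left_comm _ c]
    rw [integral_const_mul]; ring

instance finiteDimensional_fullSpace (N k : ℕ) : FiniteDimensional ℝ (fullSpace d N k) := by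
  have hle : fullSpace d N k ≤ Submodule.span ℝ
      ((fun p : Fin d → ℕ × Fin (k + 1) => fun x : Fin d → ℝ =>
          ∏ i, cellBasis N (p i).1 (p i).2 (x i)) ''
        (Fintype.piFinset fun _ : Fin d =>
          Finset.range (2 ^ N) ×ˢ (Finset.univ : Finset (Fin (k + 1))))) := by
    intro f hf
    have : f = ∑ p ∈ Fintype.piFinset fun _ : Fin d =>
          Finset.range (2 ^ N) ×ˢ (Finset.univ : Finset (Fin (k + 1))),
        (∫ y in cube d, (∏ i, cellDual k N (p i).1 (p i).2 (y i)) * f y)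
          • fun x : Fin d → ℝ => ∏ i, cellBasis N (p i).1 (p i).2 (x i) := by
      funext x
      rw [mem_fullSpace_repr hf x, Finset.sum_apply]
      rfl
    rw [this]
    exact Submodule.sum_mem _ fun p hp => Submodule.smul_mem _ _
      (Submodule.subset_span ⟨p, hp, rfl⟩)
  have := FiniteDimensional.span_of_finite ℝ (((Fintype.piFinset fun _ : Fin d =>
    Finset.range (2 ^ N) ×ˢ (Finset.univ : Finset (Fin (k + 1)))).finite_toSet).image
      (fun p : Fin d → ℕ × Fin (k + 1) => fun x : Fin d → ℝ =>
          ∏ i, cellBasis N (p i).1 (p i).2 (x i)))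
  exact Submodule.finiteDimensional_of_le hle

/-- A piecewise polynomial is determined by its class in `L²`. -/
lemma eq_zero_of_mem_fullSpace {N k : ℕ} {f : (Fin d → ℝ) → ℝ} (hf : f ∈ fullSpace d N k)
    (h : f =ᵐ[cubeMeasure d] 0) : f = 0 := by
  funext x
  rw [mem_fullSpace_repr hf x]
  refine Finset.sum_eq_zero fun p _ => ?_
  have : ∫ y in cube d, (∏ i, cellDual k N (p i).1 (p i).2 (y i)) * f y = 0 := by
    rw [integral_congr_ae (g := fun _ => (0 : ℝ))]
    · simp
    · filter_upwards [h] with y hy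
      rw [hy]; simp
  rw [this, zero_mul]

/-! ### Cellwise derivatives -/

lemma mem_cell {N : ℕ} {j : Fin d → Fin (2 ^ N)} {x : Fin d → ℝ} :
    x ∈ cell N j ↔ ∀ i, x i ∈ Ioo (((j i : ℕ) : ℝ) / 2 ^ N) ((((j i : ℕ) : ℝ) + 1) / 2 ^ N) := by
  simp [cell]

lemma isOpen_cell (N : ℕ) (j : Fin d → Fin (2 ^ N)) : IsOpen (cell N j) :=
  isOpen_set_pi Set.finite_univ fun _ _ => isOpen_Ioo

lemma cell_subset_cube (N : ℕ) (j : Fin d → Fin (2 ^ N)) : cell N j ⊆ cube d := by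
  intro x hx
  rw [mem_cell] at hx
  rw [mem_cube]
  intro i
  have h2 : (0 : ℝ) < 2 ^ N := by positivity
  refine ⟨lt_of_le_of_lt (by positivity) (hx i).1, (hx i).2.trans_le ?_⟩
  rw [div_le_one h2]
  exact_mod_cast (j i).2

/-- On a cell a piecewise polynomial agrees with a smooth function on the whole space. -/
lemma exists_contDiff_eqOn_cell {N k : ℕ} {f : (Fin d → ℝ) → ℝ} (hf : f ∈ fullSpace d N k)
    (j : Fin d → Fin (2 ^ N)) : ∃ F, ContDiff ℝ ∞ F ∧ EqOn f F (cell N j) := by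
  induction hf using Submodule.span_induction with
  | mem f h =>
    obtain ⟨g, hg, rfl⟩ := h
    choose P hP hPe using fun i => (hg i).2 (j i) (j i).2
    refine ⟨fun x => ∏ i, (P i).eval (x i), ?_, fun x hx => ?_⟩
    · refine contDiff_prod fun i _ => ?_
      have h : ContDiff ℝ ∞ fun y : ℝ => (P i).eval y := by
        simpa [Polynomial.coe_aeval_eq_eval] using (P i).contDiff_aeval (𝕜 := ℝ) ∞
      exact h.comp (contDiff_apply ℝ ℝ i)
    · rw [mem_cell] at hx
      exact Finset.prod_congr rfl fun i _ => hPe i _ (Ioo_subset_Ioc_self (hx i))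
  | zero => exact ⟨0, contDiff_const, fun _ _ => rfl⟩
  | add f g _ _ hf hg =>
    obtain ⟨F, hF, hFe⟩ := hf
    obtain ⟨G, hG, hGe⟩ := hg
    exact ⟨F + G, hF.add hG, fun x hx => by simp [hFe hx, hGe hx]⟩
  | smul c f _ hf =>
    obtain ⟨F, hF, hFe⟩ := hf
    exact ⟨c • F, contDiff_const.smul hF, fun x hx => by simp [hFe hx]⟩

lemma cell_apply_mem {N : ℕ} {j : Fin d → Fin (2 ^ N)} {x : Fin d → ℝ} (hx : x ∈ cell N j)
    (m : Fin d) : x m ∈ Ioc (0 : ℝ) 1 ∧ cellIdx N (x m) = ((j m : ℕ) : ℤ) := by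
  have h1 := Ioo_subset_Ioc_self (mem_cell.1 hx m)
  exact ⟨cell_subset_Ioc (j m).2 h1, cellIdx_of_mem (j m).2 h1⟩

/-- On open cells the classical derivative is given by the derivative of the reproducing kernel. -/
lemma partialDeriv_eq_dprojOp {N k : ℕ} {f : (Fin d → ℝ) → ℝ} (hf : f ∈ fullSpace d N k)
    {j : Fin d → Fin (2 ^ N)} {x : Fin d → ℝ} (hx : x ∈ cell N j) (m : Fin d) :
    partialDeriv m f x = 2 ^ N * dprojOp k N m f x := by
  obtain ⟨F, hF, hFe⟩ := exists_contDiff_eqOn_cell hf j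
  have hev : f =ᶠ[nhds x] F := by
    filter_upwards [(isOpen_cell N j).mem_nhds hx] with y hy using hFe hy
  have hd : DifferentiableAt ℝ f x := (hF.differentiable (by simp) x).congr_of_eventuallyEq hev
  obtain ⟨hx1, hx2⟩ := cell_apply_mem hx m
  obtain ⟨P, hP, hPe⟩ := exists_poly_of_mem_V (slice_mem_V hf m x) hx1
  have h1 := (integral_cellKernel_of_poly hx1 hP hPe).2
  rw [dprojOp, kernelOp, h1]
  have h2 : HasDerivAt (fun s => f (Function.update x m s)) (partialDeriv m f x) (x m) := by
    have := hasDerivAt_comp_update (f := f) (x := x) (m := m) (s := x m)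
      (by rwa [Function.update_eq_self])
    rwa [Function.update_eq_self] at this
  have h3 : (fun s => f (Function.update x m s)) =ᶠ[nhds (x m)] fun s => P.eval s := by
    filter_upwards [isOpen_Ioo.mem_nhds (mem_cell.1 hx m)] with s hs
    have hs' := Ioo_subset_Ioc_self hs
    exact hPe s (cell_subset_Ioc (j m).2 hs') (by rw [cellIdx_of_mem (j m).2 hs', hx2])
  exact (h2.congr_of_eventuallyEq h3.symm).unique (P.hasDerivAt (x m))

end Spaces

/-! ### The sparse approximation operator -/

section SparseOp
variable {d : ℕ}

lemma BddKernel.sub {κ κ' : ℝ → ℝ → ℝ} (h : BddKernel κ) (h' : BddKernel κ') :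
    BddKernel (fun x y => κ x y - κ' x y) := by
  obtain ⟨C, hC⟩ := h.bdd
  obtain ⟨D, hD⟩ := h'.bdd
  exact ⟨h.measurable.sub h'.measurable, C + D, fun x y =>
    (abs_sub _ _).trans (add_le_add (hC x y) (hD x y))⟩

lemma bddKernel_proj (k n : ℕ) : BddKernel (cellKernel n (reproKernel k)) :=
  (localKernel_repro k).bddKernel n

lemma bddKernel_rem (q n : ℕ) : BddKernel (cellKernel n (taylorKernel q)) :=
  (localKernel_taylor q).bddKernel n

lemma bddKernel_dproj (k n : ℕ) : BddKernel (cellKernel n (reproDeriv k)) :=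
  (localKernel_reproDeriv k).bddKernel n

/-- The kernel of the difference of the projections of two consecutive levels. -/
def detailKernel (k : ℕ) : ℕ → ℝ → ℝ → ℝ
  | 0 => cellKernel 0 (reproKernel k)
  | n + 1 => fun x y => cellKernel (n + 1) (reproKernel k) x y - cellKernel n (reproKernel k) x y

lemma bddKernel_detail (k n : ℕ) : BddKernel (detailKernel k n) := by
  cases n with
  | zero => exact bddKernel_proj k 0
  | succ n => exact (bddKernel_proj k (n + 1)).sub (bddKernel_proj k n)

/-- The increment of the projections in the `m`-th variable between the levels `n - 1` and `n`. -/
abbrev detailOp (k n : ℕ) (m : Fin d) : ((Fin d → ℝ) → ℝ) → (Fin d → ℝ) → ℝ :=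
  kernelOp (detailKernel k n) m

lemma detailOp_succ (k n : ℕ) (m : Fin d) {f : (Fin d → ℝ) → ℝ} (hf : BddMeas f) :
    detailOp k (n + 1) m f = fun x => projOp k (n + 1) m f x - projOp k n m f x := by
  ext x
  simp only [detailOp, projOp, kernelOp, detailKernel, sub_mul]
  exact integral_sub ((bddKernel_proj k (n + 1)).integrable _ (hf.slice_integrable m x))
    ((bddKernel_proj k n).integrable _ (hf.slice_integrable m x))

lemma sum_detailOp (k N : ℕ) (m : Fin d) {f : (Fin d → ℝ) → ℝ} (hf : BddMeas f) (x : Fin d → ℝ) :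
    ∑ n ∈ Finset.range (N + 1), detailOp k n m f x = projOp k N m f x := by
  induction N with
  | zero => simp only [zero_add, Finset.sum_range_one]; rfl
  | succ N ih => rw [Finset.sum_range_succ, ih, detailOp_succ k N m hf]; ring

/-- The sparse combination `∑ ∏ Δ_{l_m}^{(m)}` over the levels with `∑ l_m ≤ N`, for the directions
in a list. -/
def sparseOp (k : ℕ) : List (Fin d) → ℕ → ((Fin d → ℝ) → ℝ) → (Fin d → ℝ) → ℝ
  | [], _, f => f
  | m :: S, N, f => fun x => ∑ n ∈ Finset.range (N + 1), detailOp k n m (sparseOp k S (N - n) f) x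

lemma BddMeas.sparseOp {f : (Fin d → ℝ) → ℝ} (hf : BddMeas f) (k : ℕ) (S : List (Fin d)) (N : ℕ) :
    BddMeas (sparseOp k S N f) := by
  induction S generalizing N with
  | nil => exact hf
  | cons m S ih => exact BddMeas.sum _ fun n _ => (ih (N - n)).kernelOp (bddKernel_detail k n) m

/-- The sparse operator commutes with operators in a direction that it does not touch. -/
lemma kernelOp_sparseOp {κ : ℝ → ℝ → ℝ} (hκ : BddKernel κ) {m : Fin d} {S : List (Fin d)}
    (hm : m ∉ S) (k N : ℕ) {f : (Fin d → ℝ) → ℝ} (hf : BddMeas f) :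
    kernelOp κ m (sparseOp k S N f) = sparseOp k S N (kernelOp κ m f) := by
  induction S generalizing N with
  | nil => rfl
  | cons m' S ih =>
    have h1 : m ≠ m' := fun h => hm (by simp [h])
    have h2 : m ∉ S := fun h => hm (by simp [h])
    simp only [sparseOp]
    rw [kernelOp_sum hκ _ fun n _ => (hf.sparseOp k S (N - n)).kernelOp (bddKernel_detail k n) m']
    ext x
    refine Finset.sum_congr rfl fun n _ => ?_
    rw [kernelOp_comm hκ (bddKernel_detail k n) h1 (hf.sparseOp k S _), ih h2]

lemma sparseOp_sub (k : ℕ) (S : List (Fin d)) (N : ℕ) {f g : (Fin d → ℝ) → ℝ} (hf : BddMeas f)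
    (hg : BddMeas g) : sparseOp k S N (fun x => f x - g x)
      = fun x => sparseOp k S N f x - sparseOp k S N g x := by
  induction S generalizing N with
  | nil => rfl
  | cons m S ih =>
    ext x
    simp only [sparseOp]
    rw [← Finset.sum_sub_distrib]
    refine Finset.sum_congr rfl fun n _ => ?_
    rw [ih, detailOp, kernelOp_sub (bddKernel_detail k n) (hf.sparseOp k S _) (hg.sparseOp k S _)]

lemma sparseOp_const_mul (k : ℕ) (S : List (Fin d)) (N : ℕ) (c : ℝ) (f : (Fin d → ℝ) → ℝ) :
    sparseOp k S N (fun x => c * f x) = fun x => c * sparseOp k S N f x := by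
  induction S generalizing N with
  | nil => rfl
  | cons m S ih =>
    ext x
    simp only [sparseOp]
    rw [Finset.mul_sum]
    refine Finset.sum_congr rfl fun n _ => ?_
    rw [ih, detailOp, kernelOp_const_mul]

lemma sparseOp_congr_cube (k : ℕ) (S : List (Fin d)) (N : ℕ) {f g : (Fin d → ℝ) → ℝ}
    (h : EqOn f g (cube d)) : EqOn (sparseOp k S N f) (sparseOp k S N g) (cube d) := by
  induction S generalizing N with
  | nil => exact h
  | cons m S ih =>
    intro x hx
    exact Finset.sum_congr rfl fun n _ => kernelOp_congr_cube (ih (N - n)) hx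

/-- The operator that recovers the projection error from the derivative of order `q + 1`. -/
def errOp (k q n : ℕ) (m : Fin d) (u : (Fin d → ℝ) → ℝ) (x : Fin d → ℝ) : ℝ :=
  (1 / 2 ^ n) ^ (q + 1) * (remOp q n m u x - projOp k n m (remOp q n m u) x)

lemma BddMeas.errOp {u : (Fin d → ℝ) → ℝ} (hu : BddMeas u) (k q n : ℕ) (m : Fin d) :
    BddMeas (errOp k q n m u) := by
  have h := hu.kernelOp (bddKernel_rem q n) m
  exact (h.sub (h.kernelOp (bddKernel_proj k n) m)).const_mul _

lemma errOp_sub (k q n : ℕ) (m : Fin d) {u v : (Fin d → ℝ) → ℝ} (hu : BddMeas u)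
    (hv : BddMeas v) : errOp k q n m (fun x => u x - v x)
      = fun x => errOp k q n m u x - errOp k q n m v x := by
  ext x
  have hu' := hu.kernelOp (bddKernel_rem q n) m
  have hv' := hv.kernelOp (bddKernel_rem q n) m
  simp only [errOp, remOp, projOp]
  rw [kernelOp_sub (bddKernel_rem q n) hu hv, kernelOp_sub (bddKernel_proj k n) hu' hv']
  ring

lemma errOp_sparseOp (k q n : ℕ) {m : Fin d} {S : List (Fin d)} (hm : m ∉ S) (N : ℕ)
    {u : (Fin d → ℝ) → ℝ} (hu : BddMeas u) :
    errOp k q n m (sparseOp k S N u) = sparseOp k S N (errOp k q n m u) := by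
  have hu' := hu.kernelOp (bddKernel_rem q n) m
  unfold errOp remOp projOp
  rw [sparseOp_const_mul, sparseOp_sub k S N hu' (hu'.kernelOp (bddKernel_proj k n) m),
    kernelOp_sparseOp (bddKernel_rem q n) hm k N hu,
    kernelOp_sparseOp (bddKernel_proj k n) hm k N hu']

lemma l2Norm_errOp_le (k q n : ℕ) (m : Fin d) {u : (Fin d → ℝ) → ℝ} (hu : BddMeas u) :
    l2Norm (cube d) (errOp k q n m u)
      ≤ (1 / 2 ^ n) ^ (q + 1) * (2 * reproBound k) * l2Norm (cube d) u := by
  have hM := one_le_reproBound k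
  have h := hu.kernelOp (bddKernel_rem q n) m
  have h1 := l2Norm_cellKernel_le (localKernel_taylor q) n m hu
  have h2 := l2Norm_cellKernel_le (localKernel_repro k) n m h
  have h3 := l2Norm_sub_le (U := cube d) (h.memLp 2)
    ((h.kernelOp (bddKernel_proj k n) m).memLp 2)
  have h4 := l2Norm_nonneg (cube d) u
  unfold errOp
  rw [l2Norm_const_mul, abs_of_pos (by positivity), mul_assoc]
  refine mul_le_mul_of_nonneg_left ?_ (by positivity)
  refine h3.trans ?_
  nlinarith [l2Norm_nonneg (cube d) (kernelOp (cellKernel n (taylorKernel q)) m u)]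

lemma sub_projOp_eqOn {k q : ℕ} (hq : q ≤ k) (n : ℕ) (m : Fin d) {f : (Fin d → ℝ) → ℝ}
    (hf : ContDiff ℝ ∞ f) (hg : BddMeas ((partialDeriv m)^[q + 1] f)) :
    EqOn (fun x => f x - projOp k n m f x) (errOp k q n m ((partialDeriv m)^[q + 1] f))
      (cube d) := fun _ hx => sub_projOp_eq hq n m hf hg (Ioo_subset_Ioc_self (mem_cube.1 hx m))

lemma l2Norm_congr_cube {f g : (Fin d → ℝ) → ℝ} (h : EqOn f g (cube d)) :
    l2Norm (cube d) f = l2Norm (cube d) g :=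
  l2Norm_congr (by filter_upwards [ae_mem_cube d] with x hx using h hx)

/-- The detail of level `n + 1` of a sparse approximation error gains `q + 1` powers of the mesh
size at the price of `q + 1` derivatives. -/
lemma l2Norm_detailOp_error_le {k q : ℕ} (hq : q ≤ k) (n : ℕ) {m : Fin d} {S : List (Fin d)}
    (hm : m ∉ S) (N : ℕ) {f : (Fin d → ℝ) → ℝ} (hf : ContDiff ℝ ∞ f) (hfb : BddMeas f)
    (hg : BddMeas ((partialDeriv m)^[q + 1] f)) :
    l2Norm (cube d) (detailOp k (n + 1) m (fun x => f x - sparseOp k S N f x))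
      ≤ (1 / 2 ^ (n + 1)) ^ (q + 1) * (2 ^ (q + 1) * (4 * reproBound k))
        * l2Norm (cube d) (fun x => (partialDeriv m)^[q + 1] f x
            - sparseOp k S N ((partialDeriv m)^[q + 1] f) x) := by
  set g := (partialDeriv m)^[q + 1] f with hgdef
  set G : (Fin d → ℝ) → ℝ := fun x => g x - sparseOp k S N g x with hG
  have hGb : BddMeas G := hg.sub (hg.sparseOp k S N)
  have hΔ := bddKernel_detail k (n + 1)
  have hfΔ := hfb.kernelOp hΔ m
  -- The detail of `f` is the difference of the projection errors on two consecutive levels.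
  have e0 : EqOn (detailOp k (n + 1) m f)
      (fun x => errOp k q n m g x - errOp k q (n + 1) m g x) (cube d) := by
    intro x hx
    have h1 := sub_projOp_eqOn hq n m hf hg hx
    have h2 := sub_projOp_eqOn hq (n + 1) m hf hg hx
    simp only at h1 h2
    rw [detailOp_succ k n m hfb]
    simp only
    rw [← h1, ← h2]; ring
  have hE1 := hg.errOp k q n m
  have hE2 := hg.errOp k q (n + 1) m
  -- Operators in different directions commute, so the error in the directions of `S` passes to the
  -- derivative.
  have e1 : EqOn (detailOp k (n + 1) m (fun x => f x - sparseOp k S N f x))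
      (fun x => errOp k q n m G x - errOp k q (n + 1) m G x) (cube d) := by
    intro x hx
    rw [detailOp, kernelOp_sub hΔ hfb (hfb.sparseOp k S N), kernelOp_sparseOp hΔ hm k N hfb]
    have h1 := sparseOp_congr_cube k S N e0 hx
    have h2 := e0 hx
    simp only [detailOp] at h1 h2 ⊢
    rw [h1, h2, sparseOp_sub k S N hE1 hE2, hG, errOp_sub k q n m hg (hg.sparseOp k S N),
      errOp_sub k q (n + 1) m hg (hg.sparseOp k S N), errOp_sparseOp k q n hm N hg,
      errOp_sparseOp k q (n + 1) hm N hg]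
    ring
  rw [l2Norm_congr_cube e1]
  refine (l2Norm_sub_le ((hGb.errOp k q n m).memLp 2) ((hGb.errOp k q (n + 1) m).memLp 2)).trans ?_
  have b1 := l2Norm_errOp_le k q n m hGb
  have b2 := l2Norm_errOp_le k q (n + 1) m hGb
  refine (add_le_add b1 b2).trans ?_
  -- The coarser of the two levels costs a factor `2^(q+1)`.
  have hp : ((1 : ℝ) / 2 ^ n) ^ (q + 1) = (1 / 2 ^ (n + 1)) ^ (q + 1) * 2 ^ (q + 1) := by
    rw [← mul_pow]; congr 1; rw [pow_succ]; field_simp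
  rw [hp]
  have hM := one_le_reproBound k
  have h4 := l2Norm_nonneg (cube d) G
  have h5 : (1 : ℝ) ≤ 2 ^ (q + 1) := one_le_pow₀ (by norm_num)
  have h6 : (0 : ℝ) ≤ (1 / 2 ^ (n + 1)) ^ (q + 1) := by positivity
  have h7 : 0 ≤ (1 / 2 ^ (n + 1)) ^ (q + 1) * (2 * reproBound k) * l2Norm (cube d) G := by
    positivity
  nlinarith

/-- The constant of the sparse approximation estimate. -/
def sparseConst (k q : ℕ) : ℝ := 2 ^ (q + 1) * (8 * reproBound k)

lemma one_le_sparseConst (k q : ℕ) : 1 ≤ sparseConst k q := by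
  have h1 := one_le_reproBound k
  have h5 : (1 : ℝ) ≤ 2 ^ (q + 1) := one_le_pow₀ (by norm_num)
  unfold sparseConst
  nlinarith

/-- The sparse approximation estimate for a family of mixed derivatives
`g L = ∏_{i ∈ L} ∂_i^{q+1} v`.
The induction over the directions peels off one direction at a time: the error splits into the
one-dimensional projection error and the details of the error in the remaining directions. -/
lemma l2Norm_sub_sparseOp_le {k q : ℕ} (hq : q ≤ k) {g : Finset (Fin d) → (Fin d → ℝ) → ℝ}
    (hsm : ∀ L, ContDiff ℝ ∞ (g L)) (hbd : ∀ L, BddMeas (g L))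
    (hstep : ∀ L m, m ∉ L → (partialDeriv m)^[q + 1] (g L) = g (insert m L))
    {B : ℝ} (hB0 : 0 ≤ B) (hB : ∀ L : Finset (Fin d), L.Nonempty → l2Norm (cube d) (g L) ≤ B)
    (S : List (Fin d)) (hS : S.Nodup) (L : Finset (Fin d)) (hL : ∀ m ∈ S, m ∉ L) (N : ℕ) :
    l2Norm (cube d) (fun x => g L x - sparseOp k S N (g L) x)
      ≤ (sparseConst k q * (N + 1)) ^ S.length * (1 / 2 ^ N) ^ (q + 1) * B := by
  have hA := one_le_sparseConst k q
  have hM := one_le_reproBound k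
  have h5 : (1 : ℝ) ≤ 2 ^ (q + 1) := one_le_pow₀ (by norm_num)
  induction S generalizing L N with
  | nil =>
    simp only [sparseOp, sub_self, l2Norm_zero]
    positivity
  | cons m S ih =>
    have hmS : m ∉ S := (List.nodup_cons.1 hS).1
    have hS' := (List.nodup_cons.1 hS).2
    have hmL : m ∉ L := hL m (by simp)
    have hgm : BddMeas ((partialDeriv m)^[q + 1] (g L)) := by rw [hstep L m hmL]; exact hbd _
    set X : ℝ := (sparseConst k q * (N + 1)) ^ S.length with hX
    have hX1 : 1 ≤ X := one_le_pow₀ (by nlinarith [(Nat.cast_nonneg N : (0 : ℝ) ≤ N)])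
    set w : ℕ → (Fin d → ℝ) → ℝ := fun n x => g L x - sparseOp k S (N - n) (g L) x with hw
    have hwb : ∀ n, BddMeas (w n) := fun n => (hbd L).sub ((hbd L).sparseOp k S _)
    -- `1 - ∑ Δ_n ⊗ Q_{N-n} = (1 - P_N) + ∑ Δ_n (1 - Q_{N-n})`, since the details `Δ_n` add up to
    -- `P_N`; here `Q` is the sparse operator in the remaining directions.
    have hdec : ∀ x, g L x - sparseOp k (m :: S) N (g L) x = (g L x - projOp k N m (g L) x)
        + ∑ n ∈ Finset.range (N + 1), detailOp k n m (w n) x := by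
      intro x
      have : ∀ n, detailOp k n m (w n) x
          = detailOp k n m (g L) x - detailOp k n m (sparseOp k S (N - n) (g L)) x := by
        intro n
        simp only [hw]
        rw [detailOp, kernelOp_sub (bddKernel_detail k n) (hbd L) ((hbd L).sparseOp k S _)]
      simp_rw [this]
      rw [Finset.sum_sub_distrib, sum_detailOp k N m (hbd L)]
      simp only [sparseOp]
      ring
    simp_rw [hdec]
    have hwΔ : ∀ n, BddMeas (detailOp k n m (w n)) := fun n =>
      (hwb n).kernelOp (bddKernel_detail k n) m
    have hP := (hbd L).sub ((hbd L).kernelOp (bddKernel_proj k N) m)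
    refine (l2Norm_add_le (hP.memLp 2) ((BddMeas.sum _ fun n _ => hwΔ n).memLp 2)).trans ?_
    have t1 : l2Norm (cube d) (fun x => g L x - projOp k N m (g L) x)
        ≤ (1 / 2 ^ N) ^ (q + 1) * (2 * reproBound k) * B := by
      rw [l2Norm_congr_cube (sub_projOp_eqOn hq N m (hsm L) hgm)]
      refine (l2Norm_errOp_le k q N m hgm).trans ?_
      rw [hstep L m hmL]
      gcongr
      exact hB _ (Finset.insert_nonempty _ _)
    -- The detail of level `n` gains `2^{-n(q+1)}` and the remaining directions gain
    -- `2^{-(N-n)(q+1)}`: all `N + 1` terms are of the same size.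
    have t2 : ∀ n ∈ Finset.range (N + 1), l2Norm (cube d) (detailOp k n m (w n))
        ≤ 2 ^ (q + 1) * (4 * reproBound k) * (X * (1 / 2 ^ N) ^ (q + 1) * B) := by
      intro n hn
      have hnN : n ≤ N := Nat.lt_succ_iff.1 (Finset.mem_range.1 hn)
      have hXn : (sparseConst k q * ((N - n : ℕ) + 1)) ^ S.length ≤ X := by
        rw [hX]
        gcongr
        exact_mod_cast Nat.sub_le N n
      cases n with
      | zero =>
        -- On level `0` no derivative is spent on the direction `m`.
        refine (l2Norm_cellKernel_le (localKernel_repro k) 0 m (hwb 0)).trans ?_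
        have := ih hS' L (fun m' h => hL m' (by simp [h])) N
        simp only [hw, Nat.sub_zero]
        have h0 : 0 ≤ X * (1 / 2 ^ N) ^ (q + 1) * B := by positivity
        calc reproBound k * l2Norm (cube d) (fun x => g L x - sparseOp k S N (g L) x)
            ≤ reproBound k * (X * (1 / 2 ^ N) ^ (q + 1) * B) := by gcongr
          _ ≤ 2 ^ (q + 1) * (4 * reproBound k) * (X * (1 / 2 ^ N) ^ (q + 1) * B) := by
              gcongr; nlinarith
      | succ n =>
        refine (l2Norm_detailOp_error_le hq n hmS (N - (n + 1)) (hsm L) (hbd L) hgm).trans ?_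
        rw [hstep L m hmL]
        have := ih hS' (insert m L) (fun m' h => by
          rw [Finset.mem_insert]
          rintro (rfl | h')
          · exact hmS h
          · exact hL m' (by simp [h]) h') (N - (n + 1))
        have hpow : ((1 : ℝ) / 2 ^ (n + 1)) ^ (q + 1) * (1 / 2 ^ (N - (n + 1))) ^ (q + 1)
            = (1 / 2 ^ N) ^ (q + 1) := by
          rw [← mul_pow]
          congr 1
          rw [one_div_mul_one_div, ← pow_add, Nat.add_sub_cancel' hnN]
        calc (1 / 2 ^ (n + 1)) ^ (q + 1) * (2 ^ (q + 1) * (4 * reproBound k))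
              * l2Norm (cube d) (fun x => g (insert m L) x
                - sparseOp k S (N - (n + 1)) (g (insert m L)) x)
            ≤ (1 / 2 ^ (n + 1)) ^ (q + 1) * (2 ^ (q + 1) * (4 * reproBound k))
              * (X * (1 / 2 ^ (N - (n + 1))) ^ (q + 1) * B) := by
              gcongr
              refine this.trans ?_
              gcongr
          _ = 2 ^ (q + 1) * (4 * reproBound k) * (X *
                (((1 : ℝ) / 2 ^ (n + 1)) ^ (q + 1) * (1 / 2 ^ (N - (n + 1))) ^ (q + 1)) * B) := by
              ring
          _ = _ := by rw [hpow]
    have t3 := (l2Norm_sum_le (U := cube d) _ fun n _ => (hwΔ n).memLp 2).trans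
      (Finset.sum_le_sum t2)
    rw [Finset.sum_const, Finset.card_range, nsmul_eq_mul] at t3
    refine (add_le_add t1 t3).trans ?_
    rw [List.length_cons,
      show (sparseConst k q * (N + 1)) ^ (S.length + 1) = X * (sparseConst k q * (N + 1)) from
        pow_succ _ _]
    have hY : 0 ≤ (1 / 2 ^ N) ^ (q + 1) * B := by positivity
    have hN : (0 : ℝ) ≤ N := Nat.cast_nonneg N
    -- The projection error is absorbed by the surplus factor `2` in `sparseConst`.
    have key : 2 * reproBound k + (N + 1) * (2 ^ (q + 1) * (4 * reproBound k) * X)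
        ≤ X * (sparseConst k q * (N + 1)) := by
      unfold sparseConst
      have a1 : 2 * reproBound k ≤ 2 ^ (q + 1) * (4 * reproBound k) * X * (N + 1) := by
        have a2 : 1 ≤ 2 ^ (q + 1) * X * (N + 1) := by
          have : 1 ≤ 2 ^ (q + 1) * X := by nlinarith
          nlinarith
        nlinarith
      nlinarith
    push_cast
    calc (1 / 2 ^ N) ^ (q + 1) * (2 * reproBound k) * B
          + ((N : ℝ) + 1) * (2 ^ (q + 1) * (4 * reproBound k) * (X * (1 / 2 ^ N) ^ (q + 1) * B))
        = (2 * reproBound k + (N + 1) * (2 ^ (q + 1) * (4 * reproBound k) * X))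
          * ((1 / 2 ^ N) ^ (q + 1) * B) := by ring
      _ ≤ X * (sparseConst k q * (N + 1)) * ((1 / 2 ^ N) ^ (q + 1) * B) := by gcongr
      _ = _ := by ring

/-! ### The sparse approximation lies in the sparse space -/

/-- Products of piecewise polynomials in the variables of `S`, with levels in `A`, and of a bounded
function of the other variables. -/
def partialSpan (k : ℕ) (S : Finset (Fin d)) (A : Set (Fin d → ℕ)) :
    Submodule ℝ ((Fin d → ℝ) → ℝ) :=
  Submodule.span ℝ {f | ∃ (l : Fin d → ℕ) (g : Fin d → ℝ → ℝ) (c : (Fin d → ℝ) → ℝ),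
    l ∈ A ∧ (∀ i ∈ S, g i ∈ V (l i) k) ∧ BddMeas c ∧
    (∀ x, ∀ m ∈ S, ∀ s, c (Function.update x m s) = c x) ∧
    f = fun x => (∏ i ∈ S, g i (x i)) * c x}

lemma bddMeas_of_mem_partialSpan {k : ℕ} {S : Finset (Fin d)} {A : Set (Fin d → ℕ)}
    {f : (Fin d → ℝ) → ℝ} (hf : f ∈ partialSpan k S A) : BddMeas f := by
  induction hf using Submodule.span_induction with
  | mem f h =>
    obtain ⟨l, g, c, -, hg, hc, -, rfl⟩ := h
    refine (BddMeas.prod _ fun i hi => ?_).mul hc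
    have := measurable_bdd_of_mem_V (hg i hi)
    exact bddMeas_comp_apply this.1 this.2 i
  | zero => exact BddMeas.const 0
  | add f g _ _ hf hg => exact hf.add hg
  | smul c f _ hf => exact hf.const_mul c

lemma prod_erase_update {S : Finset (Fin d)} {m : Fin d} (hm : m ∉ S) (g : Fin d → ℝ → ℝ)
    (x : Fin d → ℝ) (s : ℝ) :
    ∏ i ∈ S, g i (Function.update x m s i) = ∏ i ∈ S, g i (x i) :=
  Finset.prod_congr rfl fun i hi => by
    rw [Function.update_of_ne (by rintro rfl; exact hm hi)]

/-- The projection in a new direction turns the free factor into a piecewise polynomial times a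
function of the other variables, because its kernel has finite rank. -/
lemma projOp_mem_partialSpan {k n : ℕ} {S : Finset (Fin d)} {m : Fin d} (hm : m ∉ S)
    {A A' : Set (Fin d → ℕ)} (hA : ∀ l ∈ A, Function.update l m n ∈ A')
    {f : (Fin d → ℝ) → ℝ} (hf : f ∈ partialSpan k S A) :
    projOp k n m f ∈ partialSpan k (insert m S) A' := by
  induction hf using Submodule.span_induction with
  | mem f h =>
    obtain ⟨l, g, c, hl, hg, hc, hci, rfl⟩ := h
    have hint : ∀ x j (i : Fin (k + 1)), Integrable
        (fun s => cellDual k n j i s * c (Function.update x m s)) unitMeasure := by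
      intro x j i
      obtain ⟨C, hC⟩ := exists_abs_cellDual_le k n j i
      exact (hc.slice_integrable m x).bdd_mul (c := C)
        (measurable_cellDual k n j i).aestronglyMeasurable (Filter.Eventually.of_forall hC)
    have : projOp k n m (fun x => (∏ i ∈ S, g i (x i)) * c x)
        = ∑ j ∈ Finset.range (2 ^ n), ∑ i : Fin (k + 1), fun x : Fin d → ℝ =>
            (∏ a ∈ insert m S, Function.update g m (cellBasis n j i) a (x a))
              * kernelOp (fun _ s => cellDual k n j i s) m c x := by
      ext x
      simp only [projOp, kernelOp, prod_erase_update hm, cellKernel_reproKernel_eq,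
        Finset.sum_apply]
      have hre : ∀ s, (∑ j ∈ Finset.range (2 ^ n), ∑ i : Fin (k + 1),
            cellBasis n j i (x m) * cellDual k n j i s)
              * ((∏ i ∈ S, g i (x i)) * c (Function.update x m s))
          = ∑ j ∈ Finset.range (2 ^ n), ∑ i : Fin (k + 1),
            (cellBasis n j i (x m) * ∏ i ∈ S, g i (x i))
              * (cellDual k n j i s * c (Function.update x m s)) := by
        intro s
        rw [Finset.sum_mul]
        refine Finset.sum_congr rfl fun j _ => ?_
        rw [Finset.sum_mul]
        exact Finset.sum_congr rfl fun i _ => by ring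
      simp_rw [hre]
      rw [integral_finsetSum _ fun j _ => integrable_finsetSum _ fun i _ =>
        (hint x j i).const_mul _]
      refine Finset.sum_congr rfl fun j _ => ?_
      rw [integral_finsetSum _ fun i _ => (hint x j i).const_mul _]
      refine Finset.sum_congr rfl fun i _ => ?_
      rw [integral_const_mul, Finset.prod_insert hm, Function.update_self]
      congr 2
      exact Finset.prod_congr rfl fun a ha => by
        rw [Function.update_of_ne (by rintro rfl; exact hm ha)]
    rw [this]
    refine Submodule.sum_mem _ fun j _ => Submodule.sum_mem _ fun i _ => Submodule.subset_span ?_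
    refine ⟨Function.update l m n, Function.update g m (cellBasis n j i), _, hA l hl, ?_, ?_, ?_,
        rfl⟩
    · intro a ha
      by_cases h : a = m
      · subst h
        rw [Function.update_self, Function.update_self]
        exact cellBasis_mem_V (Nat.lt_succ_iff.1 i.2)
      · rw [Function.update_of_ne h, Function.update_of_ne h]
        exact hg a (Finset.mem_of_mem_insert_of_ne ha h)
    -- The integral no longer depends on the new variable, nor on the variables of `S`.
    · have hκ : BddKernel (fun _ s => cellDual k n j i s) := by
        obtain ⟨C, hC⟩ := exists_abs_cellDual_le k n j i
        exact ⟨(measurable_cellDual k n j i).comp measurable_snd, C, fun _ s => hC s⟩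
      exact hc.kernelOp hκ m
    · intro x a ha t
      simp only [kernelOp]
      congr 1
      ext s
      by_cases h : a = m
      · subst h; rw [Function.update_idem]
      · rw [Function.update_comm h, hci _ a (Finset.mem_of_mem_insert_of_ne ha h)]
  | zero =>
    have : projOp k n m (0 : (Fin d → ℝ) → ℝ) = 0 := kernelOp_zero
    rw [this]; exact Submodule.zero_mem _
  | add f g hf' hg' hf hg =>
    have : projOp k n m (f + g) = projOp k n m f + projOp k n m g :=
      kernelOp_add (bddKernel_proj k n) (bddMeas_of_mem_partialSpan hf')
        (bddMeas_of_mem_partialSpan hg')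
    rw [this]; exact Submodule.add_mem _ hf hg
  | smul c f _ hf =>
    have : projOp k n m (c • f) = c • projOp k n m f := kernelOp_const_mul c
    rw [this]; exact Submodule.smul_mem _ c hf

lemma sparseOp_mem_partialSpan (k : ℕ) (S : List (Fin d)) (hS : S.Nodup) (N : ℕ)
    {f : (Fin d → ℝ) → ℝ} (hf : BddMeas f) : sparseOp k S N f ∈
      partialSpan k S.toFinset {l | ∑ i ∈ S.toFinset, l i ≤ N} := by
  induction S generalizing N with
  | nil =>
    refine Submodule.subset_span ⟨0, 0, f, by simp, by simp, hf, by simp, ?_⟩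
    ext x; simp [sparseOp]
  | cons m S ih =>
    have hm : m ∉ S.toFinset := by simpa using (List.nodup_cons.1 hS).1
    have h : sparseOp k (m :: S) N f = ∑ n ∈ Finset.range (N + 1),
        detailOp k n m (sparseOp k S (N - n) f) := by
      ext x; simp [sparseOp]
    rw [h, List.toFinset_cons]
    refine Submodule.sum_mem _ fun n hn => ?_
    have hnN : n ≤ N := Nat.lt_succ_iff.1 (Finset.mem_range.1 hn)
    have h1 := ih (List.nodup_cons.1 hS).2 (N - n)
    have h2 : ∀ n' ≤ n, projOp k n' m (sparseOp k S (N - n) f)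
        ∈ partialSpan k (insert m S.toFinset) {l | ∑ i ∈ insert m S.toFinset, l i ≤ N} := by
      intro n' hn'
      refine projOp_mem_partialSpan hm (fun l hl => ?_) h1
      rw [mem_ofPred_eq] at hl ⊢
      rw [Finset.sum_insert hm, Function.update_self, Finset.sum_update_of_notMem hm]
      omega
    cases n with
    | zero => exact h2 0 le_rfl
    | succ n =>
      rw [detailOp_succ k n m (hf.sparseOp k S _)]
      exact Submodule.sub_mem _ (h2 (n + 1) le_rfl) (h2 n (Nat.le_succ n))

/-- A function that does not depend on any single variable is constant. -/
lemma eq_of_update_invariant {c : (Fin d → ℝ) → ℝ}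
    (hc : ∀ x m s, c (Function.update x m s) = c x) (x y : Fin d → ℝ) : c x = c y := by
  have : ∀ T : Finset (Fin d), c (fun i => if i ∈ T then y i else x i) = c x := by
    intro T
    induction T using Finset.induction_on with
    | empty => simp
    | insert a T _ ih =>
      have h := hc (fun i => if i ∈ T then y i else x i) a (y a)
      rw [ih] at h
      rw [← h]
      congr 1
      ext i
      by_cases h : i = a
      · subst h; simp
      · simp [h]
  simpa using (this Finset.univ).symm

lemma partialSpan_univ_le {k : ℕ} {A : Set (Fin d → ℕ)} {T : Submodule ℝ ((Fin d → ℝ) → ℝ)}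
    (hT : ∀ l ∈ A, tensorSpan (fun i => V (l i) k) ≤ T) :
    partialSpan k (Finset.univ : Finset (Fin d)) A ≤ T := by
  refine Submodule.span_le.2 ?_
  rintro f ⟨l, g, c, hl, hg, -, hc, rfl⟩
  have : (fun x : Fin d → ℝ => (∏ i, g i (x i)) * c x)
      = c 0 • fun x : Fin d → ℝ => ∏ i, g i (x i) := by
    ext x
    rw [eq_of_update_invariant (fun x m s => hc x m (Finset.mem_univ m) s) x 0]
    simp [mul_comm]
  rw [this]
  exact Submodule.smul_mem _ _ (hT l hl
    (mem_tensorSpan fun i => hg i (Finset.mem_univ i)))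

/-- The sparse operator takes its values in the sparse space. -/
lemma sparseOp_mem_sparseSpace (k N : ℕ) {f : (Fin d → ℝ) → ℝ} (hf : BddMeas f) :
    sparseOp k (List.finRange d) N f ∈ sparseSpace d N k := by
  have h := sparseOp_mem_partialSpan k (List.finRange d) (List.nodup_finRange d) N hf
  rw [List.toFinset_finRange] at h
  exact partialSpan_univ_le (fun l hl => tensorSpan_V_le_sparseSpace hl) h

end SparseOp

/-! ### Traces and the energy identity on a line -/

section Line
open Filter Topology

lemma exists_polys_of_mem_V {N k : ℕ} {v : ℝ → ℝ} (hv : v ∈ V N k) :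
    ∃ P : ℕ → Polynomial ℝ, ∀ j : ℕ, j < 2 ^ N → ∀ x
        ∈ Ioc ((j : ℝ) / 2 ^ N) (((j : ℝ) + 1) / 2 ^ N),
      v x = (P j).eval x := by
  choose P _ hP using fun j : {j : ℕ // j < 2 ^ N} => hv.2 j.1 j.2
  refine ⟨fun j => if h : j < 2 ^ N then P ⟨j, h⟩ else 0, fun j hj x hx => ?_⟩
  simp only [dif_pos hj]
  exact hP ⟨j, hj⟩ x hx

lemma node_lt (N j : ℕ) : (j : ℝ) / 2 ^ N < ((j : ℝ) + 1) / 2 ^ N := by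
  gcongr; linarith

lemma tendsto_left_succ_of_mem_V {N k : ℕ} {v : ℝ → ℝ} (hv : v ∈ V N k) {j : ℕ} (hj : j < 2 ^ N) :
    Tendsto v (𝓝[<] (((j : ℝ) + 1) / 2 ^ N)) (𝓝 (v (((j : ℝ) + 1) / 2 ^ N))) := by
  obtain ⟨P, hP⟩ := exists_polys_of_mem_V hv
  rw [hP j hj _ (right_mem_Ioc.2 (node_lt N j))]
  refine ((P j).continuous.tendsto _ |>.mono_left nhdsWithin_le_nhds).congr' ?_
  filter_upwards [Ioo_mem_nhdsLT (node_lt N j)] with x hx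
  exact (hP j hj x (Ioo_subset_Ioc_self hx)).symm

lemma tendsto_left_of_mem_V {N k : ℕ} {v : ℝ → ℝ} (hv : v ∈ V N k) {i : ℕ} (hi : i < 2 ^ N) :
    Tendsto v (𝓝[<] ((i : ℝ) / 2 ^ N)) (𝓝 (v ((i : ℝ) / 2 ^ N))) := by
  rcases i with _ | j
  · have hlt : 2 ^ N - 1 < 2 ^ N := Nat.sub_lt (by positivity) one_pos
    have h := tendsto_left_succ_of_mem_V hv hlt
    have h1 : (((2 ^ N - 1 : ℕ) : ℝ) + 1) / 2 ^ N = 1 := by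
      rw [Nat.cast_sub Nat.one_le_two_pow]; push_cast; field_simp; ring
    rw [h1] at h
    have h0 : ((0 : ℕ) : ℝ) / 2 ^ N = 0 := by simp
    rw [h0, show v 0 = v 1 by rw [← hv.1 0, zero_add]]
    refine (h.comp (f := fun x : ℝ => x + 1) ?_).congr fun x => hv.1 x
    refine tendsto_nhdsWithin_iff.2 ⟨?_, ?_⟩
    · have : Tendsto (fun x : ℝ => x + 1) (𝓝 0) (𝓝 (0 + 1)) :=
        (continuous_id.add continuous_const).tendsto 0
      rw [zero_add] at this
      exact this.mono_left nhdsWithin_le_nhds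
    · filter_upwards [self_mem_nhdsWithin] with x hx
      simp only [mem_Iio] at hx ⊢
      linarith
  · have := tendsto_left_succ_of_mem_V hv (j := j) (by omega)
    simpa using this

lemma tendsto_right_of_mem_V {N : ℕ} {v : ℝ → ℝ} {P : ℕ → Polynomial ℝ}
    (hP : ∀ j : ℕ, j < 2 ^ N → ∀ x ∈ Ioc ((j : ℝ) / 2 ^ N) (((j : ℝ) + 1) / 2 ^ N), v x
        = (P j).eval x)
    {i : ℕ} (hi : i < 2 ^ N) :
    Tendsto v (𝓝[>] ((i : ℝ) / 2 ^ N)) (𝓝 ((P i).eval ((i : ℝ) / 2 ^ N))) := by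
  refine ((P i).continuous.tendsto _ |>.mono_left nhdsWithin_le_nhds).congr' ?_
  filter_upwards [Ioo_mem_nhdsGT (node_lt N i)] with x hx
  exact (hP i hi x (Ioo_subset_Ioc_self hx)).symm

lemma tendsto_rightLim_of_mem_V {N k : ℕ} {v : ℝ → ℝ} (hv : v ∈ V N k) {i : ℕ} (hi : i < 2 ^ N) :
    Tendsto v (𝓝[>] ((i : ℝ) / 2 ^ N)) (𝓝 (Function.rightLim v ((i : ℝ) / 2 ^ N))) := by
  obtain ⟨P, hP⟩ := exists_polys_of_mem_V hv
  have h := tendsto_right_of_mem_V hP hi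
  rwa [rightLim_eq_of_tendsto h]

lemma leftLim_of_mem_V {N k : ℕ} {v : ℝ → ℝ} (hv : v ∈ V N k) {i : ℕ} (hi : i < 2 ^ N) :
    Function.leftLim v ((i : ℝ) / 2 ^ N) = v ((i : ℝ) / 2 ^ N) :=
  leftLim_eq_of_tendsto (tendsto_left_of_mem_V hv hi)

lemma node_zero_eq_last {N : ℕ} {v : ℝ → ℝ} (hv : Function.Periodic v 1) :
    v (((2 ^ N : ℕ) : ℝ) / 2 ^ N) = v (((0 : ℕ) : ℝ) / 2 ^ N) := by
  have : ((2 ^ N : ℕ) : ℝ) / 2 ^ N = 0 + 1 := by push_cast; field_simp; ring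
  rw [this, hv]; simp

/-- Summation over the nodes is invariant under a shift by one node. -/
lemma sum_node_succ (N : ℕ) {v : ℝ → ℝ} (hv : Function.Periodic v 1) :
    ∑ i ∈ Finset.range (2 ^ N), v (((i : ℝ) + 1) / 2 ^ N)
      = ∑ i ∈ Finset.range (2 ^ N), v ((i : ℝ) / 2 ^ N) := by
  have h1 := Finset.sum_range_succ (fun i : ℕ => v ((i : ℝ) / 2 ^ N)) (2 ^ N)
  have h2 := Finset.sum_range_succ' (fun i : ℕ => v ((i : ℝ) / 2 ^ N)) (2 ^ N)
  rw [h1] at h2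
  simp only [node_zero_eq_last hv] at h2
  have h3 := add_right_cancel h2
  rw [h3]
  exact Finset.sum_congr rfl fun i _ => by push_cast; rfl

/-- Integration by parts cell by cell for a piecewise polynomial `e` and a smooth periodic `U`. -/
lemma integral_line_eq_sum {N k : ℕ} {e U U' D : ℝ → ℝ} (he : e ∈ V N k)
    (hU : ∀ s, HasDerivAt U (U' s) s) (hU' : Continuous U') (hUp : Function.Periodic U 1)
    (hD : ∀ s, D s = 2 ^ N * ∫ σ in Ioo (0 : ℝ) 1, cellKernel N (reproDeriv k) s σ * e σ) :
    ∫ s in Ioo (0 : ℝ) 1, ((U s + e s) * D s + U' s * e s)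
      = ∑ i ∈ Finset.range (2 ^ N),
        (U ((i : ℝ) / 2 ^ N) * (e ((i : ℝ) / 2 ^ N) - Function.rightLim e ((i : ℝ) / 2 ^ N))
          + (e ((i : ℝ) / 2 ^ N) ^ 2 - Function.rightLim e ((i : ℝ) / 2 ^ N) ^ 2) / 2) := by
  have hex : ∀ j : {j : ℕ // j < 2 ^ N}, ∃ P : Polynomial ℝ, P.natDegree ≤ k ∧
      ∀ x ∈ Ioc ((j.1 : ℝ) / 2 ^ N) (((j.1 : ℝ) + 1) / 2 ^ N), e x = P.eval x :=
    fun j => he.2 j.1 j.2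
  choose P₀ hd hP₀ using hex
  set P : ℕ → Polynomial ℝ := fun j => if h : j < 2 ^ N then P₀ ⟨j, h⟩ else 0 with hPdef
  have hP : ∀ j : ℕ, j < 2 ^ N → ∀ x ∈ Ioc ((j : ℝ) / 2 ^ N) (((j : ℝ) + 1) / 2 ^ N),
      e x = (P j).eval x := by
    intro j hj x hx
    simp only [hPdef, dif_pos hj]
    exact hP₀ ⟨j, hj⟩ x hx
  have hPd : ∀ j, (P j).natDegree ≤ k := by
    intro j
    simp only [hPdef]
    split_ifs
    · exact hd _
    · simp
  have hUc : Continuous U := continuous_iff_continuousAt.2 fun s => (hU s).continuousAt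
  set F : ℝ → ℝ := fun s => (U s + e s) * D s + U' s * e s with hF
  set G' : ℕ → ℝ → ℝ := fun j s => (U s + (P j).eval s) * (P j).derivative.eval s
    + U' s * (P j).eval s with hG'
  have hG'c : ∀ j, Continuous (G' j) := fun j =>
    ((hUc.add (P j).continuous).mul (P j).derivative.continuous).add (hU'.mul (P j).continuous)
  -- On a cell the integrand is the derivative of `U P + P² / 2`, where `P` is the polynomial `e`.
  have hDj : ∀ j : ℕ, j < 2 ^ N → ∀ x ∈ Ioc ((j : ℝ) / 2 ^ N) (((j : ℝ) + 1) / 2 ^ N),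
      F x = G' j x := by
    intro j hj x hx
    have hx1 := cell_subset_Ioc hj hx
    have h := (integral_cellKernel_of_poly (v := e) hx1 (hPd j) (fun s hs hsx => by
      rw [cellIdx_of_mem hj hx] at hsx
      exact hP j hj s ((cellIdx_eq_iff hj hs).1 hsx))).2
    simp only [hF, hG', hD, h, hP j hj x hx]
  have hint : ∀ j : ℕ, j < 2 ^ N → IntervalIntegrable F volume ((j : ℝ) / 2 ^ N)
      (((j + 1 : ℕ) : ℝ) / 2 ^ N) := by
    intro j hj
    push_cast
    rw [intervalIntegrable_iff_integrableOn_Ioc_of_le (node_lt N j).le]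
    refine IntegrableOn.congr_fun ?_ (fun x hx => (hDj j hj x hx).symm) measurableSet_Ioc
    exact ((hG'c j).integrableOn_Icc).mono_set Ioc_subset_Icc_self
  have hsum := intervalIntegral.sum_integral_adjacent_intervals (f := F) (μ := volume)
    (a := fun j : ℕ => (j : ℝ) / 2 ^ N) (n := 2 ^ N) hint
  have h01 : ((2 ^ N : ℕ) : ℝ) / 2 ^ N = 1 := by push_cast; field_simp
  rw [h01] at hsum
  simp only [Nat.cast_zero, zero_div] at hsum
  rw [← integral_Ioc_eq_integral_Ioo, ← intervalIntegral.integral_of_le zero_le_one, ← hsum]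
  set G : ℕ → ℝ → ℝ := fun j s => U s * (P j).eval s + (P j).eval s ^ 2 / 2 with hG
  have hcell : ∀ j ∈ Finset.range (2 ^ N),
      ∫ s in ((j : ℝ) / 2 ^ N)..(((j + 1 : ℕ) : ℝ) / 2 ^ N), F s
        = G j (((j : ℝ) + 1) / 2 ^ N) - G j ((j : ℝ) / 2 ^ N) := by
    intro j hj
    have hj' := Finset.mem_range.1 hj
    push_cast
    have : ∫ s in ((j : ℝ) / 2 ^ N)..(((j : ℝ) + 1) / 2 ^ N), F s
        = ∫ s in ((j : ℝ) / 2 ^ N)..(((j : ℝ) + 1) / 2 ^ N), G' j s := by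
      rw [intervalIntegral.integral_of_le (node_lt N j).le,
        intervalIntegral.integral_of_le (node_lt N j).le]
      exact setIntegral_congr_fun measurableSet_Ioc (hDj j hj')
    rw [this]
    refine intervalIntegral.integral_eq_sub_of_hasDerivAt (fun s _ => ?_)
      ((hG'c j).intervalIntegrable _ _)
    have h1 := (P j).hasDerivAt s
    refine HasDerivAt.congr_deriv (((hU s).mul h1).add ((h1.pow 2).div_const 2)) ?_
    simp only [hG', Nat.cast_ofNat, Nat.add_one_sub_one, pow_one]
    ring
  rw [Finset.sum_congr rfl hcell, Finset.sum_sub_distrib]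
  have hr : ∀ i ∈ Finset.range (2 ^ N),
      Function.rightLim e ((i : ℝ) / 2 ^ N) = (P i).eval ((i : ℝ) / 2 ^ N) := fun i hi =>
    rightLim_eq_of_tendsto (tendsto_right_of_mem_V hP (Finset.mem_range.1 hi))
  have hper : Function.Periodic (fun s => U s * e s + e s ^ 2 / 2) 1 := fun s => by
    simp only [hUp s, he.1 s]
  -- By periodicity the sum over the right end points is a sum over the same nodes as the left ones.
  have hs := sum_node_succ N hper
  have h1 : ∑ j ∈ Finset.range (2 ^ N), G j (((j : ℝ) + 1) / 2 ^ N)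
      = ∑ i ∈ Finset.range (2 ^ N), (U ((i : ℝ) / 2 ^ N) * e ((i : ℝ) / 2 ^ N)
        + e ((i : ℝ) / 2 ^ N) ^ 2 / 2) := by
    rw [← hs]
    refine Finset.sum_congr rfl fun j hj => ?_
    simp only [hG]
    rw [← hP j (Finset.mem_range.1 hj) _ (right_mem_Ioc.2 (node_lt N j))]
  rw [h1, ← Finset.sum_sub_distrib]
  refine Finset.sum_congr rfl fun i hi => ?_
  rw [hr i hi]
  simp only [hG]
  ring

/-- The scalar upwind flux with traces `m` and `p` from the lower and the upper side. -/
def flux (a m p : ℝ) : ℝ := a * ((m + p) / 2) + |a| / 2 * (m - p)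

/-- The upwind flux absorbs the jump of the test function. -/
lemma flux_young (a y m p em ep : ℝ) :
    a * (y * (em - ep) + (em ^ 2 - ep ^ 2) / 2) - flux a (m + em) (p + ep) * (em - ep)
      ≤ |a| / 2 * ((m - y) ^ 2 + (p - y) ^ 2) := by
  unfold flux
  rcases abs_cases a with ⟨h, h'⟩ | ⟨h, h'⟩ <;> rw [h]
  · nlinarith [mul_nonneg h' (sq_nonneg ((m - y) + (em - ep))), mul_nonneg h' (sq_nonneg (p - y))]
  · have h'' : 0 ≤ -a := by linarith
    nlinarith [mul_nonneg h'' (sq_nonneg ((p - y) - (em - ep))), mul_nonneg h'' (sq_nonneg (m - y))]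

/-- The energy inequality of the upwind scheme on a line. -/
lemma line_energy_le {N k : ℕ} {w e U U' D : ℝ → ℝ} (a : ℝ) (hw : w ∈ V N k) (he : e ∈ V N k)
    (hU : ∀ s, HasDerivAt U (U' s) s) (hU' : Continuous U') (hUp : Function.Periodic U 1)
    (hD : ∀ s, D s = 2 ^ N * ∫ σ in Ioo (0 : ℝ) 1, cellKernel N (reproDeriv k) s σ * e σ) :
    a * (∫ s in Ioo (0 : ℝ) 1, ((U s + e s) * D s + U' s * e s))
      - ∑ i ∈ Finset.range (2 ^ N),
        flux a (Function.leftLim (fun s => w s + e s) ((i : ℝ) / 2 ^ N))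
          (Function.rightLim (fun s => w s + e s) ((i : ℝ) / 2 ^ N))
        * (Function.leftLim e ((i : ℝ) / 2 ^ N) - Function.rightLim e ((i : ℝ) / 2 ^ N))
      ≤ |a| / 2 * ∑ i ∈ Finset.range (2 ^ N),
        ((Function.leftLim w ((i : ℝ) / 2 ^ N) - U ((i : ℝ) / 2 ^ N)) ^ 2
          + (Function.rightLim w ((i : ℝ) / 2 ^ N) - U ((i : ℝ) / 2 ^ N)) ^ 2) := by
  -- After integration by parts both sides are sums over the nodes, compared term by term.
  rw [integral_line_eq_sum he hU hU' hUp hD, Finset.mul_sum, Finset.mul_sum,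
    ← Finset.sum_sub_distrib]
  refine Finset.sum_le_sum fun i hi => ?_
  have hi' := Finset.mem_range.1 hi
  rw [leftLim_eq_of_tendsto ((tendsto_left_of_mem_V hw hi').add (tendsto_left_of_mem_V he hi')),
    rightLim_eq_of_tendsto ((tendsto_rightLim_of_mem_V hw hi').add
      (tendsto_rightLim_of_mem_V he hi')), leftLim_of_mem_V hw hi', leftLim_of_mem_V he hi']
  exact flux_young a _ _ _ _ _

end Line

/-! ### Sums over the cells and the faces of the grid -/

/-- The grid boxes cover the unit box up to a null set, in any finite set of coordinates. -/
lemma sum_setIntegral_boxes {ι : Type*} [Fintype ι] [DecidableEq ι] (N : ℕ) {F : (ι → ℝ) → ℝ}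
    (hF : IntegrableOn F (univ.pi fun _ : ι => Ioo (0 : ℝ) 1)) :
    ∑ j : ι → Fin (2 ^ N), ∫ x in univ.pi (fun i =>
        Ioo (((j i : ℕ) : ℝ) / 2 ^ N) ((((j i : ℕ) : ℝ) + 1) / 2 ^ N)), F x
      = ∫ x in univ.pi (fun _ : ι => Ioo (0 : ℝ) 1), F x := by
  set c : (ι → Fin (2 ^ N)) → Set (ι → ℝ) := fun j => univ.pi fun i =>
    Ioc (((j i : ℕ) : ℝ) / 2 ^ N) ((((j i : ℕ) : ℝ) + 1) / 2 ^ N) with hc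
  have hunion : ⋃ j, c j = univ.pi fun _ : ι => Ioc (0 : ℝ) 1 := by
    ext x
    simp only [hc, mem_iUnion, mem_univ_pi]
    constructor
    · rintro ⟨j, hj⟩ i
      exact cell_subset_Ioc (j i).2 (hj i)
    · intro hx
      choose j hj hxj using fun i => exists_mem_cell N (hx i)
      exact ⟨fun i => ⟨j i, hj i⟩, hxj⟩
  have hdisj : Pairwise (Function.onFun Disjoint c) := by
    intro j j' hjj
    refine Set.disjoint_left.2 fun x hx hx' => hjj ?_
    ext i
    have h1 := cellIdx_of_mem (j i).2 (mem_univ_pi.1 hx i)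
    have h2 := cellIdx_of_mem (j' i).2 (mem_univ_pi.1 hx' i)
    rw [h1] at h2
    exact_mod_cast h2
  have hmeas : ∀ j, MeasurableSet (c j) := fun j => MeasurableSet.univ_pi fun _ => measurableSet_Ioc
  have h0 : (univ.pi fun _ : ι => Ioo (0 : ℝ) 1) =ᵐ[volume] univ.pi fun _ : ι => Ioc (0 : ℝ) 1 :=
    Measure.pi_Ioo_ae_eq_pi_Ioc
  have hF' : IntegrableOn F (univ.pi fun _ : ι => Ioc (0 : ℝ) 1) := hF.congr_set_ae h0.symm
  rw [setIntegral_congr_set h0, ← hunion, integral_iUnion_fintype hmeas hdisj fun j =>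
    hF'.mono_set (by rw [← hunion]; exact subset_iUnion c j)]
  exact Finset.sum_congr rfl fun j _ => setIntegral_congr_set Measure.pi_Ioo_ae_eq_pi_Ioc

variable {d : ℕ}

lemma sum_integral_cell (N : ℕ) {F : (Fin d → ℝ) → ℝ} (hF : BddMeas F) :
    ∑ j : Fin d → Fin (2 ^ N), ∫ x in cell N j, F x = ∫ x in cube d, F x :=
  sum_setIntegral_boxes N (hF.integrable (ν := cubeMeasure d))

/-- The integrals over all faces orthogonal to `e_m`, written on the cube. -/
lemma sum_faceIntegral (N : ℕ) (m : Fin d) {f : (Fin d → ℝ) → ℝ}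
    (hf : ∀ i : ℕ, i < 2 ^ N → BddMeas fun x => f (Function.update x m ((i : ℝ) / 2 ^ N))) :
    ∑ j, faceIntegral N m j f
      = ∫ x in cube d, ∑ i ∈ Finset.range (2 ^ N), f (Function.update x m ((i : ℝ) / 2 ^ N)) := by
  classical
  set g : ℕ → ({i : Fin d // i ≠ m} → ℝ) → ℝ := fun i y =>
    f (fun i' => if h : i' = m then (i : ℝ) / 2 ^ N else y ⟨i', h⟩) with hg
  set ext0 : ({i : Fin d // i ≠ m} → ℝ) → Fin d → ℝ := fun y i' =>
    if h : i' = m then 0 else y ⟨i', h⟩ with hext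
  have hextm : Measurable ext0 := by
    rw [measurable_pi_iff]
    intro i
    by_cases h : i = m
    · simp only [hext, h, dif_pos]; exact measurable_const
    · simp only [hext, h, dif_neg, not_false_eq_true]; exact measurable_pi_apply _
  have hgext : ∀ i y, g i y = f (Function.update (ext0 y) m ((i : ℝ) / 2 ^ N)) := by
    intro i y
    simp only [hg]
    congr 1
    ext i'
    by_cases h : i' = m
    · subst h; simp
    · simp [h, hext]
  have hgmeas : ∀ i < 2 ^ N, Measurable (g i) := fun i hi => by
    rw [funext (hgext i)]
    exact (hf i hi).measurable.comp hextm
  have hfin : IsFiniteMeasure (volume.restrict (univ.pi fun _ : {i : Fin d // i ≠ m} =>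
      Ioo (0 : ℝ) 1)) := by
    rw [← (measurePreserving_forget m).map_eq]; infer_instance
  have hgint : ∀ i < 2 ^ N, IntegrableOn (g i) (univ.pi fun _ : {i : Fin d // i ≠ m} =>
      Ioo (0 : ℝ) 1) := by
    intro i hi
    obtain ⟨C, hC⟩ := (hf i hi).bdd
    exact Integrable.of_bound (hgmeas i hi).aestronglyMeasurable C
      (Filter.Eventually.of_forall fun y => by rw [hgext]; exact hC _)
  -- A face is given by the node of the coordinate `m` and the cell of the other coordinates.
  rw [integral_finsetSum _ fun i hi => (hf i (Finset.mem_range.1 hi)).integrable,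
    ← Equiv.sum_comp (Equiv.funSplitAt m (Fin (2 ^ N))).symm, Fintype.sum_prod_type,
    ← Fin.sum_univ_eq_sum_range (fun i => ∫ x in cube d,
      f (Function.update x m ((i : ℝ) / 2 ^ N)))]
  refine Finset.sum_congr rfl fun i _ => ?_
  have h1 : ∀ j' : {i : Fin d // i ≠ m} → Fin (2 ^ N),
      faceIntegral N m ((Equiv.funSplitAt m (Fin (2 ^ N))).symm (i, j')) f
        = ∫ y in univ.pi (fun l : {i : Fin d // i ≠ m} =>
          Ioo (((j' l : ℕ) : ℝ) / 2 ^ N) ((((j' l : ℕ) : ℝ) + 1) / 2 ^ N)), g i y := by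
    intro j'
    have e1 : ∀ l : {i : Fin d // i ≠ m},
        (Equiv.funSplitAt m (Fin (2 ^ N))).symm (i, j') l.1 = j' l := by
      intro l; simp [Equiv.funSplitAt_symm_apply, l.2]
    have e2 : (Equiv.funSplitAt m (Fin (2 ^ N))).symm (i, j') m = i := by
      simp [Equiv.funSplitAt_symm_apply]
    simp only [faceIntegral, e1, e2, hg]
  rw [Finset.sum_congr rfl fun j' _ => h1 j', sum_setIntegral_boxes N (hgint i i.2),
    ← (measurePreserving_forget m).map_eq,
    integral_map (measurePreserving_forget m).measurable.aemeasurable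
      (hgmeas i i.2).aestronglyMeasurable]
  refine integral_congr_ae (Filter.Eventually.of_forall fun x => ?_)
  simp only [hg]
  congr 1
  ext i'
  by_cases h : i' = m
  · subst h; simp
  · simp [h]

/-! ### Periodic functions -/

lemma UnitPeriodic.add_int {f : (Fin d → ℝ) → ℝ} (hf : UnitPeriodic f) (z : Fin d → ℤ)
    (x : Fin d → ℝ) : f (fun i => x i + z i) = f x := by
  have key : ∀ S : Finset (Fin d), f (x + ∑ i ∈ S, (z i) • (Pi.single i (1 : ℝ) : Fin d → ℝ))
      = f x := by
    intro S
    induction S using Finset.induction_on with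
    | empty => simp
    | insert a S ha ih =>
      rw [Finset.sum_insert ha, add_comm (z a • _), ← add_assoc, (hf a).zsmul (z a), ih]
  rw [← key Finset.univ]
  congr 1
  ext i
  simp [Finset.sum_apply, Pi.single_apply]

lemma UnitPeriodic.eq_fract {f : (Fin d → ℝ) → ℝ} (hf : UnitPeriodic f) (x : Fin d → ℝ) :
    f x = f (fun i => Int.fract (x i)) := by
  rw [← hf.add_int (fun i => ⌊x i⌋) (fun i => Int.fract (x i))]
  congr 1
  ext i
  rw [Int.fract_add_floor]

lemma UnitPeriodic.bddMeas {f : (Fin d → ℝ) → ℝ} (hf : UnitPeriodic f) (hc : Continuous f) :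
    BddMeas f := by
  have hK : IsCompact (Icc (0 : Fin d → ℝ) 1) := isCompact_Icc
  obtain ⟨C, hC⟩ := hK.exists_bound_of_continuousOn hc.continuousOn
  refine ⟨hc.measurable, C, fun x => ?_⟩
  rw [hf.eq_fract x]
  exact hC _ ⟨fun i => Int.fract_nonneg _, fun i => (Int.fract_lt_one _).le⟩

lemma UnitPeriodic.partialDeriv {f : (Fin d → ℝ) → ℝ} (hf : UnitPeriodic f) (i : Fin d) :
    UnitPeriodic (partialDeriv i f) := by
  intro j x
  simp only [SparseDG.partialDeriv]
  rw [← fderiv_comp_add_right]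
  congr 2
  exact funext (hf j)

lemma UnitPeriodic.iterate_partialDeriv {f : (Fin d → ℝ) → ℝ} (hf : UnitPeriodic f) (i : Fin d)
    (n : ℕ) : UnitPeriodic ((SparseDG.partialDeriv i)^[n] f) := by
  induction n with
  | zero => exact hf
  | succ n ih => rw [Function.iterate_succ_apply']; exact ih.partialDeriv i

lemma UnitPeriodic.slice {f : (Fin d → ℝ) → ℝ} (hf : UnitPeriodic f) (m : Fin d)
    (x : Fin d → ℝ) : Function.Periodic (fun s => f (Function.update x m s)) 1 := by
  intro s
  simp only
  rw [← hf m (Function.update x m s)]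
  congr 1
  ext i
  by_cases h : i = m
  · subst h; simp
  · simp [h]

lemma continuous_slice {f : (Fin d → ℝ) → ℝ} (hf : Continuous f) (m : Fin d) (x : Fin d → ℝ) :
    Continuous (fun s => f (Function.update x m s)) :=
  hf.comp (continuous_const.update m continuous_id)

/-! ### The discontinuous Galerkin form -/

section DGForm
open Filter Topology

lemma traceMinus_update (m : Fin d) (f : (Fin d → ℝ) → ℝ) (x : Fin d → ℝ) (c : ℝ) :
    traceMinus m f (Function.update x m c)
      = Function.leftLim (fun s => f (Function.update x m s)) c := by
  simp only [traceMinus, Function.update_self, Function.update_idem]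

lemma tracePlus_update (m : Fin d) (f : (Fin d → ℝ) → ℝ) (x : Fin d → ℝ) (c : ℝ) :
    tracePlus m f (Function.update x m c)
      = Function.rightLim (fun s => f (Function.update x m s)) c := by
  simp only [tracePlus, Function.update_self, Function.update_idem]

lemma bddMeas_traceMinus {N k : ℕ} {f : (Fin d → ℝ) → ℝ} (hf : f ∈ fullSpace d N k) (m : Fin d)
    {i : ℕ} (hi : i < 2 ^ N) :
    BddMeas (fun x => traceMinus m f (Function.update x m ((i : ℝ) / 2 ^ N))) := by
  have : (fun x => traceMinus m f (Function.update x m ((i : ℝ) / 2 ^ N)))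
      = fun x => f (Function.update x m ((i : ℝ) / 2 ^ N)) := by
    ext x
    rw [traceMinus_update, leftLim_of_mem_V (slice_mem_V hf m x) hi]
  rw [this]
  exact (bddMeas_of_mem_fullSpace hf).update m _

lemma bddMeas_tracePlus {N k : ℕ} {f : (Fin d → ℝ) → ℝ} (hf : f ∈ fullSpace d N k) (m : Fin d)
    {i : ℕ} (hi : i < 2 ^ N) :
    BddMeas (fun x => tracePlus m f (Function.update x m ((i : ℝ) / 2 ^ N))) := by
  have hb := bddMeas_of_mem_fullSpace hf
  obtain ⟨C, hC⟩ := hb.bdd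
  have hlim : Tendsto (fun n : ℕ => (i : ℝ) / 2 ^ N + 1 / ((n : ℝ) + 1)) atTop
      (𝓝[>] ((i : ℝ) / 2 ^ N)) := by
    refine tendsto_nhdsWithin_iff.2 ⟨?_, Eventually.of_forall fun n => ?_⟩
    · simpa using (tendsto_const_nhds (x := (i : ℝ) / 2 ^ N)).add
        tendsto_one_div_add_atTop_nhds_zero_nat
    · have : (0 : ℝ) < 1 / ((n : ℝ) + 1) := by positivity
      simp only [mem_Ioi]; linarith
  have key : ∀ x, Tendsto (fun n : ℕ =>
      f (Function.update x m ((i : ℝ) / 2 ^ N + 1 / ((n : ℝ) + 1)))) atTop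
      (𝓝 (tracePlus m f (Function.update x m ((i : ℝ) / 2 ^ N)))) := by
    intro x
    rw [tracePlus_update]
    exact (tendsto_rightLim_of_mem_V (slice_mem_V hf m x) hi).comp hlim
  refine ⟨measurable_of_tendsto_metrizable (fun n => (hb.update m _).measurable)
    (tendsto_pi_nhds.2 key), C, fun x => ?_⟩
  exact le_of_tendsto (key x).abs (Eventually.of_forall fun n => hC _)

lemma sum_upwindFlux_mul_jump (a : EuclideanSpace ℝ (Fin d)) (m : Fin d)
    (u v : (Fin d → ℝ) → ℝ) (x : Fin d → ℝ) :
    ∑ i, upwindFlux a m u x i * jump m v x i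
      = flux (a m) (traceMinus m u x) (tracePlus m u x) * (traceMinus m v x - tracePlus m v x) := by
  have h1 : ∑ i, a i * normal m i = a m := by simp [normal, Pi.single_apply]
  have h2 : ∀ i, jump m v x i = if i = m then traceMinus m v x - tracePlus m v x else 0 := by
    intro i
    by_cases h : i = m
    · subst h; simp [jump, normal]; ring
    · simp [jump, normal, h]
  simp only [h2, mul_ite, mul_zero, Finset.sum_ite_eq', Finset.mem_univ, if_true]
  congr 1
  simp only [upwindFlux, Pi.add_apply, Pi.smul_apply, smul_eq_mul]
  rw [h1]
  simp only [average, flux, jump, normal, Pi.add_apply, Pi.smul_apply, smul_eq_mul,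
    Pi.single_eq_same, Pi.neg_apply]
  ring

/-- The broken partial derivative of a piecewise polynomial. -/
def brokenDeriv (k N : ℕ) (m : Fin d) (f : (Fin d → ℝ) → ℝ) (x : Fin d → ℝ) : ℝ :=
  2 ^ N * dprojOp k N m f x

lemma BddMeas.brokenDeriv {f : (Fin d → ℝ) → ℝ} (hf : BddMeas f) (k N : ℕ) (m : Fin d) :
    BddMeas (brokenDeriv k N m f) := (hf.kernelOp (bddKernel_dproj k N) m).const_mul _

lemma bddMeas_flux (a : ℝ) {m p : (Fin d → ℝ) → ℝ} (hm : BddMeas m) (hp : BddMeas p) :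
    BddMeas (fun x => flux a (m x) (p x)) := by
  unfold flux
  have h := ((hm.add hp).const_mul (a / 2)).add ((hm.sub hp).const_mul (|a| / 2))
  convert h using 2
  ring

/-- The integrand of the interface terms orthogonal to `e_m`. -/
def interfaceTerm (a : ℝ) (N : ℕ) (m : Fin d) (u v : (Fin d → ℝ) → ℝ) (x : Fin d → ℝ) : ℝ :=
  ∑ i ∈ Finset.range (2 ^ N),
    flux a (traceMinus m u (Function.update x m ((i : ℝ) / 2 ^ N)))
      (tracePlus m u (Function.update x m ((i : ℝ) / 2 ^ N)))
    * (traceMinus m v (Function.update x m ((i : ℝ) / 2 ^ N))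
      - tracePlus m v (Function.update x m ((i : ℝ) / 2 ^ N)))

lemma bddMeas_interfaceTerm {N k : ℕ} (a : ℝ) (m : Fin d) {u v : (Fin d → ℝ) → ℝ}
    (hu : u ∈ fullSpace d N k) (hv : v ∈ fullSpace d N k) :
    BddMeas (interfaceTerm a N m u v) :=
  BddMeas.sum _ fun i hi => by
    have hi' := Finset.mem_range.1 hi
    exact (bddMeas_flux a (bddMeas_traceMinus hu m hi') (bddMeas_tracePlus hu m hi')).mul
      ((bddMeas_traceMinus hv m hi').sub (bddMeas_tracePlus hv m hi'))

/-- The form of the scheme as an integral over the cube: the interface integrals are integrated in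
the direction normal to the interfaces as well, on which they do not depend. -/
lemma dgForm_eq {N k : ℕ} (a : EuclideanSpace ℝ (Fin d)) {u v : (Fin d → ℝ) → ℝ}
    (hu : u ∈ fullSpace d N k) (hv : v ∈ fullSpace d N k) :
    dgForm a N u v = ∑ m, ((∫ x in cube d, u x * (a m * brokenDeriv k N m v x))
      - ∫ x in cube d, interfaceTerm (a m) N m u v x) := by
  have hub := bddMeas_of_mem_fullSpace hu
  have hvb := bddMeas_of_mem_fullSpace hv
  rw [dgForm, Finset.sum_sub_distrib]
  congr 1
  · have h1 : ∀ j : Fin d → Fin (2 ^ N), ∫ x in cell N j, u x * ∑ i, a i * partialDeriv i v x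
        = ∫ x in cell N j, u x * ∑ i, a i * brokenDeriv k N i v x := by
      intro j
      refine setIntegral_congr_fun (isOpen_cell N j).measurableSet fun x hx => ?_
      simp only [brokenDeriv, partialDeriv_eq_dprojOp hv hx]
    rw [Finset.sum_congr rfl fun j _ => h1 j, sum_integral_cell N
      (hub.mul (BddMeas.sum _ fun i _ => (hvb.brokenDeriv k N i).const_mul _))]
    simp_rw [Finset.mul_sum]
    exact integral_finsetSum _ fun m _ => (hub.mul ((hvb.brokenDeriv k N m).const_mul _)).integrable
  · refine Finset.sum_congr rfl fun m _ => ?_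
    rw [sum_faceIntegral N m fun i hi => ?_]
    · simp only [sum_upwindFlux_mul_jump, interfaceTerm]
    · simp only [sum_upwindFlux_mul_jump]
      exact (bddMeas_flux _ (bddMeas_traceMinus hu m hi) (bddMeas_tracePlus hu m hi)).mul
        ((bddMeas_traceMinus hv m hi).sub (bddMeas_tracePlus hv m hi))

/-- The squared distance of the traces of `w` from `u` on all interfaces orthogonal to `e_m`. -/
def traceError (N : ℕ) (m : Fin d) (w u : (Fin d → ℝ) → ℝ) (x : Fin d → ℝ) : ℝ :=
  ∑ i ∈ Finset.range (2 ^ N),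
    ((traceMinus m w (Function.update x m ((i : ℝ) / 2 ^ N))
        - u (Function.update x m ((i : ℝ) / 2 ^ N))) ^ 2
      + (tracePlus m w (Function.update x m ((i : ℝ) / 2 ^ N))
        - u (Function.update x m ((i : ℝ) / 2 ^ N))) ^ 2)

lemma bddMeas_traceError {N k : ℕ} (m : Fin d) {w u : (Fin d → ℝ) → ℝ}
    (hw : w ∈ fullSpace d N k) (hu : BddMeas u) : BddMeas (traceError N m w u) :=
  BddMeas.sum _ fun i hi => by
    have hi' := Finset.mem_range.1 hi
    exact ((bddMeas_traceMinus hw m hi').sub (hu.update m _)).sq.add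
      ((bddMeas_tracePlus hw m hi').sub (hu.update m _)).sq

/-- The energy inequality of the scheme: the consistency error of the upwind form is controlled by
the traces of the approximation error, once the volume term has been split off. -/
lemma dgForm_energy_le {N k : ℕ} (a : EuclideanSpace ℝ (Fin d)) {w e u : (Fin d → ℝ) → ℝ}
    (hw : w ∈ fullSpace d N k) (he : e ∈ fullSpace d N k) (hu : ContDiff ℝ ∞ u)
    (hup : UnitPeriodic u) :
    dgForm a N (fun x => w x + e x) e + ∫ x in cube d, (∑ m, a m * partialDeriv m u x) * e x
      ≤ ∑ m, (a m * (∫ x in cube d, (w x - u x) * brokenDeriv k N m e x)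
          + |a m| / 2 * ∫ x in cube d, traceError N m w u x) := by
  have hwe : (fun x => w x + e x) ∈ fullSpace d N k := Submodule.add_mem _ hw he
  have hub := hup.bddMeas hu.continuous
  have hwb := bddMeas_of_mem_fullSpace hw
  have heb := bddMeas_of_mem_fullSpace he
  have hdb : ∀ m, BddMeas (partialDeriv m u) := fun m =>
    (hup.partialDeriv m).bddMeas (contDiff_partialDeriv hu m).continuous
  have hDb := fun m => heb.brokenDeriv k N m
  rw [dgForm_eq a hwe he]
  simp_rw [Finset.sum_mul]
  rw [integral_finsetSum _ fun m _ => (((hdb m).const_mul _).mul heb).integrable,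
    ← Finset.sum_add_distrib]
  refine Finset.sum_le_sum fun m _ => ?_
  have hib := bddMeas_interfaceTerm (a m) m hwe he
  set G : (Fin d → ℝ) → ℝ := fun x => (u x + e x) * brokenDeriv k N m e x
    + partialDeriv m u x * e x with hG
  have hGb : BddMeas G := ((hub.add heb).mul (hDb m)).add ((hdb m).mul heb)
  -- Replace `w` by `u` in the volume term; what remains is an exact derivative on each line.
  have hsplit : (∫ x in cube d, (w x + e x) * (a m * brokenDeriv k N m e x))
      + (∫ x in cube d, a m * partialDeriv m u x * e x)
      = a m * (∫ x in cube d, (w x - u x) * brokenDeriv k N m e x)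
        + a m * ∫ x in cube d, G x := by
    have i1 : Integrable (fun x => (w x + e x) * (a m * brokenDeriv k N m e x)) (cubeMeasure d) :=
      ((hwb.add heb).mul ((hDb m).const_mul _)).integrable
    have i2 : Integrable (fun x => a m * partialDeriv m u x * e x) (cubeMeasure d) :=
      (((hdb m).const_mul _).mul heb).integrable
    have i3 : Integrable (fun x => a m * ((w x - u x) * brokenDeriv k N m e x)) (cubeMeasure d) :=
      (((hwb.sub hub).mul (hDb m)).const_mul _).integrable
    have i4 : Integrable (fun x => a m * G x) (cubeMeasure d) := (hGb.const_mul _).integrable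
    rw [← integral_add i1 i2, ← integral_const_mul, ← integral_const_mul, ← integral_add i3 i4]
    refine integral_congr_ae (Eventually.of_forall fun x => ?_)
    simp only [hG]
    ring
  -- Fubini reduces the estimate to the lines in direction `m`.
  have hmain : a m * (∫ x in cube d, G x) - (∫ x in cube d, interfaceTerm (a m) N m
      (fun x => w x + e x) e x) ≤ |a m| / 2 * ∫ x in cube d, traceError N m w u x := by
    have hGi : Integrable (fun x => ∫ s in Ioo (0 : ℝ) 1, G (Function.update x m s))
        (cubeMeasure d) := (integrable_update m hGb.integrable).integral_prod_left
    rw [integral_update m hGb.integrable, ← integral_const_mul, ← integral_const_mul,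
      ← integral_sub (hGi.const_mul _) hib.integrable]
    refine integral_mono ((hGi.const_mul _).sub hib.integrable)
      ((bddMeas_traceError m hw hub).const_mul _).integrable fun x => ?_
    have h := line_energy_le (k := k) (N := N) (a m) (slice_mem_V hw m x) (slice_mem_V he m x)
      (U := fun s => u (Function.update x m s))
      (U' := fun s => partialDeriv m u (Function.update x m s))
      (D := fun s => brokenDeriv k N m e (Function.update x m s))
      (fun s => hasDerivAt_comp_update ((hu.differentiable (by simp)) _))
      (continuous_slice (contDiff_partialDeriv hu m).continuous m x) (hup.slice m x)
      (fun s => by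
        simp only [brokenDeriv, dprojOp, kernelOp, Function.update_self, Function.update_idem])
    simp only [interfaceTerm, traceError, traceMinus_update, tracePlus_update, hG]
    exact h
  linarith [hsplit, hmain]

/-- The traces of the approximation error are controlled by its norm and by one derivative of order
`q + 1`. -/
lemma integral_traceError_le {N k q : ℕ} (hq : q ≤ k) (m : Fin d) {w u : (Fin d → ℝ) → ℝ}
    (hw : w ∈ fullSpace d N k) (hu : ContDiff ℝ ∞ u) (hup : UnitPeriodic u) :
    ∫ x in cube d, traceError N m w u x
      ≤ 2 ^ N * (4 * reproBound k ^ 2 * l2Norm (cube d) (fun x => w x - u x) ^ 2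
        + 16 * reproBound k ^ 2 * ((1 / 2 ^ N) ^ (q + 1)) ^ 2
          * l2Norm (cube d) ((partialDeriv m)^[q + 1] u) ^ 2) := by
  set M := reproBound k
  set g := (partialDeriv m)^[q + 1] u with hgdef
  have hub := hup.bddMeas hu.continuous
  have hwb := bddMeas_of_mem_fullSpace hw
  have hwu := hwb.sub hub
  have hgb : BddMeas g := (hup.iterate_partialDeriv m _).bddMeas
    (contDiff_iterate_partialDeriv hu m _).continuous
  -- `w - u` is the sum of the piecewise polynomial `P (w - u)` and of the projection error of `u`,
  -- and both are bounded pointwise by averages over the cell.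
  set H : (Fin d → ℝ) → ℝ := fun x => 2 * M ^ 2 * (w x - u x) ^ 2
    + 8 * M ^ 2 * ((1 / 2 ^ N) ^ (q + 1)) ^ 2 * g x ^ 2 with hH
  have hHb : BddMeas H := (hwu.sq.const_mul _).add (hgb.sq.const_mul _)
  have hκ := localKernel_one.bddKernel N
  have hAH : ∀ x, cellAvg N m H x = 2 * M ^ 2 * cellAvg N m (fun x => (w x - u x) ^ 2) x
      + 8 * M ^ 2 * ((1 / 2 ^ N) ^ (q + 1)) ^ 2 * cellAvg N m (fun x => g x ^ 2) x := by
    intro x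
    have := congrFun (kernelOp_add (m := m) hκ (hwu.sq.const_mul (2 * M ^ 2))
      (hgb.sq.const_mul (8 * M ^ 2 * ((1 / 2 ^ N) ^ (q + 1)) ^ 2))) x
    rw [kernelOp_const_mul, kernelOp_const_mul] at this
    exact this
  have hpt : ∀ x : Fin d → ℝ, x m ∈ Ioc (0 : ℝ) 1 → (w x - u x) ^ 2 ≤ cellAvg N m H x := by
    intro x hx
    have h1 := sq_kernelOp_le_cellAvg (localKernel_repro k) N m hwu x
    have h2 := sq_sub_projOp_le hq N m hu hgb hx
    rw [kernelOp_sub (bddKernel_proj k N) hwb hub] at h1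
    have h3 : kernelOp (cellKernel N (reproKernel k)) m w = w := projOp_of_mem_fullSpace hw m
    rw [h3] at h1
    rw [hAH]
    have h4 : (w x - u x) ^ 2 ≤ 2 * (w x - projOp k N m u x) ^ 2
        + 2 * (u x - projOp k N m u x) ^ 2 := by
      nlinarith [sq_nonneg ((w x - projOp k N m u x) + (u x - projOp k N m u x))]
    refine h4.trans ?_
    have h5 : (w x - projOp k N m u x) ^ 2 ≤ _ := h1
    nlinarith [h5, h2]
  have hnode : ∀ i : ℕ, i < 2 ^ N → ((i : ℝ) + 1) / 2 ^ N
      ∈ Ioc ((i : ℝ) / 2 ^ N) (((i : ℝ) + 1) / 2 ^ N) :=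
    fun i _ => right_mem_Ioc.2 (node_lt N i)
  -- All points of a cell share the same average, in particular its right end point.
  have hcell : ∀ x, ∀ i : ℕ, i < 2 ^ N → ∀ s ∈ Ioc ((i : ℝ) / 2 ^ N) (((i : ℝ) + 1) / 2 ^ N),
      (w (Function.update x m s) - u (Function.update x m s)) ^ 2
        ≤ cellAvg N m H (Function.update x m (((i : ℝ) + 1) / 2 ^ N)) := by
    intro x i hi s hs
    have h := hpt (Function.update x m s) (by
      rw [Function.update_self]; exact cell_subset_Ioc hi hs)
    refine h.trans (le_of_eq ?_)
    simp only [cellAvg, kernelOp, cellKernel, Function.update_self, Function.update_idem,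
      cellIdx_of_mem hi hs, cellIdx_of_mem hi (hnode i hi)]
  have hsumA : ∀ x, ∑ i ∈ Finset.range (2 ^ N),
      cellAvg N m H (Function.update x m (((i : ℝ) + 1) / 2 ^ N))
        = 2 ^ N * ∫ s in Ioo (0 : ℝ) 1, H (Function.update x m s) := by
    intro x
    simp only [cellAvg, kernelOp, Function.update_self, Function.update_idem]
    rw [← integral_finsetSum _ fun i _ => hκ.integrable _ (hHb.slice_integrable m x),
      ← integral_const_mul]
    refine integral_congr_ae (Eventually.of_forall fun s => ?_)
    simp only
    rw [← Finset.sum_mul]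
    congr 1
    obtain ⟨j, hj, hsj⟩ := exists_cellIdx_eq N s
    rw [Finset.sum_eq_single_of_mem j (Finset.mem_range.2 hj)]
    · simp [cellKernel, cellIdx_of_mem hj (hnode j hj), hsj]
    · intro i hi hij
      rw [cellKernel, cellIdx_of_mem (Finset.mem_range.1 hi) (hnode i (Finset.mem_range.1 hi)), hsj,
        if_neg (by exact_mod_cast hij)]
  have hT : ∀ x, traceError N m w u x ≤ 2 * 2 ^ N *
      ∫ s in Ioo (0 : ℝ) 1, H (Function.update x m s) := by
    intro x
    have hV := slice_mem_V hw m x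
    -- The left trace of a left-continuous piecewise polynomial is its value.
    have hminus : ∑ i ∈ Finset.range (2 ^ N),
        (traceMinus m w (Function.update x m ((i : ℝ) / 2 ^ N))
        - u (Function.update x m ((i : ℝ) / 2 ^ N))) ^ 2
        ≤ 2 ^ N * ∫ s in Ioo (0 : ℝ) 1, H (Function.update x m s) := by
      have hper : Function.Periodic (fun s => (w (Function.update x m s)
          - u (Function.update x m s)) ^ 2) 1 := fun s => by
        have h1 := hV.1 s
        have h2 := hup.slice m x s
        simp only at h1 h2 ⊢
        rw [h1, h2]
      have h := sum_node_succ N hper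
      rw [← hsumA x]
      have e : ∀ i ∈ Finset.range (2 ^ N), (traceMinus m w (Function.update x m ((i : ℝ) / 2 ^ N))
          - u (Function.update x m ((i : ℝ) / 2 ^ N))) ^ 2
          = (w (Function.update x m ((i : ℝ) / 2 ^ N))
            - u (Function.update x m ((i : ℝ) / 2 ^ N))) ^ 2 := fun i hi => by
        rw [traceMinus_update, leftLim_of_mem_V hV (Finset.mem_range.1 hi)]
      rw [Finset.sum_congr rfl e, ← h]
      exact Finset.sum_le_sum fun i hi =>
        hcell x i (Finset.mem_range.1 hi) _ (hnode i (Finset.mem_range.1 hi))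
    -- The right trace is the limit of values in the adjacent cell, which obey the same bound.
    have hplus : ∑ i ∈ Finset.range (2 ^ N), (tracePlus m w (Function.update x m ((i : ℝ) / 2 ^ N))
        - u (Function.update x m ((i : ℝ) / 2 ^ N))) ^ 2
        ≤ 2 ^ N * ∫ s in Ioo (0 : ℝ) 1, H (Function.update x m s) := by
      rw [← hsumA x]
      refine Finset.sum_le_sum fun i hi => ?_
      have hi' := Finset.mem_range.1 hi
      rw [tracePlus_update]
      have hl := ((tendsto_rightLim_of_mem_V hV hi').sub
        ((continuous_slice hu.continuous m x).tendsto _ |>.mono_left nhdsWithin_le_nhds)).pow 2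
      refine le_of_tendsto hl ?_
      filter_upwards [Ioo_mem_nhdsGT (node_lt N i)] with s hs
      exact hcell x i hi' s (Ioo_subset_Ioc_self hs)
    rw [traceError, Finset.sum_add_distrib]
    linarith
  have hHi : Integrable (fun x => ∫ s in Ioo (0 : ℝ) 1, H (Function.update x m s))
      (cubeMeasure d) := (integrable_update m hHb.integrable).integral_prod_left
  calc ∫ x in cube d, traceError N m w u x
      ≤ ∫ x in cube d, 2 * 2 ^ N * ∫ s in Ioo (0 : ℝ) 1, H (Function.update x m s) :=
        integral_mono (bddMeas_traceError m hw hub).integrable (hHi.const_mul _) hT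
    _ = 2 * 2 ^ N * ∫ x in cube d, H x := by
        rw [integral_const_mul, ← integral_update m hHb.integrable]
    _ = 2 * 2 ^ N * (2 * M ^ 2 * l2Norm (cube d) (fun x => w x - u x) ^ 2
          + 8 * M ^ 2 * ((1 / 2 ^ N) ^ (q + 1)) ^ 2 * l2Norm (cube d) g ^ 2) := by
        rw [l2Norm_sq, l2Norm_sq, ← integral_const_mul (2 * M ^ 2),
          ← integral_const_mul (8 * M ^ 2 * ((1 / 2 ^ N) ^ (q + 1)) ^ 2),
          ← integral_add (hwu.sq.const_mul _).integrable (hgb.sq.const_mul _).integrable]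
    _ = _ := by ring

end DGForm

/-! ### Translations of periodic functions -/

lemma measurePreserving_fract_sub (c : ℝ) :
    MeasurePreserving (fun s => Int.fract (s - c)) unitMeasure unitMeasure := by
  have hm : Measurable fun s : ℝ => Int.fract (s - c) :=
    measurable_fract.comp (measurable_id.sub_const c)
  refine ⟨hm, ?_⟩
  ext s hs
  have hA : MeasurableSet (Int.fract ⁻¹' s : Set ℝ) := measurable_fract hs
  rw [Measure.map_apply hm hs]
  have h1 : unitMeasure ((fun s => Int.fract (s - c)) ⁻¹' s)
      = volume ((Int.fract ⁻¹' s : Set ℝ) ∩ Ioc (-c) (-c + 1)) := by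
    rw [unitMeasure_eq_Ioc, Measure.restrict_apply (hm hs),
      ← (measurePreserving_sub_right volume c).measure_preimage
        (hA.inter measurableSet_Ioc).nullMeasurableSet]
    congr 1
    ext x
    simp only [mem_inter_iff, mem_preimage, mem_Ioc]
    constructor
    · rintro ⟨a, b, e⟩
      exact ⟨a, by linarith, by linarith⟩
    · rintro ⟨a, b, e⟩
      exact ⟨a, by linarith, by linarith⟩
  have h2 := (isAddFundamentalDomain_Ioc (one_pos : (0 : ℝ) < 1) (-c) volume).measure_set_eq
    (isAddFundamentalDomain_Ioc (one_pos : (0 : ℝ) < 1) 0 volume) hA (by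
      rintro ⟨g, hg⟩
      obtain ⟨z, rfl⟩ := AddSubgroup.mem_zmultiples_iff.1 hg
      ext x
      simp [AddSubgroup.vadd_def])
  rw [h1, h2, zero_add, ← Measure.restrict_apply hA, ← unitMeasure_eq_Ioc]
  refine measure_congr ?_
  filter_upwards [ae_restrict_mem measurableSet_Ioo] with x hx
  have : Int.fract x = x := Int.fract_eq_self.2 ⟨hx.1.le, hx.2⟩
  change (Int.fract x ∈ s) = (x ∈ s)
  rw [this]

variable {d : ℕ}

/-- The translate of a function by `c`. -/
def translate (c : Fin d → ℝ) (f : (Fin d → ℝ) → ℝ) (x : Fin d → ℝ) : ℝ := f (x - c)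

lemma measurePreserving_fract (c : Fin d → ℝ) :
    MeasurePreserving (fun (x : Fin d → ℝ) i => Int.fract (x i - c i)) (cubeMeasure d)
      (cubeMeasure d) := by
  rw [cubeMeasure_eq_pi]
  exact measurePreserving_pi _ _ fun i => measurePreserving_fract_sub (c i)

lemma UnitPeriodic.translate_eq {f : (Fin d → ℝ) → ℝ} (hf : UnitPeriodic f) (c : Fin d → ℝ) :
    translate c f = f ∘ fun x i => Int.fract (x i - c i) := by
  ext x
  simp only [translate, Function.comp_apply]
  rw [hf.eq_fract]
  rfl

lemma UnitPeriodic.integral_translate {f : (Fin d → ℝ) → ℝ} (hf : UnitPeriodic f)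
    (hm : AEStronglyMeasurable f (cubeMeasure d)) (c : Fin d → ℝ) :
    ∫ x in cube d, translate c f x = ∫ x in cube d, f x := by
  have h := measurePreserving_fract c
  conv_rhs => rw [show volume.restrict (cube d) = cubeMeasure d from rfl, ← h.map_eq]
  rw [integral_map h.measurable.aemeasurable (by rw [h.map_eq]; exact hm), hf.translate_eq]
  rfl

lemma UnitPeriodic.memLp_translate {f : (Fin d → ℝ) → ℝ} (hf : UnitPeriodic f) {p : ENNReal}
    (hm : MemLp f p (cubeMeasure d)) (c : Fin d → ℝ) : MemLp (translate c f) p (cubeMeasure d) := by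
  rw [hf.translate_eq]
  exact hm.comp_measurePreserving (measurePreserving_fract c)

lemma UnitPeriodic.translate {f : (Fin d → ℝ) → ℝ} (hf : UnitPeriodic f) (c : Fin d → ℝ) :
    UnitPeriodic (translate c f) := fun i x => by
  simp only [SparseDG.translate, add_sub_right_comm]
  exact hf i _

lemma UnitPeriodic.l2Norm_translate {f : (Fin d → ℝ) → ℝ} (hf : UnitPeriodic f)
    (hm : AEStronglyMeasurable f (cubeMeasure d)) (c : Fin d → ℝ) :
    l2Norm (cube d) (SparseDG.translate c f) = l2Norm (cube d) f := by
  have h : UnitPeriodic fun x => f x ^ 2 := fun i x => by simp only [hf i x]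
  rw [l2Norm, l2Norm, ← h.integral_translate (hm.pow 2) c]
  rfl

lemma contDiff_translate {f : (Fin d → ℝ) → ℝ} (hf : ContDiff ℝ ∞ f) (c : Fin d → ℝ) :
    ContDiff ℝ ∞ (translate c f) := hf.comp (contDiff_id.sub contDiff_const)

lemma partialDeriv_translate (f : (Fin d → ℝ) → ℝ) (c : Fin d → ℝ) (m : Fin d) :
    partialDeriv m (translate c f) = translate c (partialDeriv m f) := by
  ext x
  simp only [partialDeriv, translate]
  rw [← fderiv_comp_sub]
  rfl

lemma iterate_partialDeriv_translate (f : (Fin d → ℝ) → ℝ) (c : Fin d → ℝ) (m : Fin d) (n : ℕ) :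
    (partialDeriv m)^[n] (translate c f) = translate c ((partialDeriv m)^[n] f) := by
  induction n with
  | zero => rfl
  | succ n ih => rw [Function.iterate_succ_apply', ih, partialDeriv_translate,
      Function.iterate_succ_apply']

lemma fderiv_apply_eq_sum (f : (Fin d → ℝ) → ℝ) (x c : Fin d → ℝ) :
    fderiv ℝ f x c = ∑ m, c m * partialDeriv m f x := by
  conv_lhs => rw [pi_eq_sum_univ' c]
  rw [map_sum]
  refine Finset.sum_congr rfl fun m _ => ?_
  rw [map_smul, smul_eq_mul, partialDeriv]

/-- The smooth solution of the transport equation satisfies the weak equation against every bounded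
function. -/
lemma hasDerivAt_integral_translate {v b : (Fin d → ℝ) → ℝ} (hv : ContDiff ℝ ∞ v)
    (hvp : UnitPeriodic v) (hb : BddMeas b) (a : Fin d → ℝ) (t : ℝ) :
    HasDerivAt (fun s => ∫ x in cube d, translate (s • a) v x * b x)
      (-∫ x in cube d, (∑ m, a m * partialDeriv m (translate (t • a) v) x) * b x) t := by
  have hvb : ∀ c, BddMeas (translate c v) := fun c =>
    (hvp.translate c).bddMeas (contDiff_translate hv c).continuous
  have hdb : ∀ m c, BddMeas (translate c (partialDeriv m v)) := fun m c =>
    ((hvp.partialDeriv m).translate c).bddMeas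
      (contDiff_translate (contDiff_partialDeriv hv m) c).continuous
  have hgb : BddMeas fun x => ∑ m, a m * partialDeriv m v x := BddMeas.sum _ fun m _ =>
    ((hvp.partialDeriv m).bddMeas (contDiff_partialDeriv hv m).continuous).const_mul _
  obtain ⟨C, hC⟩ := hgb.bdd
  obtain ⟨D, hD⟩ := hb.bdd
  have hF' : ∀ s : ℝ, BddMeas fun x => -(∑ m, a m * partialDeriv m (translate (s • a) v) x) * b x
      := by
    intro s
    simp only [partialDeriv_translate]
    exact (BddMeas.sum _ fun m _ => (hdb m _).const_mul _).neg.mul hb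
  have h := (hasDerivAt_integral_of_dominated_loc_of_deriv_le (μ := cubeMeasure d) (𝕜 := ℝ)
    (F := fun (s : ℝ) x => translate (s • a) v x * b x)
    (F' := fun (s : ℝ) x => -(∑ m, a m * partialDeriv m (translate (s • a) v) x) * b x)
    (x₀ := t) (s := univ) (bound := fun _ => C * D) Filter.univ_mem
    (Filter.Eventually.of_forall fun s => ((hvb _).mul hb).measurable.aestronglyMeasurable)
    ((hvb _).mul hb).integrable (hF' t).measurable.aestronglyMeasurable
    (Filter.Eventually.of_forall fun x s _ => by
      simp only [partialDeriv_translate, translate]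
      rw [norm_mul, norm_neg]
      exact mul_le_mul (hC _) (hD _) (abs_nonneg _) ((abs_nonneg _).trans (hC 0)))
    (integrable_const _)
    (Filter.Eventually.of_forall fun x s _ => by
      refine HasDerivAt.mul_const ?_ _
      have h1 : HasDerivAt (fun s : ℝ => x - s • a) (-a) s := by
        simpa using ((hasDerivAt_id s).smul_const a).const_sub x
      have h2 := ((hv.differentiable (by simp)) (x - s • a)).hasFDerivAt.comp_hasDerivAt s h1
      refine h2.congr_deriv ?_
      rw [map_neg, fderiv_apply_eq_sum]
      simp only [partialDeriv_translate, translate])).2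
  refine h.congr_deriv ?_
  rw [← integral_neg]
  simp only [neg_mul]

/-! ### Projection onto finite-dimensional spaces of bounded functions -/

/-- Expansion of the elements of a space of piecewise polynomials in an orthonormal basis. Functions
are not identified almost everywhere, and the expansion holds at every point. -/
lemma exists_orthonormal_basis {N k : ℕ} {S : Submodule ℝ ((Fin d → ℝ) → ℝ)}
    (hS : S ≤ fullSpace d N k) : ∃ (n : ℕ) (b : Fin n → (Fin d → ℝ) → ℝ), (∀ i, b i ∈ S) ∧
      (∀ i j, ∫ x in cube d, b i x * b j x = if i = j then 1 else 0) ∧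
      ∀ z ∈ S, z = fun x => ∑ i, (∫ y in cube d, z y * b i y) * b i x := by
  have hfd : FiniteDimensional ℝ S :=
    Submodule.finiteDimensional_of_le hS
  have hbm : ∀ z : S, BddMeas (z : (Fin d → ℝ) → ℝ) := fun z => bddMeas_of_mem_fullSpace (hS z.2)
  -- A piecewise polynomial of norm zero vanishes identically, so the `L²` product is definite.
  let core : InnerProductSpace.Core ℝ S :=
    { inner := fun f g => ∫ x in cube d, (f : (Fin d → ℝ) → ℝ) x * (g : (Fin d → ℝ) → ℝ) x
      conj_inner_symm := fun f g => by
        simp only [conj_trivial]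
        congr 1; ext x; ring
      re_inner_nonneg := fun f => integral_nonneg fun x => mul_self_nonneg _
      add_left := fun f g h => by
        rw [← integral_add ((hbm f).mul (hbm h)).integrable ((hbm g).mul (hbm h)).integrable]
        congr 1; ext x; simp only [Submodule.coe_add, Pi.add_apply]; ring
      smul_left := fun f g r => by
        simp only [conj_trivial]
        rw [← integral_const_mul]
        congr 1; ext x; simp only [Submodule.coe_smul, Pi.smul_apply, smul_eq_mul]; ring
      definite := fun f hf => by
        have h0 : (fun x => (f : (Fin d → ℝ) → ℝ) x * (f : (Fin d → ℝ) → ℝ) x)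
            =ᵐ[cubeMeasure d] 0 :=
          (integral_eq_zero_iff_of_nonneg (fun x => mul_self_nonneg _)
            ((hbm f).mul (hbm f)).integrable).1 hf
        refine Subtype.ext (eq_zero_of_mem_fullSpace (hS f.2) ?_)
        filter_upwards [h0] with x hx
        exact mul_self_eq_zero.1 hx }
  let _ : NormedAddCommGroup S := core.toNormedAddCommGroup
  let _ : InnerProductSpace ℝ S := InnerProductSpace.ofCore core.toCore
  let B := stdOrthonormalBasis ℝ S
  have hin : ∀ f g : S, inner ℝ f g
      = ∫ x in cube d, (f : (Fin d → ℝ) → ℝ) x * (g : (Fin d → ℝ) → ℝ) x := fun _ _ => rfl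
  refine ⟨_, fun i => B i, fun i => (B i).2, fun i j => ?_, fun z hz => ?_⟩
  · rw [← hin]
    exact orthonormal_iff_ite.1 B.orthonormal i j
  · have h := congrArg (Subtype.val) (B.sum_repr' ⟨z, hz⟩)
    ext x
    rw [Submodule.coe_sum] at h
    have h' := congrFun h x
    simp only [Finset.sum_apply, Submodule.coe_smul, Pi.smul_apply, smul_eq_mul, hin] at h'
    rw [← h']
    refine Finset.sum_congr rfl fun i _ => ?_
    congr 2
    ext y; ring

section Proj
variable {N k : ℕ} {S : Submodule ℝ ((Fin d → ℝ) → ℝ)}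

lemma integrable_mul_of_memLp {u v : (Fin d → ℝ) → ℝ} {U : Set (Fin d → ℝ)}
    (hu : MemLp u 2 (volume.restrict U)) (hv : MemLp v 2 (volume.restrict U)) :
    Integrable (fun x => u x * v x) (volume.restrict U) := hu.integrable_mul hv

/-- Existence of the projection. -/
lemma exists_isL2Proj (hS : S ≤ fullSpace d N k) {u : (Fin d → ℝ) → ℝ}
    (hu : MemLp u 2 (cubeMeasure d)) : ∃ w, IsL2Proj S u w := by
  obtain ⟨n, b, hb, hbo, hexp⟩ := exists_orthonormal_basis hS
  have hbm : ∀ i, BddMeas (b i) := fun i => bddMeas_of_mem_fullSpace (hS (hb i))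
  set w : (Fin d → ℝ) → ℝ := fun x => ∑ i, (∫ y in cube d, u y * b i y) * b i x with hw
  have hwm : BddMeas w := BddMeas.sum _ fun i _ => (hbm i).const_mul _
  have hwS : w ∈ S := by
    have : w = ∑ i, (∫ y in cube d, u y * b i y) • b i := by
      ext x; simp [hw, Finset.sum_apply]
    rw [this]
    exact Submodule.sum_mem _ fun i _ => Submodule.smul_mem _ _ (hb i)
  have hwb : ∀ i, ∫ x in cube d, w x * b i x = ∫ y in cube d, u y * b i y := by
    intro i
    simp only [hw, Finset.sum_mul, mul_assoc]
    rw [integral_finsetSum _ fun j _ => (((hbm j).mul (hbm i)).const_mul _).integrable]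
    simp only [integral_const_mul, hbo, mul_ite, mul_one, mul_zero, Finset.sum_ite_eq',
      Finset.mem_univ, if_true]
  refine ⟨w, hwS, fun z hz => ?_⟩
  have hi : ∀ i, Integrable (fun x => (w x - u x) * b i x) (cubeMeasure d) := fun i =>
    integrable_mul_of_memLp ((hwm.memLp 2).sub hu) ((hbm i).memLp 2)
  rw [hexp z hz]
  have h1 : ∀ x, (w x - u x) * ∑ i, (∫ y in cube d, z y * b i y) * b i x
      = ∑ i, (∫ y in cube d, z y * b i y) * ((w x - u x) * b i x) := fun x => by
    rw [Finset.mul_sum]; exact Finset.sum_congr rfl fun i _ => by ring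
  simp only [h1]
  rw [integral_finsetSum _ fun i _ => (hi i).const_mul _]
  refine Finset.sum_eq_zero fun i _ => ?_
  rw [integral_const_mul]
  simp only [sub_mul]
  rw [integral_sub ((hwm.mul (hbm i)).integrable)
    (integrable_mul_of_memLp hu ((hbm i).memLp 2)), hwb i, sub_self, mul_zero]

lemma IsL2Proj.memLp (hS : S ≤ fullSpace d N k) {u w : (Fin d → ℝ) → ℝ} (h : IsL2Proj S u w) :
    MemLp w 2 (cubeMeasure d) := (bddMeas_of_mem_fullSpace (hS h.1)).memLp 2

lemma IsL2Proj.integral_eq (hS : S ≤ fullSpace d N k) {u w z : (Fin d → ℝ) → ℝ}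
    (h : IsL2Proj S u w) (hu : MemLp u 2 (cubeMeasure d)) (hz : z ∈ S) :
    ∫ x in cube d, w x * z x = ∫ x in cube d, u x * z x := by
  have hzm := (bddMeas_of_mem_fullSpace (hS hz)).memLp (ν := cubeMeasure d) 2
  have h1 := h.2 z hz
  simp only [sub_mul] at h1
  rw [integral_sub (integrable_mul_of_memLp (h.memLp hS) hzm) (integrable_mul_of_memLp hu hzm)]
    at h1
  linarith

/-- The projection is a contraction. -/
lemma IsL2Proj.l2Norm_le (hS : S ≤ fullSpace d N k) {u w : (Fin d → ℝ) → ℝ}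
    (h : IsL2Proj S u w) (hu : MemLp u 2 (cubeMeasure d)) :
    l2Norm (cube d) w ≤ l2Norm (cube d) u := by
  have h1 : l2Norm (cube d) w ^ 2 = ∫ x in cube d, u x * w x := by
    rw [l2Norm_sq, ← h.integral_eq hS hu h.1]
    simp only [pow_two]
  have h2 := (le_abs_self _).trans (abs_integral_mul_le_l2Norm hu (h.memLp hS))
  rw [← h1] at h2
  by_contra! hc
  have := l2Norm_nonneg (cube d) u
  nlinarith

lemma IsL2Proj.sub (hS : S ≤ fullSpace d N k) {u v w z : (Fin d → ℝ) → ℝ} (h : IsL2Proj S u w)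
    (h' : IsL2Proj S v z) (hu : MemLp u 2 (cubeMeasure d)) (hv : MemLp v 2 (cubeMeasure d)) :
    IsL2Proj S (fun x => u x - v x) (fun x => w x - z x) := by
  refine ⟨Submodule.sub_mem _ h.1 h'.1, fun y hy => ?_⟩
  have hym := (bddMeas_of_mem_fullSpace (hS hy)).memLp (ν := cubeMeasure d) 2
  have e : ∀ x, (w x - z x - (u x - v x)) * y x = (w x - u x) * y x - (z x - v x) * y x :=
    fun x => by ring
  simp only [e]
  have i1 : Integrable (fun x => (w x - u x) * y x) (cubeMeasure d) :=
    integrable_mul_of_memLp ((h.memLp hS).sub hu) hym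
  have i2 : Integrable (fun x => (z x - v x) * y x) (cubeMeasure d) :=
    integrable_mul_of_memLp ((h'.memLp hS).sub hv) hym
  rw [integral_sub i1 i2, h.2 y hy, h'.2 y hy, sub_zero]

/-- The projection is the best approximation. -/
lemma IsL2Proj.l2Norm_sub_le (hS : S ≤ fullSpace d N k) {u w z : (Fin d → ℝ) → ℝ}
    (h : IsL2Proj S u w) (hu : MemLp u 2 (cubeMeasure d)) (hz : z ∈ S) :
    l2Norm (cube d) (fun x => w x - u x) ≤ l2Norm (cube d) (fun x => z x - u x) := by
  have hw := h.memLp hS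
  have hzm := (bddMeas_of_mem_fullSpace (hS hz)).memLp (ν := cubeMeasure d) 2
  have h0 := h.2 (fun x => w x - z x) (Submodule.sub_mem _ h.1 hz)
  have h1 : l2Norm (cube d) (fun x => w x - u x) ^ 2
      = ∫ x in cube d, (w x - u x) * (z x - u x) := by
    have i1 : Integrable (fun x => (w x - u x) ^ 2) (cubeMeasure d) := (hw.sub hu).integrable_sq
    have i2 : Integrable (fun x => (w x - u x) * (z x - u x)) (cubeMeasure d) :=
      integrable_mul_of_memLp (hw.sub hu) (hzm.sub hu)
    rw [l2Norm_sq, ← sub_eq_zero, ← integral_sub i1 i2, ← h0]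
    congr 1; ext x; ring
  have h2 := (le_abs_self _).trans (abs_integral_mul_le_l2Norm (hw.sub hu) (hzm.sub hu))
  simp only [Pi.sub_apply] at h2
  rw [← h1] at h2
  by_contra! hc
  have h3 := l2Norm_nonneg (cube d) (fun x => z x - u x)
  have h4 : l2Norm (cube d) (fun x => w x - u x) ^ 2 ≤ l2Norm (cube d) (fun x => w x - u x)
    * l2Norm (cube d) (fun x => z x - u x) := h2
  nlinarith

end Proj

/-! ### The error equation of the scheme -/

section Evolution
variable {d : ℕ}

/-- A family of smooth periodic functions `g L = ∏_{i ∈ L} ∂_i^r v` of mixed derivatives of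
`v = g ∅`, bounded by `B` in `L²` for non-empty `L`. -/
structure IsMixedFamily (r : ℕ) (g : Finset (Fin d) → (Fin d → ℝ) → ℝ) (B : ℝ) : Prop where
  contDiff : ∀ L, ContDiff ℝ ∞ (g L)
  periodic : ∀ L, UnitPeriodic (g L)
  step : ∀ L m, m ∉ L → (partialDeriv m)^[r] (g L) = g (insert m L)
  nonneg : 0 ≤ B
  l2Norm_le : ∀ L : Finset (Fin d), L.Nonempty → l2Norm (cube d) (g L) ≤ B

lemma IsMixedFamily.bddMeas {r : ℕ} {g : Finset (Fin d) → (Fin d → ℝ) → ℝ} {B : ℝ}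
    (h : IsMixedFamily r g B) (L : Finset (Fin d)) : BddMeas (g L) :=
  (h.periodic L).bddMeas (h.contDiff L).continuous

lemma IsMixedFamily.translate {r : ℕ} {g : Finset (Fin d) → (Fin d → ℝ) → ℝ} {B : ℝ}
    (h : IsMixedFamily r g B) (c : Fin d → ℝ) :
    IsMixedFamily r (fun L => SparseDG.translate c (g L)) B where
  contDiff L := contDiff_translate (h.contDiff L) c
  periodic L := (h.periodic L).translate c
  step L m hm := by rw [iterate_partialDeriv_translate, h.step L m hm]
  nonneg := h.nonneg
  l2Norm_le L hL := by
    rw [(h.periodic L).l2Norm_translate (h.bddMeas L).measurable.aestronglyMeasurable]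
    exact h.l2Norm_le L hL

/-- The bound of the sparse approximation error. -/
def sparseErr (d k q N : ℕ) (B : ℝ) : ℝ :=
  (sparseConst k q * (N + 1)) ^ d * (1 / 2 ^ N) ^ (q + 1) * B

/-- The bound `h^{q+1} B` of a one-dimensional error is below that of the sparse error. -/
lemma pow_mul_le_sparseErr (d k q N : ℕ) {B : ℝ} (hB : 0 ≤ B) :
    (1 / 2 ^ N) ^ (q + 1) * B ≤ sparseErr d k q N B := by
  have h1 : 1 ≤ (sparseConst k q * ((N : ℝ) + 1)) ^ d := by
    refine one_le_pow₀ ?_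
    nlinarith [one_le_sparseConst k q, (Nat.cast_nonneg N : (0 : ℝ) ≤ N)]
  have h2 : (0 : ℝ) ≤ (1 / 2 ^ N) ^ (q + 1) * B := by positivity
  unfold sparseErr
  nlinarith

/-- The sparse space approximates `g ∅` with error at most `sparseErr`. -/
lemma IsMixedFamily.exists_approx {k q N : ℕ} (hq : q ≤ k)
    {g : Finset (Fin d) → (Fin d → ℝ) → ℝ} {B : ℝ} (h : IsMixedFamily (q + 1) g B) :
    ∃ z ∈ sparseSpace d N k, l2Norm (cube d) (fun x => z x - g ∅ x) ≤ sparseErr d k q N B := by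
  refine ⟨_, sparseOp_mem_sparseSpace k N (h.bddMeas ∅), ?_⟩
  rw [l2Norm_sub_comm]
  have := l2Norm_sub_sparseOp_le hq h.contDiff h.bddMeas h.step h.nonneg h.l2Norm_le
    (List.finRange d) (List.nodup_finRange d) ∅ (by simp) N
  simpa [sparseErr] using this

/-- The right-hand side of the energy inequality. -/
lemma energy_rhs_le {k q N : ℕ} (hq : q ≤ k) (a : EuclideanSpace ℝ (Fin d))
    {g : Finset (Fin d) → (Fin d → ℝ) → ℝ} {B : ℝ} (h : IsMixedFamily (q + 1) g B)
    {w e : (Fin d → ℝ) → ℝ} (hw : IsL2Proj (sparseSpace d N k) (g ∅) w)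
    (he : e ∈ sparseSpace d N k) :
    dgForm a N (fun x => w x + e x) e
        + ∫ x in cube d, (∑ m, a m * partialDeriv m (g ∅) x) * e x
      ≤ (∑ m, |a m|) * (10 * reproBound k ^ 2 * 2 ^ N * sparseErr d k q N B ^ 2) := by
  have hS := sparseSpace_le_fullSpace d N k
  refine (dgForm_energy_le a (hS hw.1) (hS he) (h.contDiff ∅) (h.periodic ∅)).trans ?_
  rw [Finset.sum_mul]
  refine Finset.sum_le_sum fun m _ => ?_
  -- The volume term vanishes: the cellwise derivative of `e` is in the sparse space.
  have h0 : ∫ x in cube d, (w x - g ∅ x) * brokenDeriv k N m e x = 0 :=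
    hw.2 _ (derivOp_mem_sparseSpace he m)
  rw [h0, mul_zero, zero_add]
  obtain ⟨z, hz, hzX⟩ := h.exists_approx (N := N) hq
  have hwX := (hw.l2Norm_sub_le hS ((h.bddMeas ∅).memLp 2) hz).trans hzX
  have hstep := h.step ∅ m (by simp)
  have hg1 : l2Norm (cube d) ((partialDeriv m)^[q + 1] (g ∅)) ≤ B := by
    rw [hstep]; exact h.l2Norm_le _ (Finset.insert_nonempty _ _)
  have ht := integral_traceError_le hq m (hS hw.1) (h.contDiff ∅) (h.periodic ∅)
  set X := sparseErr d k q N B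
  have hX := pow_mul_le_sparseErr d k q N h.nonneg
  have hn1 := l2Norm_nonneg (cube d) (fun x => w x - g ∅ x)
  have hn2 := l2Norm_nonneg (cube d) ((partialDeriv m)^[q + 1] (g ∅))
  have b1 : l2Norm (cube d) (fun x => w x - g ∅ x) ^ 2 ≤ X ^ 2 := by gcongr
  have b2 : ((1 / 2 ^ N) ^ (q + 1)) ^ 2 * l2Norm (cube d) ((partialDeriv m)^[q + 1] (g ∅)) ^ 2
      ≤ X ^ 2 := by
    rw [← mul_pow]
    refine pow_le_pow_left₀ (by positivity) (le_trans ?_ hX) 2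
    gcongr
  calc |a m| / 2 * ∫ x in cube d, traceError N m w (g ∅) x
      ≤ |a m| / 2 * (2 ^ N * (4 * reproBound k ^ 2 * l2Norm (cube d) (fun x => w x - g ∅ x) ^ 2
        + 16 * reproBound k ^ 2 * ((1 / 2 ^ N) ^ (q + 1)) ^ 2
          * l2Norm (cube d) ((partialDeriv m)^[q + 1] (g ∅)) ^ 2)) := by gcongr
    _ ≤ |a m| / 2 * (2 ^ N * (4 * reproBound k ^ 2 * X ^ 2 + 16 * reproBound k ^ 2 * X ^ 2)) := by
        gcongr |a m| / 2 * (2 ^ N * (4 * reproBound k ^ 2 * ?_ + ?_))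
        rw [mul_assoc (16 * reproBound k ^ 2)]
        gcongr
    _ = _ := by ring

/-- A function on the half line whose derivative is at most `K` grows at most linearly. -/
lemma le_add_mul_of_hasDerivWithinAt {E E' : ℝ → ℝ} {K : ℝ}
    (hE : ∀ s, 0 ≤ s → HasDerivWithinAt E (E' s) (Ici 0) s) (hK : ∀ s, 0 ≤ s → E' s ≤ K) {t : ℝ}
    (ht : 0 ≤ t) : E t ≤ E 0 + K * t :=
  image_le_of_deriv_right_le_deriv_boundary (a := 0) (b := t) (f := E) (f' := E')
    (B := fun r => E 0 + K * r) (B' := fun _ => K)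
    (fun s hs => ((hE s hs.1).continuousWithinAt).mono Icc_subset_Ici_self)
    (fun s hs => (hE s hs.1).mono (Ici_subset_Ici.2 hs.1)) (by simp) (by fun_prop)
    (fun s _ => by
      simpa using (((hasDerivAt_id s).const_mul K).const_add (E 0)).hasDerivWithinAt)
    (fun s hs => hK s hs.1) (right_mem_Icc.2 ht)

lemma le_add_sqrt_mul_of_sq_le {A t R e e₀ X : ℝ} (hA : 0 ≤ A) (ht : 0 ≤ t) (hR : 0 ≤ R)
    (he₀ : 0 ≤ e₀) (hX : 0 ≤ X) (h : e ^ 2 ≤ e₀ ^ 2 + A * t * R * X ^ 2) :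
    e ≤ e₀ + √(A * t * R) * X := by
  refine le_of_sq_le_sq ?_ (by positivity)
  have h1 : √(A * t * R) ^ 2 = A * t * R := Real.sq_sqrt (by positivity)
  have h2 : 0 ≤ 2 * e₀ * (√(A * t * R) * X) := by positivity
  nlinarith

/-- The error estimate for smooth data: the discrete error grows like the square root of time. -/
lemma l2Norm_dg_sub_translate_le {k q N : ℕ} (hq : q ≤ k) (a : EuclideanSpace ℝ (Fin d))
    {g : Finset (Fin d) → (Fin d → ℝ) → ℝ} {B : ℝ} (h : IsMixedFamily (q + 1) g B)
    {uh : ℝ → (Fin d → ℝ) → ℝ} {u₀ : (Fin d → ℝ) → ℝ} (hdg : IsDGSolution a N k uh)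
    (hu₀ : MemLp u₀ 2 (cubeMeasure d)) (h0 : IsL2Proj (sparseSpace d N k) u₀ (uh 0))
    {t : ℝ} (ht : 0 ≤ t) :
    l2Norm (cube d) (fun x => uh t x - translate (t • ⇑a) (g ∅) x)
      ≤ l2Norm (cube d) (fun x => u₀ x - g ∅ x)
        + √((∑ m, |a m|) * t * (20 * reproBound k ^ 2 * 2 ^ N)) * sparseErr d k q N B
        + sparseErr d k q N B := by
  have hS := sparseSpace_le_fullSpace d N k
  set c : ℝ → Fin d → ℝ := fun s => s • ⇑a with hc
  set v : ℝ → (Fin d → ℝ) → ℝ := fun s => translate (c s) (g ∅) with hv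
  have hfam : ∀ s, IsMixedFamily (q + 1) (fun L => translate (c s) (g L)) B := fun s =>
    h.translate (c s)
  have hvb : ∀ s, BddMeas (v s) := fun s => (hfam s).bddMeas ∅
  have huhb : ∀ s, 0 ≤ s → BddMeas (uh s) := fun s hs =>
    bddMeas_of_mem_fullSpace (hS (hdg.mem s hs))
  -- The projection of the exact solution at each time; `e` is the part of the error in the sparse
  -- space.
  choose w hw using fun s => exists_isL2Proj hS ((hvb s).memLp (ν := cubeMeasure d) 2)
  have hwb : ∀ s, BddMeas (w s) := fun s => bddMeas_of_mem_fullSpace (hS (hw s).1)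
  set e : ℝ → (Fin d → ℝ) → ℝ := fun s x => uh s x - w s x with he
  have heS : ∀ s, 0 ≤ s → e s ∈ sparseSpace d N k := fun s hs =>
    Submodule.sub_mem _ (hdg.mem s hs) (hw s).1
  have heb : ∀ s, 0 ≤ s → BddMeas (e s) := fun s hs => (huhb s hs).sub (hwb s)
  set X := sparseErr d k q N B with hX
  set K : ℝ := 2 * ((∑ m, |a m|) * (10 * reproBound k ^ 2 * 2 ^ N * X ^ 2)) with hK
  obtain ⟨n, b, hb, hbo, hexp⟩ := exists_orthonormal_basis hS
  have hbm : ∀ i, BddMeas (b i) := fun i => bddMeas_of_mem_fullSpace (hS (hb i))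
  -- The coefficients of `e`. Testing with a fixed `b i` replaces `w` by `v`, so they are
  -- differentiable in time although nothing is known about the time dependence of `w`.
  set η : Fin n → ℝ → ℝ := fun i s => (∫ x in cube d, uh s x * b i x)
    - ∫ x in cube d, v s x * b i x with hη
  set η' : Fin n → ℝ → ℝ := fun i s => dgForm a N (uh s) (b i)
    + ∫ x in cube d, (∑ m, a m * partialDeriv m (v s) x) * b i x with hη'
  have hder : ∀ i s, 0 ≤ s → HasDerivWithinAt (η i) (η' i s) (Ici 0) s := by
    intro i s hs
    have h1 := hdg.eqn s hs (b i) (hb i)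
    have h2 := (hasDerivAt_integral_translate (h.contDiff ∅) (h.periodic ∅) (hbm i) (⇑a) s
      ).hasDerivWithinAt (s := Ici 0)
    refine (h1.sub h2).congr_deriv ?_
    simp only [hη', sub_neg_eq_add]
    rfl
  have hηe : ∀ i s, 0 ≤ s → η i s = ∫ x in cube d, e s x * b i x := by
    intro i s hs
    simp only [hη, he, sub_mul]
    rw [integral_sub ((huhb s hs).mul (hbm i)).integrable ((hwb s).mul (hbm i)).integrable,
      (hw s).integral_eq hS ((hvb s).memLp 2) (hb i)]
  have heexp : ∀ s, 0 ≤ s → e s = fun x => ∑ i, η i s * b i x := by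
    intro s hs
    conv_lhs => rw [hexp (e s) (heS s hs)]
    simp only [hηe _ s hs]
  have hsum : ∀ s, 0 ≤ s → ∀ f : (Fin d → ℝ) → ℝ, BddMeas f →
      ∫ x in cube d, f x * e s x = ∑ i, η i s * ∫ x in cube d, f x * b i x := by
    intro s hs f hf
    have e1 : ∀ x, f x * e s x = ∑ i, η i s * (f x * b i x) := by
      intro x
      conv_lhs => rw [heexp s hs]
      rw [Finset.mul_sum]
      exact Finset.sum_congr rfl fun i _ => by ring
    simp only [e1]
    rw [integral_finsetSum _ fun i _ => ((hf.mul (hbm i)).const_mul _).integrable]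
    simp only [integral_const_mul]
  -- Parseval
  have hE : ∀ s, 0 ≤ s → ∑ i, η i s ^ 2 = l2Norm (cube d) (e s) ^ 2 := by
    intro s hs
    rw [l2Norm_sq]
    simp only [pow_two]
    rw [hsum s hs _ (heb s hs)]
    exact Finset.sum_congr rfl fun i _ => by rw [← hηe i s hs]
  -- The form is linear in the test function because it is the derivative of a linear functional.
  have hlin : ∀ s, 0 ≤ s → dgForm a N (uh s) (e s) = ∑ i, η i s * dgForm a N (uh s) (b i) := by
    intro s hs
    have h1 := hdg.eqn s hs (e s) (heS s hs)
    have h2 : HasDerivWithinAt (fun r => ∑ i, η i s * ∫ x in cube d, uh r x * b i x)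
        (∑ i, η i s * dgForm a N (uh s) (b i)) (Ici 0) s :=
      HasDerivWithinAt.fun_sum fun i _ => (hdg.eqn s hs (b i) (hb i)).const_mul _
    have h3 := h2.congr (f₁ := fun r => ∫ x in cube d, uh r x * e s x)
      (fun r hr => hsum s hs _ (huhb r hr)) (hsum s hs _ (huhb s hs))
    exact (uniqueDiffOn_Ici (0 : ℝ) s hs).eq_deriv _ h1 h3
  have hbound : ∀ s, 0 ≤ s → ∑ i, 2 * η i s * η' i s ≤ K := by
    intro s hs
    have h1 := energy_rhs_le hq a (hfam s) (hw s) (heS s hs)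
    have h2 : (fun x => w s x + e s x) = uh s := by ext x; simp [he]
    have hgb : BddMeas fun x => ∑ m, a m * partialDeriv m (v s) x := BddMeas.sum _ fun m _ =>
      ((((hfam s).periodic ∅).partialDeriv m).bddMeas
        (contDiff_partialDeriv ((hfam s).contDiff ∅) m).continuous).const_mul _
    rw [h2, hlin s hs, hsum s hs _ hgb, ← Finset.sum_add_distrib] at h1
    have h3 : ∑ i, 2 * η i s * η' i s = 2 * ∑ i, (η i s * dgForm a N (uh s) (b i)
        + η i s * ∫ x in cube d, (∑ m, a m * partialDeriv m (v s) x) * b i x) := by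
      rw [Finset.mul_sum]
      refine Finset.sum_congr rfl fun i _ => ?_
      simp only [hη']
      ring
    rw [h3, hK]
    exact mul_le_mul_of_nonneg_left h1 zero_le_two
  have hEder : ∀ s, 0 ≤ s → HasDerivWithinAt (fun r => ∑ i, η i r ^ 2)
      (∑ i, 2 * η i s * η' i s) (Ici 0) s := by
    intro s hs
    refine HasDerivWithinAt.fun_sum fun i _ => ?_
    refine ((hder i s hs).pow 2).congr_deriv ?_
    simp
  -- The derivative of `‖e‖²` is bounded by the constant `K`.
  have hgrow := le_add_mul_of_hasDerivWithinAt hEder hbound ht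
  simp only [hE t ht, hE 0 le_rfl] at hgrow
  have hX0 : 0 ≤ X := le_trans (by have := h.nonneg; positivity)
    (pow_mul_le_sparseErr d k q N h.nonneg)
  have ha0 : 0 ≤ ∑ m, |a m| := Finset.sum_nonneg fun m _ => abs_nonneg _
  have het : l2Norm (cube d) (e t) ≤ l2Norm (cube d) (e 0)
      + √((∑ m, |a m|) * t * (20 * reproBound k ^ 2 * 2 ^ N)) * X := by
    refine le_add_sqrt_mul_of_sq_le ha0 ht (by positivity) (l2Norm_nonneg _ _) hX0 ?_
    refine hgrow.trans (le_of_eq ?_)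
    rw [hK]; ring
  -- Both `uh 0` and `w 0` are projections, and the projection is a contraction.
  have he0 : l2Norm (cube d) (e 0) ≤ l2Norm (cube d) (fun x => u₀ x - g ∅ x) := by
    have h1 := (h0.sub hS (hw 0) hu₀ ((hvb 0).memLp 2)).l2Norm_le hS
      (hu₀.sub ((hvb 0).memLp 2))
    have h2 : v 0 = g ∅ := by ext x; simp [hv, hc, translate]
    rw [h2] at h1
    exact h1
  have hwX : l2Norm (cube d) (fun x => w t x - v t x) ≤ X := by
    obtain ⟨z, hz, hzX⟩ := (hfam t).exists_approx (N := N) hq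
    exact ((hw t).l2Norm_sub_le hS ((hvb t).memLp 2) hz).trans hzX
  have htri := l2Norm_sub_le_sub (U := cube d) ((huhb t ht).memLp 2) ((hwb t).memLp 2)
    ((hvb t).memLp 2)
  have : l2Norm (cube d) (fun x => uh t x - w t x) = l2Norm (cube d) (e t) := rfl
  change l2Norm (cube d) (fun x => uh t x - v t x) ≤ _
  linarith

end Evolution

/-! ### Classical derivatives of higher order -/

section MultiDeriv
variable {d : ℕ}

lemma iterate_partialDeriv_comm {f : (Fin d → ℝ) → ℝ} (hf : ContDiff ℝ ∞ f) (i j : Fin d)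
    (a b : ℕ) : (partialDeriv i)^[a] ((partialDeriv j)^[b] f)
      = (partialDeriv j)^[b] ((partialDeriv i)^[a] f) := by
  have h1 : ∀ b : ℕ, ∀ g : (Fin d → ℝ) → ℝ, ContDiff ℝ ∞ g →
      partialDeriv i ((partialDeriv j)^[b] g) = (partialDeriv j)^[b] (partialDeriv i g) := by
    intro b
    induction b with
    | zero => intro g _; rfl
    | succ b ih =>
      intro g hg
      rw [Function.iterate_succ_apply', partialDeriv_comm (contDiff_iterate_partialDeriv hg j b),
        ih g hg, Function.iterate_succ_apply']
  induction a with
  | zero => rfl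
  | succ a ih =>
    rw [Function.iterate_succ_apply', ih, h1 b _ (contDiff_iterate_partialDeriv hf i a),
      Function.iterate_succ_apply']

/-- The composition of the derivatives `∂_i^{α_i}` over a list of directions. -/
def listDeriv (α : Fin d → ℕ) (l : List (Fin d)) (f : (Fin d → ℝ) → ℝ) : (Fin d → ℝ) → ℝ :=
  l.foldr (fun i g => (partialDeriv i)^[α i] g) f

lemma listDeriv_cons (α : Fin d → ℕ) (i : Fin d) (l : List (Fin d)) (f : (Fin d → ℝ) → ℝ) :
    listDeriv α (i :: l) f = (partialDeriv i)^[α i] (listDeriv α l f) := rfl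

lemma contDiff_listDeriv {f : (Fin d → ℝ) → ℝ} (hf : ContDiff ℝ ∞ f) (α : Fin d → ℕ)
    (l : List (Fin d)) : ContDiff ℝ ∞ (listDeriv α l f) := by
  induction l with
  | nil => exact hf
  | cons i l ih => exact contDiff_iterate_partialDeriv ih i _

lemma contDiff_multiDeriv {f : (Fin d → ℝ) → ℝ} (hf : ContDiff ℝ ∞ f) (α : Fin d → ℕ) :
    ContDiff ℝ ∞ (multiDeriv α f) := contDiff_listDeriv hf α _

lemma listDeriv_congr {α β : Fin d → ℕ} {l : List (Fin d)} (h : ∀ i ∈ l, α i = β i)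
    (f : (Fin d → ℝ) → ℝ) : listDeriv α l f = listDeriv β l f := by
  induction l with
  | nil => rfl
  | cons i l ih =>
    rw [listDeriv_cons, listDeriv_cons, h i (by simp), ih fun j hj => h j (by simp [hj])]

lemma listDeriv_update {f : (Fin d → ℝ) → ℝ} (hf : ContDiff ℝ ∞ f) (α : Fin d → ℕ) (m : Fin d)
    (r : ℕ) {l : List (Fin d)} (hl : l.Nodup) (hm : m ∈ l) :
    listDeriv (Function.update α m (α m + r)) l f = (partialDeriv m)^[r] (listDeriv α l f) := by
  induction l with
  | nil => simp at hm
  | cons i l ih =>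
    have hil := (List.nodup_cons.1 hl).1
    rw [listDeriv_cons, listDeriv_cons]
    by_cases h : i = m
    · subst h
      rw [Function.update_self, add_comm, Function.iterate_add_apply]
      congr 2
      refine listDeriv_congr (fun j hj => Function.update_of_ne ?_ _ _) f
      rintro rfl
      exact hil hj
    · have hm' : m ∈ l := by
        rcases List.mem_cons.1 hm with h' | h'
        · exact absurd h'.symm h
        · exact h'
      rw [Function.update_of_ne h, ih (List.nodup_cons.1 hl).2 hm',
        iterate_partialDeriv_comm (contDiff_listDeriv hf α l)]

/-- Raising one exponent of a mixed derivative. -/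
lemma multiDeriv_update {f : (Fin d → ℝ) → ℝ} (hf : ContDiff ℝ ∞ f) (α : Fin d → ℕ) (m : Fin d)
    (r : ℕ) : multiDeriv (Function.update α m (α m + r)) f
      = (partialDeriv m)^[r] (multiDeriv α f) :=
  listDeriv_update hf α m r (List.nodup_finRange d) (List.mem_finRange m)

lemma multiDeriv_zero (f : (Fin d → ℝ) → ℝ) : multiDeriv 0 f = f := by
  change listDeriv 0 (List.finRange d) f = f
  induction List.finRange d with
  | nil => rfl
  | cons i l ih => rw [listDeriv_cons, ih]; rfl

lemma UnitPeriodic.multiDeriv {f : (Fin d → ℝ) → ℝ} (hf : UnitPeriodic f) (α : Fin d → ℕ) :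
    UnitPeriodic (multiDeriv α f) := by
  change UnitPeriodic (listDeriv α (List.finRange d) f)
  induction List.finRange d with
  | nil => exact hf
  | cons i l ih => exact ih.iterate_partialDeriv i _

lemma tsupport_partialDeriv_subset (f : (Fin d → ℝ) → ℝ) (i : Fin d) :
    tsupport (partialDeriv i f) ⊆ tsupport f := by
  refine (closure_mono ?_).trans (tsupport_fderiv_subset ℝ (f := f))
  intro x hx
  simp only [Function.mem_support, partialDeriv] at hx ⊢
  intro h
  rw [h] at hx
  exact hx rfl

lemma tsupport_iterate_partialDeriv_subset (f : (Fin d → ℝ) → ℝ) (i : Fin d) (n : ℕ) :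
    tsupport ((partialDeriv i)^[n] f) ⊆ tsupport f := by
  induction n with
  | zero => exact subset_rfl
  | succ n ih =>
    rw [Function.iterate_succ_apply']
    exact (tsupport_partialDeriv_subset _ i).trans ih

lemma tsupport_multiDeriv_subset (f : (Fin d → ℝ) → ℝ) (α : Fin d → ℕ) :
    tsupport (multiDeriv α f) ⊆ tsupport f := by
  change tsupport (listDeriv α (List.finRange d) f) ⊆ tsupport f
  induction List.finRange d with
  | nil => exact subset_rfl
  | cons i l ih => exact (tsupport_iterate_partialDeriv_subset _ i _).trans ih

lemma HasCompactSupport.partialDeriv {f : (Fin d → ℝ) → ℝ} (hf : HasCompactSupport f) (i : Fin d) :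
    HasCompactSupport (SparseDG.partialDeriv i f) :=
  IsCompact.of_isClosed_subset hf (isClosed_tsupport _) (tsupport_partialDeriv_subset f i)

/-- The derivative of a composition with an affine map `t ↦ z + r t`. -/
lemma partialDeriv_comp_affine {f : (Fin d → ℝ) → ℝ} (hf : ContDiff ℝ ∞ f) (z : Fin d → ℝ)
    (c r : ℝ) (i : Fin d) : partialDeriv i (fun t => c * f (z + r • t))
      = fun t => (c * r) * partialDeriv i f (z + r • t) := by
  ext t
  have h1 : HasFDerivAt (fun t : Fin d → ℝ => z + r • t)
      (r • ContinuousLinearMap.id ℝ (Fin d → ℝ)) t :=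
    ((hasFDerivAt_id t).const_smul r).const_add z
  have h2 := (((hf.differentiable (by simp)) (z + r • t)).hasFDerivAt.comp t h1).const_mul c
  have h3 : fderiv ℝ (fun t => c * f (z + r • t)) t = _ := h2.fderiv
  simp only [partialDeriv]
  rw [h3]
  simp
  ring

lemma iterate_partialDeriv_comp_affine {f : (Fin d → ℝ) → ℝ} (hf : ContDiff ℝ ∞ f)
    (z : Fin d → ℝ) (c r : ℝ) (i : Fin d) (n : ℕ) :
    (partialDeriv i)^[n] (fun t => c * f (z + r • t))
      = fun t => (c * r ^ n) * (partialDeriv i)^[n] f (z + r • t) := by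
  induction n with
  | zero => simp
  | succ n ih =>
    rw [Function.iterate_succ_apply', ih,
      partialDeriv_comp_affine (contDiff_iterate_partialDeriv hf i n)]
    simp only [Function.iterate_succ_apply', pow_succ, mul_assoc]

lemma multiDeriv_comp_affine {f : (Fin d → ℝ) → ℝ} (hf : ContDiff ℝ ∞ f)
    (z : Fin d → ℝ) (r : ℝ) (α : Fin d → ℕ) :
    multiDeriv α (fun t => f (z + r • t))
      = fun t => r ^ (∑ i, α i) * multiDeriv α f (z + r • t) := by
  have key : ∀ l : List (Fin d), listDeriv α l (fun t => f (z + r • t))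
      = fun t => r ^ (l.map α).sum * listDeriv α l f (z + r • t) := by
    intro l
    induction l with
    | nil => ext t; simp [listDeriv]
    | cons i l ih =>
      rw [listDeriv_cons, ih, iterate_partialDeriv_comp_affine (contDiff_listDeriv hf α l)]
      ext t
      simp only [List.map_cons, List.sum_cons, listDeriv_cons, pow_add]
      ring
  have h := key (List.finRange d)
  rw [show ((List.finRange d).map α).sum = ∑ i, α i by rw [← List.sum_ofFn, List.ofFn_eq_map]] at h
  exact h

end MultiDeriv

/-! ### Mollification -/

section Mollify
variable {d : ℕ}
open scoped Convolution

/-- The convolution of `f` with `φ`. -/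
def mollify (f φ : (Fin d → ℝ) → ℝ) : (Fin d → ℝ) → ℝ :=
  f ⋆[ContinuousLinearMap.mul ℝ ℝ, volume] φ

lemma mollify_apply (f φ : (Fin d → ℝ) → ℝ) (x : Fin d → ℝ) :
    mollify f φ x = ∫ t, f t * φ (x - t) := rfl

lemma mollify_apply' (f φ : (Fin d → ℝ) → ℝ) (x : Fin d → ℝ) :
    mollify f φ x = ∫ y, φ y * f (x - y) := by
  rw [mollify_apply, ← integral_sub_left_eq_self _ volume x]
  simp only [sub_sub_cancel, mul_comm]

lemma contDiff_mollify {f φ : (Fin d → ℝ) → ℝ} (hf : LocallyIntegrable f)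
    (hφ : ContDiff ℝ ∞ φ) (hc : HasCompactSupport φ) : ContDiff ℝ ∞ (mollify f φ) :=
  hc.contDiff_convolution_right _ hf hφ

lemma partialDeriv_mollify {f φ : (Fin d → ℝ) → ℝ} (hf : LocallyIntegrable f)
    (hφ : ContDiff ℝ ∞ φ) (hc : HasCompactSupport φ) (i : Fin d) :
    partialDeriv i (mollify f φ) = mollify f (partialDeriv i φ) := by
  ext x
  have h := (hc.hasFDerivAt_convolution_right (ContinuousLinearMap.mul ℝ ℝ) hf
    (hφ.of_le (by exact_mod_cast le_top)) x).fderiv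
  simp only [partialDeriv, mollify]
  rw [h, convolution_precompR_apply _ hf (hc.fderiv ℝ) (hφ.continuous_fderiv (by simp))]
  rfl

lemma hasCompactSupport_iterate_partialDeriv {φ : (Fin d → ℝ) → ℝ} (hc : HasCompactSupport φ)
    (i : Fin d) (n : ℕ) : HasCompactSupport ((partialDeriv i)^[n] φ) :=
  IsCompact.of_isClosed_subset hc (isClosed_tsupport _) (tsupport_iterate_partialDeriv_subset φ i n)

lemma iterate_partialDeriv_mollify {f φ : (Fin d → ℝ) → ℝ} (hf : LocallyIntegrable f)
    (hφ : ContDiff ℝ ∞ φ) (hc : HasCompactSupport φ) (i : Fin d) (n : ℕ) :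
    (partialDeriv i)^[n] (mollify f φ) = mollify f ((partialDeriv i)^[n] φ) := by
  induction n with
  | zero => rfl
  | succ n ih =>
    rw [Function.iterate_succ_apply', ih, partialDeriv_mollify hf
      (contDiff_iterate_partialDeriv hφ i n) (hasCompactSupport_iterate_partialDeriv hc i n),
      Function.iterate_succ_apply']

lemma multiDeriv_mollify {f φ : (Fin d → ℝ) → ℝ} (hf : LocallyIntegrable f)
    (hφ : ContDiff ℝ ∞ φ) (hc : HasCompactSupport φ) (α : Fin d → ℕ) :
    multiDeriv α (mollify f φ) = mollify f (multiDeriv α φ) := by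
  have key : ∀ l : List (Fin d), HasCompactSupport (listDeriv α l φ) ∧
      listDeriv α l (mollify f φ) = mollify f (listDeriv α l φ) := by
    intro l
    induction l with
    | nil => exact ⟨hc, rfl⟩
    | cons i l ih =>
      refine ⟨hasCompactSupport_iterate_partialDeriv ih.1 i _, ?_⟩
      rw [listDeriv_cons, ih.2, iterate_partialDeriv_mollify hf (contDiff_listDeriv hφ α l) ih.1,
        listDeriv_cons]
  exact (key _).2

/-- Derivatives of a mollification are mollifications of the weak derivative, at the points where
the mollifier only sees the domain. -/
lemma multiDeriv_mollify_eq {f φ v G : (Fin d → ℝ) → ℝ} {U : Set (Fin d → ℝ)} (hU : IsOpen U)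
    (hf : LocallyIntegrable f) (hfv : ∀ x ∈ U, f x = v x) (hφ : ContDiff ℝ ∞ φ)
    (hc : HasCompactSupport φ) {α : Fin d → ℕ} (hG : HasWeakDeriv α U v G) {x : Fin d → ℝ}
    (hx : tsupport (fun t => φ (x - t)) ⊆ U) :
    multiDeriv α (mollify f φ) x = ∫ t in U, G t * φ (x - t) := by
  set ψ : (Fin d → ℝ) → ℝ := fun t => φ (x - t) with hψ
  have hψs : ContDiff ℝ ∞ ψ := hφ.comp (contDiff_const.sub contDiff_id)
  have hψc : HasCompactSupport ψ := hc.comp_homeomorph (Homeomorph.subLeft x)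
  have hder : ∀ t, multiDeriv α ψ t = (-1) ^ (∑ i, α i) * multiDeriv α φ (x - t) := by
    intro t
    have h := congrFun (multiDeriv_comp_affine hφ x (-1) α) t
    simpa [hψ, sub_eq_add_neg] using h
  have hsq : ((-1 : ℝ) ^ (∑ i, α i)) * (-1) ^ (∑ i, α i) = 1 := by
    rw [← mul_pow]; simp
  rw [multiDeriv_mollify hf hφ hc, mollify_apply]
  have h1 : ∀ t, f t * multiDeriv α φ (x - t) = (-1) ^ (∑ i, α i) * (f t * multiDeriv α ψ t) := by
    intro t
    rw [hder, mul_left_comm, ← mul_assoc _ _ (multiDeriv α φ (x - t)), mul_left_comm (f t), hsq,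
      one_mul]
  simp only [h1]
  rw [integral_const_mul]
  have h2 : ∫ t, f t * multiDeriv α ψ t = ∫ t in U, v t * multiDeriv α ψ t := by
    rw [← setIntegral_eq_integral_of_forall_compl_eq_zero (s := U)]
    · exact setIntegral_congr_fun hU.measurableSet fun t ht => by simp only [hfv t ht]
    · intro t ht
      have : multiDeriv α ψ t = 0 := by
        by_contra hne
        exact ht (hx (tsupport_multiDeriv_subset ψ α (subset_tsupport _ hne)))
      rw [this, mul_zero]
  -- The sign of the weak derivative cancels that of the reflection `t ↦ x - t`.
  rw [h2, hG.2.2 ψ hψs hψc hx, ← mul_assoc, hsq, one_mul]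

/-- A smooth probability density supported in the ball of radius `δ`. -/
structure IsMollifier (φ : (Fin d → ℝ) → ℝ) (δ : ℝ) : Prop where
  contDiff : ContDiff ℝ ∞ φ
  hasCompactSupport : HasCompactSupport φ
  nonneg : ∀ x, 0 ≤ φ x
  integral_eq : ∫ x, φ x = 1
  tsupport_subset : tsupport φ ⊆ Metric.closedBall 0 δ

lemma IsMollifier.norm_le {φ : (Fin d → ℝ) → ℝ} {δ : ℝ} (h : IsMollifier φ δ) {y : Fin d → ℝ}
    (hy : φ y ≠ 0) : ‖y‖ ≤ δ := by
  have := h.tsupport_subset (subset_tsupport _ hy)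
  simpa using this

lemma exists_isMollifier {δ : ℝ} (hδ : 0 < δ) : ∃ φ : (Fin d → ℝ) → ℝ, IsMollifier φ δ := by
  let b : ContDiffBump (0 : Fin d → ℝ) := ⟨δ / 2, δ, by positivity, by linarith⟩
  refine ⟨b.normed volume, b.contDiff_normed, b.hasCompactSupport_normed, b.nonneg_normed,
    b.integral_normed, ?_⟩
  rw [b.tsupport_normed_eq]

lemma IsMollifier.integrable_mul {φ : (Fin d → ℝ) → ℝ} {δ : ℝ} (h : IsMollifier φ δ)
    {f : (Fin d → ℝ) → ℝ} (hf : LocallyIntegrable f) (x : Fin d → ℝ) :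
    Integrable (fun y => φ y * f (x - y)) := by
  have h1 := (h.hasCompactSupport.convolutionExists_right (ContinuousLinearMap.mul ℝ ℝ) hf
    h.contDiff.continuous x).integrable_swap
  simpa [mul_comm] using h1

/-- Jensen's inequality for averages. -/
lemma eLpNorm_average_le {φ : (Fin d → ℝ) → ℝ} {δ : ℝ} (h : IsMollifier φ δ)
    {μ : Measure (Fin d → ℝ)} [SFinite μ] {F : (Fin d → ℝ) → (Fin d → ℝ) → ℝ}
    (hF : Measurable (Function.uncurry F)) {C : ENNReal}
    (hC : ∀ y, φ y ≠ 0 → eLpNorm (fun x => F x y) 2 μ ≤ C) :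
    eLpNorm (fun x => ∫ y, φ y * F x y) 2 μ ≤ C := by
  have hφm : Measurable fun y => ENNReal.ofReal (φ y) :=
    h.contDiff.continuous.measurable.ennreal_ofReal
  -- The average is an integral against the probability measure with density `φ`.
  set ν : Measure (Fin d → ℝ) := volume.withDensity fun y => ENNReal.ofReal (φ y) with hν
  have hφint : Integrable φ := by
    by_contra hn
    have := h.integral_eq
    rw [integral_undef hn] at this
    exact zero_ne_one this
  have hνp : IsProbabilityMeasure ν := by
    refine ⟨?_⟩
    rw [hν, withDensity_apply _ MeasurableSet.univ, Measure.restrict_univ,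
      ← ofReal_integral_eq_lintegral_ofReal hφint (Filter.Eventually.of_forall h.nonneg),
      h.integral_eq, ENNReal.ofReal_one]
  have havg : ∀ x, ∫ y, φ y * F x y = ∫ y, F x y ∂ν := by
    intro x
    rw [hν, integral_withDensity_eq_integral_toReal_smul hφm
      (Filter.Eventually.of_forall fun _ => ENNReal.ofReal_lt_top)]
    refine integral_congr_ae (Filter.Eventually.of_forall fun y => ?_)
    simp only [smul_eq_mul, ENNReal.toReal_ofReal (h.nonneg y)]
  have hsq : ∀ (g : (Fin d → ℝ) → ℝ) (ρ : Measure (Fin d → ℝ)),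
      eLpNorm g 2 ρ ^ (2 : ℝ) = ∫⁻ x, ‖g x‖ₑ ^ (2 : ℝ) ∂ρ := by
    intro g ρ
    exact eLpNorm_nnreal_pow_eq_lintegral (p := 2) (by norm_num)
  have hpt : ∀ x, ‖∫ y, φ y * F x y‖ₑ ^ (2 : ℝ) ≤ ∫⁻ y, ‖F x y‖ₑ ^ (2 : ℝ) ∂ν := by
    intro x
    have hFx : Measurable (F x) := hF.comp (measurable_const.prodMk measurable_id)
    rw [havg, ← hsq]
    refine ENNReal.rpow_le_rpow ?_ (by norm_num)
    refine (enorm_integral_le_lintegral_enorm _).trans ?_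
    rw [← eLpNorm_one_eq_lintegral_enorm]
    exact eLpNorm_le_eLpNorm_of_exponent_le (by norm_num) hFx.aestronglyMeasurable
  have hmain : eLpNorm (fun x => ∫ y, φ y * F x y) 2 μ ^ (2 : ℝ) ≤ C ^ (2 : ℝ) := by
    rw [hsq]
    calc ∫⁻ x, ‖∫ y, φ y * F x y‖ₑ ^ (2 : ℝ) ∂μ
        ≤ ∫⁻ x, ∫⁻ y, ‖F x y‖ₑ ^ (2 : ℝ) ∂ν ∂μ := lintegral_mono hpt
      _ = ∫⁻ y, ∫⁻ x, ‖F x y‖ₑ ^ (2 : ℝ) ∂μ ∂ν :=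
          lintegral_lintegral_swap ((hF.enorm.pow_const _).aemeasurable)
      _ ≤ ∫⁻ _, C ^ (2 : ℝ) ∂ν := by
          refine lintegral_mono_ae ?_
          have hpos : ∀ᵐ y ∂ν, φ y ≠ 0 := by
            rw [hν, ae_withDensity_iff hφm]
            refine Filter.Eventually.of_forall fun y hy h0 => hy ?_
            rw [h0, ENNReal.ofReal_zero]
          filter_upwards [hpos] with y hy
          rw [← hsq (fun x => F x y)]
          exact ENNReal.rpow_le_rpow (hC y hy) (by norm_num)
      _ = C ^ (2 : ℝ) := by simp
  exact (ENNReal.rpow_le_rpow_iff (by norm_num)).1 hmain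

lemma l2Norm_eq_toReal_eLpNorm {U : Set (Fin d → ℝ)} {f : (Fin d → ℝ) → ℝ}
    (hf : MemLp f 2 (volume.restrict U)) :
    l2Norm U f = (eLpNorm f 2 (volume.restrict U)).toReal := by
  rw [l2Norm_eq_norm_toLp hf, Lp.norm_toLp]

lemma eLpNorm_eq_ofReal_l2Norm {U : Set (Fin d → ℝ)} {f : (Fin d → ℝ) → ℝ}
    (hf : MemLp f 2 (volume.restrict U)) :
    eLpNorm f 2 (volume.restrict U) = ENNReal.ofReal (l2Norm U f) := by
  rw [l2Norm_eq_toReal_eLpNorm hf, ENNReal.ofReal_toReal hf.2.ne]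

lemma l2Norm_le_of_eLpNorm_le {U : Set (Fin d → ℝ)} {f : (Fin d → ℝ) → ℝ} {C : ℝ} (hC : 0 ≤ C)
    (hm : AEStronglyMeasurable f (volume.restrict U))
    (h : eLpNorm f 2 (volume.restrict U) ≤ ENNReal.ofReal C) :
    MemLp f 2 (volume.restrict U) ∧ l2Norm U f ≤ C := by
  have hf : MemLp f 2 (volume.restrict U) := ⟨hm, h.trans_lt ENNReal.ofReal_lt_top⟩
  refine ⟨hf, ?_⟩
  rw [l2Norm_eq_toReal_eLpNorm hf]
  exact ENNReal.toReal_le_of_le_ofReal hC h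

/-- Continuity in `L²(ℝ^d)` of small dilations and translations. -/
lemma exists_eLpNorm_affine_sub_le {f : (Fin d → ℝ) → ℝ} (hfm : Measurable f) (hf : MemLp f 2)
    {η : ℝ} (hη : 0 < η) : ∃ δ > 0, δ ≤ 1 / 2 ∧ ∀ r : ℝ, 1 - δ ≤ r → r ≤ 1 → ∀ z : Fin d → ℝ,
      ‖z‖ ≤ δ → eLpNorm (fun x => f (z + r • x) - f x) 2 ≤ ENNReal.ofReal η := by
  set A : ℝ := √(2 ^ d) with hA
  have hA0 : 0 < A := by positivity
  -- The affine maps distort the norm by a factor of at most `A`.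
  have haff : ∀ g : (Fin d → ℝ) → ℝ, Measurable g → ∀ r : ℝ, 1 / 2 ≤ r → ∀ z : Fin d → ℝ,
      eLpNorm (fun x => g (z + r • x)) 2 ≤ ENNReal.ofReal A * eLpNorm g 2 := by
    intro g hg r hr z
    have hr0 : 0 < r := by linarith
    have hmap : Measure.map (fun x : Fin d → ℝ => z + r • x) volume
        = ENNReal.ofReal |(r ^ d)⁻¹| • (volume : Measure (Fin d → ℝ)) := by
      have h1 := Measure.map_addHaar_smul (volume : Measure (Fin d → ℝ)) hr0.ne'
      have h2 : (fun x : Fin d → ℝ => z + r • x) = (fun x => z + x) ∘ fun x => r • x := rfl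
      rw [h2, ← Measure.map_map (measurable_const_add z) (measurable_const_smul r), h1,
        Measure.map_smul, (measurePreserving_add_left volume z).map_eq]
      simp
    have hme : Measurable fun x : Fin d → ℝ => z + r • x :=
      (measurable_const_add z).comp (measurable_const_smul r)
    have h3 := eLpNorm_map_measure (μ := (volume : Measure (Fin d → ℝ))) (p := 2) (g := g)
      (f := fun x : Fin d → ℝ => z + r • x) hg.aestronglyMeasurable hme.aemeasurable
    rw [hmap] at h3
    change eLpNorm (g ∘ fun x => z + r • x) 2 volume ≤ _
    rw [← h3, eLpNorm_smul_measure_of_ne_top (by norm_num)]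
    simp only [smul_eq_mul]
    gcongr
    rw [ENNReal.ofReal_rpow_of_nonneg (abs_nonneg _) (by norm_num)]
    refine ENNReal.ofReal_le_ofReal ?_
    rw [show ((1 : ENNReal) / 2).toReal = 1 / 2 by simp, ← Real.sqrt_eq_rpow, hA]
    refine Real.sqrt_le_sqrt ?_
    rw [abs_of_pos (by positivity), inv_le_comm₀ (by positivity) (by positivity), ← inv_pow]
    exact pow_le_pow_left₀ (by norm_num) (by linarith) d
  have hε : 0 < η / (2 * (A + 1)) := by positivity
  -- Approximate by a continuous function of compact support, which is uniformly continuous.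
  obtain ⟨g, hgc, hfg, hgcont, hgL⟩ := hf.exists_hasCompactSupport_eLpNorm_sub_le (by norm_num)
    (ε := ENNReal.ofReal (η / (2 * (A + 1)))) (by simpa using hε)
  -- A ball that contains all the supports of the moved approximations.
  obtain ⟨R, hR0, hR⟩ := hgc.isCompact.isBounded.exists_pos_norm_le
  set K : Set (Fin d → ℝ) := Metric.closedBall 0 (2 * R + 1) with hK
  set mK : ℝ := (volume K).toReal with hmK
  have hmK' : volume K = ENNReal.ofReal mK := (ENNReal.ofReal_toReal
    (isCompact_closedBall (0 : Fin d → ℝ) (2 * R + 1)).measure_lt_top.ne).symm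
  have huc := hgc.uniformContinuous_of_continuous hgcont
  set τ : ℝ := η / (2 * (√mK + 1)) with hτ
  have hτ0 : 0 < τ := by positivity
  obtain ⟨ρ, hρ0, hρ⟩ := Metric.uniformContinuous_iff.1 huc τ hτ0
  set δ : ℝ := min (1 / 2) (ρ / (2 * (2 * R + 2))) with hδ
  have hδ0 : 0 < δ := by positivity
  refine ⟨δ, hδ0, min_le_left _ _, fun r hr1 hr2 z hz => ?_⟩
  have hδ1 : δ ≤ 1 / 2 := min_le_left _ _
  have hr : 1 / 2 ≤ r := by linarith
  have hδ2 : δ * (2 * R + 2) < ρ := by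
    have : δ ≤ ρ / (2 * (2 * R + 2)) := min_le_right _ _
    calc δ * (2 * R + 2) ≤ ρ / (2 * (2 * R + 2)) * (2 * R + 2) := by gcongr
      _ = ρ / 2 := by field_simp
      _ < ρ := by linarith
  have hgm := hgcont.measurable
  have hme : Measurable fun x : Fin d → ℝ => z + r • x :=
    (measurable_const_add z).comp (measurable_const_smul r)
  have hg2 : eLpNorm (fun x => g (z + r • x) - g x) 2 ≤ ENNReal.ofReal (η / 2) := by
    have hbd : ∀ x, ‖g (z + r • x) - g x‖ ≤ ‖K.indicator (fun _ => τ) x‖ := by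
      intro x
      by_cases hx : x ∈ K
      · rw [indicator_of_mem hx, Real.norm_of_nonneg hτ0.le, ← dist_eq_norm]
        refine (hρ ?_).le
        rw [dist_eq_norm, show z + r • x - x = z - (1 - r) • x by rw [sub_smul, one_smul]; abel]
        have hxn : ‖x‖ ≤ 2 * R + 1 := by simpa [hK] using hx
        calc ‖z - (1 - r) • x‖ ≤ ‖z‖ + ‖(1 - r) • x‖ := norm_sub_le _ _
          _ ≤ δ + δ * (2 * R + 1) := by
              rw [norm_smul, Real.norm_of_nonneg (by linarith)]
              gcongr
              linarith
          _ = δ * (2 * R + 2) := by ring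
          _ < ρ := hδ2
      · have hxn : 2 * R + 1 < ‖x‖ := by simpa [hK] using hx
        have h1 : g x = 0 := by
          by_contra hne
          have := hR x (subset_tsupport g hne)
          linarith
        have h2 : g (z + r • x) = 0 := by
          by_contra hne
          have h3 := hR _ (subset_tsupport g hne)
          have h4 : ‖r • x‖ ≤ ‖z + r • x‖ + ‖z‖ := by
            have := norm_sub_le (z + r • x) z
            rwa [add_sub_cancel_left] at this
          rw [norm_smul, Real.norm_of_nonneg (by linarith)] at h4
          nlinarith
        rw [h1, h2]
        simp
    refine (eLpNorm_mono hbd).trans ?_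
    rw [eLpNorm_indicator_const (isCompact_closedBall _ _).measurableSet (by norm_num)
      (by norm_num), hmK', Real.enorm_of_nonneg hτ0.le,
      ENNReal.ofReal_rpow_of_nonneg ENNReal.toReal_nonneg (by norm_num),
      ← ENNReal.ofReal_mul hτ0.le]
    refine ENNReal.ofReal_le_ofReal ?_
    rw [show (1 / (2 : ENNReal).toReal) = 1 / 2 by simp, ← Real.sqrt_eq_rpow, hτ,
        div_mul_eq_mul_div,
      div_le_div_iff₀ (by positivity) (by norm_num)]
    nlinarith [Real.sqrt_nonneg mK]
  -- `f - g` is small before and after the affine map, and `g` hardly moves.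
  have e : (fun x => f (z + r • x) - f x) = fun x => ((f - g) (z + r • x) - (f - g) x)
      + (g (z + r • x) - g x) := by
    ext x; simp only [Pi.sub_apply]; ring
  have hfg' : Measurable (f - g) := hfm.sub hgm
  have m1 : AEStronglyMeasurable (fun x => (f - g) (z + r • x))
    (volume : Measure (Fin d → ℝ)) := (hfg'.comp hme).aestronglyMeasurable
  have m2 : AEStronglyMeasurable (fun x => (f - g) x) (volume : Measure (Fin d → ℝ)) :=
    hfg'.aestronglyMeasurable
  have m3 : AEStronglyMeasurable (fun x => g (z + r • x) - g x) (volume : Measure (Fin d → ℝ)) :=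
    ((hgm.comp hme).sub hgm).aestronglyMeasurable
  rw [e]
  calc eLpNorm (fun x => ((f - g) (z + r • x) - (f - g) x) + (g (z + r • x) - g x)) 2 volume
      ≤ eLpNorm (fun x => (f - g) (z + r • x) - (f - g) x) 2 volume
        + eLpNorm (fun x => g (z + r • x) - g x) 2 volume :=
        eLpNorm_add_le (m1.sub m2) m3 (by norm_num)
    _ ≤ (eLpNorm (fun x => (f - g) (z + r • x)) 2 volume + eLpNorm (fun x => (f - g) x) 2 volume)
        + eLpNorm (fun x => g (z + r • x) - g x) 2 volume := by
        gcongr; exact eLpNorm_sub_le m1 m2 (by norm_num)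
    _ ≤ (ENNReal.ofReal A * ENNReal.ofReal (η / (2 * (A + 1)))
          + ENNReal.ofReal (η / (2 * (A + 1)))) + ENNReal.ofReal (η / 2) := by
        gcongr
        exact (haff _ hfg' r hr z).trans (by gcongr)
    _ = ENNReal.ofReal η := by
        rw [← ENNReal.ofReal_mul hA0.le, ← ENNReal.ofReal_add (by positivity) (by positivity),
          ← ENNReal.ofReal_add (by positivity) (by positivity)]
        congr 1
        field_simp
        norm_num

end Mollify

/-! ### Weak derivatives -/

section WeakDeriv
variable {d : ℕ}

lemma integrable_mul_test {U : Set (Fin d → ℝ)} {g φ : (Fin d → ℝ) → ℝ}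
    (hg : LocallyIntegrableOn g U) (hφ : ContDiff ℝ ∞ φ) (hc : HasCompactSupport φ)
    (hs : tsupport φ ⊆ U) : Integrable fun x => g x * φ x := by
  obtain ⟨C, hC⟩ := hφ.continuous.bounded_above_of_compact_support hc
  have h1 : IntegrableOn g (tsupport φ) := hg.integrableOn_compact_subset hs hc
  have h2 : IntegrableOn (fun x => g x * φ x) (tsupport φ) :=
    h1.mul_bdd (c := C) hφ.continuous.aestronglyMeasurable (Filter.Eventually.of_forall hC)
  refine (integrableOn_iff_integrable_of_support_subset fun x hx => ?_).1 h2
  exact subset_tsupport _ (right_ne_zero_of_mul hx)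

lemma HasWeakDeriv.mono {α : Fin d → ℕ} {U U' : Set (Fin d → ℝ)} {v g : (Fin d → ℝ) → ℝ}
    (h : HasWeakDeriv α U v g) (hs : U' ⊆ U) : HasWeakDeriv α U' v g := by
  refine ⟨h.1.mono_set hs, h.2.1.mono_set hs, fun φ hφ hc ht => ?_⟩
  have h0 := h.2.2 φ hφ hc (ht.trans hs)
  have e1 : ∀ {A : Set (Fin d → ℝ)} {F : (Fin d → ℝ) → ℝ}, tsupport φ ⊆ A →
      (∀ x, x ∉ tsupport φ → F x = 0) → ∫ x in A, F x = ∫ x, F x := fun hA hF =>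
    setIntegral_eq_integral_of_forall_compl_eq_zero fun x hx => hF x fun hx' => hx (hA hx')
  have z1 : ∀ x, x ∉ tsupport φ → v x * multiDeriv α φ x = 0 := fun x hx => by
    have : multiDeriv α φ x = 0 := by
      by_contra hne
      exact hx (tsupport_multiDeriv_subset φ α (subset_tsupport _ hne))
    rw [this, mul_zero]
  have z2 : ∀ x, x ∉ tsupport φ → g x * φ x = 0 := fun x hx => by
    rw [image_eq_zero_of_notMem_tsupport hx, mul_zero]
  rw [e1 (ht.trans hs) z1, e1 (ht.trans hs) z2] at h0
  rw [e1 ht z1, e1 ht z2, h0]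

/-- Weak derivatives are unique up to null sets. -/
lemma HasWeakDeriv.ae_eq {α : Fin d → ℕ} {U : Set (Fin d → ℝ)} (hU : IsOpen U)
    {v g g' : (Fin d → ℝ) → ℝ} (h : HasWeakDeriv α U v g) (h' : HasWeakDeriv α U v g') :
    g =ᵐ[volume.restrict U] g' := by
  have hz : ∀ᵐ x, x ∈ U → (g - g') x = 0 := by
    refine hU.ae_eq_zero_of_integral_contDiff_smul_eq_zero (h.2.1.sub h'.2.1)
      fun φ hφ hc hs => ?_
    have i1 := integrable_mul_test h.2.1 hφ hc hs
    have i2 := integrable_mul_test h'.2.1 hφ hc hs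
    have e1 : ∀ {F : (Fin d → ℝ) → ℝ}, ∫ x in U, F x * φ x = ∫ x, F x * φ x := fun {F} =>
      setIntegral_eq_integral_of_forall_compl_eq_zero fun x hx => by
        rw [image_eq_zero_of_notMem_tsupport fun hx' => hx (hs hx'), mul_zero]
    have e2 : ∫ x, g x * φ x = ∫ x, g' x * φ x := by
      have h3 := (h.2.2 φ hφ hc hs).symm.trans (h'.2.2 φ hφ hc hs)
      rw [e1, e1] at h3
      exact mul_left_cancel₀ (pow_ne_zero _ (by norm_num)) h3
    simp only [smul_eq_mul, Pi.sub_apply, mul_comm (φ _), sub_mul]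
    rw [integral_sub i1 i2, e2, sub_self]
  rw [Filter.EventuallyEq, ae_restrict_iff' hU.measurableSet]
  filter_upwards [hz] with x hx hxU
  exact sub_eq_zero.1 (hx hxU)

lemma weakDeriv_ae_eq {α : Fin d → ℕ} {U : Set (Fin d → ℝ)} (hU : IsOpen U)
    {v g : (Fin d → ℝ) → ℝ} (h : HasWeakDeriv α U v g) :
    weakDeriv α U v =ᵐ[volume.restrict U] g := by
  have hex : ∃ g, HasWeakDeriv α U v g := ⟨g, h⟩
  rw [weakDeriv, dif_pos hex]
  exact hex.choose_spec.ae_eq hU h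

lemma hasWeakDeriv_zero {U : Set (Fin d → ℝ)} {v : (Fin d → ℝ) → ℝ}
    (hv : LocallyIntegrableOn v U) : HasWeakDeriv 0 U v v :=
  ⟨hv, hv, fun φ _ _ _ => by simp [multiDeriv_zero]⟩

lemma HasWeakDeriv.ae_eq_of_zero {U : Set (Fin d → ℝ)} (hU : IsOpen U)
    {v g : (Fin d → ℝ) → ℝ} (h : HasWeakDeriv 0 U v g) : v =ᵐ[volume.restrict U] g :=
  (hasWeakDeriv_zero h.1).ae_eq hU h

/-- Weak derivatives on the whole space are invariant under the translations that preserve the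
function. -/
lemma HasWeakDeriv.comp_add {α : Fin d → ℕ} {v g : (Fin d → ℝ) → ℝ}
    (h : HasWeakDeriv α univ v g) {c : Fin d → ℝ} (hc : ∀ x, v (x + c) = v x) :
    HasWeakDeriv α univ v fun x => g (x + c) := by
  refine ⟨h.1, ?_, fun φ hφ hφc _ => ?_⟩
  · rw [locallyIntegrableOn_univ]
    have h1 := locallyIntegrableOn_univ.1 h.2.1
    refine (locallyIntegrable_map_homeomorph (Homeomorph.addRight c) (f := g)).1 ?_
    rw [show ⇑(Homeomorph.addRight c) = fun x => x + c from rfl,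
      (measurePreserving_add_right volume c).map_eq]
    exact h1
  · have hψ : ContDiff ℝ ∞ fun t => φ (t - c) := hφ.comp (contDiff_id.sub contDiff_const)
    have hψc : HasCompactSupport fun t => φ (t - c) :=
      hφc.comp_homeomorph (Homeomorph.subRight c)
    have h0 := h.2.2 _ hψ hψc (subset_univ _)
    have hd : multiDeriv α (fun t => φ (t - c)) = fun t => multiDeriv α φ (t - c) := by
      have h1 := multiDeriv_comp_affine hφ (-c) 1 α
      simpa [neg_add_eq_sub] using h1
    rw [hd] at h0
    simp only [Measure.restrict_univ] at h0 ⊢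
    rw [← integral_add_right_eq_self _ c, ← integral_add_right_eq_self (fun x => g x * _) c] at h0
    simpa [hc] using h0

end WeakDeriv

/-! ### Smooth approximation of periodic functions -/

section PeriodicApprox
variable {d : ℕ}

/-- A function that is periodic up to null sets has a measurable periodic representative. -/
lemma exists_periodic_rep {g : (Fin d → ℝ) → ℝ} (hg : AEStronglyMeasurable g)
    (hper : ∀ z : Fin d → ℤ, (fun x => g (x + fun i => (z i : ℝ))) =ᵐ[volume] g) :
    ∃ g', Measurable g' ∧ UnitPeriodic g' ∧ g =ᵐ[volume] g' := by
  have hm : Measurable (hg.mk g) := hg.stronglyMeasurable_mk.measurable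
  -- Evaluate a measurable representative at the fractional parts.
  refine ⟨fun x => hg.mk g fun i => Int.fract (x i), hm.comp (measurable_pi_lambda _ fun i =>
    measurable_fract.comp (measurable_pi_apply i)), fun j x => ?_, ?_⟩
  · simp only [Pi.add_apply]
    congr 1
    ext i
    by_cases hij : i = j
    · subst hij; simp
    · simp [hij]
  have h1 : ∀ᵐ x : Fin d → ℝ, ∀ z : Fin d → ℤ, g (x + fun i => (z i : ℝ)) = g x :=
    ae_all_iff.2 hper
  have h2 : ∀ᵐ x : Fin d → ℝ, ∀ z : Fin d → ℤ,
      g (x + fun i => (z i : ℝ)) = hg.mk g (x + fun i => (z i : ℝ)) :=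
    ae_all_iff.2 fun z =>
      (measurePreserving_add_right volume fun i => (z i : ℝ)).quasiMeasurePreserving.ae_eq_comp
        hg.ae_eq_mk
  filter_upwards [h1, h2] with x hx1 hx2
  have e : (fun i => Int.fract (x i)) = x + fun i => ((-⌊x i⌋ : ℤ) : ℝ) := by
    ext i
    simp only [Pi.add_apply, Int.cast_neg, Int.fract]
    ring
  rw [e, ← hx2, hx1]

lemma HasWeakDeriv.exists_periodic {α : Fin d → ℕ} {v g : (Fin d → ℝ) → ℝ}
    (hv : UnitPeriodic v) (h : HasWeakDeriv α univ v g) :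
    ∃ g', Measurable g' ∧ UnitPeriodic g' ∧ g =ᵐ[volume] g' := by
  refine exists_periodic_rep (locallyIntegrableOn_univ.1 h.2.1).aestronglyMeasurable fun z => ?_
  have := (h.comp_add (c := fun i => (z i : ℝ)) fun x => hv.add_int z x).ae_eq isOpen_univ h
  rwa [Measure.restrict_univ] at this

/-- Averages of a periodic function are not larger than the function. -/
lemma l2Norm_average_le {φ : (Fin d → ℝ) → ℝ} {δ : ℝ} (hφ : IsMollifier φ δ)
    {g : (Fin d → ℝ) → ℝ} (hm : Measurable g) (hg : UnitPeriodic g)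
    (h2 : MemLp g 2 (cubeMeasure d)) :
    eLpNorm (fun x => ∫ y, φ y * g (x - y)) 2 (cubeMeasure d)
      ≤ ENNReal.ofReal (l2Norm (cube d) g) := by
  refine eLpNorm_average_le hφ (F := fun x y => g (x - y))
    (hm.comp (measurable_fst.sub measurable_snd)) fun y _ => ?_
  have h3 := hg.memLp_translate h2 y
  have h4 := eLpNorm_eq_ofReal_l2Norm h3
  rw [hg.l2Norm_translate h2.1 y] at h4
  exact h4.le

/-- A periodic function that is square integrable over a period is so over every compact set. -/
lemma UnitPeriodic.integrableOn_sq {g : (Fin d → ℝ) → ℝ} (hg : UnitPeriodic g)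
    (h2 : MemLp g 2 (cubeMeasure d)) {K : Set (Fin d → ℝ)}
    (hK : IsCompact K) : IntegrableOn (fun x => g x ^ 2) K := by
  have hloc : LocallyIntegrable fun x => g x ^ 2 := by
    intro x
    set c : Fin d → ℝ := fun i => 1 / 2 - x i with hc
    refine ⟨(fun y => y + c) ⁻¹' cube d, ?_, ?_⟩
    · refine ((isOpen_cube d).preimage (by fun_prop)).mem_nhds ?_
      rw [mem_preimage, mem_cube]
      intro i
      simp only [hc, Pi.add_apply]
      constructor <;> linarith
    · have h3 := (hg.memLp_translate h2 c).integrable_sq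
      have h4 : IntegrableOn (fun x => SparseDG.translate c g x ^ 2) (cube d) := h3
      rw [← (measurePreserving_add_right volume c).integrableOn_comp_preimage
        (Homeomorph.addRight c).measurableEmbedding] at h4
      refine h4.congr_fun (fun y _ => ?_) ((isOpen_cube d).preimage (by fun_prop)).measurableSet
      simp [SparseDG.translate]
  exact hloc.integrableOn_isCompact hK

/-- The mollifications of a periodic function converge to it over a period. -/
lemma exists_mollify_sub_le {g : (Fin d → ℝ) → ℝ} (hm : Measurable g) (hg : UnitPeriodic g)
    (h2 : MemLp g 2 (cubeMeasure d)) {η : ℝ} (hη : 0 < η) :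
    ∃ δ > 0, ∀ φ, IsMollifier φ δ →
      eLpNorm (fun x => ∫ y, φ y * (g (x - y) - g x)) 2 (cubeMeasure d) ≤ ENNReal.ofReal η := by
  -- A periodic function is not in `L²(ℝ^d)`; cut it off to a ball that contains the cube and its
  -- small translates.
  set K : Set (Fin d → ℝ) := Metric.closedBall 0 2 with hK
  have hKm : MeasurableSet K := Metric.isClosed_closedBall.measurableSet
  have hfm : Measurable (K.indicator g) := hm.indicator hKm
  have hf : MemLp (K.indicator g) 2 := by
    rw [memLp_indicator_iff_restrict hKm, memLp_two_iff_integrable_sq hm.aestronglyMeasurable]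
    exact hg.integrableOn_sq h2 (isCompact_closedBall _ _)
  obtain ⟨δ, hδ, hδ2, h⟩ := exists_eLpNorm_affine_sub_le hfm hf hη
  refine ⟨δ, hδ, fun φ hφ => eLpNorm_average_le hφ (F := fun x y => g (x - y) - g x)
    ((hm.comp (measurable_fst.sub measurable_snd)).sub (hm.comp measurable_fst)) fun y hy => ?_⟩
  have hyn := hφ.norm_le hy
  refine le_trans ?_ (h 1 (by linarith) le_rfl (-y) (by rwa [norm_neg]))
  refine (eLpNorm_congr_ae ?_).trans_le (eLpNorm_mono_measure _ Measure.restrict_le_self)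
  filter_upwards [ae_mem_cube d] with x hx
  have hx1 : ‖x‖ ≤ 1 := by
    rw [pi_norm_le_iff_of_nonneg zero_le_one]
    intro i
    have := mem_cube.1 hx i
    rw [Real.norm_eq_abs, abs_le]
    constructor <;> linarith [this.1, this.2]
  have m1 : x ∈ K := by simp only [hK, mem_closedBall_zero_iff]; linarith
  have m2 : -y + (1 : ℝ) • x ∈ K := by
    simp only [hK, mem_closedBall_zero_iff, one_smul]
    have := norm_add_le (-y) x
    rw [norm_neg] at this
    linarith
  rw [indicator_of_mem m1, indicator_of_mem m2, one_smul, neg_add_eq_sub]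

lemma MemMixedPeriodic.memLp {m : ℕ} {v : (Fin d → ℝ) → ℝ} (hv : MemMixedPeriodic m v) :
    MemLp v 2 (cubeMeasure d) := by
  obtain ⟨g, hg, hw⟩ := hv.2 0 (by simp)
  exact hg.ae_eq ((hw.mono (subset_univ _)).ae_eq_of_zero (isOpen_cube d)).symm

lemma l2Norm_le_mixedSeminorm {m : ℕ} (v : (Fin d → ℝ) → ℝ) {L : Finset (Fin d)}
    (hL : L.Nonempty) :
    l2Norm (cube d) (weakDeriv (fun i => if i ∈ L then m else 0) (cube d) v)
      ≤ mixedSeminorm m (cube d) v :=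
  le_ciSup (f := fun L : {L : Finset (Fin d) // L.Nonempty} =>
    l2Norm (cube d) (weakDeriv (fun i => if i ∈ L.1 then m else 0) (cube d) v))
    (Set.finite_range _).bddAbove ⟨L, hL⟩

lemma mixedSeminorm_nonneg (m : ℕ) (v : (Fin d → ℝ) → ℝ) : 0 ≤ mixedSeminorm m (cube d) v :=
  Real.iSup_nonneg fun _ => l2Norm_nonneg _ _

/-- Functions of mixed smoothness are limits of smooth periodic functions whose mixed derivatives
obey the same bound. -/
lemma MemMixedPeriodic.exists_isMixedFamily {p q : ℕ} (hq : q ≤ p) {v : (Fin d → ℝ) → ℝ}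
    (hv : MemMixedPeriodic p v) {ε : ℝ} (hε : 0 < ε) :
    ∃ g, IsMixedFamily q g (mixedSeminorm q (cube d) v) ∧
      l2Norm (cube d) (fun x => v x - g ∅ x) ≤ ε := by
  obtain ⟨g₀, hg₀, hw₀⟩ := hv.2 0 (by simp)
  have hvl : LocallyIntegrable v := locallyIntegrableOn_univ.1 hw₀.1
  have hv2 := hv.memLp
  obtain ⟨w, hwm, hwp, hvw⟩ := (hasWeakDeriv_zero hw₀.1).exists_periodic hv.1
  have hvw' : v =ᵐ[cubeMeasure d] w := ae_restrict_of_ae hvw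
  have hw2 : MemLp w 2 (cubeMeasure d) := hv2.ae_eq hvw'
  obtain ⟨δ, hδ, hδφ⟩ := exists_mollify_sub_le hwm hwp hw2 hε
  obtain ⟨φ, hφ⟩ := exists_isMollifier (d := d) hδ
  -- Mollification commutes with weak derivatives and with the periods, and it is a contraction on
  -- periodic functions.
  set u := mollify v φ with hu
  have hus : ContDiff ℝ ∞ u := contDiff_mollify hvl hφ.contDiff hφ.hasCompactSupport
  have huper : UnitPeriodic u := fun i x => by
    rw [hu, mollify_apply', mollify_apply']
    simp only [add_sub_right_comm, hv.1 i _]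
  set A : Finset (Fin d) → Fin d → ℕ := fun L i => if i ∈ L then q else 0 with hA
  refine ⟨fun L => multiDeriv (A L) u, ⟨fun L => contDiff_multiDeriv hus _,
    fun L => huper.multiDeriv _, fun L m hm => ?_, mixedSeminorm_nonneg _ _, fun L hL => ?_⟩, ?_⟩
  · rw [← multiDeriv_update hus]
    congr 1
    ext i
    by_cases him : i = m
    · subst him; simp [hA, hm]
    · simp [hA, him]
  · obtain ⟨G, hG, hwG⟩ := hv.2 (A L) fun i => by
      simp only [hA]; split_ifs <;> omega
    obtain ⟨G', hm', hp', hGG'⟩ := hwG.exists_periodic hv.1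
    have hGG'' : G =ᵐ[cubeMeasure d] G' := ae_restrict_of_ae hGG'
    have hG2 : MemLp G' 2 (cubeMeasure d) := hG.ae_eq hGG''
    -- A mixed derivative of `u` is an average of translates of the weak derivative of `v`.
    have e : multiDeriv (A L) u = fun x => ∫ y, φ y * G' (x - y) := by
      ext x
      rw [hu, multiDeriv_mollify_eq isOpen_univ hvl (fun _ _ => rfl) hφ.contDiff
        hφ.hasCompactSupport hwG (subset_univ _), Measure.restrict_univ]
      rw [← mollify_apply' G' φ x, mollify_apply]
      refine integral_congr_ae ?_
      filter_upwards [hGG'] with t ht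
      rw [ht]
    have h1 := l2Norm_average_le hφ hm' hp' hG2
    rw [← e] at h1
    have hc := (contDiff_multiDeriv hus (A L)).continuous.aestronglyMeasurable
      (μ := volume.restrict (cube d))
    refine (l2Norm_le_of_eLpNorm_le (l2Norm_nonneg _ _) hc h1).2.trans ?_
    refine le_trans (le_of_eq ?_) (l2Norm_le_mixedSeminorm v hL)
    refine l2Norm_congr ?_
    exact hGG''.symm.trans (weakDeriv_ae_eq (isOpen_cube d) (hwG.mono (subset_univ _))).symm
  · have e0 : A ∅ = 0 := by ext i; simp [hA]
    have h1 := hδφ φ hφ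
    have e : (fun x => u x - w x) = fun x => ∫ y, φ y * (w (x - y) - w x) := by
      have hwl : LocallyIntegrable w := fun x => by
        obtain ⟨s, hs, hi⟩ := hvl x
        exact ⟨s, hs, hi.congr (ae_restrict_of_ae hvw)⟩
      have hu' : u = mollify w φ := by
        ext x
        rw [hu, mollify_apply, mollify_apply]
        refine integral_congr_ae ?_
        filter_upwards [hvw] with t ht
        rw [ht]
      ext x
      have hφi : Integrable φ := hφ.contDiff.continuous.integrable_of_hasCompactSupport
        hφ.hasCompactSupport
      simp only [mul_sub]
      rw [integral_sub (hφ.integrable_mul hwl x) (hφi.mul_const _), integral_mul_const,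
        hφ.integral_eq, one_mul, hu', mollify_apply']
    rw [← e] at h1
    have h2 := (l2Norm_le_of_eLpNorm_le hε.le
      (hus.continuous.measurable.sub hwm).aestronglyMeasurable h1).2
    simp only [e0, multiDeriv_zero]
    rw [l2Norm_sub_comm]
    refine le_trans (le_of_eq (l2Norm_congr ?_)) h2
    filter_upwards [hvw'] with x hx
    rw [hx, Pi.sub_apply]

end PeriodicApprox

/-! ### The transport equation -/

section Transport
variable {d : ℕ}

/-- The phase `2π n · x` of a trigonometric monomial. -/
def phase (n : Fin d → ℤ) (x : Fin d → ℝ) : ℝ := 2 * Real.pi * ∑ i, n i * x i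

lemma phase_add (n : Fin d → ℤ) (x y : Fin d → ℝ) : phase n (x + y) = phase n x + phase n y := by
  simp only [phase, Pi.add_apply, mul_add, Finset.sum_add_distrib]

lemma phase_smul (n : Fin d → ℤ) (s : ℝ) (x : Fin d → ℝ) : phase n (s • x) = s * phase n x := by
  simp only [phase, Pi.smul_apply, smul_eq_mul, Finset.mul_sum]
  exact Finset.sum_congr rfl fun i _ => by ring

lemma contDiff_cos_phase (n : Fin d → ℤ) (b : ℝ) :
    ContDiff ℝ ∞ fun x : Fin d → ℝ => Real.cos (phase n x + b) := by
  unfold phase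
  fun_prop

lemma unitPeriodic_cos_phase (n : Fin d → ℤ) (b : ℝ) :
    UnitPeriodic fun x : Fin d → ℝ => Real.cos (phase n x + b) := fun i x => by
  have : phase n (Pi.single i (1 : ℝ)) = n i * (2 * Real.pi) := by
    simp [phase, Pi.single_apply, mul_comm]
  simp only [phase_add, this]
  rw [add_right_comm, Real.cos_add_int_mul_two_pi]

lemma partialDeriv_cos_phase (n : Fin d → ℤ) (b : ℝ) (i : Fin d) (x : Fin d → ℝ) :
    partialDeriv i (fun x : Fin d → ℝ => Real.cos (phase n x + b)) x
      = 2 * Real.pi * n i * Real.cos (phase n x + (b + Real.pi / 2)) := by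
  have hs : HasDerivAt (fun s : ℝ => Real.cos (phase n (x + s • Pi.single i 1) + b))
      (2 * Real.pi * n i * Real.cos (phase n x + (b + Real.pi / 2))) 0 := by
    have e : ∀ s : ℝ, phase n (x + s • Pi.single i (1 : ℝ)) + b
        = s * (2 * Real.pi * n i) + (phase n x + b) := by
      intro s
      rw [phase_add, phase_smul]
      simp only [phase, Pi.single_apply, mul_ite, mul_one, mul_zero, Finset.sum_ite_eq',
        Finset.mem_univ, if_true]
      ring
    simp only [e]
    refine HasDerivAt.congr_deriv
      ((((hasDerivAt_id (0 : ℝ)).mul_const (2 * Real.pi * n i)).add_const (phase n x + b)).cos) ?_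
    simp only [id, zero_mul, zero_add, one_mul]
    rw [← add_assoc, Real.cos_add_pi_div_two]
    ring
  have hd : DifferentiableAt ℝ (fun x : Fin d → ℝ => Real.cos (phase n x + b)) x :=
    ((contDiff_cos_phase n b).differentiable (by simp)) x
  have h2 := (hd.hasFDerivAt.hasLineDerivAt (Pi.single i (1 : ℝ)))
  exact h2.unique hs

/-- A weak solution of the transport equation has the trigonometric moments of the translated
initial datum. -/
lemma IsTransportSolution.moment {a : EuclideanSpace ℝ (Fin d)} {u₀ : (Fin d → ℝ) → ℝ}
    {u : ℝ → (Fin d → ℝ) → ℝ} (h : IsTransportSolution a u₀ u) (n : Fin d → ℤ) (b : ℝ)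
    {t : ℝ} (ht : 0 ≤ t) :
    ∫ x in cube d, u t x * Real.cos (phase n x + b)
      = ∫ x in cube d, u₀ x * Real.cos (phase n x + (b + t * phase n ⇑a)) := by
  set w : ℝ := phase n ⇑a with hw
  set I : ℝ → ℝ → ℝ := fun b s => ∫ x in cube d, u s x * Real.cos (phase n x + b) with hI
  -- The equation, tested with `cos`, turns the phase by a quarter of a period.
  have hder : ∀ b s, 0 ≤ s → HasDerivWithinAt (I b) (w * I (b + Real.pi / 2) s) (Ici 0) s := by
    intro b s hs
    have h1 := h.eqn s hs _ (contDiff_cos_phase n b) (unitPeriodic_cos_phase n b)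
    refine h1.congr_deriv ?_
    simp only [hI]
    rw [← integral_const_mul]
    refine integral_congr_ae (Filter.Eventually.of_forall fun x => ?_)
    simp only [partialDeriv_cos_phase]
    generalize Real.cos (phase n x + (b + Real.pi / 2)) = c
    simp only [hw, phase, Finset.mul_sum, Finset.sum_mul]
    exact Finset.sum_congr rfl fun i _ => by ring
  have hint : ∀ s, 0 ≤ s → ∀ b, Integrable (fun x => u s x * Real.cos (phase n x + b))
      (cubeMeasure d) := fun s hs b =>
    integrable_mul_of_memLp (h.memLp s hs)
      (((unitPeriodic_cos_phase n b).bddMeas (contDiff_cos_phase n b).continuous).memLp 2)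
  -- The moments with arbitrary phase are combinations of two of them.
  have hrot : ∀ s, 0 ≤ s → ∀ b c, I (b + c) s
      = Real.cos c * I b s + Real.sin c * I (b + Real.pi / 2) s := by
    intro s hs b c
    simp only [hI]
    rw [← integral_const_mul, ← integral_const_mul, ← integral_add
      ((hint s hs b).const_mul _) ((hint s hs _).const_mul _)]
    refine integral_congr_ae (Filter.Eventually.of_forall fun x => ?_)
    simp only
    rw [← add_assoc, ← add_assoc, Real.cos_add_pi_div_two, Real.cos_add]
    ring
  -- The moment of phase `b + (t - s) w` at time `s`: it does not change along the flow, equals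
  -- `I b t` at `s = t`, and is a moment of the initial value at `s = 0`.
  set E : ℝ → ℝ := fun s => Real.cos (s * w) * I (b + t * w) s
    - Real.sin (s * w) * I (b + t * w + Real.pi / 2) s with hE
  have hpi : ∀ s, 0 ≤ s → ∀ b, I (b + Real.pi / 2 + Real.pi / 2) s = -I b s := by
    intro s hs b
    rw [add_assoc, add_halves, hrot s hs b Real.pi]
    simp
  have hE' : ∀ s, 0 ≤ s → HasDerivWithinAt E 0 (Ici 0) s := by
    intro s hs
    have h1 : HasDerivWithinAt (fun s : ℝ => Real.cos (s * w)) (-Real.sin (s * w) * w)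
        (Ici 0) s := by
      have := ((hasDerivAt_id s).mul_const w).cos
      simpa using this.hasDerivWithinAt
    have h2 : HasDerivWithinAt (fun s : ℝ => Real.sin (s * w)) (Real.cos (s * w) * w)
        (Ici 0) s := by
      have := ((hasDerivAt_id s).mul_const w).sin
      simpa using this.hasDerivWithinAt
    refine ((h1.mul (hder (b + t * w) s hs)).sub
      (h2.mul (hder (b + t * w + Real.pi / 2) s hs))).congr_deriv ?_
    rw [hpi s hs]
    ring
  have hconst := constant_of_has_deriv_right_zero (f := E) (a := 0) (b := t)
    (fun s hs => ((hE' s hs.1).continuousWithinAt).mono Icc_subset_Ici_self)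
    (fun s hs => (hE' s hs.1).mono (Ici_subset_Ici.2 hs.1)) t ⟨ht, le_rfl⟩
  have hEt : E t = I b t := by
    have := hrot t ht (b + t * w) (-(t * w))
    rw [Real.cos_neg, Real.sin_neg, add_neg_cancel_right] at this
    rw [this, hE]
    ring
  have hE0 : E 0 = I (b + t * w) 0 := by simp [hE]
  rw [hEt, hE0] at hconst
  simp only [hI] at hconst
  rw [hconst]
  refine integral_congr_ae ?_
  filter_upwards [h.init] with x hx
  rw [hx]

lemma UnitPeriodic.moment_translate {v : (Fin d → ℝ) → ℝ} (hv : UnitPeriodic v)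
    (hm : AEStronglyMeasurable v (cubeMeasure d)) (n : Fin d → ℤ) (b : ℝ) (c : Fin d → ℝ) :
    ∫ x in cube d, SparseDG.translate c v x * Real.cos (phase n x + b)
      = ∫ x in cube d, v x * Real.cos (phase n x + (b + phase n c)) := by
  have hp : UnitPeriodic fun x => v x * Real.cos (phase n x + (b + phase n c)) := fun i x => by
    have := unitPeriodic_cos_phase n (b + phase n c) i x
    simp only at this
    simp only [hv i x, this]
  rw [← hp.integral_translate (hm.mul
    (contDiff_cos_phase n _).continuous.aestronglyMeasurable) c]
  refine integral_congr_ae (Filter.Eventually.of_forall fun x => ?_)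
  simp only [SparseDG.translate]
  congr 2
  have := phase_add n (x - c) c
  rw [sub_add_cancel] at this
  rw [this]
  ring

/-- The normalized Haar measure on the circle. -/
local instance haarMeasureSpace : MeasureSpace UnitAddCircle := ⟨AddCircle.haarAddCircle⟩

lemma mFourier_coe (n : Fin d → ℤ) (x : Fin d → ℝ) :
    UnitAddTorus.mFourier n (fun i => (x i : UnitAddCircle))
      = Complex.exp (phase n x * Complex.I) := by
  simp only [UnitAddTorus.mFourier, ContinuousMap.coe_mk, fourier_coe_apply, phase]
  rw [← Complex.exp_sum]
  congr 1
  push_cast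
  rw [Finset.mul_sum, Finset.sum_mul]
  exact Finset.sum_congr rfl fun i _ => by simp; ring

/-- Completeness of the trigonometric system. -/
lemma ae_eq_zero_of_moments {D : (Fin d → ℝ) → ℝ} (hD : MemLp D 2 (cubeMeasure d))
    (h : ∀ n b, ∫ x in cube d, D x * Real.cos (phase n x + b) = 0) : D =ᵐ[cubeMeasure d] 0 := by
  have hmD := hD.1.stronglyMeasurable_mk.measurable
  set D' := hD.1.mk D with hD'
  have hDD' : D =ᵐ[cubeMeasure d] D' := hD.1.ae_eq_mk
  have hD2 : MemLp D' 2 (cubeMeasure d) := hD.ae_eq hDD'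
  have hen : ∀ r : ℝ, ‖(r : ℂ)‖ₑ = ‖r‖ₑ := fun r => by
    rw [← ofReal_norm, Complex.norm_real, ofReal_norm]
  set box : Set (Fin d → ℝ) := {x | ∀ i, x i ∈ Ioc ((0 : Fin d → ℝ) i) ((0 : Fin d → ℝ) i + 1)}
    with hbox
  have hboxm : MeasurableSet box := by
    have : box = Set.univ.pi fun _ => Ioc (0 : ℝ) 1 := by
      ext x; simp [hbox]
    rw [this]
    exact MeasurableSet.univ_pi fun _ => measurableSet_Ioc
  have hμ : volume.restrict box = cubeMeasure d := by
    have : box = Set.univ.pi fun _ => Ioc (0 : ℝ) 1 := by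
      ext x; simp [hbox]
    refine Measure.restrict_congr_set ?_
    rw [this]
    exact (Measure.univ_pi_Ioo_ae_eq_Icc (μ := fun _ : Fin d => (volume : Measure ℝ))).trans
      (Measure.univ_pi_Ioc_ae_eq_Icc (μ := fun _ : Fin d => (volume : Measure ℝ))).symm |>.symm
  -- Transfer to the torus, where the Fourier series is available.
  set T : UnitAddTorus (Fin d) → ℂ := fun y =>
    (D' (UnitAddTorus.measurableEquivPiIoc (0 : Fin d → ℝ) y).1 : ℂ) with hT
  have hTm : Measurable T := Complex.measurable_ofReal.comp (hmD.comp
    (measurable_subtype_coe.comp (UnitAddTorus.measurableEquivPiIoc (0 : Fin d → ℝ)).measurable))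
  have hTx : ∀ x ∈ box, T (fun i => (x i : UnitAddCircle)) = D' x := by
    intro x hx
    have h1 := (UnitAddTorus.measurableEquivPiIoc (0 : Fin d → ℝ)).apply_symm_apply ⟨x, hx⟩
    rw [UnitAddTorus.coe_symm_measurableEquivPiIoc_apply] at h1
    simp only [hT]
    rw [h1]
  have hT2 : MemLp T 2 := by
    refine ⟨hTm.aestronglyMeasurable, ?_⟩
    rw [eLpNorm_lt_top_iff_lintegral_rpow_enorm_lt_top (by norm_num) (by norm_num),
      UnitAddTorus.lintegral_preimage _ 0,
      setLIntegral_congr_fun (g := fun x => ‖D' x‖ₑ ^ (2 : ENNReal).toReal) hboxm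
        (fun x hx => by simp only [hTx x hx, hen])]
    have := hD2.2
    rw [eLpNorm_lt_top_iff_lintegral_rpow_enorm_lt_top (by norm_num) (by norm_num)] at this
    rwa [hμ]
  -- The phases `0` and `-π/2` give the real and the imaginary part of the Fourier coefficient.
  have hcoef : ∀ n, UnitAddTorus.mFourierCoeff T n = 0 := by
    intro n
    have hi : ∀ b, Integrable (fun x => D x * Real.cos (phase (-n) x + b)) (cubeMeasure d) :=
      fun b => integrable_mul_of_memLp hD
        (((unitPeriodic_cos_phase _ b).bddMeas (contDiff_cos_phase _ b).continuous).memLp 2)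
    rw [UnitAddTorus.mFourierCoeff_eq_integral T n 0]
    have e : ∫ x in box, UnitAddTorus.mFourier (-n) (fun i => (x i : UnitAddCircle))
        • T (fun i => (x i : UnitAddCircle))
        = ∫ x, (((D x * Real.cos (phase (-n) x + 0) : ℝ) : ℂ)
          + ((D x * Real.cos (phase (-n) x + (-(Real.pi / 2))) : ℝ) : ℂ) * Complex.I)
            ∂(cubeMeasure d) := by
      rw [← hμ]
      refine integral_congr_ae ?_
      rw [← hμ] at hDD'
      filter_upwards [hDD', ae_restrict_mem hboxm] with x hx hxb
      rw [hTx x hxb, mFourier_coe, hx, Complex.exp_mul_I, add_zero, ← sub_eq_add_neg,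
        Real.cos_sub_pi_div_two]
      push_cast
      simp only [smul_eq_mul]
      ring
    rw [e, integral_add (hi 0).ofReal ((hi _).ofReal.mul_const _), integral_mul_const,
      integral_complex_ofReal, integral_complex_ofReal]
    have h1 := h (-n) 0
    have h2 := h (-n) (-(Real.pi / 2))
    change ∫ x, _ ∂(cubeMeasure d) = 0 at h1 h2
    rw [h1, h2]
    simp
  have hTz : hT2.toLp T = 0 := by
    have hs := UnitAddTorus.hasSum_mFourier_series_L2 (hT2.toLp T)
    have hc : ∀ n, UnitAddTorus.mFourierCoeff (hT2.toLp T) n = 0 := by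
      intro n
      rw [← hcoef n]
      refine integral_congr_ae ?_
      filter_upwards [hT2.coeFn_toLp] with x hx
      rw [hx]
    simp only [hc, zero_smul] at hs
    exact hs.unique hasSum_zero
  have hT0 : T =ᵐ[volume] 0 := by
    have h1 := hT2.coeFn_toLp
    rw [hTz] at h1
    exact h1.symm.trans (Lp.coeFn_zero ℂ 2 volume)
  -- Back to the cube: the integral of `|T|` over the torus is that of `|D|` over the cube.
  have hl : ∫⁻ y, ‖T y‖ₑ = 0 := by
    rw [lintegral_congr_ae (g := fun _ => 0) (by filter_upwards [hT0] with x hx; rw [hx]; simp)]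
    simp
  rw [UnitAddTorus.lintegral_preimage _ 0,
    setLIntegral_congr_fun (g := fun x => ‖D' x‖ₑ) hboxm
      (fun x hx => by simp only [hTx x hx, hen])] at hl
  change ∫⁻ x in box, _ = 0 at hl
  rw [hμ, lintegral_eq_zero_iff hmD.enorm] at hl
  filter_upwards [hDD', hl] with x h1 h2
  rw [h1]
  simpa using h2

/-- The weak solution of the transport equation is the translated initial datum. -/
lemma IsTransportSolution.ae_eq_translate {a : EuclideanSpace ℝ (Fin d)} {u₀ : (Fin d → ℝ) → ℝ}
    {u : ℝ → (Fin d → ℝ) → ℝ} (h : IsTransportSolution a u₀ u) (hp : UnitPeriodic u₀)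
    (h2 : MemLp u₀ 2 (cubeMeasure d)) {t : ℝ} (ht : 0 ≤ t) :
    u t =ᵐ[cubeMeasure d] translate (t • ⇑a) u₀ := by
  have hu := h.memLp t ht
  have hv := hp.memLp_translate h2 (t • ⇑a)
  have hz : u t - translate (t • ⇑a) u₀ =ᵐ[cubeMeasure d] 0 := by
    refine ae_eq_zero_of_moments (hu.sub hv) fun n b => ?_
    have hb : MemLp (fun x : Fin d → ℝ => Real.cos (phase n x + b)) 2 (cubeMeasure d) :=
      ((unitPeriodic_cos_phase n b).bddMeas (contDiff_cos_phase n b).continuous).memLp 2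
    have i1 := integrable_mul_of_memLp hu hb
    have i2 := integrable_mul_of_memLp hv hb
    simp only [Pi.sub_apply, sub_mul]
    rw [integral_sub i1 i2, h.moment n b ht, hp.moment_translate h2.1, phase_smul, sub_self]
  filter_upwards [hz] with x hx
  exact sub_eq_zero.1 hx

end Transport

/-! ### The full tensor-product projection -/

section FullProjection
variable {d : ℕ}

/-- The one-dimensional projection is symmetric. -/
lemma integral_proj1_mul_comm {k n : ℕ} {v w : ℝ → ℝ} (hv : Measurable v)
    (hvb : ∃ C, ∀ x, |v x| ≤ C) (hw : Measurable w) (hwb : ∃ C, ∀ x, |w x| ≤ C) :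
    ∫ x in Ioo (0 : ℝ) 1, proj1 k n v x * w x = ∫ x in Ioo (0 : ℝ) 1, v x * proj1 k n w x := by
  obtain ⟨C, hC⟩ := hvb
  obtain ⟨D, hD⟩ := hwb
  have hκ := bddKernel_proj k n
  obtain ⟨F, hF⟩ := hκ.bdd
  simp only [proj1, ← integral_mul_const]
  rw [integral_integral_swap]
  · refine integral_congr_ae (Filter.Eventually.of_forall fun s => ?_)
    simp only
    rw [← integral_const_mul]
    refine integral_congr_ae (Filter.Eventually.of_forall fun x => ?_)
    simp only
    rw [cellKernel_repro_symm]; ring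
  · refine Integrable.of_bound (C := F * C * D) ?_ (Filter.Eventually.of_forall fun p => ?_)
    · exact ((hκ.measurable.mul (hv.comp measurable_snd)).mul
        (hw.comp measurable_fst)).aestronglyMeasurable
    · simp only [Function.uncurry]
      rw [Real.norm_eq_abs, abs_mul, abs_mul]
      have := (abs_nonneg _).trans (hF 0 0)
      have := (abs_nonneg _).trans (hC 0)
      gcongr
      · exact hF _ _
      · exact hC _
      · exact hD _

lemma BddMeas.slice_bdd {f : (Fin d → ℝ) → ℝ} (hf : BddMeas f) (m : Fin d) (x : Fin d → ℝ) :
    ∃ C, ∀ s, |f (Function.update x m s)| ≤ C := hf.bdd.imp fun _ h _ => h _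

lemma projOp_update (k n : ℕ) (m : Fin d) (f : (Fin d → ℝ) → ℝ) (x : Fin d → ℝ) (s : ℝ) :
    projOp k n m f (Function.update x m s) = proj1 k n (fun r => f (Function.update x m r)) s := by
  simp only [projOp, kernelOp, proj1, Function.update_self, Function.update_idem]

/-- The projection in one variable is self-adjoint. -/
lemma integral_projOp_mul_comm (k n : ℕ) (m : Fin d) {f g : (Fin d → ℝ) → ℝ} (hf : BddMeas f)
    (hg : BddMeas g) :
    ∫ x in cube d, projOp k n m f x * g x = ∫ x in cube d, f x * projOp k n m g x := by
  have hκ := bddKernel_proj k n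
  rw [integral_update m ((hf.kernelOp hκ m).mul hg).integrable,
    integral_update m (hf.mul (hg.kernelOp hκ m)).integrable]
  refine integral_congr_ae (Filter.Eventually.of_forall fun x => ?_)
  simp only [projOp_update]
  exact integral_proj1_mul_comm (hf.slice_measurable m x) (hf.slice_bdd m x)
    (hg.slice_measurable m x) (hg.slice_bdd m x)

lemma projOp_projOp (k n : ℕ) (m : Fin d) {f : (Fin d → ℝ) → ℝ} (hf : BddMeas f) :
    projOp k n m (projOp k n m f) = projOp k n m f := by
  ext x
  have h := integral_cellKernel_of_mem_V (proj1_mem_V k n (hf.slice_integrable m x)) (x m)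
  rw [← projOp_update, Function.update_eq_self] at h
  simp only [← projOp_update] at h
  exact h

lemma cellKernel_reproDeriv_mem_V (k n : ℕ) (x : ℝ) :
    (fun y => cellKernel n (reproDeriv k) x y) ∈ V n k := by
  rw [← mem_VSubmodule]
  obtain ⟨j, hj, hxj⟩ := exists_cellIdx_eq n x
  have e : (fun y => cellKernel n (reproDeriv k) x y)
      = ∑ i : Fin (k + 1), ∑ l : Fin (k + 1),
        (2 ^ n * (gramInv k i l * ((i : ℕ) * cellLoc n x ^ ((i : ℕ) - 1)))) •
          cellBasis n j (l : ℕ) := by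
    ext y
    simp only [Finset.sum_apply, Pi.smul_apply, smul_eq_mul, cellKernel, cellBasis, hxj]
    by_cases h : cellIdx n y = j
    · rw [if_pos h.symm, reproDeriv, Finset.mul_sum]
      refine Finset.sum_congr rfl fun i _ => ?_
      rw [Finset.mul_sum]
      refine Finset.sum_congr rfl fun l _ => ?_
      rw [if_pos h]; ring
    · rw [if_neg (Ne.symm h)]
      simp [h]
  rw [e]
  exact Submodule.sum_mem _ fun i _ => Submodule.sum_mem _ fun l _ =>
    Submodule.smul_mem _ _ (cellBasis_mem_V (Nat.lt_succ_iff.1 l.2))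

/-- The derivative of the projection sees only the projection of its argument. -/
lemma dprojOp_projOp (k n : ℕ) (m : Fin d) {f : (Fin d → ℝ) → ℝ} (hf : BddMeas f) :
    dprojOp k n m (projOp k n m f) = dprojOp k n m f := by
  ext x
  have hV := cellKernel_reproDeriv_mem_V k n (x m)
  obtain ⟨h1, h2⟩ := measurable_bdd_of_mem_V hV
  have h := integral_proj1_mul_comm (k := k) (n := n) (hf.slice_measurable m x) (hf.slice_bdd m x)
    h1 h2
  simp only [dprojOp, kernelOp, projOp_update, mul_comm (cellKernel n (reproDeriv k) _ _)]
  rw [h]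
  refine integral_congr_ae (Filter.Eventually.of_forall fun s => ?_)
  simp only
  congr 1
  exact integral_cellKernel_of_mem_V hV s

/-- The projection error is orthogonal to the range of the projection. -/
lemma integral_sub_projOp_mul (k n : ℕ) (m : Fin d) {f g : (Fin d → ℝ) → ℝ} (hf : BddMeas f)
    (hg : BddMeas g) : ∫ x in cube d, (f x - projOp k n m f x) * projOp k n m g x = 0 := by
  have hκ := bddKernel_proj k n
  have hPf := hf.kernelOp hκ m
  have hPg := hg.kernelOp hκ m
  have i1 : Integrable (fun x => f x * projOp k n m g x) (cubeMeasure d) :=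
    (hf.mul hPg).integrable
  have i2 : Integrable (fun x => projOp k n m f x * projOp k n m g x) (cubeMeasure d) :=
    (hPf.mul hPg).integrable
  simp only [sub_mul]
  rw [integral_sub i1 i2, integral_projOp_mul_comm k n m hf hPg, projOp_projOp k n m hg, sub_self]

lemma l2Norm_add_sq_of_orthogonal {f g : (Fin d → ℝ) → ℝ} (hf : BddMeas f) (hg : BddMeas g)
    (h : ∫ x in cube d, f x * g x = 0) :
    l2Norm (cube d) (fun x => f x + g x) ^ 2 = l2Norm (cube d) f ^ 2 + l2Norm (cube d) g ^ 2 := by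
  have i1 : Integrable (fun x => f x ^ 2) (cubeMeasure d) := hf.sq.integrable
  have i2 : Integrable (fun x => g x ^ 2) (cubeMeasure d) := hg.sq.integrable
  have i3 : Integrable (fun x => 2 * (f x * g x)) (cubeMeasure d) :=
    ((hf.mul hg).const_mul 2).integrable
  have i4 : Integrable (fun x => f x ^ 2 + 2 * (f x * g x)) (cubeMeasure d) := i1.add i3
  rw [l2Norm_sq, l2Norm_sq, l2Norm_sq]
  have e : ∀ x, (f x + g x) ^ 2 = f x ^ 2 + 2 * (f x * g x) + g x ^ 2 := fun x => by ring
  simp only [e]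
  rw [integral_add i4 i2, integral_add i1 i3, integral_const_mul, h]
  ring

lemma l2Norm_projOp_le (k n : ℕ) (m : Fin d) {f : (Fin d → ℝ) → ℝ} (hf : BddMeas f) :
    l2Norm (cube d) (projOp k n m f) ≤ l2Norm (cube d) f := by
  have hP := hf.kernelOp (bddKernel_proj k n) m
  have h := l2Norm_add_sq_of_orthogonal (hf.sub hP) hP (integral_sub_projOp_mul k n m hf hf)
  simp only [sub_add_cancel] at h
  refine (pow_le_pow_iff_left₀ (l2Norm_nonneg _ _) (l2Norm_nonneg _ _) two_ne_zero).1 ?_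
  rw [h]
  exact le_add_of_nonneg_left (sq_nonneg _)

/-- The composition of the projections of level `N` in the directions of a list. -/
def fullOp (k N : ℕ) (S : List (Fin d)) (f : (Fin d → ℝ) → ℝ) : (Fin d → ℝ) → ℝ :=
  S.foldr (fun m g => projOp k N m g) f

lemma fullOp_cons (k N : ℕ) (m : Fin d) (S : List (Fin d)) (f : (Fin d → ℝ) → ℝ) :
    fullOp k N (m :: S) f = projOp k N m (fullOp k N S f) := rfl

lemma BddMeas.fullOp {f : (Fin d → ℝ) → ℝ} (hf : BddMeas f) (k N : ℕ) (S : List (Fin d)) :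
    BddMeas (fullOp k N S f) := by
  induction S with
  | nil => exact hf
  | cons m S ih => exact ih.kernelOp (bddKernel_proj k N) m

lemma fullOp_const_mul (k N : ℕ) (S : List (Fin d)) (c : ℝ) (f : (Fin d → ℝ) → ℝ) :
    fullOp k N S (fun x => c * f x) = fun x => c * fullOp k N S f x := by
  induction S with
  | nil => rfl
  | cons m S ih =>
    rw [fullOp_cons, ih]
    exact kernelOp_const_mul c

lemma kernelOp_fullOp {κ : ℝ → ℝ → ℝ} (hκ : BddKernel κ) {m : Fin d} {S : List (Fin d)}
    (hm : m ∉ S) (k N : ℕ) {f : (Fin d → ℝ) → ℝ} (hf : BddMeas f) :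
    kernelOp κ m (fullOp k N S f) = fullOp k N S (kernelOp κ m f) := by
  induction S with
  | nil => rfl
  | cons m' S ih =>
    have h1 : m ≠ m' := fun h => hm (by simp [h])
    have h2 : m ∉ S := fun h => hm (by simp [h])
    rw [fullOp_cons, fullOp_cons, kernelOp_comm hκ (bddKernel_proj k N) h1 (hf.fullOp k N S), ih h2]

/-- The derivative of the full projection: the projection in the direction of the derivative is
absorbed, the others commute with it. -/
lemma dprojOp_fullOp (k N : ℕ) {m : Fin d} {S : List (Fin d)} (hS : S.Nodup) (hm : m ∈ S)
    {f : (Fin d → ℝ) → ℝ} (hf : BddMeas f) :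
    dprojOp k N m (fullOp k N S f) = fullOp k N (S.erase m) (dprojOp k N m f) := by
  induction S with
  | nil => simp at hm
  | cons a S ih =>
    obtain ⟨haS, hS'⟩ := List.nodup_cons.1 hS
    by_cases h : a = m
    · subst h
      rw [fullOp_cons, dprojOp_projOp k N a (hf.fullOp k N S), List.erase_cons_head]
      exact kernelOp_fullOp (bddKernel_dproj k N) haS k N hf
    · have hmS : m ∈ S := by
        rcases List.mem_cons.1 hm with rfl | h'
        · exact absurd rfl h
        · exact h'
      rw [List.erase_cons_tail (by simpa using h), fullOp_cons, fullOp_cons, ← ih hS' hmS]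
      exact kernelOp_comm (bddKernel_dproj k N) (bddKernel_proj k N) (Ne.symm h)
        (hf.fullOp k N S)

lemma fullOp_mem_fullSpace (k N : ℕ) {f : (Fin d → ℝ) → ℝ} (hf : BddMeas f) :
    fullOp k N (List.finRange d) f ∈ fullSpace d N k := by
  have key : ∀ S : List (Fin d), S.Nodup →
      fullOp k N S f ∈ partialSpan k S.toFinset {fun _ => N} := by
    intro S hS
    induction S with
    | nil =>
      refine Submodule.subset_span ⟨_, 0, f, rfl, by simp, hf, by simp, ?_⟩
      ext x; simp [fullOp]
    | cons m S ih =>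
      obtain ⟨hm, hS'⟩ := List.nodup_cons.1 hS
      rw [List.toFinset_cons]
      refine projOp_mem_partialSpan (by simpa using hm) (fun l hl => ?_) (ih hS')
      rw [mem_singleton_iff] at hl ⊢
      subst hl
      exact Function.update_eq_self m _
  have h := key _ (List.nodup_finRange d)
  rw [List.toFinset_finRange] at h
  exact partialSpan_univ_le (fun l hl => by rw [mem_singleton_iff.1 hl]; exact le_rfl) h

/-- The composition of the projections in all directions is the projection onto the full space. -/
lemma isL2Proj_fullOp (k N : ℕ) {f : (Fin d → ℝ) → ℝ} (hf : BddMeas f) :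
    IsL2Proj (fullSpace d N k) f (fullOp k N (List.finRange d) f) := by
  refine ⟨fullOp_mem_fullSpace k N hf, fun z hz => ?_⟩
  have hzb := bddMeas_of_mem_fullSpace hz
  -- Each projection is symmetric and fixes `z`.
  have key : ∀ S : List (Fin d),
      ∫ x in cube d, fullOp k N S f x * z x = ∫ x in cube d, f x * z x := by
    intro S
    induction S with
    | nil => rfl
    | cons m S ih =>
      rw [fullOp_cons, integral_projOp_mul_comm k N m (hf.fullOp k N S) hzb,
        projOp_of_mem_fullSpace hz, ih]
  have i1 : Integrable (fun x => fullOp k N (List.finRange d) f x * z x) (cubeMeasure d) :=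
    ((hf.fullOp k N _).mul hzb).integrable
  have i2 : Integrable (fun x => f x * z x) (cubeMeasure d) := (hf.mul hzb).integrable
  simp only [sub_mul]
  rw [integral_sub i1 i2, key, sub_self]

/-- The errors of the projections in the single directions add up in squares, since the summands
`P_1 ⋯ P_{i-1} (1 - P_i) f` of the total error are orthogonal. This makes the estimate independent
of the dimension. -/
lemma l2Norm_sub_fullOp_sq_le (k N : ℕ) (S : List (Fin d)) (hS : S.Nodup) {f : (Fin d → ℝ) → ℝ}
    (hf : BddMeas f) : l2Norm (cube d) (fun x => f x - fullOp k N S f x) ^ 2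
      ≤ ∑ m ∈ S.toFinset, l2Norm (cube d) (fun x => f x - projOp k N m f x) ^ 2 := by
  induction S with
  | nil => simp [fullOp, l2Norm_zero]
  | cons m S ih =>
    obtain ⟨hm, hS'⟩ := List.nodup_cons.1 hS
    have hX := hf.fullOp k N S
    have hκ := bddKernel_proj k N
    have hh := hf.sub hX
    have e : ∀ x, f x - fullOp k N (m :: S) f x = (f x - projOp k N m f x)
        + projOp k N m (fun x => f x - fullOp k N S f x) x := by
      intro x
      rw [fullOp_cons]
      unfold projOp
      rw [kernelOp_sub hκ hf hX]
      ring
    simp only [e]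
    -- The first summand is orthogonal to the range of `P_m`.
    rw [l2Norm_add_sq_of_orthogonal (hf.sub (hf.kernelOp hκ m)) (hh.kernelOp hκ m)
      (integral_sub_projOp_mul k N m hf hh), List.toFinset_cons,
      Finset.sum_insert (by simpa using hm)]
    gcongr
    refine le_trans ?_ (ih hS')
    gcongr
    · exact l2Norm_nonneg _ _
    · exact l2Norm_projOp_le k N m hh

lemma l2Norm_sub_projOp_le {k q : ℕ} (hq : q ≤ k) (N : ℕ) (m : Fin d) {f : (Fin d → ℝ) → ℝ}
    (hf : ContDiff ℝ ∞ f) (hg : BddMeas ((partialDeriv m)^[q + 1] f)) :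
    l2Norm (cube d) (fun x => f x - projOp k N m f x)
      ≤ (1 / 2 ^ N) ^ (q + 1) * (2 * reproBound k)
        * l2Norm (cube d) ((partialDeriv m)^[q + 1] f) := by
  rw [l2Norm_congr_cube (sub_projOp_eqOn hq N m hf hg)]
  exact l2Norm_errOp_le k q N m hg

lemma l2Norm_sub_fullOp_sq_le_sum {k q : ℕ} (hq : q ≤ k) (N : ℕ) {S : List (Fin d)} (hS : S.Nodup)
    {f : (Fin d → ℝ) → ℝ} (hf : ContDiff ℝ ∞ f) (hfb : BddMeas f)
    (hg : ∀ m, BddMeas ((partialDeriv m)^[q + 1] f)) :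
    l2Norm (cube d) (fun x => f x - fullOp k N S f x) ^ 2
      ≤ ((1 / 2 ^ N) ^ (q + 1) * (2 * reproBound k)) ^ 2
        * ∑ m, l2Norm (cube d) ((partialDeriv m)^[q + 1] f) ^ 2 := by
  refine (l2Norm_sub_fullOp_sq_le k N S hS hfb).trans ?_
  refine (Finset.sum_le_sum_of_subset_of_nonneg (Finset.subset_univ _)
    fun _ _ _ => sq_nonneg _).trans ?_
  rw [Finset.mul_sum]
  refine Finset.sum_le_sum fun m _ => ?_
  rw [← mul_pow]
  gcongr
  · exact l2Norm_nonneg _ _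
  · exact l2Norm_sub_projOp_le hq N m hf (hg m)

/-- The error of the derivative of the full projection. The part of the error that comes from the
other directions is `P'_m R_0 (1 - Q) ∂_m f` with the projection `Q` in those directions. -/
lemma l2Norm_partialDeriv_sub_fullOp_sq_le {k r : ℕ} (hr : r + 1 ≤ k) (N : ℕ) (m : Fin d)
    {f : (Fin d → ℝ) → ℝ} (hf : ContDiff ℝ ∞ f) (hfb : BddMeas f) (hfm : BddMeas (partialDeriv m f))
    (hg : BddMeas ((partialDeriv m)^[r + 2] f))
    (hgi : ∀ i, BddMeas ((partialDeriv i)^[r + 1] (partialDeriv m f))) :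
    l2Norm (cube d) (fun x => partialDeriv m f x
        - 2 ^ N * dprojOp k N m (fullOp k N (List.finRange d) f) x) ^ 2
      ≤ 8 * reproBound k ^ 4 * ((1 / 2 ^ N) ^ (r + 1)) ^ 2
        * (l2Norm (cube d) ((partialDeriv m)^[r + 2] f) ^ 2
          + ∑ i, l2Norm (cube d) ((partialDeriv i)^[r + 1] (partialDeriv m f)) ^ 2) := by
  have hM := one_le_reproBound k
  set S := (List.finRange d).erase m with hS
  have hSn : S.Nodup := (List.nodup_finRange d).erase m
  have hmS : m ∉ S := (List.nodup_finRange d).not_mem_erase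
  have hκ' := bddKernel_dproj k N
  have hκ0 := bddKernel_rem 0 N
  set f' := partialDeriv m f with hf'
  set h := (partialDeriv m)^[r + 2] f with hh
  -- `A` is the error in direction `m` alone. The rest is `B`, in which the derivative has already
  -- been moved onto `f`, so that the error `X` in the other directions is that of `∂_m f`.
  set X : (Fin d → ℝ) → ℝ := fun x => f' x - fullOp k N S f' x with hX
  have hXb : BddMeas X := hfm.sub (hfm.fullOp k N S)
  set A : (Fin d → ℝ) → ℝ := fun x => f' x - 2 ^ N * dprojOp k N m f x with hA
  set B : (Fin d → ℝ) → ℝ := dprojOp k N m (remOp 0 N m X) with hB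
  have hAb : BddMeas A := hfm.sub ((hfb.kernelOp hκ' m).const_mul _)
  have hBb : BddMeas B := (hXb.kernelOp hκ0 m).kernelOp hκ' m
  have hD : dprojOp k N m f = fun x => (1 / 2 ^ N) * dprojOp k N m (remOp 0 N m f') x :=
    funext fun x => dprojOp_eq N m hf hfm x
  -- The factor `2^N` of the inverse estimate cancels against the `2^{-N}` in `hD`.
  have hsplit : ∀ x, f' x - 2 ^ N * dprojOp k N m (fullOp k N (List.finRange d) f) x
      = A x + B x := by
    intro x
    rw [dprojOp_fullOp k N (List.nodup_finRange d) (List.mem_finRange m) hfb]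
    have e1 : B x = dprojOp k N m (remOp 0 N m f') x
        - fullOp k N S (dprojOp k N m (remOp 0 N m f')) x := by
      simp only [hB, hX, dprojOp, remOp]
      rw [kernelOp_sub hκ0 hfm (hfm.fullOp k N S),
        kernelOp_sub hκ' (hfm.kernelOp hκ0 m) ((hfm.fullOp k N S).kernelOp hκ0 m),
        kernelOp_fullOp hκ0 hmS k N hfm, kernelOp_fullOp hκ' hmS k N (hfm.kernelOp hκ0 m)]
    have e2 : fullOp k N S (dprojOp k N m f) x
        = (1 / 2 ^ N) * fullOp k N S (dprojOp k N m (remOp 0 N m f')) x := by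
      rw [hD, fullOp_const_mul]
    have e3 : dprojOp k N m f x = (1 / 2 ^ N) * dprojOp k N m (remOp 0 N m f') x := by
      rw [hD]
    rw [← hS, e2, hA, e1]
    simp only
    rw [e3]
    field_simp
    ring
  have nA : l2Norm (cube d) A ≤ (1 / 2 ^ N) ^ (r + 1) * (2 * reproBound k) * l2Norm (cube d) h := by
    have hR := hg.kernelOp (bddKernel_rem r N) m
    have hR1 := hg.kernelOp (bddKernel_rem (r + 1) N) m
    have e : EqOn A (fun x => (1 / 2 ^ N) ^ (r + 1)
        * (remOp r N m h x - dprojOp k N m (remOp (r + 1) N m h) x)) (cube d) := fun x hx =>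
      partialDeriv_sub_dprojOp_eq hr N m hf hg (Ioo_subset_Ioc_self (mem_cube.1 hx m))
    rw [l2Norm_congr_cube e, l2Norm_const_mul, abs_of_pos (by positivity), mul_assoc]
    refine mul_le_mul_of_nonneg_left ?_ (by positivity)
    refine (l2Norm_sub_le (hR.memLp 2) ((hR1.kernelOp hκ' m).memLp 2)).trans ?_
    have h1 := l2Norm_cellKernel_le (localKernel_taylor r) N m hg
    have h2 := l2Norm_cellKernel_le (localKernel_reproDeriv k) N m hR1
    have h3 := l2Norm_cellKernel_le (localKernel_taylor (r + 1)) N m hg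
    have h4 := l2Norm_nonneg (cube d) h
    have h5 : reproBound k * l2Norm (cube d) (kernelOp (cellKernel N (taylorKernel (r + 1))) m h)
        ≤ reproBound k * (1 * l2Norm (cube d) h) := by gcongr
    nlinarith
  have nB : l2Norm (cube d) B ≤ reproBound k * l2Norm (cube d) X := by
    have h1 := l2Norm_cellKernel_le (localKernel_reproDeriv k) N m (hXb.kernelOp hκ0 m)
    have h2 := l2Norm_cellKernel_le (localKernel_taylor 0) N m hXb
    rw [one_mul] at h2
    exact h1.trans (by gcongr)
  have nX := l2Norm_sub_fullOp_sq_le_sum (k := k) (q := r) (by omega) N hSn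
    (contDiff_partialDeriv hf m)
    hfm hgi
  simp only [hsplit]
  set a := l2Norm (cube d) A
  set b := l2Norm (cube d) B
  set η : ℝ := (1 / 2 ^ N) ^ (r + 1) with hη
  set s₂ := ∑ i, l2Norm (cube d) ((partialDeriv i)^[r + 1] f') ^ 2
  have hadd : l2Norm (cube d) (fun x => A x + B x) ≤ a + b :=
    l2Norm_add_le (hAb.memLp 2) (hBb.memLp 2)
  have ha0 : 0 ≤ a := l2Norm_nonneg _ _
  have hb0 : 0 ≤ b := l2Norm_nonneg _ _
  have hη0 : 0 ≤ η := by positivity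
  have hs₂ : 0 ≤ s₂ := Finset.sum_nonneg fun _ _ => sq_nonneg _
  have ha2 : a ^ 2 ≤ (η * (2 * reproBound k) * l2Norm (cube d) h) ^ 2 := by gcongr
  have hb2 : b ^ 2 ≤ reproBound k ^ 2 * ((η * (2 * reproBound k)) ^ 2 * s₂) := by
    calc b ^ 2 ≤ (reproBound k * l2Norm (cube d) X) ^ 2 := by gcongr
      _ = reproBound k ^ 2 * l2Norm (cube d) X ^ 2 := mul_pow _ _ _
      _ ≤ _ := by gcongr
  calc l2Norm (cube d) (fun x => A x + B x) ^ 2 ≤ (a + b) ^ 2 := by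
        gcongr
        exact l2Norm_nonneg _ _
    _ ≤ 2 * a ^ 2 + 2 * b ^ 2 := by nlinarith [sq_nonneg (a - b)]
    _ ≤ 2 * (η * (2 * reproBound k) * l2Norm (cube d) h) ^ 2
        + 2 * (reproBound k ^ 2 * ((η * (2 * reproBound k)) ^ 2 * s₂)) := by gcongr
    _ = 8 * reproBound k ^ 2 * η ^ 2 * l2Norm (cube d) h ^ 2
        + 8 * reproBound k ^ 4 * η ^ 2 * s₂ := by ring
    _ ≤ 8 * reproBound k ^ 4 * η ^ 2 * l2Norm (cube d) h ^ 2
        + 8 * reproBound k ^ 4 * η ^ 2 * s₂ := by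
        have : reproBound k ^ 2 ≤ reproBound k ^ 4 := pow_le_pow_right₀ hM (by norm_num)
        gcongr
    _ = _ := by ring

end FullProjection

/-! ### Smooth approximation on the cube -/

section CubeApprox
variable {d : ℕ}

lemma hasWeakDeriv_weakDeriv {α : Fin d → ℕ} {U : Set (Fin d → ℝ)} {v : (Fin d → ℝ) → ℝ}
    (h : ∃ g, HasWeakDeriv α U v g) : HasWeakDeriv α U v (weakDeriv α U v) := by
  rw [weakDeriv, dif_pos h]
  exact h.choose_spec

lemma MemSobolev.hasWeakDeriv {m : ℕ} {U : Set (Fin d → ℝ)} {v : (Fin d → ℝ) → ℝ}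
    (hv : MemSobolev m U v) {α : Fin d → ℕ} (hα : ∑ i, α i ≤ m) :
    HasWeakDeriv α U v (weakDeriv α U v) :=
  hasWeakDeriv_weakDeriv ((hv α hα).imp fun _ h => h.2)

lemma MemSobolev.memLp_weakDeriv {m : ℕ} {U : Set (Fin d → ℝ)} (hU : IsOpen U)
    {v : (Fin d → ℝ) → ℝ} (hv : MemSobolev m U v) {α : Fin d → ℕ} (hα : ∑ i, α i ≤ m) :
    MemLp (weakDeriv α U v) 2 (volume.restrict U) := by
  obtain ⟨g, hg, hw⟩ := hv α hα
  exact hg.ae_eq (weakDeriv_ae_eq hU hw).symm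

lemma MemSobolev.memLp {m : ℕ} {U : Set (Fin d → ℝ)} (hU : IsOpen U)
    {v : (Fin d → ℝ) → ℝ} (hv : MemSobolev m U v) : MemLp v 2 (volume.restrict U) := by
  have h0 : ∑ i, (0 : Fin d → ℕ) i ≤ m := by simp
  exact (hv.memLp_weakDeriv hU h0).ae_eq ((hv.hasWeakDeriv h0).ae_eq_of_zero hU).symm

lemma bddMeas_of_hasCompactSupport {f : (Fin d → ℝ) → ℝ} (hf : Continuous f)
    (hc : HasCompactSupport f) : BddMeas f :=
  ⟨hf.measurable, hf.bounded_above_of_compact_support hc⟩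

/-- Mollified dilations converge in `L²` of the cube. -/
lemma eventually_l2Norm_scaled_mollify_sub_le {G : (Fin d → ℝ) → ℝ} (hG : Measurable G)
    (h2 : MemLp G 2) (a : ℕ) {η : ℝ} (hη : 0 < η) :
    ∀ᶠ s in nhdsWithin (0 : ℝ) (Ioi 0), ∀ φ, IsMollifier φ (s / 2) →
      l2Norm (cube d) (fun x => (1 - 2 * s) ^ a
        * mollify G φ ((fun _ => s) + (1 - 2 * s) • x) - G x) ≤ η := by
  obtain ⟨δ, hδ, hδ2, h⟩ := exists_eLpNorm_affine_sub_le hG h2 (half_pos hη)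
  set B := l2Norm (cube d) G with hB
  have hB0 : 0 ≤ B := l2Norm_nonneg _ _
  have hs₀ : 0 < min (δ / 2) (η / (4 * (a * B + 1))) := by positivity
  filter_upwards [Ioc_mem_nhdsGT hs₀] with s hs φ hφ
  have hs0 : 0 < s := hs.1
  have hs1 : s ≤ δ / 2 := hs.2.trans (min_le_left _ _)
  have hs2 : s ≤ η / (4 * (a * B + 1)) := hs.2.trans (min_le_right _ _)
  set r : ℝ := 1 - 2 * s with hr
  have hr0 : 0 ≤ r := by linarith
  have hr1 : r ≤ 1 := by linarith
  set z : Fin d → ℝ := fun _ => s with hz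
  have hzn : ‖z‖ ≤ s := (pi_norm_le_iff_of_nonneg hs0.le).2 fun i => by
    simp [hz, abs_of_pos hs0]
  have hGl : LocallyIntegrable G := h2.locallyIntegrable (by norm_num)
  have hG2 : MemLp G 2 (cubeMeasure d) := h2.restrict _
  set T : (Fin d → ℝ) → ℝ := fun x => mollify G φ (z + r • x) - G x with hT
  have hφi : Integrable φ := hφ.contDiff.continuous.integrable_of_hasCompactSupport
    hφ.hasCompactSupport
  -- The mollified dilation is an average of affine maps close to the identity.
  have hTe : T = fun x => ∫ y, φ y * (G (z - y + r • x) - G x) := by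
    ext x
    have e : ∀ y, z - y + r • x = z + r • x - y := fun y => by abel
    simp only [mul_sub, e]
    rw [integral_sub (hφ.integrable_mul hGl _) (hφi.mul_const _), integral_mul_const,
      hφ.integral_eq, one_mul, ← mollify_apply']
  have hTm : Measurable T := by
    have h1 := (contDiff_mollify hGl hφ.contDiff hφ.hasCompactSupport).continuous
    have h3 : Continuous fun x : Fin d → ℝ => z + r • x := by fun_prop
    exact (h1.comp h3).measurable.sub hG
  have hTn : eLpNorm T 2 (cubeMeasure d) ≤ ENNReal.ofReal (η / 2) := by
    rw [hTe]
    refine eLpNorm_average_le hφ (F := fun x y => G (z - y + r • x) - G x) ?_ fun y hy => ?_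
    · refine (hG.comp ?_).sub (hG.comp measurable_fst)
      fun_prop
    · have hyn := hφ.norm_le hy
      refine (eLpNorm_mono_measure _ Measure.restrict_le_self).trans
        (h r (by linarith) hr1 (z - y) ?_)
      refine (norm_sub_le _ _).trans ?_
      linarith
  obtain ⟨hT2, hT3⟩ := l2Norm_le_of_eLpNorm_le (half_pos hη).le hTm.aestronglyMeasurable hTn
  have e : (fun x => r ^ a * mollify G φ (z + r • x) - G x)
      = fun x => r ^ a * T x + (r ^ a - 1) * G x := by
    ext x; simp only [hT]; ring
  rw [e]
  refine (l2Norm_add_le (hT2.const_mul _) (hG2.const_mul _)).trans ?_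
  have hra0 : 0 ≤ r ^ a := pow_nonneg hr0 a
  have hra1 : r ^ a ≤ 1 := pow_le_one₀ hr0 hr1
  -- Bernoulli's inequality
  have hra2 : 1 - 2 * s * a ≤ r ^ a := by
    have := one_add_mul_le_pow (a := -(2 * s)) (by linarith) a
    rw [hr]
    calc 1 - 2 * s * a = 1 + a * -(2 * s) := by ring
      _ ≤ _ := this
      _ = _ := by ring
  rw [l2Norm_const_mul, l2Norm_const_mul, abs_of_nonneg hra0, abs_of_nonpos (by linarith), ← hB]
  have h5 : r ^ a * l2Norm (cube d) T ≤ 1 * (η / 2) := by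
    gcongr
    exact l2Norm_nonneg _ _
  have h6 : -(r ^ a - 1) * B ≤ 2 * s * a * B := by
    gcongr
    linarith
  have h7 : s * (4 * (a * B + 1)) ≤ η := by
    rwa [le_div_iff₀ (by positivity)] at hs2
  nlinarith

/-- Functions of `H^m` of the cube are limits of smooth functions. The cube is first dilated into
itself, so that mollification does not see its boundary. -/
lemma MemSobolev.exists_smooth_approx {m : ℕ} {v : (Fin d → ℝ) → ℝ}
    (hv : MemSobolev m (cube d) v) {η : ℝ} (hη : 0 < η) :
    ∃ g, ContDiff ℝ ∞ g ∧ HasCompactSupport g ∧ ∀ α : Fin d → ℕ, ∑ i, α i ≤ m →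
      l2Norm (cube d) (fun x => multiDeriv α g x - weakDeriv α (cube d) v x) ≤ η := by
  have hcm := measurableSet_cube d
  -- Measurable representatives of the weak derivatives, extended by zero.
  have hrep : ∀ α : Fin d → ℕ, ∑ i, α i ≤ m → ∃ G, Measurable G ∧ MemLp G 2 ∧
      ∀ᵐ x, (cube d).indicator (weakDeriv α (cube d) v) x = G x := by
    intro α hα
    have h := (memLp_indicator_iff_restrict hcm).2 (hv.memLp_weakDeriv (isOpen_cube d) hα)
    exact ⟨h.1.mk _, h.1.stronglyMeasurable_mk.measurable, h.ae_eq h.1.ae_eq_mk, h.1.ae_eq_mk⟩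
  choose! G hGm hG2 hGe using hrep
  have hfin : {α : Fin d → ℕ | ∑ i, α i ≤ m}.Finite := by
    refine (Fintype.piFinset fun _ : Fin d => Finset.range (m + 1)).finite_toSet.subset
      fun α hα => ?_
    refine Finset.mem_coe.2 (Fintype.mem_piFinset.2 fun i => Finset.mem_range.2 ?_)
    have hα : ∑ i, α i ≤ m := hα
    have := (Finset.single_le_sum (f := α) (fun _ _ => Nat.zero_le _) (Finset.mem_univ i)).trans hα
    omega
  have hev := (Filter.eventually_all_finite hfin).2 fun α hα =>
    eventually_l2Norm_scaled_mollify_sub_le (hGm α hα) (hG2 α hα) (∑ i, α i) hη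
  -- Only finitely many derivatives matter, so one scale serves them all.
  obtain ⟨s, hs, hs0, hs1⟩ := (hev.and (Ioo_mem_nhdsGT (show (0 : ℝ) < 1 / 4 by norm_num))).exists
  obtain ⟨φ, hφ⟩ := exists_isMollifier (d := d) (half_pos hs0)
  set r : ℝ := 1 - 2 * s with hr
  have hr0 : 0 < r := by linarith
  set z : Fin d → ℝ := fun _ => s with hz
  set f : (Fin d → ℝ) → ℝ := (cube d).indicator v with hf
  have hf2 : MemLp f 2 := (memLp_indicator_iff_restrict hcm).2 (hv.memLp (isOpen_cube d))
  have hfl : LocallyIntegrable f := hf2.locallyIntegrable (by norm_num)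
  have hfc : HasCompactSupport f := by
    refine HasCompactSupport.of_support_subset_isCompact
      (isCompact_univ_pi fun _ : Fin d => isCompact_Icc (a := (0 : ℝ)) (b := 1)) ?_
    refine (support_indicator_subset).trans fun x hx => ?_
    exact fun i _ => Ioo_subset_Icc_self (mem_cube.1 hx i)
  set w := mollify f φ with hw
  have hws : ContDiff ℝ ∞ w := contDiff_mollify hfl hφ.contDiff hφ.hasCompactSupport
  have hwc : HasCompactSupport w := HasCompactSupport.convolution _ hfc hφ.hasCompactSupport
  have hgc : HasCompactSupport fun x => w (z + r • x) :=
    hwc.comp_homeomorph ((Homeomorph.smulOfNeZero r hr0.ne').trans (Homeomorph.addLeft z))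
  refine ⟨fun x => w (z + r • x), hws.comp (by fun_prop),
    hgc, fun α hα => ?_⟩
  refine le_trans (le_of_eq (l2Norm_congr ?_)) (hs α hα φ hφ)
  filter_upwards [ae_mem_cube d, ae_restrict_of_ae (hGe α hα)] with x hx hxG
  rw [indicator_of_mem hx] at hxG
  rw [congrFun (multiDeriv_comp_affine hws z r α) x, hxG]
  congr 2
  -- The dilated point has distance at least `s` from the boundary, more than the radius `s / 2` of
  -- the mollifier.
  have hsupp : tsupport (fun t => φ (z + r • x - t)) ⊆ cube d := by
    have h1 : tsupport (fun t => φ (z + r • x - t)) ⊆ Metric.closedBall (z + r • x) (s / 2) := by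
      refine closure_minimal (fun t ht => ?_) Metric.isClosed_closedBall
      rw [Metric.mem_closedBall', dist_eq_norm]
      exact hφ.norm_le ht
    refine h1.trans fun t ht => mem_cube.2 fun i => ?_
    rw [Metric.mem_closedBall', dist_eq_norm] at ht
    have h2 := (norm_le_pi_norm (z + r • x - t) i).trans ht
    simp only [hz, Pi.sub_apply, Pi.add_apply, Pi.smul_apply, smul_eq_mul, Real.norm_eq_abs,
      abs_le] at h2
    obtain ⟨h3, h4⟩ := mem_cube.1 hx i
    have h5 : 0 < r * x i := mul_pos hr0 h3
    have h6 : r * x i < r := mul_lt_of_lt_one_right hr0 h4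
    constructor <;> linarith [h2.1, h2.2]
  rw [hw, multiDeriv_mollify_eq (isOpen_cube d) hfl (fun y hy => indicator_of_mem hy v)
    hφ.contDiff hφ.hasCompactSupport (hv.hasWeakDeriv hα) hsupp, mollify_apply,
    ← integral_indicator hcm]
  refine integral_congr_ae ?_
  filter_upwards [hGe α hα] with t ht
  rw [← ht]
  by_cases htc : t ∈ cube d
  · simp [indicator_of_mem htc]
  · simp [indicator_of_notMem htc]

lemma MemSobolev.exists_smooth_seq {m : ℕ} {v : (Fin d → ℝ) → ℝ}
    (hv : MemSobolev m (cube d) v) : ∃ g : ℕ → (Fin d → ℝ) → ℝ,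
      (∀ n, ContDiff ℝ ∞ (g n)) ∧ (∀ n, HasCompactSupport (g n)) ∧
      ∀ α : Fin d → ℕ, ∑ i, α i ≤ m → Filter.Tendsto (fun n => l2Norm (cube d)
        (fun x => multiDeriv α (g n) x - weakDeriv α (cube d) v x)) Filter.atTop (nhds 0) := by
  choose g h1 h2 h3 using fun n : ℕ =>
    hv.exists_smooth_approx (η := 1 / ((n : ℝ) + 1)) (by positivity)
  refine ⟨g, h1, h2, fun α hα => ?_⟩
  exact squeeze_zero (fun n => l2Norm_nonneg _ _) (fun n => h3 n α hα)
    tendsto_one_div_add_atTop_nhds_zero_nat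

lemma l2Norm_mono_set {U U' : Set (Fin d → ℝ)} (h : U ⊆ U') {f : (Fin d → ℝ) → ℝ}
    (hf : MemLp f 2 (volume.restrict U')) : l2Norm U f ≤ l2Norm U' f :=
  Real.sqrt_le_sqrt (setIntegral_mono_set hf.integrable_sq
    (Filter.Eventually.of_forall fun _ => sq_nonneg _) h.eventuallyLE)

/-- Convergence in `L²` of the cube implies convergence of the norms on subsets. -/
lemma tendsto_l2Norm {U : Set (Fin d → ℝ)} (hU : U ⊆ cube d) {f : ℕ → (Fin d → ℝ) → ℝ}
    {g : (Fin d → ℝ) → ℝ} (hf : ∀ n, MemLp (f n) 2 (cubeMeasure d))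
    (hg : MemLp g 2 (cubeMeasure d)) (h : Filter.Tendsto
      (fun n => l2Norm (cube d) (fun x => f n x - g x)) Filter.atTop (nhds 0)) :
    Filter.Tendsto (fun n => l2Norm U (f n)) Filter.atTop (nhds (l2Norm U g)) := by
  have hm : ∀ {F : (Fin d → ℝ) → ℝ}, MemLp F 2 (cubeMeasure d) → MemLp F 2 (volume.restrict U) :=
    fun hF => hF.mono_measure (Measure.restrict_mono hU le_rfl)
  have htri : ∀ {F F' : (Fin d → ℝ) → ℝ}, MemLp F 2 (volume.restrict U) →
      MemLp F' 2 (volume.restrict U) → l2Norm U F - l2Norm U F'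
          ≤ l2Norm U (fun x => F x - F' x) := by
    intro F F' hF hF'
    have h1 := l2Norm_add_le (hF.sub hF') hF'
    simp only [Pi.sub_apply, sub_add_cancel] at h1
    exact sub_le_iff_le_add.2 h1
  rw [tendsto_iff_dist_tendsto_zero]
  refine squeeze_zero (fun n => dist_nonneg) (fun n => ?_) h
  have h1 : |l2Norm U (f n) - l2Norm U g| ≤ l2Norm U (fun x => f n x - g x) := by
    rw [abs_sub_le_iff]
    refine ⟨htri (hm (hf n)) (hm hg), ?_⟩
    rw [l2Norm_sub_comm]
    exact htri (hm hg) (hm (hf n))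
  exact h1.trans (l2Norm_mono_set hU ((hf n).sub hg))

end CubeApprox

/-! ### Sobolev seminorms on the cells -/

section Seminorms
variable {d : ℕ}

lemma multiDeriv_single {f : (Fin d → ℝ) → ℝ} (hf : ContDiff ℝ ∞ f) (i : Fin d) (r : ℕ) :
    multiDeriv (Pi.single i r) f = (partialDeriv i)^[r] f := by
  have h := multiDeriv_update hf 0 i r
  rw [multiDeriv_zero] at h
  rw [← h]
  congr 1
  simp [Pi.single]

lemma multiDeriv_single_add_single {f : (Fin d → ℝ) → ℝ} (hf : ContDiff ℝ ∞ f) (i m : Fin d)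
    (r s : ℕ) : multiDeriv (Pi.single i r + Pi.single m s) f
      = (partialDeriv i)^[r] ((partialDeriv m)^[s] f) := by
  rw [← multiDeriv_single hf m s, ← multiDeriv_update hf]
  congr 1
  ext a
  by_cases h : a = i
  · subst h; simp [add_comm]
  · simp [h]

lemma sum_single (i : Fin d) (r : ℕ) : ∑ a, (Pi.single i r : Fin d → ℕ) a = r := by
  simp

lemma sobolevSeminorm_zero (U : Set (Fin d → ℝ)) (v : (Fin d → ℝ) → ℝ) :
    sobolevSeminorm 0 U v = l2Norm U (weakDeriv 0 U v) := by
  rw [sobolevSeminorm, Finset.Nat.antidiagonalTuple_zero_right, Finset.sum_singleton,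
    Real.sqrt_sq (l2Norm_nonneg _ _)]

lemma sum_antidiagonalTuple_one (F : (Fin d → ℕ) → ℝ) :
    ∑ α ∈ Finset.Nat.antidiagonalTuple d 1, F α = ∑ i, F (Pi.single i 1) := by
  have e : Finset.Nat.antidiagonalTuple d 1
      = Finset.univ.image fun i : Fin d => (Pi.single i 1 : Fin d → ℕ) := by
    ext α
    simp only [Finset.Nat.mem_antidiagonalTuple, Finset.mem_image, Finset.mem_univ, true_and]
    constructor
    · intro h
      obtain ⟨i, hi⟩ : ∃ i, α i ≠ 0 := by
        by_contra! hn
        simp [hn] at h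
      have h1 := Finset.add_sum_erase Finset.univ α (Finset.mem_univ i)
      have h2 : ∑ a ∈ Finset.univ.erase i, α a = 0 := by omega
      refine ⟨i, ?_⟩
      ext a
      by_cases ha : a = i
      · subst ha; simp only [Pi.single_eq_same]; omega
      · rw [Pi.single_eq_of_ne ha]
        exact ((Finset.sum_eq_zero_iff.1 h2) a (by simp [ha])).symm
    · rintro ⟨i, rfl⟩
      simp
  rw [e, Finset.sum_image]
  intro i _ j _ h
  by_contra hij
  have := congrFun h i
  simp [Pi.single_eq_of_ne hij] at this

lemma sobolevSeminorm_one (U : Set (Fin d → ℝ)) (v : (Fin d → ℝ) → ℝ) :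
    sobolevSeminorm 1 U v ^ 2 = ∑ i, l2Norm U (weakDeriv (Pi.single i 1) U v) ^ 2 := by
  rw [sobolevSeminorm, Real.sq_sqrt (Finset.sum_nonneg fun _ _ => sq_nonneg _),
    sum_antidiagonalTuple_one fun α => l2Norm U (weakDeriv α U v) ^ 2]

lemma l2Norm_weakDeriv_le_sobolevSeminorm {s : ℕ} (U : Set (Fin d → ℝ)) (v : (Fin d → ℝ) → ℝ)
    {α : Fin d → ℕ} (hα : ∑ i, α i = s) :
    l2Norm U (weakDeriv α U v) ≤ sobolevSeminorm s U v := by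
  refine Real.le_sqrt_of_sq_le ?_
  exact Finset.single_le_sum (f := fun α => l2Norm U (weakDeriv α U v) ^ 2)
    (fun _ _ => sq_nonneg _) (Finset.Nat.mem_antidiagonalTuple.2 hα)

/-- The exponents `a` and `b` at two ordered places determine the places. -/
lemma single_add_single_inj {a b : ℕ} (ha : 1 ≤ a) {i m i' m' : Fin d} (h : i ≤ m) (h' : i' ≤ m')
    (he : (Pi.single i a + Pi.single m b : Fin d → ℕ) = Pi.single i' a + Pi.single m' b)
    (hb : 1 ≤ b) : i = i' ∧ m = m' := by
  have key : ∀ {i m i' m' : Fin d}, i' ≤ m' →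
      (Pi.single i a + Pi.single m b : Fin d → ℕ) = Pi.single i' a + Pi.single m' b →
      ¬ i < i' := by
    intro i m i' m' h' he hlt
    have h1 := congrFun he i
    simp only [Pi.add_apply, Pi.single_eq_same, Pi.single_eq_of_ne hlt.ne,
      Pi.single_eq_of_ne (hlt.trans_le h').ne] at h1
    omega
  have hi : i = i' := le_antisymm (not_lt.1 (key h he.symm)) (not_lt.1 (key h' he))
  subst hi
  refine ⟨rfl, ?_⟩
  have h2 := congrFun (add_left_cancel he) m
  by_contra hne
  rw [Pi.single_eq_same, Pi.single_eq_of_ne hne] at h2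
  omega

/-- Every derivative of order `a + b` is a mixed derivative in at most two directions in at most two
ways. -/
lemma sum_single_add_single_le {F : (Fin d → ℕ) → ℝ} (hF : ∀ α, 0 ≤ F α) {a b : ℕ} (ha : 1 ≤ a)
    (hb : 1 ≤ b) : ∑ m, ∑ i, F (Pi.single i a + Pi.single m b)
      ≤ 2 * ∑ α ∈ Finset.Nat.antidiagonalTuple d (a + b), F α := by
  have key : ∀ (φ : Fin d × Fin d → Fin d → ℕ) (T : Finset (Fin d × Fin d)),
      (∀ p, ∑ i, φ p i = a + b) → Set.InjOn φ T →
      ∑ p ∈ T, F (φ p) ≤ ∑ α ∈ Finset.Nat.antidiagonalTuple d (a + b), F α := by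
    intro φ T hφ hinj
    rw [← Finset.sum_image (f := F) hinj]
    refine Finset.sum_le_sum_of_subset_of_nonneg (fun α hα => ?_) fun _ _ _ => hF _
    obtain ⟨p, -, rfl⟩ := Finset.mem_image.1 hα
    exact Finset.Nat.mem_antidiagonalTuple.2 (hφ p)
  -- On either side of the diagonal the pair of directions is determined by the multi-index.
  set φ : Fin d × Fin d → Fin d → ℕ := fun p => Pi.single p.2 a + Pi.single p.1 b with hφ
  have hsum : ∀ p, ∑ i, φ p i = a + b := fun p => by
    simp [hφ, Finset.sum_add_distrib]
  have h1 := key φ (Finset.univ.filter fun p => p.2 ≤ p.1) hsum (by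
    intro p hp p' hp' h
    simp only [Finset.coe_filter, Finset.mem_univ, true_and, mem_ofPred_eq] at hp hp'
    have := single_add_single_inj ha hp hp' h hb
    exact Prod.ext this.2 this.1)
  have h2 := key φ (Finset.univ.filter fun p => ¬ p.2 ≤ p.1) hsum (by
    intro p hp p' hp' h
    simp only [Finset.coe_filter, Finset.mem_univ, true_and, mem_ofPred_eq, not_le] at hp hp'
    have := single_add_single_inj hb hp.le hp'.le
      ((add_comm _ _).trans ((show Pi.single p.2 a + Pi.single p.1 b
        = (Pi.single p'.2 a + Pi.single p'.1 b : Fin d → ℕ) from h).trans (add_comm _ _))) ha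
    exact Prod.ext this.1 this.2)
  have e : ∑ m, ∑ i, F (Pi.single i a + Pi.single m b) = ∑ p, F (φ p) :=
    (Fintype.sum_prod_type fun p => F (φ p)).symm
  rw [e, ← Finset.sum_filter_add_sum_filter_not _ fun p => p.2 ≤ p.1, two_mul]
  exact add_le_add h1 h2

lemma HasWeakDeriv.sub {α : Fin d → ℕ} {U : Set (Fin d → ℝ)} {v g v' g' : (Fin d → ℝ) → ℝ}
    (h : HasWeakDeriv α U v g) (h' : HasWeakDeriv α U v' g') :
    HasWeakDeriv α U (fun x => v x - v' x) (fun x => g x - g' x) := by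
  refine ⟨h.1.sub h'.1, h.2.1.sub h'.2.1, fun φ hφ hc hs => ?_⟩
  have hm := contDiff_multiDeriv hφ α
  have hmc : HasCompactSupport (multiDeriv α φ) :=
    IsCompact.of_isClosed_subset hc (isClosed_tsupport _) (tsupport_multiDeriv_subset φ α)
  have hms := (tsupport_multiDeriv_subset φ α).trans hs
  simp only [sub_mul]
  rw [integral_sub (integrable_mul_test h.1 hm hmc hms).integrableOn
      (integrable_mul_test h'.1 hm hmc hms).integrableOn,
    integral_sub (integrable_mul_test h.2.1 hφ hc hs).integrableOn
      (integrable_mul_test h'.2.1 hφ hc hs).integrableOn, h.2.2 φ hφ hc hs, h'.2.2 φ hφ hc hs,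
    mul_sub]

lemma BddMeas.locallyIntegrableOn {f : (Fin d → ℝ) → ℝ} (hf : BddMeas f)
    (U : Set (Fin d → ℝ)) : LocallyIntegrableOn f U := by
  refine LocallyIntegrable.locallyIntegrableOn (fun x => ?_) U
  obtain ⟨C, hC⟩ := hf.bdd
  refine ⟨Metric.ball x 1, Metric.ball_mem_nhds x one_pos, ?_⟩
  exact Measure.integrableOn_of_bounded (M := C) measure_ball_lt_top.ne
    hf.measurable.aestronglyMeasurable (Filter.Eventually.of_forall hC)

/-- The weak derivatives of a piecewise polynomial on a cell are the classical ones. -/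
lemma hasWeakDeriv_of_mem_fullSpace {N k : ℕ} {w : (Fin d → ℝ) → ℝ} (hw : w ∈ fullSpace d N k)
    (j : Fin d → Fin (2 ^ N)) (m : Fin d) :
    HasWeakDeriv (Pi.single m 1) (cell N j) w (fun x => 2 ^ N * dprojOp k N m w x) := by
  have hwb := bddMeas_of_mem_fullSpace hw
  have hgb : BddMeas fun x => 2 ^ N * dprojOp k N m w x :=
    (hwb.kernelOp (bddKernel_dproj k N) m).const_mul _
  have hcm := (isOpen_cell N j).measurableSet
  refine ⟨hwb.locallyIntegrableOn _, hgb.locallyIntegrableOn _, fun φ hφ hc hs => ?_⟩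
  -- On the cell `w` is smooth, and the test functions vanish near its boundary.
  obtain ⟨F, hF, hFe⟩ := exists_contDiff_eqOn_cell hw j
  have hder : ∀ x ∈ cell N j, 2 ^ N * dprojOp k N m w x = partialDeriv m F x := by
    intro x hx
    rw [← partialDeriv_eq_dprojOp hw hx m, partialDeriv, partialDeriv]
    have hev : w =ᶠ[nhds x] F := by
      filter_upwards [(isOpen_cell N j).mem_nhds hx] with y hy using hFe hy
    rw [hev.fderiv_eq]
  have hl : ∀ {f : (Fin d → ℝ) → ℝ}, Continuous f → LocallyIntegrableOn f univ := fun hf =>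
    hf.locallyIntegrable.locallyIntegrableOn _
  have hdc := (HasCompactSupport.partialDeriv hc m)
  have hds := contDiff_partialDeriv hφ m
  have hibp := integral_mul_fderiv_eq_neg_fderiv_mul_of_integrable (μ := volume)
    (f := F) (g := φ) (v := Pi.single m 1)
    (integrable_mul_test (hl (contDiff_partialDeriv hF m).continuous) hφ hc (subset_univ _))
    (integrable_mul_test (hl hF.continuous) hds hdc (subset_univ _))
    (integrable_mul_test (hl hF.continuous) hφ hc (subset_univ _))
    (fun x _ => hF.differentiable (by simp) x) (fun x _ => hφ.differentiable (by simp) x)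
  rw [multiDeriv_single hφ, Function.iterate_one, sum_single, pow_one, neg_one_mul]
  have e1 : ∫ x in cell N j, w x * partialDeriv m φ x = ∫ x, F x * partialDeriv m φ x := by
    rw [setIntegral_congr_fun (g := fun x => F x * partialDeriv m φ x) hcm
      fun x hx => by simp only [hFe hx]]
    refine setIntegral_eq_integral_of_forall_compl_eq_zero fun x hx => ?_
    rw [image_eq_zero_of_notMem_tsupport (f := partialDeriv m φ), mul_zero]
    exact fun h => hx (hs (tsupport_partialDeriv_subset φ m h))
  have e2 : ∫ x in cell N j, 2 ^ N * dprojOp k N m w x * φ x = ∫ x, partialDeriv m F x * φ x := by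
    rw [setIntegral_congr_fun (g := fun x => partialDeriv m F x * φ x) hcm
      fun x hx => by simp only [hder x hx]]
    refine setIntegral_eq_integral_of_forall_compl_eq_zero fun x hx => ?_
    rw [image_eq_zero_of_notMem_tsupport (f := φ), mul_zero]
    exact fun h => hx (hs h)
  rw [e1, e2]
  exact hibp

lemma sum_l2Norm_cell_sq (N : ℕ) {f : (Fin d → ℝ) → ℝ} (hf : MemLp f 2 (cubeMeasure d)) :
    ∑ j : Fin d → Fin (2 ^ N), l2Norm (cell N j) f ^ 2 = l2Norm (cube d) f ^ 2 := by
  simp only [l2Norm_sq]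
  exact sum_setIntegral_boxes N hf.integrable_sq

/-- Cell-local operators are bounded on every cell. -/
lemma l2Norm_cell_kernelOp_le {k₀ : ℝ → ℝ → ℝ} {M : ℝ} (hk : LocalKernel k₀ M) {N : ℕ}
    (j : Fin d → Fin (2 ^ N)) (m : Fin d) {f : (Fin d → ℝ) → ℝ} (hf : BddMeas f) :
    l2Norm (cell N j) (kernelOp (cellKernel N k₀) m f) ≤ M * l2Norm (cell N j) f := by
  have hcm := (isOpen_cell N j).measurableSet
  -- On the cell, the operator sees only the values of `f` on the same cell.
  set f' : (Fin d → ℝ) → ℝ := (cell N j).indicator f with hf'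
  have hfb' : BddMeas f' := by
    obtain ⟨C, hC⟩ := hf.bdd
    refine ⟨hf.measurable.indicator hcm, max C 0, fun x => ?_⟩
    by_cases hx : x ∈ cell N j
    · rw [hf', indicator_of_mem hx]; exact (hC x).trans (le_max_left _ _)
    · rw [hf', indicator_of_notMem hx, abs_zero]; exact le_max_right _ _
  have e1 : EqOn (kernelOp (cellKernel N k₀) m f) (kernelOp (cellKernel N k₀) m f') (cell N j) := by
    intro x hx
    have hxm := cell_apply_mem hx m
    refine setIntegral_congr_ae measurableSet_Ioo ?_
    have hne : ∀ᵐ s : ℝ, s ≠ (((j m : ℕ) : ℝ) + 1) / 2 ^ N := by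
      simp [ae_iff]
    filter_upwards [hne] with s hsne hs
    by_cases hidx : cellIdx N s = ((j m : ℕ) : ℤ)
    · have hs2 := (cellIdx_eq_iff (j m).2 (Ioo_subset_Ioc_self hs)).1 hidx
      have hmem : Function.update x m s ∈ cell N j := by
        rw [mem_cell]
        intro i
        by_cases hi : i = m
        · subst hi
          rw [Function.update_self]
          exact ⟨hs2.1, lt_of_le_of_ne hs2.2 hsne⟩
        · rw [Function.update_of_ne hi]
          exact mem_cell.1 hx i
      rw [hf', indicator_of_mem hmem]
    · rw [cellKernel, if_neg (by rw [hxm.2]; exact Ne.symm hidx), zero_mul, zero_mul]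
  have e2 : l2Norm (cube d) f' = l2Norm (cell N j) f := by
    have : (fun x => f' x ^ 2) = (cell N j).indicator fun x => f x ^ 2 := by
      ext x
      by_cases hx : x ∈ cell N j
      · simp only [hf', indicator_of_mem hx]
      · simp only [hf', indicator_of_notMem hx]; norm_num
    rw [l2Norm, l2Norm, this, setIntegral_indicator hcm, inter_eq_right.2 (cell_subset_cube N j)]
  have hKf := hfb'.kernelOp (hk.bddKernel N) m
  calc l2Norm (cell N j) (kernelOp (cellKernel N k₀) m f)
      = l2Norm (cell N j) (kernelOp (cellKernel N k₀) m f') := l2Norm_congr (by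
        filter_upwards [ae_restrict_mem hcm] with x hx using e1 hx)
    _ ≤ l2Norm (cube d) (kernelOp (cellKernel N k₀) m f') :=
        l2Norm_mono_set (cell_subset_cube N j) (hKf.memLp (ν := cubeMeasure d) 2)
    _ ≤ M * l2Norm (cube d) f' := l2Norm_cellKernel_le hk N m hfb'
    _ = _ := by rw [e2]

end Seminorms

/-! ### Error of the projection onto the full tensor-product space -/

section Projection
variable {d : ℕ}

lemma l2Norm_multiDeriv_single {g : (Fin d → ℝ) → ℝ} (hg : ContDiff ℝ ∞ g) (m : Fin d) (r : ℕ)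
    (U : Set (Fin d → ℝ)) :
    l2Norm U (multiDeriv (Pi.single m r) g) = l2Norm U ((partialDeriv m)^[r] g) := by
  rw [multiDeriv_single hg]

/-- A function of `H^m` and its projection are limits of test functions and of their projections,
together with all derivatives that enter the projection estimates. -/
lemma MemSobolev.exists_smooth_seq_proj {M N k : ℕ} {v w : (Fin d → ℝ) → ℝ}
    (hv : MemSobolev M (cube d) v) (hM : 1 ≤ M) (hw : IsL2Proj (fullSpace d N k) v w) :
    ∃ g : ℕ → (Fin d → ℝ) → ℝ, (∀ n, ContDiff ℝ ∞ (g n)) ∧ (∀ n, HasCompactSupport (g n)) ∧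
      ∀ U ⊆ cube d,
        (∀ α : Fin d → ℕ, ∑ i, α i ≤ M → Filter.Tendsto (fun n => l2Norm U (multiDeriv α (g n)))
          Filter.atTop (nhds (l2Norm U (weakDeriv α (cube d) v)))) ∧
        Filter.Tendsto (fun n => l2Norm U
            (fun x => g n x - fullOp k N (List.finRange d) (g n) x))
          Filter.atTop (nhds (l2Norm U fun x => v x - w x)) ∧
        ∀ m, Filter.Tendsto (fun n => l2Norm U (fun x => partialDeriv m (g n) x
            - 2 ^ N * dprojOp k N m (fullOp k N (List.finRange d) (g n)) x))
          Filter.atTop (nhds (l2Norm U fun x => weakDeriv (Pi.single m 1) (cube d) v x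
            - 2 ^ N * dprojOp k N m w x)) := by
  obtain ⟨g, hg, hc, ht⟩ := hv.exists_smooth_seq
  have hvm := hv.memLp (isOpen_cube d)
  have hwb := bddMeas_of_mem_fullSpace hw.1
  have hgb : ∀ n, BddMeas (g n) := fun n =>
    bddMeas_of_hasCompactSupport (hg n).continuous (hc n)
  have hdb : ∀ α n, BddMeas (multiDeriv α (g n)) := fun α n =>
    bddMeas_of_hasCompactSupport (contDiff_multiDeriv (hg n) α).continuous
      (IsCompact.of_isClosed_subset (hc n) (isClosed_tsupport _) (tsupport_multiDeriv_subset _ α))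
  have hwn : ∀ n, IsL2Proj (fullSpace d N k) (g n) (fullOp k N (List.finRange d) (g n)) :=
    fun n => isL2Proj_fullOp k N (hgb n)
  have hwnb : ∀ n, BddMeas (fullOp k N (List.finRange d) (g n)) := fun n =>
    (hgb n).fullOp k N _
  have hgm : ∀ n, MemLp (g n) 2 (cubeMeasure d) := fun n => (hgb n).memLp 2
  have hwm : MemLp w 2 (cubeMeasure d) := hwb.memLp 2
  have hwnm : ∀ n, MemLp (fullOp k N (List.finRange d) (g n)) 2 (cubeMeasure d) :=
    fun n => (hwnb n).memLp 2
  have t0 : Filter.Tendsto (fun n => l2Norm (cube d) (fun x => g n x - v x)) Filter.atTop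
      (nhds 0) := by
    have h0 := ht 0 (by simp)
    refine h0.congr fun n => ?_
    rw [multiDeriv_zero]
    refine l2Norm_congr ?_
    filter_upwards [(hv.hasWeakDeriv (α := 0) (by simp)).ae_eq_of_zero (isOpen_cube d)] with x hx
    rw [hx]
  -- The projection is a contraction.
  have hpn : ∀ n, l2Norm (cube d) (fun x => fullOp k N (List.finRange d) (g n) x - w x)
      ≤ l2Norm (cube d) (fun x => g n x - v x) := fun n =>
    ((hwn n).sub le_rfl hw (hgm n) hvm).l2Norm_le le_rfl ((hgm n).sub hvm)
  have t1 : Filter.Tendsto (fun n => l2Norm (cube d) (fun x =>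
      (g n x - fullOp k N (List.finRange d) (g n) x) - (v x - w x))) Filter.atTop (nhds 0) := by
    refine squeeze_zero (fun n => l2Norm_nonneg _ _) (fun n => ?_) (by simpa using t0.add t0)
    have h1 := l2Norm_sub_le ((hgm n).sub hvm) ((hwnm n).sub hwm)
    simp only [Pi.sub_apply, sub_sub_sub_comm] at h1 ⊢
    exact h1.trans (add_le_add le_rfl (hpn n))
  have hDb : ∀ {f : (Fin d → ℝ) → ℝ}, BddMeas f → ∀ m,
      BddMeas fun x => 2 ^ N * dprojOp k N m f x := fun hf m =>
    (hf.kernelOp (bddKernel_dproj k N) m).const_mul _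
  have hsm : ∀ m : Fin d, ∑ i, (Pi.single m 1 : Fin d → ℕ) i ≤ M := fun m => by
    rw [sum_single]; exact hM
  have hpd : ∀ n m, multiDeriv (Pi.single m 1) (g n) = partialDeriv m (g n) := fun n m => by
    rw [multiDeriv_single (hg n), Function.iterate_one]
  have hpm : ∀ n m, MemLp (partialDeriv m (g n)) 2 (cubeMeasure d) := fun n m => by
    rw [← hpd]; exact (hdb _ n).memLp 2
  -- The operator `2^N dprojOp` is bounded in `L²`, with a norm that depends on `N`.
  have t2 : ∀ m, Filter.Tendsto (fun n => l2Norm (cube d) (fun x =>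
      (partialDeriv m (g n) x - 2 ^ N * dprojOp k N m (fullOp k N (List.finRange d) (g n)) x)
        - (weakDeriv (Pi.single m 1) (cube d) v x - 2 ^ N * dprojOp k N m w x)))
      Filter.atTop (nhds 0) := by
    intro m
    have hsum := (ht (Pi.single m 1) (hsm m)).add (t0.const_mul (2 ^ N * reproBound k))
    rw [mul_zero, add_zero] at hsum
    refine squeeze_zero (fun n => l2Norm_nonneg _ _) (fun n => ?_) hsum
    have h1 := l2Norm_sub_le ((hpm n m).sub (hv.memLp_weakDeriv (isOpen_cube d) (hsm m)))
      (((hDb (hwnb n) m).memLp (ν := cubeMeasure d) 2).sub ((hDb hwb m).memLp 2))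
    simp only [Pi.sub_apply, sub_sub_sub_comm] at h1 ⊢
    refine h1.trans (add_le_add (le_of_eq (by rw [hpd]; rfl)) ?_)
    have e : ((fun x => 2 ^ N * dprojOp k N m (fullOp k N (List.finRange d) (g n)) x)
        - fun x => 2 ^ N * dprojOp k N m w x)
        = fun x => 2 ^ N * dprojOp k N m
          (fun y => fullOp k N (List.finRange d) (g n) y - w y) x := by
      unfold dprojOp
      rw [kernelOp_sub (bddKernel_dproj k N) (hwnb n) hwb]
      ext x
      simp only [Pi.sub_apply, mul_sub]
    rw [e, l2Norm_const_mul, abs_of_pos (by positivity), mul_assoc]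
    refine mul_le_mul_of_nonneg_left ?_ (by positivity)
    refine (l2Norm_cellKernel_le (localKernel_reproDeriv k) N m ((hwnb n).sub hwb)).trans ?_
    exact mul_le_mul_of_nonneg_left (hpn n) (localKernel_reproDeriv k).nonneg
  refine ⟨g, hg, hc, fun U hU => ⟨fun α hα => ?_, ?_, fun m => ?_⟩⟩
  · exact tendsto_l2Norm hU (fun n => (hdb α n).memLp 2) (hv.memLp_weakDeriv (isOpen_cube d) hα)
      (ht α hα)
  · exact tendsto_l2Norm hU (fun n => (hgm n).sub (hwnm n)) (hvm.sub hwm) t1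
  · exact tendsto_l2Norm hU (fun n => (hpm n m).sub ((hDb (hwnb n) m).memLp 2))
      ((hv.memLp_weakDeriv (isOpen_cube d) (hsm m)).sub ((hDb hwb m).memLp 2)) (t2 m)

lemma MemSobolev.sobolevSeminorm_zero_sub {M N k : ℕ} {v w : (Fin d → ℝ) → ℝ}
    (hv : MemSobolev M (cube d) v) (hw : w ∈ fullSpace d N k) (j : Fin d → Fin (2 ^ N)) :
    sobolevSeminorm 0 (cell N j) (fun x => w x - v x) = l2Norm (cell N j) fun x => v x - w x := by
  have h1 : LocallyIntegrableOn v (cell N j) :=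
    (hv.hasWeakDeriv (α := 0) (by simp)).1.mono_set (cell_subset_cube N j)
  have h2 : HasWeakDeriv 0 (cell N j) (fun x => w x - v x) fun x => w x - v x :=
    hasWeakDeriv_zero (((bddMeas_of_mem_fullSpace hw).locallyIntegrableOn _).sub h1)
  rw [sobolevSeminorm_zero, l2Norm_congr (weakDeriv_ae_eq (isOpen_cell N j) h2)]
  exact l2Norm_sub_comm _ w v

lemma MemSobolev.sobolevSeminorm_one_sub_sq {M N k : ℕ} {v w : (Fin d → ℝ) → ℝ}
    (hv : MemSobolev M (cube d) v) (hM : 1 ≤ M) (hw : w ∈ fullSpace d N k)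
    (j : Fin d → Fin (2 ^ N)) :
    sobolevSeminorm 1 (cell N j) (fun x => w x - v x) ^ 2
      = ∑ m, l2Norm (cell N j) (fun x => weakDeriv (Pi.single m 1) (cube d) v x
          - 2 ^ N * dprojOp k N m w x) ^ 2 := by
  rw [sobolevSeminorm_one]
  refine Finset.sum_congr rfl fun m _ => ?_
  have h1 := (hv.hasWeakDeriv (α := Pi.single m 1) (by rw [sum_single]; exact hM)).mono
    (cell_subset_cube N j)
  rw [l2Norm_congr (weakDeriv_ae_eq (isOpen_cell N j)
    ((hasWeakDeriv_of_mem_fullSpace hw j m).sub h1)), l2Norm_sub_comm]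

lemma MemSobolev.memLp_weakDeriv_sub {M N k : ℕ} {v w : (Fin d → ℝ) → ℝ}
    (hv : MemSobolev M (cube d) v) (hM : 1 ≤ M) (hw : w ∈ fullSpace d N k) (m : Fin d) :
    MemLp (fun x => weakDeriv (Pi.single m 1) (cube d) v x - 2 ^ N * dprojOp k N m w x) 2
      (cubeMeasure d) :=
  (hv.memLp_weakDeriv (isOpen_cube d) (by rw [sum_single]; exact hM)).sub
    ((((bddMeas_of_mem_fullSpace hw).kernelOp (bddKernel_dproj k N) m).const_mul _).memLp 2)

lemma MemSobolev.brokenSeminorm_zero_sub {M N k : ℕ} {v w : (Fin d → ℝ) → ℝ}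
    (hv : MemSobolev M (cube d) v) (hw : w ∈ fullSpace d N k) :
    brokenSeminorm 0 N (fun x => w x - v x) = l2Norm (cube d) fun x => v x - w x := by
  have hm : MemLp (fun x => v x - w x) 2 (cubeMeasure d) :=
    (hv.memLp (isOpen_cube d)).sub ((bddMeas_of_mem_fullSpace hw).memLp 2)
  rw [brokenSeminorm]
  simp only [hv.sobolevSeminorm_zero_sub hw]
  rw [sum_l2Norm_cell_sq N hm, Real.sqrt_sq (l2Norm_nonneg _ _)]

lemma MemSobolev.brokenSeminorm_one_sub_sq {M N k : ℕ} {v w : (Fin d → ℝ) → ℝ}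
    (hv : MemSobolev M (cube d) v) (hM : 1 ≤ M) (hw : w ∈ fullSpace d N k) :
    brokenSeminorm 1 N (fun x => w x - v x) ^ 2
      = ∑ m, l2Norm (cube d) (fun x => weakDeriv (Pi.single m 1) (cube d) v x
          - 2 ^ N * dprojOp k N m w x) ^ 2 := by
  rw [brokenSeminorm, Real.sq_sqrt (Finset.sum_nonneg fun _ _ => sq_nonneg _)]
  simp only [hv.sobolevSeminorm_one_sub_sq hM hw]
  rw [Finset.sum_comm]
  exact Finset.sum_congr rfl fun m _ => sum_l2Norm_cell_sq N (hv.memLp_weakDeriv_sub hM hw m)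

lemma sobolevSeminorm_sq (s : ℕ) (U : Set (Fin d → ℝ)) (v : (Fin d → ℝ) → ℝ) :
    sobolevSeminorm s U v ^ 2
      = ∑ α ∈ Finset.Nat.antidiagonalTuple d s, l2Norm U (weakDeriv α U v) ^ 2 :=
  Real.sq_sqrt (Finset.sum_nonneg fun _ _ => sq_nonneg _)

lemma sobolevSeminorm_nonneg (s : ℕ) (U : Set (Fin d → ℝ)) (v : (Fin d → ℝ) → ℝ) :
    0 ≤ sobolevSeminorm s U v := Real.sqrt_nonneg _

/-- The mixed derivatives in two directions, counted with their multiplicity. -/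
lemma sum_l2Norm_weakDeriv_single_add_single_le {q : ℕ} (hq : 1 ≤ q) (v : (Fin d → ℝ) → ℝ) :
    ∑ m, ∑ i, l2Norm (cube d) (weakDeriv (Pi.single i q + Pi.single m 1) (cube d) v) ^ 2
      ≤ 2 * sobolevSeminorm (q + 1) (cube d) v ^ 2 := by
  rw [sobolevSeminorm_sq]
  exact sum_single_add_single_le (F := fun α => l2Norm (cube d) (weakDeriv α (cube d) v) ^ 2)
    (fun _ => sq_nonneg _) hq le_rfl

lemma sum_single_le_sum_single_add_single {F : (Fin d → ℕ) → ℝ} (hF : ∀ α, 0 ≤ F α) (a b : ℕ) :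
    ∑ m, F (Pi.single m (a + b)) ≤ ∑ m, ∑ i, F (Pi.single i a + Pi.single m b) := by
  refine Finset.sum_le_sum fun m _ => ?_
  have e : (Pi.single m (a + b) : Fin d → ℕ) = Pi.single m a + Pi.single m b := by
    ext i
    by_cases h : i = m
    · subst h; simp
    · simp [h]
  have h := Finset.single_le_sum (f := fun i => F (Pi.single i a + Pi.single m b))
    (fun _ _ => hF _) (Finset.mem_univ m)
  exact (le_of_eq (congrArg F e)).trans h

lemma sum_l2Norm_weakDeriv_single_le {q : ℕ} (hq : 1 ≤ q) (v : (Fin d → ℝ) → ℝ) :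
    ∑ m, l2Norm (cube d) (weakDeriv (Pi.single m (q + 1)) (cube d) v) ^ 2
      ≤ 2 * sobolevSeminorm (q + 1) (cube d) v ^ 2 :=
  (sum_single_le_sum_single_add_single
    (F := fun α => l2Norm (cube d) (weakDeriv α (cube d) v) ^ 2) (fun _ => sq_nonneg _) q 1).trans
    (sum_l2Norm_weakDeriv_single_add_single_le hq v)

/-- The case `s = 0` of the projection estimate on the full space. -/
lemma MemSobolev.l2Norm_sub_proj_le {p q N k : ℕ} (hq : 1 ≤ q) (hqk : q ≤ k) (hqp : q ≤ p)
    {v w : (Fin d → ℝ) → ℝ} (hv : MemSobolev (p + 1) (cube d) v)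
    (hw : IsL2Proj (fullSpace d N k) v w) :
    l2Norm (cube d) (fun x => v x - w x)
      ≤ 6 * reproBound k ^ 2 * (1 / 2 ^ N) ^ (q + 1) * sobolevSeminorm (q + 1) (cube d) v := by
  have hM := one_le_reproBound k
  obtain ⟨g, hg, hc, ht⟩ := hv.exists_smooth_seq_proj (by omega) hw
  obtain ⟨t1, t2, -⟩ := ht (cube d) subset_rfl
  have h := le_of_tendsto_of_tendsto' (t2.pow 2)
    ((tendsto_finsetSum Finset.univ fun m _ => (t1 (Pi.single m (q + 1))
      (by rw [sum_single]; omega)).pow 2).const_mul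
        (((1 / 2 ^ N) ^ (q + 1) * (2 * reproBound k)) ^ 2))
    fun n => by
      simp only [l2Norm_multiDeriv_single (hg n)]
      exact l2Norm_sub_fullOp_sq_le_sum hqk N (List.nodup_finRange d) (hg n)
        (bddMeas_of_hasCompactSupport (hg n).continuous (hc n)) fun m =>
          bddMeas_of_hasCompactSupport
            (contDiff_iterate_partialDeriv (hg n) m _).continuous
            (hasCompactSupport_iterate_partialDeriv (hc n) m _)
  have hY := sobolevSeminorm_nonneg (q + 1) (cube d) v
  refine abs_le_of_sq_le_sq' ?_ (by positivity) |>.2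
  refine h.trans ((mul_le_mul_of_nonneg_left (sum_l2Norm_weakDeriv_single_le hq v)
    (sq_nonneg _)).trans ?_)
  have h4 : 8 * reproBound k ^ 2 ≤ 36 * reproBound k ^ 4 := by
    nlinarith [one_le_pow₀ hM (n := 2), sq_nonneg (reproBound k)]
  calc _ = 8 * reproBound k ^ 2 * (((1 / 2 ^ N) ^ (q + 1)) ^ 2
        * sobolevSeminorm (q + 1) (cube d) v ^ 2) := by ring
    _ ≤ 36 * reproBound k ^ 4 * (((1 / 2 ^ N) ^ (q + 1)) ^ 2
        * sobolevSeminorm (q + 1) (cube d) v ^ 2) := by gcongr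
    _ = _ := by ring

/-- The case `s = 1` of the projection estimate on the full space, with `q = r + 1`. -/
lemma MemSobolev.sum_l2Norm_weakDeriv_sub_proj_sq_le {p r N k : ℕ} (hr : r + 1 ≤ k)
    (hrp : r + 1 ≤ p) {v w : (Fin d → ℝ) → ℝ} (hv : MemSobolev (p + 1) (cube d) v)
    (hw : IsL2Proj (fullSpace d N k) v w) :
    ∑ m, l2Norm (cube d) (fun x => weakDeriv (Pi.single m 1) (cube d) v x
          - 2 ^ N * dprojOp k N m w x) ^ 2
      ≤ (6 * reproBound k ^ 2 * (1 / 2 ^ N) ^ (r + 1)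
          * sobolevSeminorm (r + 1 + 1) (cube d) v) ^ 2 := by
  obtain ⟨g, hg, hc, ht⟩ := hv.exists_smooth_seq_proj (by omega) hw
  obtain ⟨t1, -, t3⟩ := ht (cube d) subset_rfl
  have hb : ∀ n m, BddMeas (partialDeriv m (g n)) := fun n m =>
    bddMeas_of_hasCompactSupport (contDiff_partialDeriv (hg n) m).continuous
      (HasCompactSupport.partialDeriv (hc n) m)
  have h : ∀ m, l2Norm (cube d) (fun x => weakDeriv (Pi.single m 1) (cube d) v x
          - 2 ^ N * dprojOp k N m w x) ^ 2
      ≤ 8 * reproBound k ^ 4 * ((1 / 2 ^ N) ^ (r + 1)) ^ 2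
        * (l2Norm (cube d) (weakDeriv (Pi.single m (r + 1 + 1)) (cube d) v) ^ 2
          + ∑ i, l2Norm (cube d)
            (weakDeriv (Pi.single i (r + 1) + Pi.single m 1) (cube d) v) ^ 2) := by
    intro m
    have l1 := (t1 (Pi.single m (r + 1 + 1)) (by rw [sum_single]; omega)).pow 2
    have l2 : ∀ i, Filter.Tendsto (fun n => l2Norm (cube d)
        (multiDeriv (Pi.single i (r + 1) + Pi.single m 1) (g n)) ^ 2) Filter.atTop
        (nhds (l2Norm (cube d)
          (weakDeriv (Pi.single i (r + 1) + Pi.single m 1) (cube d) v) ^ 2)) := fun i => by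
      refine (t1 _ ?_).pow 2
      simp only [Pi.add_apply, Finset.sum_add_distrib, sum_single]; omega
    refine le_of_tendsto_of_tendsto' ((t3 m).pow 2)
      ((l1.add (tendsto_finsetSum Finset.univ fun i _ => l2 i)).const_mul _) fun n => ?_
    simp only [l2Norm_multiDeriv_single (hg n), multiDeriv_single_add_single (hg n),
      Function.iterate_one]
    exact l2Norm_partialDeriv_sub_fullOp_sq_le hr N m (hg n)
        (bddMeas_of_hasCompactSupport (hg n).continuous (hc n)) (hb n m)
        (bddMeas_of_hasCompactSupport (contDiff_iterate_partialDeriv (hg n) m _).continuous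
          (hasCompactSupport_iterate_partialDeriv (hc n) m _)) fun i =>
        bddMeas_of_hasCompactSupport
          (contDiff_iterate_partialDeriv (contDiff_partialDeriv (hg n) m) i _).continuous
          (hasCompactSupport_iterate_partialDeriv (HasCompactSupport.partialDeriv (hc n) m) i _)
  refine (Finset.sum_le_sum fun m _ => h m).trans ?_
  rw [← Finset.mul_sum, Finset.sum_add_distrib]
  have h1 := add_le_add (sum_l2Norm_weakDeriv_single_le (q := r + 1) (by omega) v)
    (sum_l2Norm_weakDeriv_single_add_single_le (q := r + 1) (by omega) v)
  refine (mul_le_mul_of_nonneg_left h1 (by positivity)).trans ?_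
  have h2 : 0 ≤ reproBound k ^ 4 * ((1 / 2 ^ N) ^ (r + 1)) ^ 2
    * sobolevSeminorm (r + 1 + 1) (cube d) v ^ 2 := by positivity
  linarith

lemma two_rpow_neg_mul (n q : ℕ) :
    (2 : ℝ) ^ (-((n : ℝ) * (q : ℝ))) = (1 / 2 ^ n) ^ q := by
  rw [Real.rpow_neg zero_le_two, Real.rpow_mul zero_le_two, Real.rpow_natCast, Real.rpow_natCast,
    one_div, inv_pow]

/-- One constant serves all dimensions, both seminorms and all `q`. -/
lemma isProjConstTensor {cc : ℕ → ℕ → ℕ → ℝ} (hcc : ∀ k s q, 6 * reproBound k ^ 2 ≤ cc k s q) :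
    IsProjConstTensor cc := by
  intro d k p q s N _ hk hq hqpk hs v w hv hw
  have hqp := hqpk.trans (min_le_left _ _)
  have hqk := hqpk.trans (min_le_right _ _)
  have hY := sobolevSeminorm_nonneg (q + 1) (cube d) v
  have key : brokenSeminorm s N (fun x => w x - v x) ≤ 6 * reproBound k ^ 2
      * (2 : ℝ) ^ (-((N : ℝ) * ((q : ℝ) + 1 - s))) * sobolevSeminorm (q + 1) (cube d) v := by
    interval_cases s
    · rw [hv.brokenSeminorm_zero_sub hw.1, Nat.cast_zero, sub_zero]
      have e := two_rpow_neg_mul N (q + 1)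
      push_cast at e
      rw [e]
      exact hv.l2Norm_sub_proj_le hq hqk hqp hw
    · rw [Nat.cast_one, add_sub_cancel_right, two_rpow_neg_mul]
      obtain ⟨r, rfl⟩ : ∃ r, q = r + 1 := ⟨q - 1, by omega⟩
      refine abs_le_of_sq_le_sq' ?_ (by positivity) |>.2
      rw [hv.brokenSeminorm_one_sub_sq (by omega) hw.1]
      exact hv.sum_l2Norm_weakDeriv_sub_proj_sq_le hqk hqp hw
  refine key.trans ?_
  gcongr
  exact hcc k s q

end Projection

/-! ### Error of the projection of functions of one variable -/

section OneVariable
variable {d : ℕ}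

/-- The two terms of the error representations, on one cell. -/
lemma l2Norm_cell_remOp_sub_le {k₀ : ℝ → ℝ → ℝ} {M c : ℝ} (hk : LocalKernel k₀ M) (hM : 1 ≤ M)
    (hc : 0 ≤ c) {N : ℕ} (j : Fin d → Fin (2 ^ N)) (m : Fin d) (a b : ℕ)
    {f : (Fin d → ℝ) → ℝ} (hf : BddMeas f) :
    l2Norm (cell N j) (fun x => c * (remOp a N m f x
      - kernelOp (cellKernel N k₀) m (remOp b N m f) x)) ≤ c * (2 * M) * l2Norm (cell N j) f := by
  have hb := hf.kernelOp (bddKernel_rem b N) m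
  have ha := hf.kernelOp (bddKernel_rem a N) m
  have hF := l2Norm_nonneg (cell N j) f
  rw [l2Norm_const_mul, abs_of_nonneg hc, mul_assoc]
  refine mul_le_mul_of_nonneg_left ?_ hc
  have hsub : ∀ {F : (Fin d → ℝ) → ℝ}, BddMeas F → MemLp F 2 (volume.restrict (cell N j)) :=
    fun hF => (hF.memLp (ν := cubeMeasure d) 2).mono_measure
      (Measure.restrict_mono (cell_subset_cube N j) le_rfl)
  have h1 := l2Norm_cell_kernelOp_le (localKernel_taylor a) j m hf
  have h2 := l2Norm_cell_kernelOp_le (localKernel_taylor b) j m hf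
  have h3 := l2Norm_cell_kernelOp_le hk j m hb
  have h4 := l2Norm_sub_le (hsub ha) (hsub (hb.kernelOp (hk.bddKernel N) m))
  refine h4.trans ?_
  nlinarith [mul_le_mul_of_nonneg_left h2 (zero_le_one.trans hM)]

lemma l2Norm_cell_sub_projOp_le {k q : ℕ} (hq : q ≤ k) {N : ℕ} (j : Fin d → Fin (2 ^ N))
    (m : Fin d) {f : (Fin d → ℝ) → ℝ} (hf : ContDiff ℝ ∞ f)
    (hg : BddMeas ((partialDeriv m)^[q + 1] f)) :
    l2Norm (cell N j) (fun x => f x - projOp k N m f x)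
      ≤ (1 / 2 ^ N) ^ (q + 1) * (2 * reproBound k)
        * l2Norm (cell N j) ((partialDeriv m)^[q + 1] f) := by
  refine le_trans (le_of_eq (l2Norm_congr ?_)) (l2Norm_cell_remOp_sub_le (localKernel_repro k)
    (one_le_reproBound k) (by positivity) j m q q hg)
  filter_upwards [ae_restrict_mem (isOpen_cell N j).measurableSet] with x hx
  exact sub_projOp_eq hq N m hf hg
    (Ioo_subset_Ioc_self (mem_cube.1 (cell_subset_cube N j hx) m))

lemma l2Norm_cell_partialDeriv_sub_dprojOp_le {k r : ℕ} (hr : r + 1 ≤ k) {N : ℕ}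
    (j : Fin d → Fin (2 ^ N)) (m : Fin d) {f : (Fin d → ℝ) → ℝ} (hf : ContDiff ℝ ∞ f)
    (hg : BddMeas ((partialDeriv m)^[r + 2] f)) :
    l2Norm (cell N j) (fun x => partialDeriv m f x - 2 ^ N * dprojOp k N m f x)
      ≤ (1 / 2 ^ N) ^ (r + 1) * (2 * reproBound k)
        * l2Norm (cell N j) ((partialDeriv m)^[r + 2] f) := by
  refine le_trans (le_of_eq (l2Norm_congr ?_)) (l2Norm_cell_remOp_sub_le (localKernel_reproDeriv k)
    (one_le_reproBound k) (by positivity) j m r (r + 1) hg)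
  filter_upwards [ae_restrict_mem (isOpen_cell N j).measurableSet] with x hx
  exact partialDeriv_sub_dprojOp_eq hr N m hf hg
    (Ioo_subset_Ioc_self (mem_cube.1 (cell_subset_cube N j hx) m))

lemma MemSobolev.l2Norm_cell_weakDeriv_le {M : ℕ} {v : (Fin d → ℝ) → ℝ}
    (hv : MemSobolev M (cube d) v) {α : Fin d → ℕ} {s : ℕ} (hα : ∑ i, α i = s) (hs : s ≤ M)
    {N : ℕ} (j : Fin d → Fin (2 ^ N)) :
    l2Norm (cell N j) (weakDeriv α (cube d) v) ≤ sobolevSeminorm s (cell N j) v := by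
  rw [← l2Norm_congr (weakDeriv_ae_eq (isOpen_cell N j)
    ((hv.hasWeakDeriv (hα.le.trans hs)).mono (cell_subset_cube N j)))]
  exact l2Norm_weakDeriv_le_sobolevSeminorm _ _ hα

/-- The one-dimensional estimate on each cell; here `fullOp` is the single projection. -/
lemma isProjConst1D {c : ℕ → ℕ → ℕ → ℝ} (hc : ∀ k s q, 2 * reproBound k ≤ c k s q) :
    IsProjConst1D c := by
  intro k p q s N hk hq hqpk hs v w hv hw j
  have hqp := hqpk.trans (min_le_left _ _)
  have hqk := hqpk.trans (min_le_right _ _)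
  have hY := sobolevSeminorm_nonneg (q + 1) (cell N j) v
  obtain ⟨g, hg, hgc, ht⟩ := hv.exists_smooth_seq_proj (by omega) hw
  obtain ⟨t1, t2, t3⟩ := ht (cell N j) (cell_subset_cube N j)
  have hgb : ∀ n, BddMeas (g n) := fun n =>
    bddMeas_of_hasCompactSupport (hg n).continuous (hgc n)
  have hdb : ∀ n r, BddMeas ((partialDeriv 0)^[r] (g n)) := fun n r =>
    bddMeas_of_hasCompactSupport (contDiff_iterate_partialDeriv (hg n) 0 _).continuous
      (hasCompactSupport_iterate_partialDeriv (hgc n) 0 _)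
  have hR := hv.l2Norm_cell_weakDeriv_le (sum_single (0 : Fin 1) (q + 1)) (by omega) j
  have ht1 := t1 (Pi.single 0 (q + 1)) (by rw [sum_single]; omega)
  have hM := one_le_reproBound k
  have key : sobolevSeminorm s (cell N j) (fun x => w x - v x) ≤ 2 * reproBound k
      * (2 : ℝ) ^ (-((N : ℝ) * ((q : ℝ) + 1 - s))) * sobolevSeminorm (q + 1) (cell N j) v := by
    interval_cases s
    · rw [hv.sobolevSeminorm_zero_sub hw.1, Nat.cast_zero, sub_zero]
      have e := two_rpow_neg_mul N (q + 1)
      push_cast at e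
      rw [e]
      have h := le_of_tendsto_of_tendsto' t2
        (ht1.const_mul ((1 / 2 ^ N) ^ (q + 1) * (2 * reproBound k))) fun n => by
          rw [l2Norm_multiDeriv_single (hg n)]
          exact l2Norm_cell_sub_projOp_le hqk j 0 (hg n) (hdb n _)
      refine h.trans ((mul_le_mul_of_nonneg_left hR (by positivity)).trans (le_of_eq ?_))
      ring
    · rw [Nat.cast_one, add_sub_cancel_right, two_rpow_neg_mul]
      obtain ⟨r, rfl⟩ : ∃ r, q = r + 1 := ⟨q - 1, by omega⟩
      have h := le_of_tendsto_of_tendsto' (t3 0)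
        (ht1.const_mul ((1 / 2 ^ N) ^ (r + 1) * (2 * reproBound k))) fun n => by
          rw [l2Norm_multiDeriv_single (hg n)]
          have e : dprojOp k N 0 (fullOp k N (List.finRange 1) (g n)) = dprojOp k N 0 (g n) :=
            dprojOp_projOp k N 0 (hgb n)
          rw [e]
          exact l2Norm_cell_partialDeriv_sub_dprojOp_le hqk j 0 (hg n) (hdb n _)
      have h1 : sobolevSeminorm 1 (cell N j) (fun x => w x - v x)
          = l2Norm (cell N j) (fun x => weakDeriv (Pi.single 0 1) (cube 1) v x
            - 2 ^ N * dprojOp k N 0 w x) := by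
        rw [← sq_eq_sq₀ (sobolevSeminorm_nonneg _ _ _) (l2Norm_nonneg _ _),
          hv.sobolevSeminorm_one_sub_sq (by omega) hw.1, Fin.sum_univ_one]
      rw [h1]
      refine h.trans ((mul_le_mul_of_nonneg_left hR (by positivity)).trans (le_of_eq ?_))
      ring
  refine key.trans ?_
  gcongr
  exact hc k s q

end OneVariable

/-! ### The error estimate -/

section Final
variable {d : ℕ}

lemma sum_abs_le_mul_norm (a : EuclideanSpace ℝ (Fin d)) : ∑ m, |a m| ≤ d * ‖a‖ := by
  calc ∑ m, |a m| ≤ ∑ _m : Fin d, ‖a‖ := Finset.sum_le_sum fun m _ => PiLp.norm_apply_le a m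
    _ = d * ‖a‖ := by simp

/-- The error estimate in terms of the sparse approximation error of the initial value: the smooth
approximations of the initial value are compared with the scheme, and the transport preserves their
distance to the exact solution. -/
lemma l2Norm_dg_sub_transport_le {k p q N : ℕ} (hq : q ≤ k) (hqp : q ≤ p)
    {a : EuclideanSpace ℝ (Fin d)} {u₀ : (Fin d → ℝ) → ℝ} {u uh : ℝ → (Fin d → ℝ) → ℝ}
    (hu₀ : MemMixedPeriodic (p + 1) u₀) (hu : IsTransportSolution a u₀ u)
    (hdg : IsDGSolution a N k uh) (h0 : IsL2Proj (sparseSpace d N k) u₀ (uh 0)) {t : ℝ}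
    (ht : 0 ≤ t) :
    l2Norm (cube d) (fun x => uh t x - u t x)
      ≤ (√((∑ m, |a m|) * t * (20 * reproBound k ^ 2 * 2 ^ N)) + 1)
        * sparseErr d k q N (mixedSeminorm (q + 1) (cube d) u₀) := by
  have hm := hu₀.memLp
  have huhm : MemLp (uh t) 2 (cubeMeasure d) :=
    (bddMeas_of_mem_fullSpace (sparseSpace_le_fullSpace d N k (hdg.mem t ht))).memLp 2
  have htm := hu₀.1.memLp_translate hm (t • ⇑a)
  have e1 : l2Norm (cube d) (fun x => uh t x - u t x)
      = l2Norm (cube d) (fun x => uh t x - translate (t • ⇑a) u₀ x) := by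
    refine l2Norm_congr ?_
    filter_upwards [hu.ae_eq_translate hu₀.1 hm ht] with x hx
    rw [hx]
  rw [e1]
  -- Half of `ε` for the initial value of the scheme, half for the exact solution.
  refine le_of_forall_pos_le_add fun ε hε => ?_
  obtain ⟨g, hg, hgε⟩ := hu₀.exists_isMixedFamily (Nat.succ_le_succ hqp) (half_pos hε)
  have hgb := hg.bddMeas ∅
  have h1 := l2Norm_dg_sub_translate_le hq a hg hdg hm h0 ht
  have hgm := (hg.periodic ∅).memLp_translate (hgb.memLp (ν := cubeMeasure d) 2) (t • ⇑a)
  have h2 := l2Norm_sub_le_sub huhm hgm htm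
  have hper : UnitPeriodic fun x => g ∅ x - u₀ x := fun i x => by
    simp only [hg.periodic ∅ i x, hu₀.1 i x]
  have h3 := hper.l2Norm_translate ((hgb.memLp (ν := cubeMeasure d) 2).sub hm).1 (t • ⇑a)
  rw [l2Norm_sub_comm (cube d) (g ∅)] at h3
  change l2Norm (cube d) (fun x => translate (t • ⇑a) (g ∅) x - translate (t • ⇑a) u₀ x) = _ at h3
  linarith

/-- `h^{q+1/2} = h^{-1/2} h^{q+1}` -/
lemma two_rpow_neg_mul_add_half (N q : ℕ) :
    (2 : ℝ) ^ (-((N : ℝ) * ((q : ℝ) + 1 / 2))) = √(2 ^ N) * (1 / 2 ^ N) ^ (q + 1) := by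
  rw [← two_rpow_neg_mul, Real.sqrt_eq_rpow, ← Real.rpow_natCast 2 N, ← Real.rpow_mul zero_le_two,
    ← Real.rpow_add zero_lt_two]
  congr 1
  push_cast
  ring

lemma two_rpow_neg_div_two (N : ℕ) : (2 : ℝ) ^ (-(N : ℝ) / 2) = (√(2 ^ N))⁻¹ := by
  rw [Real.sqrt_eq_rpow, ← Real.rpow_natCast 2 N, ← Real.rpow_mul zero_le_two,
    ← Real.rpow_neg zero_le_two]
  congr 1
  ring

/-- The speed and the mesh size enter the error through `√(‖a‖ t / h)`. -/
lemma l2Norm_dg_sub_transport_le_sqrt {k p q N : ℕ} (hq : q ≤ k) (hqp : q ≤ p)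
    {a : EuclideanSpace ℝ (Fin d)} {u₀ : (Fin d → ℝ) → ℝ} {u uh : ℝ → (Fin d → ℝ) → ℝ}
    (hu₀ : MemMixedPeriodic (p + 1) u₀) (hu : IsTransportSolution a u₀ u)
    (hdg : IsDGSolution a N k uh) (h0 : IsL2Proj (sparseSpace d N k) u₀ (uh 0)) {t : ℝ}
    (ht : 0 ≤ t) :
    l2Norm (cube d) (fun x => uh t x - u t x)
      ≤ (√(d * ‖a‖ * t) * (5 * reproBound k) * √(2 ^ N) + 1)
        * ((sparseConst k q * (N + 1)) ^ d * (1 / 2 ^ N) ^ (q + 1)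
          * mixedSeminorm (q + 1) (cube d) u₀) := by
  have hM := one_le_reproBound k
  have hS := one_le_sparseConst k q
  have hB := mixedSeminorm_nonneg (q + 1) u₀
  refine (l2Norm_dg_sub_transport_le hq hqp hu₀ hu hdg h0 ht).trans ?_
  have hE : 0 ≤ sparseErr d k q N (mixedSeminorm (q + 1) (cube d) u₀) := by
    unfold sparseErr
    have : (0 : ℝ) < 1 / 2 ^ N := by positivity
    positivity
  refine mul_le_mul_of_nonneg_right (add_le_add ?_ le_rfl) hE
  have e : √(d * ‖a‖ * t) * (5 * reproBound k) * √(2 ^ N)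
      = √((d * ‖a‖) * t * (25 * reproBound k ^ 2 * 2 ^ N)) := by
    rw [Real.sqrt_mul (x := d * ‖a‖ * t) (by positivity) (25 * reproBound k ^ 2 * 2 ^ N),
      Real.sqrt_mul (x := 25 * reproBound k ^ 2) (by positivity) (2 ^ N),
      show 25 * reproBound k ^ 2 = (5 * reproBound k) ^ 2 by ring, Real.sqrt_sq (by positivity),
      mul_assoc]
  rw [e]
  refine Real.sqrt_le_sqrt ?_
  gcongr
  · exact sum_abs_le_mul_norm a
  · norm_num

/-- A constant of the one-dimensional projection estimate, enlarged so that `κ_0^d` also dominates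
the constants of the sparse approximation and of the energy estimate. -/
def projConst (k q : ℕ) : ℝ := 2 ^ (q + 1) * (5 * reproBound k) * sparseConst k q

lemma mul_reproBound_le_projConst (k q : ℕ) : 5 * reproBound k ≤ projConst k q := by
  have h1 := one_le_reproBound k
  have h2 := one_le_sparseConst k q
  have h3 : (1 : ℝ) ≤ 2 ^ (q + 1) := one_le_pow₀ (by norm_num)
  unfold projConst
  nlinarith [mul_nonneg (sub_nonneg.2 h3) (sub_nonneg.2 h2)]

/-- The factor `2^{-(q+1)}` in `bigB` is compensated by the factor `2^{q+1}` in `projConst`. -/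
lemma sparseConst_pow_le_approxConst {c cc : ℕ → ℕ → ℕ → ℝ} {k q : ℕ}
    (hc : c k 0 q = projConst k q) (hcc : 0 ≤ cc k 0 q) (hd : 1 ≤ d) (N : ℕ) :
    5 * reproBound k * (sparseConst k q * (N + 1)) ^ d ≤ approxConst c cc 0 k q d N := by
  have h1 := one_le_reproBound k
  have h2 := one_le_sparseConst k q
  have h3 : (1 : ℝ) ≤ 2 ^ (q + 1) := one_le_pow₀ (by norm_num)
  have hC : projConst k q ≤ bigC c k q := by
    refine le_trans ?_ (le_max_left _ _)
    rw [cTilde, hc]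
    have h4 : 0 ≤ projConst k q := by unfold projConst; positivity
    have h5 : (0 : ℝ) ≤ 2 ^ (-((q : ℝ) + 1 - (0 : ℕ))) := by positivity
    nlinarith
  have h6 : 5 * reproBound k * 2 ^ (q + 1) * (sparseConst k q * (N + 1)) ^ d
      ≤ (((N : ℝ) + 1) * bigC c k q) ^ d := by
    calc 5 * reproBound k * 2 ^ (q + 1) * (sparseConst k q * (N + 1)) ^ d
        ≤ (5 * reproBound k * 2 ^ (q + 1)) ^ d * (sparseConst k q * (N + 1)) ^ d := by
          gcongr
          exact le_self_pow₀ (by nlinarith) (by omega)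
      _ = (((N : ℝ) + 1) * projConst k q) ^ d := by
          rw [← mul_pow]; unfold projConst; congr 1; ring
      _ ≤ _ := by
          have : 0 ≤ projConst k q := by unfold projConst; positivity
          gcongr
  have h7 : (2 : ℝ) ^ (-((q : ℝ) + 1)) = (2 ^ (q + 1))⁻¹ := by
    rw [Real.rpow_neg zero_le_two]
    congr 1
    exact_mod_cast Real.rpow_natCast 2 (q + 1)
  rw [approxConst, bigB, kappa, if_pos rfl, if_pos rfl, h7]
  refine le_add_of_nonneg_of_le hcc ?_
  rw [inv_mul_eq_div, le_div_iff₀ (by positivity)]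
  linarith

lemma abs_log_meshSize (N : ℕ) : |Real.log (meshSize N)| = N * Real.log 2 := by
  rw [meshSize, Real.log_pow, one_div, Real.log_inv, mul_neg, abs_neg,
    abs_of_nonneg (mul_nonneg N.cast_nonneg (Real.log_nonneg one_le_two))]

lemma meshSize_rpow (N k : ℕ) :
    meshSize N ^ ((k : ℝ) + 1 / 2) = (2 : ℝ) ^ (-((N : ℝ) * ((k : ℝ) + 1 / 2))) := by
  rw [meshSize, Real.rpow_neg zero_le_two, Real.rpow_mul zero_le_two, Real.rpow_natCast, one_div,
    inv_pow, Real.inv_rpow (by positivity)]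

end Final

end SparseDG

end

theorem mainTheorem1 :
    (∃ (c cc : ℕ → ℕ → ℕ → ℝ) (Cd : ℕ → ℝ),
      (∀ k s q, 0 < c k s q) ∧ (∀ k s q, 0 < cc k s q) ∧ (∀ d, 0 < Cd d) ∧
      SparseDG.IsProjConst1D c ∧ SparseDG.IsProjConstTensor cc ∧
      ∀ (d k p q N : ℕ), 2 ≤ d → 1 ≤ k → 1 ≤ q → q ≤ min p k → 1 ≤ N →
      ∀ (a : EuclideanSpace ℝ (Fin d)) (u₀ : (Fin d → ℝ) → ℝ) (u uh : ℝ → (Fin d → ℝ) → ℝ),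
        SparseDG.MemMixedPeriodic (p + 1) u₀ →
        SparseDG.IsTransportSolution a u₀ u →
        SparseDG.IsDGSolution a N k uh →
        SparseDG.IsL2Proj (SparseDG.sparseSpace d N k) u₀ (uh 0) →
        ∀ t : ℝ, 0 ≤ t →
          SparseDG.l2Norm (SparseDG.cube d) (fun x => uh t x - u t x)
            ≤ (2 * √(Cd d * ‖a‖ * t) * SparseDG.cStar c cc k q d N
                + SparseDG.approxConst c cc 0 k q d N * (2 : ℝ) ^ (-(N : ℝ) / 2))
              * (2 : ℝ) ^ (-((N : ℝ) * ((q : ℝ) + 1 / 2)))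
              * SparseDG.mixedSeminorm (q + 1) (SparseDG.cube d) u₀) ∧
    (∀ d k : ℕ, 2 ≤ d → 1 ≤ k → ∃ M : ℝ, 0 < M ∧
      ∀ (a : EuclideanSpace ℝ (Fin d)) (u₀ : (Fin d → ℝ) → ℝ) (u : ℝ → (Fin d → ℝ) → ℝ),
        SparseDG.MemMixedPeriodic (k + 1) u₀ →
        SparseDG.IsTransportSolution a u₀ u →
        ∀ (N : ℕ) (uh : ℝ → (Fin d → ℝ) → ℝ), 1 ≤ N →
          SparseDG.IsDGSolution a N k uh →
          SparseDG.IsL2Proj (SparseDG.sparseSpace d N k) u₀ (uh 0) →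
          ∀ t : ℝ, 0 ≤ t →
            SparseDG.l2Norm (SparseDG.cube d) (fun x => uh t x - u t x)
              ≤ M * (1 + √(‖a‖ * t)) * SparseDG.mixedSeminorm (k + 1) (SparseDG.cube d) u₀
                * ((N : ℝ) ^ d * (2 : ℝ) ^ (-((N : ℝ) * ((k : ℝ) + 1 / 2)))) ∧
            SparseDG.l2Norm (SparseDG.cube d) (fun x => uh t x - u t x)
              ≤ M * (1 + √(‖a‖ * t)) * SparseDG.mixedSeminorm (k + 1) (SparseDG.cube d) u₀
                * (|Real.log (SparseDG.meshSize N)| ^ d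
                    * SparseDG.meshSize N ^ ((k : ℝ) + 1 / 2))) := by
  refine ⟨⟨fun k _ q => SparseDG.projConst k q, fun k _ _ => 6 * SparseDG.reproBound k ^ 2,
    fun d => d + 1, fun k s q => ?_, fun k s q => ?_, fun d => by positivity, ?_, ?_, ?_⟩, ?_⟩
  · linarith [SparseDG.one_le_reproBound k, SparseDG.mul_reproBound_le_projConst k q]
  · have := SparseDG.one_le_reproBound k
    positivity
  · exact SparseDG.isProjConst1D fun k _ q => by
      linarith [SparseDG.one_le_reproBound k, SparseDG.mul_reproBound_le_projConst k q]
  · exact SparseDG.isProjConstTensor fun _ _ _ => le_rfl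
  · intro d k p q N hd hk hq hqpk hN a u₀ u uh hu₀ hu hdg h0 t ht
    have h := SparseDG.l2Norm_dg_sub_transport_le_sqrt (hqpk.trans (min_le_right _ _))
      (hqpk.trans (min_le_left _ _)) hu₀ hu hdg h0 ht
    have hM := SparseDG.one_le_reproBound k
    have hS := SparseDG.one_le_sparseConst k q
    have hA := SparseDG.sparseConst_pow_le_approxConst
      (c := fun k _ q => SparseDG.projConst k q) (cc := fun k _ _ => 6 * SparseDG.reproBound k ^ 2)
      (k := k) (q := q) (d := d) rfl (by positivity) (by omega) N
    -- The term with `s = 0` in the maximum that defines `cStar` is enough.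
    set A := SparseDG.approxConst (fun k _ q => SparseDG.projConst k q)
      (fun k _ _ => 6 * SparseDG.reproBound k ^ 2) 0 k q d N
    have hC : A ≤ SparseDG.cStar (fun k _ q => SparseDG.projConst k q)
      (fun k _ _ => 6 * SparseDG.reproBound k ^ 2) k q d N := le_max_left _ _
    set C := SparseDG.cStar (fun k _ q => SparseDG.projConst k q)
      (fun k _ _ => 6 * SparseDG.reproBound k ^ 2) k q d N
    have hB := SparseDG.mixedSeminorm_nonneg (q + 1) u₀
    set B := SparseDG.mixedSeminorm (q + 1) (SparseDG.cube d) u₀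
    set σ := (SparseDG.sparseConst k q * ((N : ℝ) + 1)) ^ d with hσ
    have hσ0 : 0 ≤ σ := by positivity
    have hσA : σ ≤ A := by nlinarith
    have hs : 0 < √((2 : ℝ) ^ N) := by positivity
    have hr : √(d * ‖a‖ * t) ≤ √((d + 1 : ℝ) * ‖a‖ * t) :=
      Real.sqrt_le_sqrt (by gcongr; linarith)
    rw [SparseDG.two_rpow_neg_mul_add_half, SparseDG.two_rpow_neg_div_two]
    refine h.trans ?_
    -- The constant of the energy estimate is part of `hA`, and `√(2^N) 2^{-N/2} = 1`.
    have key : (√(d * ‖a‖ * t) * (5 * SparseDG.reproBound k) * √(2 ^ N) + 1) * σ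
        ≤ 2 * √((d + 1 : ℝ) * ‖a‖ * t) * C * √(2 ^ N) + A := by
      have h1 : √(d * ‖a‖ * t) * √(2 ^ N) * (5 * SparseDG.reproBound k * σ)
          ≤ √((d + 1 : ℝ) * ‖a‖ * t) * √(2 ^ N) * C := by
        gcongr
        exact hA.trans hC
      have h2 : 0 ≤ √((d + 1 : ℝ) * ‖a‖ * t) * √(2 ^ N) * C :=
        mul_nonneg (by positivity) (hσ0.trans (hσA.trans hC))
      linarith
    calc (√(d * ‖a‖ * t) * (5 * SparseDG.reproBound k) * √(2 ^ N) + 1)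
          * (σ * (1 / 2 ^ N) ^ (q + 1) * B)
        = (√(d * ‖a‖ * t) * (5 * SparseDG.reproBound k) * √(2 ^ N) + 1) * σ
          * ((1 / 2 ^ N) ^ (q + 1) * B) := by ring
      _ ≤ (2 * √((d + 1 : ℝ) * ‖a‖ * t) * C * √(2 ^ N) + A) * ((1 / 2 ^ N) ^ (q + 1) * B) := by
          gcongr
      _ = _ := by field_simp
  · intro d k hd hk
    have hM := SparseDG.one_le_reproBound k
    have hS := SparseDG.one_le_sparseConst k k
    have hl : 0 < Real.log 2 := Real.log_pos one_lt_two
    have hl1 : Real.log 2 ≤ 1 := by linarith [Real.log_two_lt_d9]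
    -- `N + 1 ≤ 2 N` accounts for the factor `2 ^ d`; the division by `(log 2) ^ d` below converts
    -- powers of `N` into powers of `|log h_N| = N log 2`.
    set M₀ := (√d * (5 * SparseDG.reproBound k) + 1) * (2 * SparseDG.sparseConst k k) ^ d with hM₀
    have hM₀0 : 0 < M₀ := by positivity
    refine ⟨M₀ / Real.log 2 ^ d, by positivity, ?_⟩
    intro a u₀ u hu₀ hu N uh hN hdg h0 t ht
    have h := SparseDG.l2Norm_dg_sub_transport_le_sqrt le_rfl le_rfl hu₀ hu hdg h0 ht
    have hB := SparseDG.mixedSeminorm_nonneg (k + 1) u₀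
    set B := SparseDG.mixedSeminorm (k + 1) (SparseDG.cube d) u₀
    have hs : 1 ≤ √((2 : ℝ) ^ N) := Real.one_le_sqrt.2 (one_le_pow₀ one_le_two)
    have hN1 : (1 : ℝ) ≤ N := by exact_mod_cast hN
    have hbound : SparseDG.l2Norm (SparseDG.cube d) (fun x => uh t x - u t x)
        ≤ M₀ * (1 + √(‖a‖ * t)) * B
          * ((N : ℝ) ^ d * (2 : ℝ) ^ (-((N : ℝ) * ((k : ℝ) + 1 / 2)))) := by
      rw [SparseDG.two_rpow_neg_mul_add_half]
      refine h.trans ?_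
      rw [mul_assoc (d : ℝ), Real.sqrt_mul d.cast_nonneg]
      have h1 : √(d : ℝ) * √(‖a‖ * t) * (5 * SparseDG.reproBound k) * √(2 ^ N) + 1
          ≤ (√d * (5 * SparseDG.reproBound k) + 1) * (1 + √(‖a‖ * t)) * √(2 ^ N) := by
        have h2 : 0 ≤ √(d : ℝ) * (5 * SparseDG.reproBound k) * √(2 ^ N) := by positivity
        have h3 : 0 ≤ √(‖a‖ * t) * √(2 ^ N) := by positivity
        nlinarith
      have h4 : (SparseDG.sparseConst k k * ((N : ℝ) + 1)) ^ d
          ≤ (2 * SparseDG.sparseConst k k) ^ d * (N : ℝ) ^ d := by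
        rw [← mul_pow]
        exact pow_le_pow_left₀ (by positivity) (by nlinarith) d
      calc _ ≤ ((√d * (5 * SparseDG.reproBound k) + 1) * (1 + √(‖a‖ * t)) * √(2 ^ N))
            * (((2 * SparseDG.sparseConst k k) ^ d * (N : ℝ) ^ d) * (1 / 2 ^ N) ^ (k + 1) * B) := by
            gcongr
        _ = _ := by rw [hM₀]; ring
    have e : |Real.log (SparseDG.meshSize N)| ^ d = (N : ℝ) ^ d * Real.log 2 ^ d := by
      rw [SparseDG.abs_log_meshSize, mul_pow]
    refine ⟨hbound.trans ?_, hbound.trans (le_of_eq ?_)⟩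
    · gcongr
      exact le_div_self hM₀0.le (by positivity) (pow_le_one₀ hl.le hl1)
    · rw [e, SparseDG.meshSize_rpow]
      field_simp
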